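/- For a positive integer $n$ let $\Gamma(n)$ be the kernel of the reduction map $\mathrm{SL}_2(\mathbb Z)\to\mathrm{SL}_2(\mathbb Z/n\mathbb Z)$. A congruence subgroup is a subgroup $\Gamma\le\mathrm{SL}_2(\mathbb Z)$ containing some $\Gamma(n)$, $n\ge 1$; its exact level is the smallest such $n$. Let $\mathcal H$ be the upper half-plane and let $X_\Gamma=\Gamma\backslash(\mathcal H\cup\mathbb P^1(\mathbb Q))$ be the modular curve of $\Gamma$, a compact Riemann surface; its genus is the dimension of its space of holomorphic differentials, and the cusps of $\Gamma$ are the $\Gamma$-orbits of $\mathbb P^1(\mathbb Q)$. An element $\gamma\in\mathrm{SL}_2(\mathbb Z)$ is elliptic if $|\mathrm{tr}\,\gamma|<2$. Let $p$ be an odd prime, $e>1$ an integer, and $\Gamma$ a congruence subgroup of exact level $p^e$ such that (a) $p$ divides the order of the image $G_1$ of $\Gamma$ in $\mathrm{SL}_2(\mathbb F_p)$; (b) $-I\in\Gamma$, and every congruence subgroup $\Gamma'\le\Gamma$ that contains all elliptic elements of $\Gamma$ has at most $2$ cusps. Then either $\Gamma$ has exact level $9$ and $X_\Gamma$ has genus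 $0$, or $\Gamma$ has exact level $27$ and $X_\Gamma$ has genus $1$. Moreover, for each of the exact levels $9$ and $27$ a subgroup $\Gamma$ with these properties (with $p=3$) exists and is unique up to conjugacy in $\mathrm{SL}_2(\mathbb Z)$. -/

import Mathlib

open scoped MatrixGroups

noncomputable section

namespace ModCurve

open Matrix Matrix.SpecialLinearGroup

/-- `Γ` has exact level `n`: `n` is the smallest positive integer with `Γ(n) ≤ Γ`. In particular
`Γ` is a congruence subgroup. -/
def HasExactLevel (Γ : Subgroup SL(2, ℤ)) (n : ℕ) : Prop :=
  IsLeast {m : ℕ | 0 < m ∧ CongruenceSubgroup.Gamma m ≤ Γ} n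

/-- The image of `Γ` in `SL(2, ℤ/nℤ)`. -/
def reduction (Γ : Subgroup SL(2, ℤ)) (n : ℕ) : Subgroup SL(2, ZMod n) :=
  Γ.map (SpecialLinearGroup.map (Int.castRingHom (ZMod n)))

/-- Conjugacy of subgroups of `SL(2, ℤ)`, by an element of `SL(2, ℤ)`. -/
def AreConjugate (Γ Γ' : Subgroup SL(2, ℤ)) : Prop :=
  ∃ g : SL(2, ℤ), Γ.map (MulAut.conj g).toMonoidHom = Γ'

/-- The extended upper half-plane `ℍ ∪ ℙ¹(ℚ)`. -/
inductive ExtHalfPlane : Type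
  | interior (τ : UpperHalfPlane) : ExtHalfPlane
  | cusp (c : OnePoint ℚ) : ExtHalfPlane

namespace ExtHalfPlane

/-- `SL(2, ℤ)` acts on `ℍ ∪ ℙ¹(ℚ)` by fractional linear transformations. -/
instance : MulAction SL(2, ℤ) ExtHalfPlane where
  smul γ x := match x with
    | interior τ => interior (γ • τ)
    | cusp c => cusp (mapGL ℚ γ • c)
  one_smul x := by
    cases x with
    | interior τ => exact congrArg interior (one_smul _ τ)
    | cusp c =>
      refine congrArg cusp ?_
      rw [map_one, one_smul]
  mul_smul γ γ' x := by
    cases x with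
    | interior τ => exact congrArg interior (mul_smul γ γ' τ)
    | cusp c =>
      refine congrArg cusp ?_
      rw [map_mul, mul_smul]

/-- The usual topology of `ℍ ∪ ℙ¹(ℚ)`: it induces on `ℍ` the usual topology, `ℍ` is open, and a
fundamental system of neighbourhoods of the cusp `γ∞` is given by the sets
`{γ∞} ∪ γ {τ | M < Im τ}`. (Every cusp is of the form `γ∞` with `γ ∈ SL(2, ℤ)`.) -/
instance : TopologicalSpace ExtHalfPlane where
  IsOpen U := IsOpen (interior ⁻¹' U) ∧
    ∀ γ : SL(2, ℤ), γ • cusp OnePoint.infty ∈ U →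
      ∃ M : ℝ, ∀ τ : UpperHalfPlane, M < τ.im → γ • interior τ ∈ U
  isOpen_univ := ⟨isOpen_univ, fun _ _ => ⟨0, fun _ _ => trivial⟩⟩
  isOpen_inter U V hU hV := by
    refine ⟨hU.1.inter hV.1, fun γ hγ => ?_⟩
    obtain ⟨M, hM⟩ := hU.2 γ hγ.1
    obtain ⟨M', hM'⟩ := hV.2 γ hγ.2
    exact ⟨max M M', fun τ hτ =>
      ⟨hM τ (lt_of_le_of_lt (le_max_left _ _) hτ), hM' τ (lt_of_le_of_lt (le_max_right _ _) hτ)⟩⟩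
  isOpen_sUnion S hS := by
    refine ⟨?_, fun γ hγ => ?_⟩
    · rw [Set.preimage_sUnion]
      exact isOpen_biUnion fun U hU => (hS U hU).1
    · obtain ⟨U, hU, hγU⟩ := hγ
      obtain ⟨M, hM⟩ := (hS U hU).2 γ hγU
      exact ⟨M, fun τ hτ => ⟨U, hU, hM τ hτ⟩⟩

end ExtHalfPlane

/-- The modular curve `X_Γ`, the quotient of the extended upper half-plane by `Γ`. -/
def Curve (Γ : Subgroup SL(2, ℤ)) : Type :=
  MulAction.orbitRel.Quotient Γ ExtHalfPlane

/-- The quotient map from the extended upper half-plane to `X_Γ`. -/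
def toCurve (Γ : Subgroup SL(2, ℤ)) (x : ExtHalfPlane) : Curve Γ :=
  Quotient.mk (MulAction.orbitRel Γ ExtHalfPlane) x

/-- The quotient topology on `X_Γ`. -/
instance (Γ : Subgroup SL(2, ℤ)) : TopologicalSpace (Curve Γ) :=
  TopologicalSpace.coinduced (toCurve Γ) inferInstance

/-- The set of cusps of `X_Γ`: the images of the elements of `ℙ¹(ℚ)`. -/
def cusps (Γ : Subgroup SL(2, ℤ)) : Set (Curve Γ) :=
  Set.range fun c : OnePoint ℚ => toCurve Γ (ExtHalfPlane.cusp c)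

/-- The analytic structure on `X_Γ`: a function `F` is holomorphic on an open subset `U` of `X_Γ`
if it is continuous on `U` and its pull-back to `ℍ` is holomorphic at each point above `U`.
(At the cusps and at the elliptic points continuity suffices, by the removable singularity
theorem.) If `h` is a function on `ℍ`, then `IsPrimitiveOn Γ U F h` says that `F` is holomorphic on
`U` and that the pull-back to `ℍ` of the differential `dF` is `h(τ) dτ`. -/
def IsPrimitiveOn (Γ : Subgroup SL(2, ℤ)) (U : Set (Curve Γ)) (F : Curve Γ → ℂ)
    (h : UpperHalfPlane → ℂ) : Prop :=
  ContinuousOn F U ∧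
    ∀ τ : UpperHalfPlane, toCurve Γ (ExtHalfPlane.interior τ) ∈ U →
      HasDerivAt
        (fun w : ℂ => F (toCurve Γ (ExtHalfPlane.interior (UpperHalfPlane.ofComplex w))))
        (h τ) (τ : ℂ)

/-- The space of holomorphic differentials on the Riemann surface `X_Γ`. A holomorphic differential
is a differential that in a neighbourhood of each point (cusps and elliptic points included) is of
the form `dF` with `F` holomorphic; it is represented here by the function `h` on `ℍ` for which its
pull-back to `ℍ` is `h(τ) dτ`. -/
def holomorphicDifferentials (Γ : Subgroup SL(2, ℤ)) : Submodule ℂ (UpperHalfPlane → ℂ) where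
  carrier := {h | ∀ x : Curve Γ, ∃ U : Set (Curve Γ), IsOpen U ∧ x ∈ U ∧
    ∃ F : Curve Γ → ℂ, IsPrimitiveOn Γ U F h}
  zero_mem' _ := ⟨Set.univ, isOpen_univ, trivial, fun _ => 0, continuousOn_const,
    fun τ _ => hasDerivAt_const (τ : ℂ) (0 : ℂ)⟩
  add_mem' := by
    intro h h' hh hh' x
    obtain ⟨U, hU, hxU, F, hF, hFd⟩ := hh x
    obtain ⟨U', hU', hxU', F', hF', hFd'⟩ := hh' x
    exact ⟨U ∩ U', hU.inter hU', ⟨hxU, hxU'⟩, fun y => F y + F' y,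
      (hF.mono Set.inter_subset_left).add (hF'.mono Set.inter_subset_right),
      fun τ hτ => (hFd τ hτ.1).add (hFd' τ hτ.2)⟩
  smul_mem' := by
    intro c h hh x
    obtain ⟨U, hU, hxU, F, hF, hFd⟩ := hh x
    exact ⟨U, hU, hxU, fun y => c * F y, continuousOn_const.mul hF,
      fun τ hτ => (hFd τ hτ).const_mul c⟩

/-- The genus of the compact Riemann surface `X_Γ`: the dimension of its space of holomorphic
differentials. -/
def genus (Γ : Subgroup SL(2, ℤ)) : Cardinal :=
  Module.rank ℂ (holomorphicDifferentials Γ)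

/-- `Γ` contains `-I`, and every congruence subgroup of `Γ` containing the elliptic elements of `Γ`
has at most two cusps. -/
def FewCusps (Γ : Subgroup SL(2, ℤ)) : Prop :=
  -1 ∈ Γ ∧ ∀ Γ' : Subgroup SL(2, ℤ), CongruenceSubgroup.IsCongruenceSubgroup Γ' → Γ' ≤ Γ →
    (∀ γ ∈ Γ, (γ : Matrix (Fin 2) (Fin 2) ℤ).IsElliptic → γ ∈ Γ') → (cusps Γ').encard ≤ 2

/-- `Γ` is a congruence subgroup of exact level `p ^ e`, with `p` an odd prime and `e > 1`, such
that `p` divides the order of the image of `Γ` in `SL(2, 𝔽_p)`, and `Γ` satisfies `FewCusps`. -/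
def IsUnipotentOfLevel (Γ : Subgroup SL(2, ℤ)) (p e : ℕ) : Prop :=
  p.Prime ∧ p ≠ 2 ∧ 1 < e ∧ HasExactLevel Γ (p ^ e) ∧ p ∣ Nat.card (reduction Γ p) ∧ FewCusps Γ

end ModCurve

end

namespace ModCurve

open Matrix Matrix.SpecialLinearGroup CongruenceSubgroup

/-! ### Entries, unipotent elements and reduction maps -/

section Basic

/-! Everything about subgroups of p-power level is tested on characters. A proper subgroup of a
finite p-group lies in the kernel of a nonzero homomorphism to `ℤ/p`, so a proper inclusion of such
groups inside `Γ₁(p)` is witnessed by an additive function `E` to `ℤ/p` (`exists_additiveOn`,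
`eq_of_forall_additiveOn`). An additive function on a group containing `Γ(p ^ k)` that vanishes on
some deeper `Γ(p ^ e)` already vanishes on `Γ(p ^ (k + 1))`, so only finitely many values matter.
The link with cusps is `not_twoCusps_of_additiveOn`: if a nonzero `E` vanishes on the stabilizer of
`∞`, then the kernel of `E` has at least `p ≥ 3` inequivalent cusps. A group with few cusps
therefore cannot lie in the kernel of such an `E`, and no such `E` on the group can kill all its
elliptic elements.

Reduction to `Γ₀(p)`. The image of the group modulo `p` contains a unipotent element. If it did not
fix the line of this element, every functional on `Γ(p)/Γ(p²)`, the trace zero matrices, that kills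
the nonzero image of `Γ ∩ Γ(p)` would vanish, and then `Γ(p) ≤ Γ`, against `e > 1`. That the image
is nonzero comes from a `p`-th power of a unipotent lift for `p ≥ 5`, and from counting double
cosets for `p = 3`.

Bounding `p`. The characters of `Γ₁(p)` of p-power level are spanned by the upper right entry and by
the lower left entry divided by `p`. Two cusps force both coefficients of `E` to be nonzero, and
conjugation by an element of `Γ` with diagonal `(2, 1/2)` multiplies the two entries by `4` and
`1/4`. Hence `p` divides `15`. For `p = 5` the elliptic elements have order `4`, and the additive
function `quadFun` kills them together with the parabolic elements fixing `∞`, a contradiction.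

The case `p = 3`. Elliptic elements must exist, and this puts a conjugate of `Γ` inside `levelNine`.
The characters of `levelNineOne` are determined by their values at `al₀`, `al₁`, `al₂`, and every
element of trace `-1` there has the character values of one of these elements or its inverse. If `Γ`
is smaller than `levelNine`, the possible zero patterns of `E` on the three elements leave only
`levelTwentySeven`, up to a cyclic permutation induced by `up 1`. Below that group nothing is left:
`up 9` is a product of `al₀` and `al₂` with exponent sums zero, so no character sees the stabilizer
of `∞`. That both groups do have few cusps is `fewCusps_of`: modulo the subgroup generated by the
elliptic elements and a principal congruence subgroup, the group is cyclic, generated by an element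
stabilizing `∞`, whose inverse is represented by one stabilizing `0`.

Genus. Holomorphic differentials are the cusp forms of weight `2`
(`mem_holomorphicDifferentials_iff`). The function `etaQuot` is a cube root of the Hauptmodul of
`Γ₀(3)` and is invariant under `levelNineOne`. Let `v` be its value at the fixed point of `al₁`. The
form `cubicForm`, which is `etaQuot * formInfty * (etaQuot² + v * etaQuot + v²)²`, has only zeros of
order `6` on `ℍ`, so it has a holomorphic cube root `cuspRoot` of weight `2`. Its orders of
vanishing on `ℍ` and at the cusps are the least possible for a cusp form on `levelTwentySeven`;
dividing any other by it gives a bounded invariant function, hence a constant, and the genus is `1`.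
Under `levelNine` the form `cuspRoot` picks up the nontrivial character given by `ellThree`, so
nothing survives there and the genus is `0`. -/

lemma mul_apply_zero_zero (g h : SL(2, ℤ)) : (g * h) 0 0 = g 0 0 * h 0 0 + g 0 1 * h 1 0 := by
  simp [Matrix.mul_apply, Fin.sum_univ_two]

lemma mul_apply_zero_one (g h : SL(2, ℤ)) : (g * h) 0 1 = g 0 0 * h 0 1 + g 0 1 * h 1 1 := by
  simp [Matrix.mul_apply, Fin.sum_univ_two]

lemma mul_apply_one_zero (g h : SL(2, ℤ)) : (g * h) 1 0 = g 1 0 * h 0 0 + g 1 1 * h 1 0 := by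
  simp [Matrix.mul_apply, Fin.sum_univ_two]

lemma mul_apply_one_one (g h : SL(2, ℤ)) : (g * h) 1 1 = g 1 0 * h 0 1 + g 1 1 * h 1 1 := by
  simp [Matrix.mul_apply, Fin.sum_univ_two]

lemma inv_apply_zero_zero (g : SL(2, ℤ)) : g⁻¹ 0 0 = g 1 1 := by
  simp [SL2_inv_expl]

lemma inv_apply_zero_one (g : SL(2, ℤ)) : g⁻¹ 0 1 = -g 0 1 := by
  simp [SL2_inv_expl]

lemma inv_apply_one_zero (g : SL(2, ℤ)) : g⁻¹ 1 0 = -g 1 0 := by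
  simp [SL2_inv_expl]

lemma inv_apply_one_one (g : SL(2, ℤ)) : g⁻¹ 1 1 = g 0 0 := by
  simp [SL2_inv_expl]

lemma neg_apply (g : SL(2, ℤ)) (i j : Fin 2) : (-g) i j = -g i j := by
  simp

lemma det_eq (g : SL(2, ℤ)) : g 0 0 * g 1 1 - g 0 1 * g 1 0 = 1 := by
  have := g.2
  rwa [Matrix.det_fin_two] at this

lemma sl_ext {g h : SL(2, ℤ)} (h00 : g 0 0 = h 0 0) (h01 : g 0 1 = h 0 1) (h10 : g 1 0 = h 1 0)
    (h11 : g 1 1 = h 1 1) : g = h := by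
  ext i j
  fin_cases i <;> fin_cases j <;> assumption

/-- The element of `SL(2, ℤ)` with the given entries. -/
def mk (a b c d : ℤ) (h : a * d - b * c = 1) : SL(2, ℤ) :=
  ⟨!![a, b; c, d], by rw [Matrix.det_fin_two_of, h]⟩

section mk
variable (a b c d : ℤ) (h : a * d - b * c = 1)
@[simp] lemma mk_zero_zero : mk a b c d h 0 0 = a := rfl
@[simp] lemma mk_zero_one : mk a b c d h 0 1 = b := rfl
@[simp] lemma mk_one_zero : mk a b c d h 1 0 = c := rfl
@[simp] lemma mk_one_one : mk a b c d h 1 1 = d := rfl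
end mk

/-- The upper unipotent elements. -/
def up (n : ℤ) : SL(2, ℤ) := mk 1 n 0 1 (by ring)

/-- The lower unipotent elements. -/
def lo (n : ℤ) : SL(2, ℤ) := mk 1 0 n 1 (by ring)

section up
variable (n : ℤ)
@[simp] lemma up_zero_zero : up n 0 0 = 1 := rfl
@[simp] lemma up_zero_one : up n 0 1 = n := rfl
@[simp] lemma up_one_zero : up n 1 0 = 0 := rfl
@[simp] lemma up_one_one : up n 1 1 = 1 := rfl
@[simp] lemma lo_zero_zero : lo n 0 0 = 1 := rfl
@[simp] lemma lo_zero_one : lo n 0 1 = 0 := rfl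
@[simp] lemma lo_one_zero : lo n 1 0 = n := rfl
@[simp] lemma lo_one_one : lo n 1 1 = 1 := rfl
end up

lemma up_add (m n : ℤ) : up (m + n) = up m * up n := by
  apply sl_ext <;>
  simp only [mul_apply_zero_zero, mul_apply_zero_one, mul_apply_one_zero, mul_apply_one_one,
    up_zero_zero, up_zero_one, up_one_zero, up_one_one] <;> ring

lemma lo_add (m n : ℤ) : lo (m + n) = lo m * lo n := by
  apply sl_ext <;>
  simp only [mul_apply_zero_zero, mul_apply_zero_one, mul_apply_one_zero, mul_apply_one_one,
    lo_zero_zero, lo_zero_one, lo_one_zero, lo_one_one] <;> ring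

@[simp] lemma up_zero : up 0 = 1 := by apply sl_ext <;> simp
@[simp] lemma lo_zero : lo 0 = 1 := by apply sl_ext <;> simp

lemma up_neg (n : ℤ) : up (-n) = (up n)⁻¹ := by
  rw [eq_inv_iff_mul_eq_one, ← up_add]; simp

lemma lo_neg (n : ℤ) : lo (-n) = (lo n)⁻¹ := by
  rw [eq_inv_iff_mul_eq_one, ← lo_add]; simp

lemma up_zpow (m n : ℤ) : up m ^ n = up (m * n) := by
  induction n using Int.induction_on with
  | zero => simp
  | succ i hi => rw [_root_.zpow_add_one, hi, ← up_add]; congr 1; ring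
  | pred i hi => rw [_root_.zpow_sub_one, hi, ← up_neg, ← up_add]; congr 1; ring

lemma lo_zpow (m n : ℤ) : lo m ^ n = lo (m * n) := by
  induction n using Int.induction_on with
  | zero => simp
  | succ i hi => rw [_root_.zpow_add_one, hi, ← lo_add]; congr 1; ring
  | pred i hi => rw [_root_.zpow_sub_one, hi, ← lo_neg, ← lo_add]; congr 1; ring

lemma up_pow (m : ℤ) (n : ℕ) : up m ^ n = up (m * n) := by
  rw [← up_zpow, zpow_natCast]

lemma lo_pow (m : ℤ) (n : ℕ) : lo m ^ n = lo (m * n) := by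
  rw [← lo_zpow, zpow_natCast]

/-- Reduction modulo `n`. -/
abbrev red (n : ℕ) : SL(2, ℤ) →* SL(2, ZMod n) :=
  SpecialLinearGroup.map (Int.castRingHom (ZMod n))

lemma red_eq_iff {n : ℕ} {g h : SL(2, ℤ)} : red n g = red n h ↔
    (n : ℤ) ∣ h 0 0 - g 0 0 ∧ (n : ℤ) ∣ h 0 1 - g 0 1 ∧ (n : ℤ) ∣ h 1 0 - g 1 0 ∧
      (n : ℤ) ∣ h 1 1 - g 1 1 := by
  simp only [← ZMod.intCast_eq_intCast_iff_dvd_sub]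
  refine (Matrix.SpecialLinearGroup.ext_iff (A := red n g) (B := red n h)).trans ?_
  simp [Fin.forall_fin_two, and_assoc]

lemma mem_Gamma_iff {n : ℕ} {g : SL(2, ℤ)} : g ∈ Gamma n ↔
    (n : ℤ) ∣ g 0 0 - 1 ∧ (n : ℤ) ∣ g 0 1 ∧ (n : ℤ) ∣ g 1 0 ∧ (n : ℤ) ∣ g 1 1 - 1 := by
  rw [Gamma_mem', ← map_one (red n), eq_comm, red_eq_iff]
  simp

lemma mem_Gamma_of_red_eq {n : ℕ} {g h : SL(2, ℤ)} (e : red n g = red n h) :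
    g⁻¹ * h ∈ Gamma n := by
  rw [Gamma_mem', map_mul, map_inv]
  exact (inv_mul_eq_one).2 e

lemma red_eq_of_mem_Gamma {n : ℕ} {g h : SL(2, ℤ)} (e : g⁻¹ * h ∈ Gamma n) :
    red n g = red n h := by
  rw [Gamma_mem', map_mul, map_inv] at e
  exact (inv_mul_eq_one).1 e

lemma mem_of_red_eq {n : ℕ} {Γ : Subgroup SL(2, ℤ)} (hΓ : Gamma n ≤ Γ) {g h : SL(2, ℤ)}
    (hg : g ∈ Γ) (e : red n g = red n h) : h ∈ Γ := by
  have := Γ.mul_mem hg (hΓ (mem_Gamma_of_red_eq e))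
  rwa [mul_inv_cancel_left] at this

lemma Gamma_le_of_dvd {m n : ℕ} (h : m ∣ n) : Gamma n ≤ Gamma m := by
  intro g hg
  rw [mem_Gamma_iff] at hg ⊢
  have h' : (m : ℤ) ∣ n := Int.natCast_dvd_natCast.2 h
  exact ⟨h'.trans hg.1, h'.trans hg.2.1, h'.trans hg.2.2.1, h'.trans hg.2.2.2⟩

lemma red_eq_of_dvd {m n : ℕ} (h : m ∣ n) {g k : SL(2, ℤ)} (e : red n g = red n k) :
    red m g = red m k :=
  red_eq_of_mem_Gamma (Gamma_le_of_dvd h (mem_Gamma_of_red_eq e))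

lemma conj_mem_Gamma {n : ℕ} {g : SL(2, ℤ)} (hg : g ∈ Gamma n) (h : SL(2, ℤ)) :
    h * g * h⁻¹ ∈ Gamma n :=
  (Gamma_normal n).conj_mem g hg h

lemma up_mem_Gamma {n : ℕ} {m : ℤ} (h : (n : ℤ) ∣ m) : up m ∈ Gamma n := by
  rw [mem_Gamma_iff]; simp [h]

lemma lo_mem_Gamma {n : ℕ} {m : ℤ} (h : (n : ℤ) ∣ m) : lo m ∈ Gamma n := by
  rw [mem_Gamma_iff]; simp [h]

lemma isElliptic_iff (g : SL(2, ℤ)) :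
    (g : Matrix (Fin 2) (Fin 2) ℤ).IsElliptic ↔
      g 0 0 + g 1 1 = 0 ∨ g 0 0 + g 1 1 = 1 ∨ g 0 0 + g 1 1 = -1 := by
  rw [Matrix.IsElliptic, Matrix.discr_fin_two, Matrix.trace_fin_two, g.2]
  constructor
  · intro h
    have h1 : g 0 0 + g 1 1 < 2 := by nlinarith
    have h2 : -2 < g 0 0 + g 1 1 := by nlinarith
    omega
  · rintro (h | h | h) <;> rw [h] <;> norm_num

lemma isElliptic_conj {g : SL(2, ℤ)} (h : (g : Matrix (Fin 2) (Fin 2) ℤ).IsElliptic)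
    (x : SL(2, ℤ)) : ((x * g * x⁻¹ : SL(2, ℤ)) : Matrix (Fin 2) (Fin 2) ℤ).IsElliptic := by
  rw [isElliptic_iff] at h ⊢
  have := det_eq x
  simp only [mul_apply_zero_zero, mul_apply_zero_one, mul_apply_one_zero, mul_apply_one_one,
    inv_apply_zero_zero, inv_apply_zero_one, inv_apply_one_zero, inv_apply_one_one]
  have e : (x 0 0 * g 0 0 + x 0 1 * g 1 0) * x 1 1 + (x 0 0 * g 0 1 + x 0 1 * g 1 1) * -x 1 0 +
      ((x 1 0 * g 0 0 + x 1 1 * g 1 0) * -x 0 1 + (x 1 0 * g 0 1 + x 1 1 * g 1 1) * x 0 0)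
      = g 0 0 + g 1 1 := by
    linear_combination (g 0 0 + g 1 1) * this
  rw [e]
  exact h

end Basic

/-- The conjugate subgroup `kΓk⁻¹`. -/
def conjBy (k : SL(2, ℤ)) (Γ : Subgroup SL(2, ℤ)) : Subgroup SL(2, ℤ) :=
  Γ.map (MulAut.conj k).toMonoidHom

/-! ### Cusps as double cosets -/

section Cusps

/-- The group `Γ` has at most two orbits of cusps, as a statement on double cosets. -/
def TwoCusps (Γ : Subgroup SL(2, ℤ)) : Prop :=
  ∃ x y : SL(2, ℤ), ∀ g, ∃ γ ∈ Γ, ∃ n : ℤ,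
    g = γ * x * up n ∨ g = -(γ * x * up n) ∨ g = γ * y * up n ∨ g = -(γ * y * up n)

/-- An integral matrix fixes `∞` iff its lower left entry is zero; the determinant then makes the
diagonal `(1, 1)` or `(-1, -1)`. -/
lemma smul_infty_eq_iff (g h : SL(2, ℤ)) :
    mapGL ℚ g • (OnePoint.infty : OnePoint ℚ) = mapGL ℚ h • (OnePoint.infty : OnePoint ℚ) ↔
      ∃ n : ℤ, g = h * up n ∨ g = -(h * up n) := by
  rw [← inv_smul_eq_iff, ← map_inv, ← mul_smul, ← map_mul, OnePoint.smul_infty_eq_self_iff]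
  have key : ((mapGL ℚ (h⁻¹ * g)) 1 0 : ℚ) = (((h⁻¹ * g) 1 0 : ℤ) : ℚ) := rfl
  rw [key, Int.cast_eq_zero]
  constructor
  · intro hc
    have hd := det_eq (h⁻¹ * g)
    rw [hc, mul_zero, sub_zero] at hd
    rcases Int.eq_one_or_neg_one_of_mul_eq_one hd with ha | ha
    · have hd1 : (h⁻¹ * g) 1 1 = 1 := by rw [ha] at hd; omega
      refine ⟨(h⁻¹ * g) 0 1, Or.inl ?_⟩
      rw [← inv_mul_eq_iff_eq_mul]
      exact sl_ext ha rfl hc hd1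
    · have hd1 : (h⁻¹ * g) 1 1 = -1 := by rw [ha] at hd; omega
      refine ⟨-(h⁻¹ * g) 0 1, Or.inr ?_⟩
      rw [← mul_neg, ← inv_mul_eq_iff_eq_mul]
      apply sl_ext <;> rw [neg_apply] <;> simp [ha, hc, hd1]
  · rintro ⟨n, rfl | rfl⟩
    · rw [inv_mul_cancel_left]; simp
    · rw [← mul_neg, inv_mul_cancel_left, neg_apply]; simp

lemma toCurve_cusp_eq_iff (Γ : Subgroup SL(2, ℤ)) (c c' : OnePoint ℚ) :
    toCurve Γ (ExtHalfPlane.cusp c) = toCurve Γ (ExtHalfPlane.cusp c') ↔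
      ∃ γ ∈ Γ, mapGL ℚ γ • c' = c := by
  refine (Quotient.eq (r := MulAction.orbitRel Γ ExtHalfPlane)).trans ?_
  rw [MulAction.orbitRel_apply, MulAction.mem_orbit_iff]
  constructor
  · rintro ⟨⟨γ, hγ⟩, h⟩
    exact ⟨γ, hγ, ExtHalfPlane.cusp.inj h⟩
  · rintro ⟨γ, hγ, h⟩
    exact ⟨⟨γ, hγ⟩, congrArg ExtHalfPlane.cusp h⟩

/-- The cusp of `X_Γ` represented by `g∞`. -/
noncomputable def cuspOf (Γ : Subgroup SL(2, ℤ)) (g : SL(2, ℤ)) : Curve Γ :=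
  toCurve Γ (ExtHalfPlane.cusp (mapGL ℚ g • OnePoint.infty))

lemma cuspOf_mem (Γ : Subgroup SL(2, ℤ)) (g : SL(2, ℤ)) : cuspOf Γ g ∈ cusps Γ := ⟨_, rfl⟩

lemma cuspOf_eq_iff (Γ : Subgroup SL(2, ℤ)) (g h : SL(2, ℤ)) :
    cuspOf Γ g = cuspOf Γ h ↔ ∃ γ ∈ Γ, ∃ n : ℤ, g = γ * h * up n ∨ g = -(γ * h * up n) := by
  rw [cuspOf, cuspOf, toCurve_cusp_eq_iff]
  refine exists_congr fun γ => and_congr_right fun _ => ?_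
  rw [← mul_smul, ← map_mul, eq_comm, smul_infty_eq_iff]

lemma exists_cuspOf_eq {Γ : Subgroup SL(2, ℤ)} {x : Curve Γ} (hx : x ∈ cusps Γ) :
    ∃ g, cuspOf Γ g = x := by
  obtain ⟨c, rfl⟩ := hx
  obtain ⟨g, rfl⟩ := OnePoint.exists_mem_SL2 ℤ c
  exact ⟨g, rfl⟩

/-- `SL(2, ℤ)` is transitive on `ℙ¹(ℚ)`, so the cusps are the double cosets of `Γ` and the
stabilizer of `∞`. From here on the topology of the curve plays no role in the classification. -/
lemma encard_cusps_le_two_iff (Γ : Subgroup SL(2, ℤ)) : (cusps Γ).encard ≤ 2 ↔ TwoCusps Γ := by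
  constructor
  · intro h
    have hfin : (cusps Γ).Finite := Set.finite_of_encard_le_coe h
    obtain ⟨x, y, hxy⟩ : ∃ x y, cusps Γ ⊆ {x, y} ∧ x ∈ cusps Γ ∧ y ∈ cusps Γ := by
      have h1 : (cuspOf Γ 1) ∈ cusps Γ := cuspOf_mem Γ 1
      have h2 : (cusps Γ \ {cuspOf Γ 1}).encard ≤ 1 := by
        have := Set.encard_sdiff_singleton_add_one h1
        rw [← this] at h
        have h' : (cusps Γ \ {cuspOf Γ 1}).encard + 1 ≤ 1 + 1 := by
          rwa [one_add_one_eq_two]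
        exact (ENat.add_le_add_iff_right ENat.one_ne_top).1 h'
      rcases Set.encard_le_one_iff_eq.1 h2 with h3 | ⟨y, h3⟩
      -- With a single cusp the same representative is used twice.
      · refine ⟨cuspOf Γ 1, cuspOf Γ 1, fun z hz => ?_, h1, h1⟩
        by_contra hne
        have : z ∈ cusps Γ \ {cuspOf Γ 1} := ⟨hz, fun h => hne (by simp_all)⟩
        rw [h3] at this
        exact this
      · refine ⟨cuspOf Γ 1, y, fun z hz => ?_, h1, ?_⟩
        · by_cases hz1 : z = cuspOf Γ 1
          · exact Or.inl hz1
          · have : z ∈ cusps Γ \ {cuspOf Γ 1} := ⟨hz, hz1⟩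
            rw [h3] at this
            exact Or.inr this
        · have : y ∈ cusps Γ \ {cuspOf Γ 1} := by rw [h3]; rfl
          exact this.1
    obtain ⟨hsub, hx, hy⟩ := hxy
    obtain ⟨x, rfl⟩ := exists_cuspOf_eq hx
    obtain ⟨y, rfl⟩ := exists_cuspOf_eq hy
    refine ⟨x, y, fun g => ?_⟩
    rcases hsub (cuspOf_mem Γ g) with h | h
    · obtain ⟨γ, hγ, n, h⟩ := (cuspOf_eq_iff Γ _ _).1 h
      exact ⟨γ, hγ, n, by tauto⟩
    · obtain ⟨γ, hγ, n, h⟩ := (cuspOf_eq_iff Γ _ _).1 h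
      exact ⟨γ, hγ, n, by tauto⟩
  · rintro ⟨x, y, h⟩
    have : cusps Γ ⊆ {cuspOf Γ x, cuspOf Γ y} := by
      intro z hz
      obtain ⟨g, rfl⟩ := exists_cuspOf_eq hz
      obtain ⟨γ, hγ, n, h⟩ := h g
      have h1 : cuspOf Γ g = cuspOf Γ x ∨ cuspOf Γ g = cuspOf Γ y := by
        simp only [cuspOf_eq_iff]
        rcases h with h | h | h | h
        · exact Or.inl ⟨γ, hγ, n, Or.inl h⟩
        · exact Or.inl ⟨γ, hγ, n, Or.inr h⟩
        · exact Or.inr ⟨γ, hγ, n, Or.inl h⟩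
        · exact Or.inr ⟨γ, hγ, n, Or.inr h⟩
      exact h1
    exact (Set.encard_le_encard this).trans
      ((Set.encard_insert_le _ _).trans (by rw [Set.encard_singleton, one_add_one_eq_two]))

lemma not_twoCusps_of_pairwise {Γ : Subgroup SL(2, ℤ)} (f : Fin 3 → SL(2, ℤ))
    (hf : ∀ i j, i ≠ j → ∀ γ ∈ Γ, ∀ n : ℤ, f i ≠ γ * f j * up n ∧ f i ≠ -(γ * f j * up n)) :
    ¬ TwoCusps Γ := by
  rw [← encard_cusps_le_two_iff, not_le]
  have hinj : Function.Injective fun i => cuspOf Γ (f i) := by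
    intro i j hij
    by_contra hne
    obtain ⟨γ, hγ, n, h⟩ := (cuspOf_eq_iff Γ _ _).1 hij
    rcases h with h | h
    · exact (hf i j hne γ hγ n).1 h
    · exact (hf i j hne γ hγ n).2 h
  have h3 : (Set.range fun i => cuspOf Γ (f i)).encard = 3 := by
    rw [← Set.image_univ, hinj.encard_image]; simp
  have hle : (Set.range fun i => cuspOf Γ (f i)) ⊆ cusps Γ := by
    rintro _ ⟨i, rfl⟩; exact cuspOf_mem Γ _
  calc (2 : ℕ∞) < 3 := by norm_num
    _ = _ := h3.symm
    _ ≤ _ := Set.encard_le_encard hle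

lemma TwoCusps.mono {Γ Γ' : Subgroup SL(2, ℤ)} (h : TwoCusps Γ) (hle : Γ ≤ Γ') : TwoCusps Γ' := by
  obtain ⟨x, y, h⟩ := h
  refine ⟨x, y, fun g => ?_⟩
  obtain ⟨γ, hγ, n, hg⟩ := h g
  exact ⟨γ, hle hγ, n, hg⟩

lemma TwoCusps.conj {Γ : Subgroup SL(2, ℤ)} (h : TwoCusps Γ) (k : SL(2, ℤ)) :
    TwoCusps (conjBy k Γ) := by
  obtain ⟨x, y, h⟩ := h
  refine ⟨k * x, k * y, fun g => ?_⟩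
  obtain ⟨γ, hγ, n, hg⟩ := h (k⁻¹ * g)
  refine ⟨k * γ * k⁻¹, Subgroup.mem_map_of_mem (MulAut.conj k).toMonoidHom hγ, n, ?_⟩
  have e (z : SL(2, ℤ)) : k * γ * k⁻¹ * (k * z) * up n = k * (γ * z * up n) := by group
  simp only [e, ← mul_neg k, ← inv_mul_eq_iff_eq_mul (a := k)]
  exact hg

end Cusps

/-- The exact form in which `FewCusps` is used: conditions on double cosets. -/
lemma fewCusps_iff (Γ : Subgroup SL(2, ℤ)) : FewCusps Γ ↔
    -1 ∈ Γ ∧ ∀ Γ' : Subgroup SL(2, ℤ), IsCongruenceSubgroup Γ' → Γ' ≤ Γ →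
    (∀ γ ∈ Γ, (γ : Matrix (Fin 2) (Fin 2) ℤ).IsElliptic → γ ∈ Γ') → TwoCusps Γ' := by
  simp only [FewCusps, encard_cusps_le_two_iff]

/-! ### Conjugation of subgroups -/

section Conj

lemma mem_conjBy {k g : SL(2, ℤ)} {Γ : Subgroup SL(2, ℤ)} :
    g ∈ conjBy k Γ ↔ k⁻¹ * g * k ∈ Γ := by
  constructor
  · rintro ⟨x, hx, rfl⟩
    simpa [mul_assoc] using hx
  · intro h
    exact ⟨_, h, by simp [mul_assoc]⟩

lemma conjBy_mono (k : SL(2, ℤ)) {Γ Γ' : Subgroup SL(2, ℤ)} (h : Γ ≤ Γ') :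
    conjBy k Γ ≤ conjBy k Γ' :=
  Subgroup.map_mono h

lemma conjBy_one (Γ : Subgroup SL(2, ℤ)) : conjBy 1 Γ = Γ := by
  ext g; rw [mem_conjBy]; simp

lemma conjBy_mul (k l : SL(2, ℤ)) (Γ : Subgroup SL(2, ℤ)) :
    conjBy (k * l) Γ = conjBy k (conjBy l Γ) := by
  ext g
  simp only [mem_conjBy, _root_.mul_inv_rev, mul_assoc]

lemma conjBy_inv_conjBy (k : SL(2, ℤ)) (Γ : Subgroup SL(2, ℤ)) :
    conjBy k⁻¹ (conjBy k Γ) = Γ := by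
  rw [← conjBy_mul, inv_mul_cancel, conjBy_one]

lemma conjBy_Gamma (k : SL(2, ℤ)) (n : ℕ) : conjBy k (Gamma n) = Gamma n := by
  ext g
  rw [mem_conjBy]
  constructor
  · intro h
    have := conj_mem_Gamma h k
    simpa [mul_assoc] using this
  · intro h
    have := conj_mem_Gamma h k⁻¹
    simpa [mul_assoc] using this

lemma Gamma_le_conjBy {k : SL(2, ℤ)} {Γ : Subgroup SL(2, ℤ)} {n : ℕ} :
    Gamma n ≤ conjBy k Γ ↔ Gamma n ≤ Γ := by
  constructor
  · intro h
    rw [← conjBy_inv_conjBy k Γ, ← conjBy_Gamma k⁻¹ n]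
    exact conjBy_mono _ h
  · intro h
    rw [← conjBy_Gamma k n]
    exact conjBy_mono _ h

lemma HasExactLevel.conjBy {Γ : Subgroup SL(2, ℤ)} {n : ℕ} (h : HasExactLevel Γ n)
    (k : SL(2, ℤ)) : HasExactLevel (conjBy k Γ) n := by
  simpa only [HasExactLevel, Gamma_le_conjBy] using h

lemma isCongruenceSubgroup_conjBy {k : SL(2, ℤ)} {Γ : Subgroup SL(2, ℤ)}
    (h : IsCongruenceSubgroup Γ) : IsCongruenceSubgroup (conjBy k Γ) := by
  obtain ⟨N, hN, h⟩ := h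
  exact ⟨N, hN, Gamma_le_conjBy.2 h⟩

lemma FewCusps.conjBy {Γ : Subgroup SL(2, ℤ)} (h : FewCusps Γ) (k : SL(2, ℤ)) :
    FewCusps (conjBy k Γ) := by
  rw [fewCusps_iff] at h ⊢
  refine ⟨by rw [mem_conjBy]; simpa using h.1, fun Γ' hΓ' hle hell => ?_⟩
  have h2 := h.2 (ModCurve.conjBy k⁻¹ Γ') (isCongruenceSubgroup_conjBy hΓ') ?_ ?_
  · have := h2.conj k
    rwa [← conjBy_mul, mul_inv_cancel, conjBy_one] at this
  · rw [← conjBy_inv_conjBy k Γ]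
    exact conjBy_mono _ hle
  · intro γ hγ he
    rw [mem_conjBy, inv_inv]
    refine hell _ ?_ (isElliptic_conj he k)
    rw [mem_conjBy]
    simpa [mul_assoc] using hγ

lemma FewCusps.twoCusps {Γ : Subgroup SL(2, ℤ)} (h : FewCusps Γ) (hΓ : IsCongruenceSubgroup Γ) :
    TwoCusps Γ :=
  ((fewCusps_iff Γ).1 h).2 Γ hΓ le_rfl fun _ h _ => h

end Conj

end ModCurve

namespace ModCurve

open Matrix Matrix.SpecialLinearGroup CongruenceSubgroup

/-! ### Characters of finite p-groups -/

section PGroup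

/-- A proper subgroup lies in a maximal one, and maximal subgroups of a finite p-group are normal
(by nilpotency) of index `p`; the character is the quotient map. -/
lemma exists_hom_of_isPGroup {p : ℕ} [hp : Fact p.Prime] {G : Type*} [Group G] [Finite G]
    (hG : IsPGroup p G) {K : Subgroup G} (hK : K ≠ ⊤) :
    ∃ φ : G →* Multiplicative (ZMod p), K ≤ φ.ker ∧ ∃ g, φ g ≠ 1 := by
  obtain ⟨M, hM, hKM⟩ := (eq_top_or_exists_le_coatom K).resolve_left hK
  have hnil : Group.IsNilpotent G := hG.isNilpotent
  have hMn : M.Normal :=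
    Subgroup.NormalizerCondition.normal_of_coatom M Group.normalizerCondition_of_isNilpotent hM
  have hQ : IsPGroup p (G ⧸ M) := hG.to_quotient M
  have hnt : Nontrivial (G ⧸ M) := QuotientGroup.nontrivial_iff.2 hM.1
  obtain ⟨n, hn, hcard⟩ := (hQ.nontrivial_iff_card).1 hnt
  obtain ⟨x, hx⟩ := exists_prime_orderOf_dvd_card' (G := G ⧸ M) p
    (hcard ▸ dvd_pow_self p hn.ne')
  -- The preimage of the subgroup generated by `x` contains the maximal subgroup `M`; it is not `M`
  -- since `x` is nontrivial, so it is everything.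
  have htop : Subgroup.zpowers x = ⊤ := by
    have hle : M ≤ (Subgroup.zpowers x).comap (QuotientGroup.mk' M) := by
      intro m hm
      rw [Subgroup.mem_comap, QuotientGroup.mk'_apply, (QuotientGroup.eq_one_iff m).2 hm]
      exact one_mem _
    rcases hle.eq_or_lt with h | h
    · exfalso
      obtain ⟨y, rfl⟩ := QuotientGroup.mk'_surjective M x
      have hy : y ∈ M := by
        rw [h]; exact Subgroup.mem_zpowers _
      have h1 : QuotientGroup.mk' M y = 1 := (QuotientGroup.eq_one_iff y).2 hy
      rw [h1, orderOf_one] at hx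
      exact hp.out.one_lt.ne hx
    · have h2 := hM.2 _ h
      rw [eq_top_iff]
      intro z _
      obtain ⟨y, rfl⟩ := QuotientGroup.mk'_surjective M z
      have : y ∈ (Subgroup.zpowers x).comap (QuotientGroup.mk' M) := h2 ▸ Subgroup.mem_top y
      exact this
  have hc : Nat.card (G ⧸ M) = p := by
    rw [← hx, ← Nat.card_zpowers, htop, Subgroup.card_top]
  have hc2 : Nat.card (Multiplicative (ZMod p)) = p := by
    rw [Nat.card_congr Multiplicative.toAdd, Nat.card_zmod]
  let ι : (G ⧸ M) ≃* Multiplicative (ZMod p) := mulEquivOfPrimeCardEq hc hc2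
  refine ⟨ι.toMonoidHom.comp (QuotientGroup.mk' M), fun k hk => ?_, ?_⟩
  · rw [MonoidHom.mem_ker, MonoidHom.comp_apply, QuotientGroup.mk'_apply,
      (QuotientGroup.eq_one_iff k).2 (hKM hk), map_one]
  · obtain ⟨y, rfl⟩ := QuotientGroup.mk'_surjective M x
    refine ⟨y, fun h => ?_⟩
    have : QuotientGroup.mk' M y = 1 := ι.injective (by rw [map_one]; exact h)
    rw [this, orderOf_one] at hx
    exact hp.out.one_lt.ne hx

end PGroup

/-! ### Additive functions with values in `ℤ/p` -/

section Additive

/-- `E` is additive on the subgroup `A` of `SL(2, ℤ)`. -/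
def AdditiveOn {p : ℕ} (E : SL(2, ℤ) → ZMod p) (A : Subgroup SL(2, ℤ)) : Prop :=
  ∀ g ∈ A, ∀ h ∈ A, E (g * h) = E g + E h

namespace AdditiveOn

variable {p : ℕ} {E : SL(2, ℤ) → ZMod p} {A : Subgroup SL(2, ℤ)} (hE : AdditiveOn E A)
include hE

lemma mono {B : Subgroup SL(2, ℤ)} (h : B ≤ A) : AdditiveOn E B :=
  fun g hg k hk => hE g (h hg) k (h hk)

lemma map_one : E 1 = 0 := by
  have := hE 1 A.one_mem 1 A.one_mem
  rw [mul_one] at this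
  simpa using this

lemma map_inv {g : SL(2, ℤ)} (hg : g ∈ A) : E g⁻¹ = -E g := by
  have := hE g hg g⁻¹ (A.inv_mem hg)
  rw [mul_inv_cancel, hE.map_one] at this
  exact (neg_eq_of_add_eq_zero_right this.symm).symm

lemma map_pow {g : SL(2, ℤ)} (hg : g ∈ A) (n : ℕ) : E (g ^ n) = n * E g := by
  induction n with
  | zero => simp [hE.map_one]
  | succ n ih => rw [pow_succ, hE _ (A.pow_mem hg n) _ hg, ih]; push_cast; ring

lemma map_zpow {g : SL(2, ℤ)} (hg : g ∈ A) (n : ℤ) : E (g ^ n) = n * E g := by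
  cases n with
  | ofNat n => simpa using hE.map_pow hg n
  | negSucc n =>
    rw [_root_.zpow_negSucc, hE.map_inv (A.pow_mem hg _), hE.map_pow hg, Int.cast_negSucc]
    push_cast; ring

lemma map_pow_self {g : SL(2, ℤ)} (hg : g ∈ A) : E (g ^ p) = 0 := by
  rw [hE.map_pow hg]; simp

lemma map_conj {g k : SL(2, ℤ)} (hg : g ∈ A) (hk : k ∈ A) : E (k * g * k⁻¹) = E g := by
  rw [hE _ (A.mul_mem hk hg) _ (A.inv_mem hk), hE _ hk _ hg, hE.map_inv hk]; ring

/-- The kernel of an additive function. -/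
def ker : Subgroup SL(2, ℤ) where
  carrier := {g | g ∈ A ∧ E g = 0}
  one_mem' := ⟨A.one_mem, hE.map_one⟩
  mul_mem' {g h} hg hh := ⟨A.mul_mem hg.1 hh.1, by rw [hE _ hg.1 _ hh.1, hg.2, hh.2, add_zero]⟩
  inv_mem' {g} hg := ⟨A.inv_mem hg.1, by rw [hE.map_inv hg.1, hg.2, neg_zero]⟩

lemma mem_ker {g : SL(2, ℤ)} : g ∈ hE.ker ↔ g ∈ A ∧ E g = 0 := Iff.rfl

/-- An additive function that vanishes on `Γ(n)` depends only on the reduction modulo `n`. -/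
lemma eq_of_red_eq {n : ℕ} (hA : Gamma n ≤ A) (h0 : ∀ g ∈ Gamma n, E g = 0) {g h : SL(2, ℤ)}
    (hg : g ∈ A) (e : red n g = red n h) : E g = E h := by
  have h1 := mem_Gamma_of_red_eq e
  have h2 := hE g hg _ (hA h1)
  rw [mul_inv_cancel_left, h0 _ h1, add_zero] at h2
  exact h2.symm

end AdditiveOn

/-- Modulo `p ^ e` the group `A` becomes a finite p-group in which the image of `H` is still proper,
as `H` contains `Γ(p ^ e)`. The character of the finite group is pulled back to `A` and extended by
the irrelevant value `0` outside `A`. -/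
lemma exists_additiveOn {p e : ℕ} [hp : Fact p.Prime] {A H : Subgroup SL(2, ℤ)}
    (hH : Gamma (p ^ e) ≤ H) (hHA : H < A) (hA : ∀ g ∈ A, ∃ n, g ^ p ^ n ∈ Gamma (p ^ e)) :
    ∃ E : SL(2, ℤ) → ZMod p, AdditiveOn E A ∧ (∀ h ∈ H, E h = 0) ∧ ∃ g ∈ A, E g ≠ 0 := by
  classical
  have : NeZero (p ^ e) := ⟨pow_ne_zero e hp.out.ne_zero⟩
  let P := A.map (red (p ^ e))
  have hP : IsPGroup p P := by
    rintro ⟨_, g, hg, rfl⟩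
    obtain ⟨n, hn⟩ := hA g hg
    refine ⟨n, Subtype.ext ?_⟩
    exact (_root_.map_pow (red (p ^ e)) g (p ^ n)).symm.trans ((Gamma_mem' (N := p ^ e)).1 hn)
  obtain ⟨g0, hg0, hg0H⟩ := SetLike.exists_of_lt hHA
  let K := (H.map (red (p ^ e))).subgroupOf P
  have hK : K ≠ ⊤ := by
    intro hK
    have : (⟨red (p ^ e) g0, g0, hg0, rfl⟩ : P) ∈ K := hK ▸ Subgroup.mem_top _
    obtain ⟨h, hh, e⟩ := this
    exact hg0H (mem_of_red_eq hH hh e)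
  obtain ⟨φ, hφK, ⟨_, g, hg, rfl⟩, hφg⟩ := exists_hom_of_isPGroup hP hK
  refine ⟨fun x => if hx : x ∈ A then (φ ⟨red (p ^ e) x, x, hx, rfl⟩).toAdd else 0, ?_, ?_,
    g, hg, ?_⟩
  · intro x hx y hy
    simp only [dif_pos hx, dif_pos hy, dif_pos (A.mul_mem hx hy), ← toAdd_mul, ← map_mul]
    congr 2
    exact Subtype.ext (_root_.map_mul (red (p ^ e)) x y)
  · intro h hh
    simp only [dif_pos (hHA.le hh)]
    have : (⟨red (p ^ e) h, h, hHA.le hh, rfl⟩ : P) ∈ K := ⟨h, hh, rfl⟩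
    rw [hφK this]; rfl
  · exact fun h0 => hφg (Multiplicative.toAdd.injective
      ((dif_pos (c := g ∈ A) hg).symm.trans h0))

end Additive

/-! ### Levels of additive functions -/

section Level

/-- `Γ(m)` is generated by unipotent elements modulo `Γ(n)` if `n ∣ m ^ 2`. -/
lemma red_eq_prod_of_mem_Gamma {m n : ℕ} (hn : n ∣ m * m) {g : SL(2, ℤ)} {a b c : ℤ}
    (hg : g ∈ Gamma m) (h00 : g 0 0 = 1 + m * a) (hb : g 0 1 = m * b) (hc : g 1 0 = m * c) :
    red n g = red n (up (m * (b + a)) * lo (m * (c - a)) * (lo 1 * up (m * (-a)) * (lo 1)⁻¹)) := by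
  obtain ⟨d, hd⟩ := (mem_Gamma_iff.1 hg).2.2.2
  have hdet := det_eq g
  have h11 : g 1 1 = 1 + m * d := by linarith
  have hn' : (n : ℤ) ∣ m * m := by exact_mod_cast Int.natCast_dvd_natCast.2 hn
  -- The determinant makes the deviation from the identity a trace zero matrix modulo `n`. This
  -- three-dimensional space is spanned by an upper unipotent, a lower unipotent and one conjugate
  -- of an upper unipotent.
  have had : (n : ℤ) ∣ m * a + m * d := by
    have : (m : ℤ) * a + m * d = (m * m) * (b * c - a * d) := by
      rw [h00, h11, hb, hc] at hdet
      linear_combination hdet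
    rw [this]
    exact hn'.mul_right _
  have hmul (x : ℤ) : (n : ℤ) ∣ m * m * x := hn'.mul_right x
  refine red_eq_iff.2 ?_
  simp only [mul_apply_zero_zero, mul_apply_zero_one, mul_apply_one_zero, mul_apply_one_one,
    up_zero_zero, up_zero_one, up_one_zero, up_one_one, lo_zero_zero, lo_zero_one, lo_one_zero,
    lo_one_one, inv_apply_zero_zero, inv_apply_zero_one, inv_apply_one_zero, inv_apply_one_one,
    h00, h11, hb, hc]
  obtain ⟨q, hq⟩ := hn'
  obtain ⟨r, hr⟩ := had
  have hd' : (m : ℤ) * d = n * r - m * a := by linarith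
  refine ⟨?_, ?_, ?_, ?_⟩
  · exact ⟨q * ((b + a) * (c - a) * (1 + m * a) + (b + a) * a), by
      linear_combination ((b + a) * (c - a) * (1 + m * a) + (b + a) * a) * hq⟩
  · exact ⟨q * (-(b + a) * (c - a) * m * a - (b + a) * a), by
      linear_combination (-(b + a) * (c - a) * m * a - (b + a) * a) * hq⟩
  · exact ⟨q * ((c - a) * a), by linear_combination ((c - a) * a) * hq⟩
  · exact ⟨-r + q * (-(c - a) * a), by linear_combination (-(c - a) * a) * hq - hr⟩

/-- An additive function with values in `ℤ/p` that is trivial on some `Γ(p ^ e)` is trivial on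
`Γ(p ^ (k + 1))` if it is defined on `Γ(p ^ k)`. -/
lemma AdditiveOn.eq_zero_of_mem_Gamma {p : ℕ} {E : SL(2, ℤ) → ZMod p} {A : Subgroup SL(2, ℤ)}
    (hE : AdditiveOn E A) {k e : ℕ} (hA : Gamma (p ^ k) ≤ A)
    (he : ∀ g ∈ Gamma (p ^ e), E g = 0) :
    ∀ g ∈ Gamma (p ^ (k + 1)), E g = 0 := by
  -- Modulo `Γ(p ^ (j + 2))`, elements of `Γ(p ^ (j + 1))` are products of `p`-th powers of elements
  -- of `Γ(p ^ j)`, and `E` kills `p`-th powers. The vanishing thus climbs from `e` down to `k + 1`.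
  have step (j : ℕ) (hkj : k ≤ j) (h0 : ∀ g ∈ Gamma (p ^ (j + 2)), E g = 0) :
      ∀ g ∈ Gamma (p ^ (j + 1)), E g = 0 := by
    intro g hg
    have hj : Gamma (p ^ j) ≤ A := (Gamma_le_of_dvd (pow_dvd_pow p hkj)).trans hA
    obtain ⟨⟨a, ha⟩, ⟨b, hb⟩, ⟨c, hc⟩, -⟩ := mem_Gamma_iff.1 hg
    have h := red_eq_prod_of_mem_Gamma (n := p ^ (j + 2))
      (by rw [← pow_add]; exact pow_dvd_pow p (by omega)) hg (sub_eq_iff_eq_add'.1 ha) hb hc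
    have hgA : g ∈ A := hj (Gamma_le_of_dvd (pow_dvd_pow p (by omega)) hg)
    have hj2 : Gamma (p ^ (j + 2)) ≤ A := (Gamma_le_of_dvd (pow_dvd_pow p (by omega))).trans hj
    rw [hE.eq_of_red_eq hj2 h0 hgA h]
    have e1 (w : ℤ) : up ((p ^ (j + 1) : ℕ) * w) = up ((p ^ j : ℕ) * w) ^ p := by
      rw [up_pow]; congr 1; push_cast; ring
    have e2 (w : ℤ) : lo ((p ^ (j + 1) : ℕ) * w) = lo ((p ^ j : ℕ) * w) ^ p := by
      rw [lo_pow]; congr 1; push_cast; ring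
    have m1 (w : ℤ) : up ((p ^ j : ℕ) * w) ∈ A := hj (up_mem_Gamma ⟨w, rfl⟩)
    have m2 (w : ℤ) : lo ((p ^ j : ℕ) * w) ∈ A := hj (lo_mem_Gamma ⟨w, rfl⟩)
    have m3 : lo 1 * up ((p ^ j : ℕ) * (-a)) * (lo 1)⁻¹ ∈ A :=
      hj (conj_mem_Gamma (up_mem_Gamma ⟨-a, rfl⟩) _)
    rw [e1, e2, e1, ← conj_pow, hE _ (A.mul_mem (A.pow_mem (m1 _) _) (A.pow_mem (m2 _) _)) _
      (A.pow_mem m3 _), hE _ (A.pow_mem (m1 _) _) _ (A.pow_mem (m2 _) _),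
      hE.map_pow_self (m1 _), hE.map_pow_self (m2 _), hE.map_pow_self m3]
    simp
  rcases le_or_gt e (k + 1) with hek | hek
  · exact fun g hg => he g (Gamma_le_of_dvd (pow_dvd_pow p hek) hg)
  · obtain ⟨d, rfl⟩ := Nat.exists_eq_add_of_le hek.le
    clear hek
    induction d with
    | zero => exact he
    | succ d ih =>
      exact ih (step (k + d) (by omega) (by convert he using 4; ring)
        |> fun h => by convert h using 4; ring)

/-- From `(1 + nX) ^ p ≡ 1 + pnX` modulo `n²`, and `np` divides `n²`. -/
lemma pow_mem_Gamma_mul {p n : ℕ} (hpn : p ∣ n) {g : SL(2, ℤ)} (hg : g ∈ Gamma n) :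
    g ^ p ∈ Gamma (n * p) := by
  obtain ⟨⟨a, ha⟩, ⟨b, hb⟩, ⟨c, hc⟩, ⟨d, hd⟩⟩ := mem_Gamma_iff.1 hg
  have h00 : g 0 0 = 1 + n * a := by linarith
  have h11 : g 1 1 = 1 + n * d := by linarith
  have key (k : ℕ) : ∃ x y z w : ℤ, (g ^ k) 0 0 = 1 + k * (n * a) + n * n * x ∧
      (g ^ k) 0 1 = k * (n * b) + n * n * y ∧ (g ^ k) 1 0 = k * (n * c) + n * n * z ∧
      (g ^ k) 1 1 = 1 + k * (n * d) + n * n * w := by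
    induction k with
    | zero => exact ⟨0, 0, 0, 0, by simp⟩
    | succ k ih =>
      obtain ⟨x, y, z, w, h1, h2, h3, h4⟩ := ih
      rw [pow_succ]
      simp only [mul_apply_zero_zero, mul_apply_zero_one, mul_apply_one_zero, mul_apply_one_one,
        h1, h2, h3, h4, h00, h11, hb, hc]
      refine ⟨x + k * a * a + n * x * a + k * b * c + n * y * c,
        k * a * b + n * x * b + y + k * b * d + n * y * d,
        z + k * c * a + n * z * a + k * d * c + n * w * c,
        k * c * b + n * z * b + w + k * d * d + n * w * d, ?_, ?_, ?_, ?_⟩ <;>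
      push_cast <;> ring
  obtain ⟨x, y, z, w, h1, h2, h3, h4⟩ := key p
  obtain ⟨q, rfl⟩ := hpn
  rw [mem_Gamma_iff, h1, h2, h3, h4]
  push_cast
  exact ⟨⟨a + q * x, by ring⟩, ⟨b + q * y, by ring⟩, ⟨c + q * z, by ring⟩, ⟨d + q * w, by ring⟩⟩

lemma pow_mem_Gamma_pow {p k : ℕ} (hk : k ≠ 0) {g : SL(2, ℤ)} (hg : g ∈ Gamma (p ^ k)) (n : ℕ) :
    g ^ p ^ n ∈ Gamma (p ^ (k + n)) := by
  induction n with
  | zero => simpa using hg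
  | succ n ih =>
    rw [pow_succ, pow_mul, ← add_assoc, pow_succ p]
    exact pow_mem_Gamma_mul (dvd_pow_self p (by omega)) ih

lemma mem_Gamma1_iff {n : ℕ} {g : SL(2, ℤ)} : g ∈ Gamma1 n ↔
    (n : ℤ) ∣ g 0 0 - 1 ∧ (n : ℤ) ∣ g 1 0 ∧ (n : ℤ) ∣ g 1 1 - 1 := by
  rw [Gamma1_mem]
  simp only [← ZMod.intCast_zmod_eq_zero_iff_dvd, Int.cast_sub, Int.cast_one, sub_eq_zero]
  tauto

lemma mem_Gamma0_iff {n : ℕ} {g : SL(2, ℤ)} : g ∈ Gamma0 n ↔ (n : ℤ) ∣ g 1 0 := by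
  rw [Gamma0_mem, ZMod.intCast_zmod_eq_zero_iff_dvd]

lemma Gamma_le_Gamma1 (n : ℕ) : Gamma n ≤ Gamma1 n := by
  intro g hg
  rw [mem_Gamma_iff] at hg
  exact mem_Gamma1_iff.2 ⟨hg.1, hg.2.2.1, hg.2.2.2⟩

lemma red_eq_up_of_mem_Gamma1 {n : ℕ} {g : SL(2, ℤ)} (hg : g ∈ Gamma1 n) :
    red n g = red n (up (g 0 1)) := by
  obtain ⟨h1, h2, h3⟩ := mem_Gamma1_iff.1 hg
  rw [red_eq_iff]
  simpa using ⟨(dvd_sub_comm).1 h1, h2, (dvd_sub_comm).1 h3⟩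

lemma pow_mem_Gamma_of_mem_Gamma1 {n : ℕ} {g : SL(2, ℤ)} (hg : g ∈ Gamma1 n) :
    g ^ n ∈ Gamma n := by
  rw [Gamma_mem', _root_.map_pow, red_eq_up_of_mem_Gamma1 hg, ← _root_.map_pow, up_pow]
  exact up_mem_Gamma (Dvd.intro_left _ rfl)

/-- The first `p`-th power lands in `Γ(p)` because the reduction modulo `p` is unipotent; each
further one gains a factor `p` in the level. -/
lemma exists_pow_mem_Gamma_of_mem_Gamma1 {p : ℕ} (e : ℕ) {g : SL(2, ℤ)} (hg : g ∈ Gamma1 p) :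
    ∃ n, g ^ p ^ n ∈ Gamma (p ^ e) := by
  refine ⟨e + 1, ?_⟩
  have h1 : g ^ p ∈ Gamma (p ^ 1) := by
    rw [pow_one]; exact pow_mem_Gamma_of_mem_Gamma1 hg
  have := pow_mem_Gamma_pow one_ne_zero h1 e
  rw [← pow_mul, ← pow_succ'] at this
  exact Gamma_le_of_dvd (pow_dvd_pow p (by omega)) this

/-- A subgroup of `Γ₁(p)` of level `p ^ e` is equal to any subgroup containing it, if all additive
functions that vanish on it vanish. -/
lemma eq_of_forall_additiveOn {p e : ℕ} [hp : Fact p.Prime] {A H : Subgroup SL(2, ℤ)}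
    (hH : Gamma (p ^ e) ≤ H) (hHA : H ≤ A) (hA : A ≤ Gamma1 p)
    (h : ∀ E : SL(2, ℤ) → ZMod p, AdditiveOn E A → (∀ h ∈ H, E h = 0) → ∀ g ∈ A, E g = 0) :
    H = A := by
  rcases hHA.eq_or_lt with h1 | h1
  · exact h1
  · obtain ⟨E, hE, hEH, g, hg, hne⟩ := exists_additiveOn hH h1
      fun g hg => exists_pow_mem_Gamma_of_mem_Gamma1 e (hA hg)
    exact absurd (h E hE hEH g hg) hne

end Level

end ModCurve

namespace ModCurve

open Matrix Matrix.SpecialLinearGroup CongruenceSubgroup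

/-! ### A unipotent element modulo `p` -/

section Unipotent

lemma trace_conj_eq (g k : SL(2, ℤ)) :
    (k⁻¹ * g * k) 0 0 + (k⁻¹ * g * k) 1 1 = g 0 0 + g 1 1 := by
  have := det_eq k
  simp only [mul_apply_zero_zero, mul_apply_zero_one, mul_apply_one_zero, mul_apply_one_one,
    inv_apply_zero_zero, inv_apply_zero_one, inv_apply_one_zero, inv_apply_one_one]
  linear_combination (g 0 0 + g 1 1) * this

/-- In characteristic `p` one has `(X - 1) ^ p = X ^ p - 1 = 0`, so `det (X - 1) = 0`; and `det (X -
1) = 2 - tr X` when `det X = 1`. -/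
lemma dvd_trace_sub_two {p : ℕ} [hp : Fact p.Prime] {g : SL(2, ℤ)} (hg : red p g ^ p = 1) :
    (p : ℤ) ∣ g 0 0 + g 1 1 - 2 := by
  set X : Matrix (Fin 2) (Fin 2) (ZMod p) := (red p g : Matrix (Fin 2) (Fin 2) (ZMod p)) with hX
  have h1 : X ^ p = 1 := by
    exact (Matrix.SpecialLinearGroup.coe_pow (red p g) p).symm.trans (congrArg Subtype.val hg)
  have h2 : (X - 1) ^ p = 0 := by
    rw [sub_pow_char_of_commute (p := p) (Commute.one_right X), h1, one_pow, sub_self]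
  have h3 : (X - 1).det = 0 := by
    have : (X - 1).det ^ p = 0 := by
      rw [← Matrix.det_pow, h2, Matrix.det_zero]
    exact pow_eq_zero_iff hp.out.ne_zero |>.1 this
  have hd : X.det = 1 := (red p g).2
  rw [Matrix.det_fin_two] at h3 hd
  simp only [Matrix.sub_apply, Matrix.one_apply_eq, Matrix.one_apply_ne (zero_ne_one),
    Matrix.one_apply_ne (one_ne_zero), sub_zero] at h3
  rw [← ZMod.intCast_zmod_eq_zero_iff_dvd]
  have e00 : X 0 0 = ((g 0 0 : ℤ) : ZMod p) := rfl
  have e11 : X 1 1 = ((g 1 1 : ℤ) : ZMod p) := rfl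
  push_cast
  rw [← e00, ← e11]
  linear_combination hd - h3

/-- A subgroup of `SL(2, ℤ)` whose image modulo `p` has order divisible by `p` contains, up to
conjugacy, an element congruent to the standard unipotent element. -/
lemma exists_conj_red_eq_up {p : ℕ} [hp : Fact p.Prime] {Γ : Subgroup SL(2, ℤ)}
    (h : p ∣ Nat.card (reduction Γ p)) :
    ∃ k, ∃ γ ∈ conjBy k Γ, red p γ = red p (up 1) := by
  classical
  obtain ⟨⟨_, g, hg, rfl⟩, hx⟩ := exists_prime_orderOf_dvd_card' (G := reduction Γ p) p h
  have hx' : orderOf (red p g) = p := by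
    exact (orderOf_injective (reduction Γ p).subtype Subtype.val_injective
      ⟨red p g, g, hg, rfl⟩).trans hx
  have hpow : red p g ^ p = 1 := by
    have := pow_orderOf_eq_one (red p g)
    rwa [hx'] at this
  have hne : red p g ≠ 1 := by
    intro h1
    rw [h1, orderOf_one] at hx'
    exact hp.out.one_lt.ne hx'
  have htr := dvd_trace_sub_two hpow
  have hprime : Prime (p : ℤ) := Nat.prime_iff_prime_int.1 hp.out
  obtain ⟨k, hk⟩ : ∃ k : SL(2, ℤ), (p : ℤ) ∣ (k⁻¹ * g * k) 1 0 := by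
    by_cases hc : (p : ℤ) ∣ g 1 0
    · exact ⟨1, by simpa using hc⟩
    -- The vector `(r, 1)` is fixed by `g` modulo `p`; it is made the first column of `k`, so that
    -- the conjugate becomes upper triangular modulo `p`.
    · obtain ⟨r, hr⟩ : ∃ r : ℤ, (p : ℤ) ∣ g 1 0 * r - (g 0 0 - 1) := by
        have hcop : IsCoprime (g 1 0) (p : ℤ) := (hprime.coprime_iff_not_dvd.2 hc).symm
        obtain ⟨u, v, huv⟩ := hcop
        exact ⟨u * (g 0 0 - 1), -(v * (g 0 0 - 1)), by linear_combination (g 0 0 - 1) * huv⟩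
      refine ⟨mk r (-1) 1 0 (by ring), ?_⟩
      refine (hprime.dvd_or_dvd ?_).resolve_left hc
      have hdet := det_eq g
      obtain ⟨q, hq⟩ := hr
      obtain ⟨t, ht⟩ := htr
      simp only [mul_apply_zero_zero, mul_apply_zero_one, mul_apply_one_zero, mul_apply_one_one,
        inv_apply_zero_zero, inv_apply_zero_one, inv_apply_one_zero, inv_apply_one_one,
        mk_zero_zero, mk_zero_one, mk_one_zero, mk_one_one]
      refine ⟨q * (g 1 0 * r + (g 0 0 - 1) + g 1 1 - g 0 0) - t, ?_⟩
      linear_combination (g 1 0 * r + (g 0 0 - 1) + g 1 1 - g 0 0) * hq + hdet - ht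
  set γ := k⁻¹ * g * k with hγ
  have htr' : (p : ℤ) ∣ γ 0 0 + γ 1 1 - 2 := by rwa [hγ, trace_conj_eq]
  have hdet := det_eq γ
  have ha : (p : ℤ) ∣ γ 0 0 - 1 := by
    obtain ⟨t, ht⟩ := htr'
    obtain ⟨q, hq⟩ := hk
    refine hprime.dvd_of_dvd_pow (n := 2) ⟨γ 0 0 * t - γ 0 1 * q, ?_⟩
    linear_combination (γ 0 0) * ht - hdet - γ 0 1 * hq
  have hd : (p : ℤ) ∣ γ 1 1 - 1 := by
    have e : γ 1 1 - 1 = (γ 0 0 + γ 1 1 - 2) - (γ 0 0 - 1) := by ring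
    rw [e]
    exact dvd_sub htr' ha
  have hγ1 : γ ∈ Gamma1 p := mem_Gamma1_iff.2 ⟨ha, hk, hd⟩
  have hb : ¬ (p : ℤ) ∣ γ 0 1 := by
    intro hb
    have : γ ∈ Gamma p := mem_Gamma_iff.2 ⟨ha, hb, hk, hd⟩
    have h2 := conj_mem_Gamma this k
    rw [hγ] at h2
    have h3 : g ∈ Gamma p := by simpa [mul_assoc] using h2
    exact hne ((Gamma_mem' (N := p)).1 h3)
  obtain ⟨u, v, huv⟩ : IsCoprime (γ 0 1) (p : ℤ) := (hprime.coprime_iff_not_dvd.2 hb).symm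
  -- The exponent `u` inverts the upper right entry modulo `p`.
  refine ⟨k⁻¹, γ ^ u, Subgroup.zpow_mem _ ?_ u, ?_⟩
  · rw [mem_conjBy]
    simpa [hγ, mul_assoc] using hg
  · rw [_root_.map_zpow, red_eq_up_of_mem_Gamma1 hγ1, ← _root_.map_zpow, up_zpow, red_eq_iff]
    simp only [up_zero_zero, up_zero_one, up_one_zero, up_one_one, sub_self, dvd_zero, true_and,
      and_true]
    exact ⟨v, by linear_combination -huv⟩

end Unipotent

/-! ### The image modulo `p` fixes a line -/

section FullImage

variable {p : ℕ}

/-- The additive functions on `Γ(m)`. -/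
lemma AdditiveOn.exists_linear {E : SL(2, ℤ) → ZMod p} {m : ℕ} (hE : AdditiveOn E (Gamma m))
    (hpm : p ∣ m) (h0 : ∀ g ∈ Gamma (m * p), E g = 0) :
    ∃ α β δ : ZMod p, ∀ g ∈ Gamma m, ∀ a b c : ℤ, g 0 0 = 1 + m * a → g 0 1 = m * b →
      g 1 0 = m * c → E g = a * α + b * β + c * δ := by
  have hA2 : Gamma (m * p) ≤ Gamma m := Gamma_le_of_dvd (Dvd.intro _ rfl)
  have m1 : up m ∈ Gamma m := up_mem_Gamma dvd_rfl
  have m2 : lo m ∈ Gamma m := lo_mem_Gamma dvd_rfl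
  have m3 : lo 1 * up m * (lo 1)⁻¹ ∈ Gamma m := conj_mem_Gamma m1 _
  refine ⟨E (up m) - E (lo m) - E (lo 1 * up m * (lo 1)⁻¹), E (up m), E (lo m),
    fun g hg a b c h00 hb hc => ?_⟩
  have h := red_eq_prod_of_mem_Gamma (n := m * p) (mul_dvd_mul_left m hpm) hg h00 hb hc
  rw [hE.eq_of_red_eq hA2 h0 hg h, ← up_zpow, ← lo_zpow, ← up_zpow, ← conj_zpow,
    hE _ (Subgroup.mul_mem _ (Subgroup.zpow_mem _ m1 _) (Subgroup.zpow_mem _ m2 _)) _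
      (Subgroup.zpow_mem _ m3 _), hE _ (Subgroup.zpow_mem _ m1 _) _ (Subgroup.zpow_mem _ m2 _),
    hE.map_zpow m1, hE.map_zpow m2, hE.map_zpow m3]
  push_cast
  ring

/-- The `n`-th power of a matrix in `SL(2, ℤ)` with trace `2 + t`, modulo `t²`. -/
lemma exists_pow_eq (g : SL(2, ℤ)) (t : ℤ) (ht : g 0 0 + g 1 1 = 2 + t) (n : ℕ) :
    ∃ x y : ℤ, let A := -((n : ℤ) - 1) - t * (n.choose 3 : ℤ) + t * t * x
      let B := (n : ℤ) + t * ((n + 1).choose 3 : ℤ) + t * t * y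
      (g ^ n) 0 0 = A + B * g 0 0 ∧ (g ^ n) 0 1 = B * g 0 1 ∧ (g ^ n) 1 0 = B * g 1 0 ∧
      (g ^ n) 1 1 = A + B * g 1 1 := by
  induction n with
  | zero => exact ⟨0, 0, by simp [Nat.choose]⟩
  | succ n ih =>
    obtain ⟨x, y, h1, h2, h3, h4⟩ := ih
    have hdet := det_eq g
    -- By Cayley–Hamilton `g² = (2 + t) g - 1`, so `g ^ n = A + B g` with the recursion `A' = -B`,
    -- `B' = A + (2 + t) B`. This is its coefficient of `t`.
    have hc : ((n + 2).choose 3 : ℤ) = 2 * ((n + 1).choose 3 : ℤ) - (n.choose 3 : ℤ) + n := by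
      have e1 : (n + 2).choose 3 = (n + 1).choose 2 + (n + 1).choose 3 := Nat.choose_succ_succ' _ _
      have e2 : (n + 1).choose 3 = n.choose 2 + n.choose 3 := Nat.choose_succ_succ' _ _
      have e3 : (n + 1).choose 2 = n.choose 1 + n.choose 2 := Nat.choose_succ_succ' _ _
      rw [Nat.choose_one_right] at e3
      push_cast [e1, e2, e3]; ring
    refine ⟨-y, x + 2 * y + ((n + 1).choose 3 : ℤ) + t * y, ?_⟩
    simp only [pow_succ, mul_apply_zero_zero, mul_apply_zero_one, mul_apply_one_zero,
      mul_apply_one_one, h1, h2, h3, h4, Nat.cast_add, Nat.cast_one, hc]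
    have hd : g 1 1 = 2 + t - g 0 0 := by linarith
    rw [hd] at hdet
    rw [hd]
    set A := -((n : ℤ) - 1) - t * (n.choose 3 : ℤ) + t * t * x
    set B := (n : ℤ) + t * ((n + 1).choose 3 : ℤ) + t * t * y with hB
    refine ⟨?_, ?_, ?_, ?_⟩
    · linear_combination (-B) * hdet
    · ring
    · ring
    · linear_combination (-B) * hdet

/-- The trace is `2 + t` with `p ∣ t`, and for `p ≥ 5` both `p.choose 3` and `(p + 1).choose 3` are
divisible by `p`. So modulo `p²` the expansion of `g ^ p` is `(1 - p) + p g`. For `p = 3` the first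
coefficient is `1`, and the argument breaks down. -/
lemma red_pow_eq_of_red_eq_up (hp : p.Prime) (h5 : 5 ≤ p) {g : SL(2, ℤ)}
    (hg : red p g = red p (up 1)) : red (p ^ 2) (g ^ p) = red (p ^ 2) (up p) := by
  obtain ⟨⟨a, ha⟩, ⟨b, hb⟩, ⟨c, hc⟩, ⟨d, hd⟩⟩ := red_eq_iff.1 hg.symm
  simp only [up_zero_zero, up_zero_one, up_one_zero, up_one_one] at ha hb hc hd
  obtain ⟨x, y, h1, h2, h3, h4⟩ := exists_pow_eq g (p * (a + d)) (by linear_combination ha + hd) p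
  obtain ⟨m, hm⟩ := hp.dvd_choose_self (k := 3) (by norm_num) (by omega)
  obtain ⟨m', hm'⟩ : p ∣ (p + 1).choose 3 := by
    rw [Nat.choose_succ_succ']
    exact dvd_add (hp.dvd_choose_self (by norm_num) (by omega))
      (hp.dvd_choose_self (by norm_num) (by omega))
  rw [hm, hm'] at h1 h4
  rw [hm'] at h2 h3
  have e00 : g 0 0 = 1 + p * a := by linarith
  have e01 : g 0 1 = 1 + p * b := by linarith
  have e10 : g 1 0 = p * c := by linarith
  have e11 : g 1 1 = 1 + p * d := by linarith
  rw [red_eq_iff, h1, h2, h3, h4, e00, e01, e10, e11]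
  simp only [up_zero_zero, up_zero_one, up_one_zero, up_one_one]
  push_cast
  refine ⟨?_, ?_, ?_, ?_⟩
  · exact ⟨-a - (-(a + d) * m + (a + d) ^ 2 * x + ((a + d) * m' + (a + d) ^ 2 * y) * (1 + p * a)),
      by ring⟩
  · exact ⟨-b - ((a + d) * m' + (a + d) ^ 2 * y) * (1 + p * b), by ring⟩
  · exact ⟨-c - ((a + d) * m' + (a + d) ^ 2 * y) * (p * c), by ring⟩
  · exact ⟨-d - (-(a + d) * m + (a + d) ^ 2 * x + ((a + d) * m' + (a + d) ^ 2 * y) * (1 + p * d)),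
      by ring⟩

/-- If the image of `Γ` in `SL(2, 𝔽_p)` contains a unipotent element and does not fix its
fixed line, and `Γ ∩ Γ(p)` is not contained in `Γ(p²)`, then a functional that is trivial on
`Γ ∩ Γ(p)` is trivial. -/
lemma eq_zero_of_linear [hp : Fact p.Prime] (hp2 : p ≠ 2) {Γ : Subgroup SL(2, ℤ)}
    {γ₀ g₀ k : SL(2, ℤ)} (hγ₀ : γ₀ ∈ Γ) (h0 : red p γ₀ = red p (up 1)) (hg₀ : g₀ ∈ Γ)
    (hc₀ : ¬ (p : ℤ) ∣ g₀ 1 0) {α β δ : ZMod p} {E : SL(2, ℤ) → ZMod p}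
    (hE : ∀ g ∈ Gamma p, ∀ a b c : ℤ, g 0 0 = 1 + p * a → g 0 1 = p * b →
      g 1 0 = p * c → E g = a * α + b * β + c * δ)
    (hk : k ∈ Γ) (hkp : k ∈ Gamma p) (hkp2 : k ∉ Gamma (p ^ 2))
    (hΓ : ∀ γ ∈ Γ, γ ∈ Gamma p → E γ = 0) : α = 0 ∧ β = 0 ∧ δ = 0 := by
  obtain ⟨⟨a, ha⟩, ⟨b, hb⟩, ⟨c, hc⟩, ⟨d, hd⟩⟩ := mem_Gamma_iff.1 hkp
  have k00 : k 0 0 = 1 + p * a := by linarith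
  have k11 : k 1 1 = 1 + p * d := by linarith
  have hp0 : (p : ℤ) ≠ 0 := by exact_mod_cast hp.out.ne_zero
  have hdet := det_eq k
  -- `Γ(p)/Γ(p²)` is the space of trace zero matrices over `𝔽_p`, with `Γ` acting by conjugation.
  have hda : (d : ZMod p) = -a := by
    rw [k00, k11, hb, hc] at hdet
    have h1 : a + d + p * (a * d - b * c) = 0 := by
      apply mul_left_cancel₀ hp0
      linear_combination hdet
    have h2 := congrArg (Int.cast : ℤ → ZMod p) h1
    push_cast at h2
    rw [CharP.cast_eq_zero, zero_mul, add_zero] at h2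
    exact (neg_eq_of_add_eq_zero_right h2).symm
  have h2 : (2 : ZMod p) ≠ 0 := by
    intro h
    have : ((2 : ℕ) : ZMod p) = 0 := by exact_mod_cast h
    rw [ZMod.natCast_eq_zero_iff] at this
    exact hp2 ((Nat.prime_dvd_prime_iff_eq hp.out Nat.prime_two).1 this)
  -- the functional is trivial on the conjugates of `k`
  have L (g : SL(2, ℤ)) (hg : g ∈ Γ) : ∀ x y z w : ZMod p, x = (g 0 0 : ℤ) → y = (g 0 1 : ℤ) →
      z = (g 1 0 : ℤ) → w = (g 1 1 : ℤ) →
      a * ((x * w + y * z) * α - 2 * x * y * β + 2 * z * w * δ) +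
      b * (-(x * z) * α + x ^ 2 * β - z ^ 2 * δ) + c * (y * w * α - y ^ 2 * β + w ^ 2 * δ) = 0 := by
    rintro x y z w rfl rfl rfl rfl
    have hmem := hΓ (g * k * g⁻¹) (Γ.mul_mem (Γ.mul_mem hg hk) (Γ.inv_mem hg))
      (conj_mem_Gamma hkp g)
    have hdg := det_eq g
    rw [hE _ (conj_mem_Gamma hkp g)
      ((g 0 0 * a + g 0 1 * c) * g 1 1 - (g 0 0 * b + g 0 1 * d) * g 1 0)
      (-(g 0 0 * a + g 0 1 * c) * g 0 1 + (g 0 0 * b + g 0 1 * d) * g 0 0)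
      ((g 1 0 * a + g 1 1 * c) * g 1 1 - (g 1 0 * b + g 1 1 * d) * g 1 0)] at hmem
    · push_cast at hmem
      rw [hda] at hmem
      linear_combination hmem
    all_goals
      simp only [mul_apply_zero_zero, mul_apply_zero_one, mul_apply_one_zero, mul_apply_one_one,
        inv_apply_zero_zero, inv_apply_zero_one, inv_apply_one_zero, inv_apply_one_one, k00, k11,
        hb, hc]
    · linear_combination hdg
    · ring
    · ring
  obtain ⟨g1, g2, g3, g4⟩ := red_eq_iff.1 h0
  simp only [up_zero_zero, up_zero_one, up_one_zero, up_one_one, ← ZMod.intCast_zmod_eq_zero_iff_dvd,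
    Int.cast_sub, Int.cast_one, Int.cast_zero, sub_eq_zero] at g1 g2 g3 g4
  have hne : ¬ ((a : ZMod p) = 0 ∧ (b : ZMod p) = 0 ∧ (c : ZMod p) = 0) := by
    rintro ⟨h1, h2, h3⟩
    have h4 : (d : ZMod p) = 0 := by rw [hda, h1, neg_zero]
    rw [ZMod.intCast_zmod_eq_zero_iff_dvd] at h1 h2 h3 h4
    refine hkp2 (mem_Gamma_iff.2 ?_)
    rw [ha, hb, hc, hd, sq]
    push_cast
    exact ⟨mul_dvd_mul_left _ h1, mul_dvd_mul_left _ h2, mul_dvd_mul_left _ h3,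
      mul_dvd_mul_left _ h4⟩
  -- the functional is trivial on the conjugates of the unipotent element
  have B (g : SL(2, ℤ)) (hg : g ∈ Γ) : ∀ x z : ZMod p, x = (g 0 0 : ℤ) → z = (g 1 0 : ℤ) →
      -(x * z) * α + x ^ 2 * β - z ^ 2 * δ = 0 := by
    rintro x z hx hz
    obtain ⟨y, hy⟩ : ∃ y : ZMod p, y = (g 0 1 : ℤ) := ⟨_, rfl⟩
    obtain ⟨w, hw⟩ : ∃ w : ZMod p, w = (g 1 1 : ℤ) := ⟨_, rfl⟩
    have r0 := L g hg x y z w hx hy hz hw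
    have r1 := L (g * γ₀) (Γ.mul_mem hg hγ₀) x (x + y) z (z + w)
      (by rw [mul_apply_zero_zero]; push_cast; rw [hx, ← g1, ← g3]; ring)
      (by rw [mul_apply_zero_one]; push_cast; rw [hx, hy, ← g2, ← g4]; ring)
      (by rw [mul_apply_one_zero]; push_cast; rw [hz, ← g1, ← g3]; ring)
      (by rw [mul_apply_one_one]; push_cast; rw [hz, hw, ← g2, ← g4]; ring)
    have r2 := L (g * γ₀ * γ₀) (Γ.mul_mem (Γ.mul_mem hg hγ₀) hγ₀) x (2 * x + y) z (2 * z + w)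
      (by simp only [mul_apply_zero_zero, mul_apply_zero_one]; push_cast
          rw [hx, ← g1, ← g3]; ring)
      (by simp only [mul_apply_zero_zero, mul_apply_zero_one]; push_cast
          rw [hx, hy, ← g1, ← g2, ← g3, ← g4]; ring)
      (by simp only [mul_apply_one_zero, mul_apply_one_one]; push_cast
          rw [hz, ← g1, ← g3]; ring)
      (by simp only [mul_apply_one_zero, mul_apply_one_one]; push_cast
          rw [hz, hw, ← g1, ← g2, ← g3, ← g4]; ring)
    set β' := -(x * z) * α + x ^ 2 * β - z ^ 2 * δ with hβ'
    set α' := (x * w + y * z) * α - 2 * x * y * β + 2 * z * w * δ with hα'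
    -- The relations at `g`, `g * γ₀`, `g * γ₀²` are values of one quadratic polynomial in the
    -- exponent of `γ₀`. Its first and second differences give `c β' = 0`, then `a β' = 0`, then `b
    -- β' = 0`; as `k` is not in `Γ(p²)`, one of `a`, `b`, `c` is a unit.
    have s1 : c * α' - (2 * a + c) * β' = 0 := by rw [hα', hβ']; linear_combination r1 - r0
    have s2 : 2 * (c * β') = 0 := by rw [hβ']; linear_combination 2 * r1 - r2 - r0
    have s3 : (c : ZMod p) * β' = 0 := (mul_eq_zero.1 s2).resolve_left h2
    rcases mul_eq_zero.1 s3 with hc0 | h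
    · rw [hc0] at s1
      have s4 : 2 * (a * β') = 0 := by linear_combination -s1
      rcases mul_eq_zero.1 ((mul_eq_zero.1 s4).resolve_left h2) with ha0 | h
      · rw [ha0, hc0] at r0
        have s5 : (b : ZMod p) * β' = 0 := by rw [hβ']; linear_combination r0
        exact (mul_eq_zero.1 s5).resolve_left fun hb0 => hne ⟨ha0, hb0, hc0⟩
      · exact h
    · exact h
  -- The relation for `1` gives `β = 0`; those for `g₀` and `γ₀ * g₀`, whose lower left entry is a
  -- unit, give `α = 0` by subtraction and then `δ = 0`.
  have hβ : β = 0 := by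
    have := B 1 Γ.one_mem 1 0 (by simp) (by simp)
    simpa using this
  subst hβ
  obtain ⟨x, hx⟩ : ∃ x : ZMod p, x = (g₀ 0 0 : ℤ) := ⟨_, rfl⟩
  obtain ⟨z, hz⟩ : ∃ z : ZMod p, z = (g₀ 1 0 : ℤ) := ⟨_, rfl⟩
  have hz0 : z ≠ 0 := by rwa [hz, Ne, ZMod.intCast_zmod_eq_zero_iff_dvd]
  have b0 := B g₀ hg₀ x z hx hz
  have b1 := B (γ₀ * g₀) (Γ.mul_mem hγ₀ hg₀) (x + z) z
    (by rw [mul_apply_zero_zero]; push_cast; rw [hx, hz, ← g1, ← g2]; ring)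
    (by rw [mul_apply_one_zero]; push_cast; rw [hz, ← g3, ← g4]; ring)
  have hα : α = 0 := by
    have : z ^ 2 * α = 0 := by linear_combination b0 - b1
    exact (mul_eq_zero.1 this).resolve_left (pow_ne_zero 2 hz0)
  subst hα
  refine ⟨rfl, rfl, ?_⟩
  have : z ^ 2 * δ = 0 := by linear_combination -b0
  exact (mul_eq_zero.1 this).resolve_left (pow_ne_zero 2 hz0)

/-- If `Γ ∩ Γ(p)` were proper in `Γ(p)`, an additive function would detect this. It is a linear
functional on `Γ(p)/Γ(p²)`, and `eq_zero_of_linear` makes it zero. -/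
lemma Gamma_le_of_full [hp : Fact p.Prime] (hp2 : p ≠ 2) {e : ℕ} (he : e ≠ 0)
    {Γ : Subgroup SL(2, ℤ)} (hΓ : Gamma (p ^ e) ≤ Γ)
    {γ₀ g₀ k : SL(2, ℤ)} (hγ₀ : γ₀ ∈ Γ) (h0 : red p γ₀ = red p (up 1)) (hg₀ : g₀ ∈ Γ)
    (hc₀ : ¬ (p : ℤ) ∣ g₀ 1 0) (hk : k ∈ Γ) (hkp : k ∈ Gamma p) (hkp2 : k ∉ Gamma (p ^ 2)) :
    Gamma p ≤ Γ := by
  have hle : Gamma (p ^ e) ≤ Gamma p := Gamma_le_of_dvd (dvd_pow_self p he)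
  have : Γ ⊓ Gamma p = Gamma p := by
    refine eq_of_forall_additiveOn (e := e) (le_inf hΓ hle) inf_le_right (Gamma_le_Gamma1 p)
      fun E hE h g hg => ?_
    have hpp : ∀ g ∈ Gamma (p * p), E g = 0 := by
      have := hE.eq_zero_of_mem_Gamma (k := 1) (e := e) (by rw [pow_one])
        fun g hg => h g ⟨hΓ hg, hle hg⟩
      rwa [one_add_one_eq_two, sq] at this
    obtain ⟨α, β, δ, hlin⟩ := hE.exists_linear dvd_rfl hpp
    obtain ⟨rfl, rfl, rfl⟩ := eq_zero_of_linear hp2 hγ₀ h0 hg₀ hc₀ hlin hk hkp hkp2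
      fun γ h1 h2 => h γ ⟨h1, h2⟩
    obtain ⟨⟨a, ha⟩, ⟨b, hb⟩, ⟨c, hc⟩, -⟩ := mem_Gamma_iff.1 hg
    rw [hlin g hg a b c (by linarith) hb hc]
    ring
  exact inf_eq_right.1 this

/-- If `Γ ∩ Γ(3) ≤ Γ(9)`, then `Γ` has more than two orbits of cusps. -/
lemma not_twoCusps_of_inf_Gamma_three_le {Γ : Subgroup SL(2, ℤ)} (h1 : -1 ∈ Γ)
    (h : Γ ⊓ Gamma 3 ≤ Gamma 9) : ¬ TwoCusps Γ := by
  rintro ⟨x, y, hxy⟩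
  -- Representatives of the `27` classes of `Γ(3)` modulo `Γ(9)`.
  let k : Fin 3 × Fin 3 × Fin 3 → SL(2, ℤ) := fun w =>
    up (3 * w.1.val) * lo (3 * w.2.1.val) * (lo 1 * up (3 * w.2.2.val) * (lo 1)⁻¹)
  have hk (w) : k w ∈ Gamma 3 := by
    refine mul_mem (mul_mem (up_mem_Gamma ⟨_, rfl⟩) (lo_mem_Gamma ⟨_, rfl⟩))
      (conj_mem_Gamma (up_mem_Gamma ⟨_, rfl⟩) _)
  have hkinj (w w') (e : red 9 (k w) = red 9 (k w')) : w = w' := by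
    obtain ⟨a, b, c⟩ := w
    obtain ⟨a', b', c'⟩ := w'
    have h := red_eq_iff.1 e
    simp only [k, mul_apply_zero_zero, mul_apply_zero_one, mul_apply_one_zero, mul_apply_one_one,
      up_zero_zero, up_zero_one, up_one_zero, up_one_one, lo_zero_zero, lo_zero_one, lo_one_zero,
      lo_one_one, inv_apply_zero_zero, inv_apply_zero_one, inv_apply_one_zero,
      inv_apply_one_one] at h
    have ha := a.2
    have hb := b.2
    have hc := c.2
    have ha' := a'.2
    have hb' := b'.2
    have hc' := c'.2
    ring_nf at h
    simp only [Prod.mk.injEq, Fin.ext_iff]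
    refine ⟨?_, ?_, ?_⟩ <;> omega
  have hdec (w) : ∃ (i : Bool) (γ : SL(2, ℤ)) (n : ℤ), γ ∈ Γ ∧
      k w = γ * (if i then x else y) * up n := by
    obtain ⟨γ, hγ, n, hn⟩ := hxy (k w)
    have hneg : -γ ∈ Γ := by
      have := Γ.mul_mem h1 hγ
      rwa [neg_one_mul] at this
    rcases hn with hn | hn | hn | hn
    · exact ⟨true, γ, n, hγ, hn⟩
    · exact ⟨true, -γ, n, hneg, by rw [hn]; simp⟩
    · exact ⟨false, γ, n, hγ, hn⟩
    · exact ⟨false, -γ, n, hneg, by rw [hn]; simp⟩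
  choose i γ n hγ hkw using hdec
  -- Two representatives in the same double coset with the same translation modulo `9` differ by an
  -- element of `Γ ∩ Γ(3)`, hence of `Γ(9)`. So `27` elements would inject into `2 * 9` pairs.
  have hinj : Function.Injective fun w => (i w, (n w : ZMod 9)) := by
    intro w w' hw
    simp only [Prod.mk.injEq] at hw
    obtain ⟨hi, hn⟩ := hw
    apply hkinj
    set z := if i w then x else y with hz
    have e1 : k w = γ w * z * up (n w) := hkw w
    have e2 : k w' = γ w' * z * up (n w') := by rw [hkw w', hz, hi]
    have hun : red 9 (up (n w)) = red 9 (up (n w')) := by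
      rw [red_eq_iff]
      simpa using ((ZMod.intCast_eq_intCast_iff_dvd_sub _ _ 9).1 hn)
    have e3 : red 9 (γ w' * (γ w)⁻¹) = red 9 (k w' * (k w)⁻¹) := by
      rw [e1, e2]
      simp only [_root_.map_mul, _root_.map_inv, hun]
      group
    have h3 : γ w' * (γ w)⁻¹ ∈ Gamma 3 :=
      mem_of_red_eq (Gamma_le_of_dvd (by norm_num) : Gamma 9 ≤ Gamma 3)
        (mul_mem (hk w') (inv_mem (hk w))) e3.symm
    have h9 := h ⟨Γ.mul_mem (hγ w') (Γ.inv_mem (hγ w)), h3⟩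
    rw [Gamma_mem', e3, _root_.map_mul, _root_.map_inv, mul_inv_eq_one] at h9
    exact h9.symm
  have := Fintype.card_le_of_injective _ hinj
  simp at this

end FullImage

/-- A subgroup as in the theorem is, up to conjugacy, contained in `Γ₀(p)`. -/
lemma exists_conjBy_le_Gamma0 {Γ : Subgroup SL(2, ℤ)} {p e : ℕ} (hp : p.Prime) (hp2 : p ≠ 2)
    (he : 1 < e) (hΓ : HasExactLevel Γ (p ^ e)) (hcard : p ∣ Nat.card (reduction Γ p))
    (hfew : FewCusps Γ) : ∃ k, conjBy k Γ ≤ Gamma0 p := by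
  have : Fact p.Prime := ⟨hp⟩
  obtain ⟨k, γ₀, hγ₀, h0⟩ := exists_conj_red_eq_up hcard
  refine ⟨k, fun g hg => ?_⟩
  rw [mem_Gamma0_iff]
  by_contra hc
  have hlev := hΓ.conjBy k
  have hf := hfew.conjBy k
  have hnot : ¬ Gamma p ≤ conjBy k Γ := by
    intro h
    have h1 : p ^ e ≤ p := hlev.2 ⟨hp.pos, h⟩
    have h2 : p ^ 1 < p ^ e := Nat.pow_lt_pow_right hp.one_lt he
    rw [pow_one] at h2
    omega
  have hsmall : ∀ x ∈ conjBy k Γ, x ∈ Gamma p → x ∈ Gamma (p ^ 2) := by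
    intro x hx hxp
    by_contra hxp2
    exact hnot (Gamma_le_of_full hp2 (by omega) hlev.1.2 hγ₀ h0 hg hc hx hxp hxp2)
  rcases (show p = 3 ∨ 5 ≤ p by
    have := hp.two_le
    have h4 : p ≠ 4 := by rintro rfl; norm_num at hp
    omega) with rfl | h5
  · refine not_twoCusps_of_inf_Gamma_three_le hf.1 (fun x hx => ?_)
      (hf.twoCusps ⟨3 ^ e, by positivity, hlev.1.2⟩)
    exact hsmall x hx.1 hx.2
  -- For `p ≥ 5` the power `γ₀ ^ p` lies in `Γ(p)` but not in `Γ(p²)`.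
  · have h1 := red_pow_eq_of_red_eq_up hp h5 h0
    have h2 : γ₀ ^ p ∈ Gamma p := by
      rw [Gamma_mem', red_eq_of_dvd (dvd_pow_self p two_ne_zero) h1]
      exact up_mem_Gamma dvd_rfl
    have h3 := hsmall _ (Subgroup.pow_mem _ hγ₀ p) h2
    rw [Gamma_mem', h1] at h3
    have h4 : (up p) ∈ Gamma (p ^ 2) := h3
    rw [mem_Gamma_iff, up_zero_one] at h4
    have h5 : p ^ 2 ∣ p := by exact_mod_cast h4.2.1
    have h6 := Nat.le_of_dvd hp.pos h5
    nlinarith [hp.one_lt]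

end ModCurve

namespace ModCurve

open Matrix Matrix.SpecialLinearGroup CongruenceSubgroup

/-! ### Two cusps inside `Γ₀(p)`, and a criterion for three -/

section ThreeCusps

/-- The element `S` of `SL(2, ℤ)`. -/
def sw : SL(2, ℤ) := mk 0 (-1) 1 0 (by ring)

@[simp] lemma sw_zero_zero : sw 0 0 = 0 := rfl
@[simp] lemma sw_zero_one : sw 0 1 = -1 := rfl
@[simp] lemma sw_one_zero : sw 1 0 = 1 := rfl
@[simp] lemma sw_one_one : sw 1 1 = 0 := rfl

lemma neg_mem_of {Γ : Subgroup SL(2, ℤ)} (h1 : -1 ∈ Γ) {g : SL(2, ℤ)} (hg : g ∈ Γ) : -g ∈ Γ := by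
  have := Γ.mul_mem h1 hg
  rwa [neg_one_mul] at this

lemma sw_mul_up (n : ℤ) : sw * up n = lo (-n) * sw := by
  apply sl_ext <;>
  simp [mul_apply_zero_zero, mul_apply_zero_one, mul_apply_one_zero, mul_apply_one_one]

/-- The cusps `∞` and `0` are inequivalent already under `Γ₀(p)`, so they represent the two orbits;
the signs are absorbed by `-1 ∈ Γ`. -/
lemma TwoCusps.forall_of_le_Gamma0 {Γ : Subgroup SL(2, ℤ)} {p : ℕ} (hp : p ≠ 1)
    (h : TwoCusps Γ) (h1 : -1 ∈ Γ) (hle : Γ ≤ Gamma0 p) (g : SL(2, ℤ)) :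
    ∃ γ ∈ Γ, ∃ n : ℤ, g = γ * up n ∨ g = γ * sw * up n := by
  have hp1 : ¬ (p : ℤ) ∣ 1 := by
    intro h
    exact hp (Nat.dvd_one.1 (by exact_mod_cast h))
  obtain ⟨x, y, h⟩ := h
  have h' : ∀ g, ∃ γ ∈ Γ, ∃ n : ℤ, g = γ * x * up n ∨ g = γ * y * up n := by
    intro g
    obtain ⟨γ, hγ, n, hg⟩ := h g
    rcases hg with hg | hg | hg | hg
    · exact ⟨γ, hγ, n, Or.inl hg⟩
    · exact ⟨-γ, neg_mem_of h1 hγ, n, Or.inl (by rw [hg]; simp)⟩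
    · exact ⟨γ, hγ, n, Or.inr hg⟩
    · exact ⟨-γ, neg_mem_of h1 hγ, n, Or.inr (by rw [hg]; simp)⟩
  clear h
  have sep : ∀ z : SL(2, ℤ), ∀ γ ∈ Γ, ∀ γ' ∈ Γ, ∀ n n' : ℤ, 1 = γ * z * up n →
      sw = γ' * z * up n' → False := by
    intro z γ hγ γ' hγ' n n' e1 e2
    have hz : z = γ⁻¹ * up (-n) := by
      rw [up_neg, eq_mul_inv_iff_mul_eq]
      exact eq_inv_of_mul_eq_one_right (by rw [← mul_assoc]; exact e1.symm)
    have e3 : sw * up (n - n') = γ' * γ⁻¹ := by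
      rw [e2, hz, up_neg, sub_eq_add_neg, up_add, up_neg]
      have hc : up n * (up n')⁻¹ = (up n')⁻¹ * up n := by
        rw [← up_neg, ← up_add, ← up_add, add_comm]
      rw [hc]; group
    have h3 := mem_Gamma0_iff.1 (hle (Γ.mul_mem hγ' (Γ.inv_mem hγ)))
    rw [← e3, mul_apply_one_zero] at h3
    simp only [sw_one_zero, up_zero_zero, sw_one_one, up_one_zero] at h3
    exact hp1 (by simpa using h3)
  have conv : ∀ z w : SL(2, ℤ), ∀ γ ∈ Γ, ∀ n : ℤ, w = γ * z * up n → ∀ γ' ∈ Γ, ∀ m : ℤ,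
      g = γ' * z * up m → ∃ γ ∈ Γ, ∃ n : ℤ, g = γ * w * up n := by
    intro z w γ hγ n hw γ' hγ' m hg
    refine ⟨γ' * γ⁻¹, Γ.mul_mem hγ' (Γ.inv_mem hγ), m - n, ?_⟩
    rw [hg, hw, sub_eq_neg_add, up_add, up_neg]; group
  obtain ⟨γ1, hγ1, n1, e1⟩ := h' 1
  obtain ⟨γ2, hγ2, n2, e2⟩ := h' sw
  obtain ⟨γ, hγ, n, e⟩ := h' g
  rcases e1 with e1 | e1 <;> rcases e2 with e2 | e2
  · exact (sep _ _ hγ1 _ hγ2 _ _ e1 e2).elim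
  · rcases e with e | e
    · obtain ⟨δ, hδ, k, h⟩ := conv _ _ _ hγ1 _ e1 _ hγ _ e
      exact ⟨δ, hδ, k, Or.inl (by rwa [mul_one] at h)⟩
    · obtain ⟨δ, hδ, k, h⟩ := conv _ _ _ hγ2 _ e2 _ hγ _ e
      exact ⟨δ, hδ, k, Or.inr h⟩
  · rcases e with e | e
    · obtain ⟨δ, hδ, k, h⟩ := conv _ _ _ hγ2 _ e2 _ hγ _ e
      exact ⟨δ, hδ, k, Or.inr h⟩
    · obtain ⟨δ, hδ, k, h⟩ := conv _ _ _ hγ1 _ e1 _ hγ _ e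
      exact ⟨δ, hδ, k, Or.inl (by rwa [mul_one] at h)⟩
  · exact (sep _ _ hγ1 _ hγ2 _ _ e1 e2).elim

/-- If a subgroup of `Γ₀(p)` has two cusps, then it is transitive on the cosets by the stabilizers
in `Γ₀(p)` of `∞` and `0`. -/
lemma TwoCusps.exists_mul_mem {Γ : Subgroup SL(2, ℤ)} {p : ℕ} (hp : p ≠ 1)
    (h : TwoCusps Γ) (h1 : -1 ∈ Γ) (hle : Γ ≤ Gamma0 p) {g : SL(2, ℤ)} (hg : g ∈ Gamma0 p) :
    (∃ n : ℤ, g * up n ∈ Γ) ∧ ∃ n : ℤ, g * lo (p * n) ∈ Γ := by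
  have hp1 : ¬ (p : ℤ) ∣ 1 := by
    intro h
    exact hp (Nat.dvd_one.1 (by exact_mod_cast h))
  have hcg := mem_Gamma0_iff.1 hg
  have hdg : ¬ (p : ℤ) ∣ g 1 1 := by
    intro hd
    apply hp1
    rw [← det_eq g]
    exact dvd_sub (hd.mul_left _) (hcg.mul_left _)
  constructor
  · obtain ⟨γ, hγ, n, e | e⟩ := h.forall_of_le_Gamma0 hp h1 hle g
    · refine ⟨-n, ?_⟩
      rwa [e, up_neg, mul_inv_cancel_right]
    · exfalso
      have h3 : γ⁻¹ * g = sw * up n := by rw [e]; group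
      have h4 := mem_Gamma0_iff.1 ((Gamma0 p).mul_mem ((Gamma0 p).inv_mem (hle hγ)) hg)
      rw [h3, mul_apply_one_zero] at h4
      exact hp1 (by simpa using h4)
  -- For the cusp `0` the transitivity is read off from `g * sw`, moving translations across by `sw
  -- * up n = lo (-n) * sw`.
  · obtain ⟨γ, hγ, n, e | e⟩ := h.forall_of_le_Gamma0 hp h1 hle (g * sw)
    · exfalso
      have h3 : γ⁻¹ * g = up n * sw⁻¹ := by
        rw [eq_mul_inv_iff_mul_eq, mul_assoc, e, inv_mul_cancel_left]
      have h4 := mem_Gamma0_iff.1 ((Gamma0 p).mul_mem ((Gamma0 p).inv_mem (hle hγ)) hg)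
      rw [h3, mul_apply_one_zero, inv_apply_zero_zero, inv_apply_one_zero] at h4
      exact hp1 (by simpa using h4)
    · rw [mul_assoc, sw_mul_up, ← mul_assoc, mul_left_inj] at e
      have h3 : g * lo n = γ := by rw [e, lo_neg, inv_mul_cancel_right]
      have h4 := mem_Gamma0_iff.1 (hle hγ)
      rw [← h3, mul_apply_one_zero] at h4
      simp only [lo_zero_zero, lo_one_zero, mul_one] at h4
      have h5 : (p : ℤ) ∣ g 1 1 * n := by simpa using dvd_sub h4 hcg
      have h6 : IsCoprime (p : ℤ) (g 1 1) := by
        obtain ⟨q, hq⟩ := hcg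
        exact ⟨-g 0 1 * q, g 0 0, by linear_combination det_eq g + g 0 1 * hq⟩
      obtain ⟨m, rfl⟩ := h6.dvd_of_dvd_mul_left h5
      exact ⟨m, by rwa [h3]⟩

/-- The kernel of an additive function that is trivial on the stabilizer of `∞` has more than two
cusps. -/
lemma not_twoCusps_of_additiveOn {p : ℕ} [hp : Fact p.Prime] (hp2 : p ≠ 2)
    {E : SL(2, ℤ) → ZMod p} {K Γ : Subgroup SL(2, ℤ)} (hE : AdditiveOn E K)
    (hup : ∀ n, up n ∈ K → E (up n) = 0) (hup' : ∀ n, -up n ∈ K → E (-up n) = 0)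
    {k : SL(2, ℤ)} (hk : k ∈ K) (hEk : E k ≠ 0)
    (hΓ : ∀ γ ∈ Γ, (γ ∈ K ∧ E γ = 0) ∨ (-γ ∈ K ∧ E (-γ) = 0)) : ¬ TwoCusps Γ := by
  -- On `K` the value of `E` is unchanged by left multiplication by its kernel and right
  -- multiplication by the stabilizer of `∞`. So the cusps of `k ^ i` for distinct `i` modulo `p`
  -- are inequivalent, and `0, 1, 2` are distinct.
  have key (i j : ℕ) (hij : (i : ZMod p) ≠ j) (γ : SL(2, ℤ)) (hγ : γ ∈ K) (h0 : E γ = 0) (n : ℤ) :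
      k ^ i ≠ γ * k ^ j * up n ∧ k ^ i ≠ -(γ * k ^ j * up n) := by
    have hγk : γ * k ^ j ∈ K := K.mul_mem hγ (K.pow_mem hk _)
    have hval : E (γ * k ^ j) = j * E k := by rw [hE _ hγ _ (K.pow_mem hk _), h0, zero_add,
      hE.map_pow hk]
    constructor
    · intro h
      have h1 : up n ∈ K := by
        rw [← inv_mul_eq_iff_eq_mul] at h
        rw [← h]; exact K.mul_mem (K.inv_mem hγk) (K.pow_mem hk _)
      have h2 := congrArg E h
      rw [hE _ hγk _ h1, hval, hup n h1, add_zero, hE.map_pow hk] at h2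
      exact hij (mul_right_cancel₀ hEk h2)
    · intro h
      rw [← mul_neg] at h
      have h1 : -up n ∈ K := by
        rw [← inv_mul_eq_iff_eq_mul] at h
        rw [← h]; exact K.mul_mem (K.inv_mem hγk) (K.pow_mem hk _)
      have h2 := congrArg E h
      rw [hE _ hγk _ h1, hval, hup' n h1, add_zero, hE.map_pow hk] at h2
      exact hij (mul_right_cancel₀ hEk h2)
  have hcast : ∀ i j : Fin 3, i ≠ j → ((i.val : ℕ) : ZMod p) ≠ (j.val : ℕ) := by
    intro i j hij h
    have h3 : 3 ≤ p := by have := hp.out.two_le; omega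
    rw [ZMod.natCast_eq_natCast_iff', Nat.mod_eq_of_lt (by omega), Nat.mod_eq_of_lt (by omega)] at h
    exact hij (Fin.ext h)
  refine not_twoCusps_of_pairwise (fun i => k ^ i.val) fun i j hij γ hγ n => ?_
  rcases hΓ γ hγ with h | h
  · exact key _ _ (hcast i j hij) γ h.1 h.2 n
  · have := key _ _ (hcast i j hij) (-γ) h.1 h.2 n
    simp only [neg_mul, neg_neg] at this
    exact this.symm

end ThreeCusps

/-! ### Characters of `Γ₁(p)` and the bound on `p` -/

section GammaZero

/-- The middle factors `up 1 * lo (p * a)` produce the diagonal entry `1 + pa`; the outer ones then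
correct the other entries. Hence `Γ₁(p)` is generated modulo `p²` by `up 1` and `lo p`. -/
lemma red_eq_of_mem_Gamma1 {p : ℕ} {g : SL(2, ℤ)} {a c : ℤ} (ha : g 0 0 = 1 + p * a)
    (hc : g 1 0 = p * c) : red (p ^ 2) g =
      red (p ^ 2) (lo (p * (c - a)) * up 1 * lo (p * a) * up ((g 0 1 - 1) * (1 - p * a))) := by
  have hdet := det_eq g
  rw [ha, hc] at hdet
  rw [red_eq_iff]
  simp only [mul_apply_zero_zero, mul_apply_zero_one, mul_apply_one_zero, mul_apply_one_one,
    up_zero_zero, up_zero_one, up_one_zero, up_one_one, lo_zero_zero, lo_zero_one, lo_one_zero,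
    lo_one_one, ha, hc]
  push_cast
  refine ⟨⟨0, by ring⟩, ⟨-(g 0 1 - 1) * a ^ 2, by ring⟩, ⟨(c - a) * a, by ring⟩,
    ⟨-(c - a) * (g 0 1 - 1) * p * a ^ 2 - a ^ 2 * (g 0 1 - 1) - g 1 1 * a ^ 2 + a * g 0 1 * c, ?_⟩⟩
  linear_combination (-(1 - p * a)) * hdet

/-- The additive functions on `Γ₁(p)`. -/
lemma AdditiveOn.eq_of_Gamma1 {p e : ℕ} {E : SL(2, ℤ) → ZMod p} (hE : AdditiveOn E (Gamma1 p))
    (he : ∀ g ∈ Gamma (p ^ e), E g = 0) {g : SL(2, ℤ)} (hg : g ∈ Gamma1 p) {c : ℤ}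
    (hc : g 1 0 = p * c) : E g = g 0 1 * E (up 1) + c * E (lo p) := by
  have hA : Gamma (p ^ 1) ≤ Gamma1 p := by rw [pow_one]; exact Gamma_le_Gamma1 p
  have h2 := hE.eq_zero_of_mem_Gamma hA he
  have hA2 : Gamma (p ^ (1 + 1)) ≤ Gamma1 p :=
    (Gamma_le_of_dvd (pow_dvd_pow p (by omega))).trans hA
  obtain ⟨a, ha⟩ := (mem_Gamma1_iff.1 hg).1
  have m1 (x : ℤ) : up x ∈ Gamma1 p := by rw [mem_Gamma1_iff]; simp
  have m2 (x : ℤ) : lo (p * x) ∈ Gamma1 p := by rw [mem_Gamma1_iff]; simp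
  have v1 (x : ℤ) : E (up x) = x * E (up 1) := by
    rw [← hE.map_zpow (m1 1), up_zpow, one_mul]
  have v2 (x : ℤ) : E (lo (p * x)) = x * E (lo p) := by
    rw [← hE.map_zpow (by simpa using m2 1), lo_zpow]
  have h := red_eq_of_mem_Gamma1 (p := p) (a := a) (by linarith) hc
  rw [hE.eq_of_red_eq hA2 h2 hg h, hE _ (mul_mem (mul_mem (m2 _) (m1 _)) (m2 _)) _ (m1 _),
    hE _ (mul_mem (m2 _) (m1 _)) _ (m2 _), hE _ (m2 _) _ (m1 _), v1, v2, v2, v1 ((_ - _) * _)]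
  push_cast
  rw [CharP.cast_eq_zero (ZMod p) p]
  ring

/-- The additive function that describes the intersection with `Γ₁(p)` of a group as in the
theorem, and the bound on `p`. -/
lemma exists_additiveOn_Gamma1 {Γ : Subgroup SL(2, ℤ)} {p e : ℕ} (hp : p.Prime) (hp2 : p ≠ 2)
    (he : 1 < e) (hΓ : HasExactLevel Γ (p ^ e)) (h1 : -1 ∈ Γ) (htwo : TwoCusps Γ)
    (hle : Γ ≤ Gamma0 p) :
    (p = 3 ∨ p = 5) ∧ ∃ β : ZMod p, β ≠ 0 ∧ ∀ g ∈ Γ, g ∈ Gamma1 p → ∀ c, g 1 0 = p * c →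
      (c : ZMod p) = β * g 0 1 := by
  have : Fact p.Prime := ⟨hp⟩
  have hpe : Gamma (p ^ e) ≤ Gamma1 p :=
    (Gamma_le_of_dvd (dvd_pow_self p (by omega))).trans (Gamma_le_Gamma1 p)
  have hlt : Γ ⊓ Gamma1 p < Gamma1 p := by
    refine lt_of_le_of_ne inf_le_right fun h => ?_
    have h2 : p ^ e ≤ p := hΓ.2 ⟨hp.pos, (Gamma_le_Gamma1 p).trans (inf_eq_right.1 h)⟩
    have h3 : p ^ 1 < p ^ e := Nat.pow_lt_pow_right hp.one_lt he
    rw [pow_one] at h3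
    omega
  obtain ⟨E, hE, hE0, g, hg, hgE⟩ := exists_additiveOn (e := e) (le_inf hΓ.1.2 hpe) hlt
    fun g hg => exists_pow_mem_Gamma_of_mem_Gamma1 e hg
  have hE0' : ∀ g ∈ Gamma (p ^ e), E g = 0 := fun g hg => hE0 g ⟨hΓ.1.2 hg, hpe hg⟩
  have m1 (x : ℤ) : up x ∈ Gamma1 p := by rw [mem_Gamma1_iff]; simp
  have m2 (x : ℤ) : lo (p * x) ∈ Gamma1 p := by rw [mem_Gamma1_iff]; simp
  have m3 : lo p ∈ Gamma1 p := by simpa using m2 1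
  have hle10 : Gamma1 p ≤ Gamma0 p := fun g hg => mem_Gamma0_iff.2 (mem_Gamma1_iff.1 hg).2.1
  have hmul := fun {g} hg => htwo.exists_mul_mem (g := g) hp.ne_one h1 hle hg
  -- Some translate `g * up n` lies in `Γ`, where `E` vanishes; if `E (up 1)` were zero, so would be
  -- `E g`. The same argument at the cusp `0` handles `lo p`.
  have hu : E (up 1) ≠ 0 := by
    intro hu
    obtain ⟨⟨n, hn⟩, -⟩ := hmul (hle10 hg)
    have h2 := hE0 _ ⟨hn, mul_mem hg (m1 n)⟩
    rw [hE _ hg _ (m1 n), ← one_mul n, ← up_zpow, hE.map_zpow (m1 1), hu, mul_zero, add_zero] at h2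
    exact hgE h2
  have hv : E (lo p) ≠ 0 := by
    intro hv
    obtain ⟨-, n, hn⟩ := hmul (hle10 hg)
    have h2 := hE0 _ ⟨hn, mul_mem hg (m2 n)⟩
    rw [hE _ hg _ (m2 n), ← lo_zpow, hE.map_zpow m3, hv, mul_zero, add_zero] at h2
    exact hgE h2
  refine ⟨?_, -(E (up 1)) * (E (lo p))⁻¹, mul_ne_zero (neg_ne_zero.2 hu) (inv_ne_zero hv), ?_⟩
  · obtain ⟨r, hr⟩ : ∃ r : ℤ, (p : ℤ) = 2 * r - 1 := by
      rcases hp.eq_two_or_odd with h | h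
      · exact absurd h hp2
      · exact ⟨(p + 1) / 2, by omega⟩
    obtain ⟨⟨n, hn⟩, -⟩ := hmul (g := mk 2 1 p r (by rw [hr]; ring)) (by rw [mem_Gamma0_iff]; simp)
    set t := mk 2 1 p r (by rw [hr]; ring) * up n with ht
    have t00 : t 0 0 = 2 := by rw [ht, mul_apply_zero_zero]; simp
    have t10 : t 1 0 = p := by rw [ht, mul_apply_one_zero]; simp
    have tconj {x : SL(2, ℤ)} (hx : x ∈ Gamma1 p) : t * x * t⁻¹ ∈ Gamma1 p := by
      have hd := det_eq t
      rw [t00, t10] at hd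
      obtain ⟨⟨k, hk⟩, ⟨l, hl⟩, ⟨m, hm⟩⟩ := mem_Gamma1_iff.1 hx
      have hk' : x 0 0 = 1 + p * k := by linarith
      have hm' : x 1 1 = 1 + p * m := by linarith
      rw [mem_Gamma1_iff]
      simp only [mul_apply_zero_zero, mul_apply_zero_one, mul_apply_one_zero, mul_apply_one_one,
        inv_apply_zero_zero, inv_apply_zero_one, inv_apply_one_zero, inv_apply_one_one, t00, t10,
        hl, hk', hm']
      refine ⟨⟨2 * k * t 1 1 + t 0 1 * l * t 1 1 - 2 * x 0 1 - t 0 1 * p * m, ?_⟩,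
        ⟨p * k * t 1 1 + t 1 1 * l * t 1 1 - p * x 0 1 - t 1 1 * p * m, ?_⟩,
        ⟨-p * k * t 0 1 - t 1 1 * l * t 0 1 + 2 * x 0 1 + t 1 1 * 2 * m, ?_⟩⟩
      · linear_combination hd
      · ring
      · linear_combination hd
    -- With `u = E (up 1)`, `v = E (lo p)` and `up 1 * lo (p * m)` in `Γ`, one gets `u + m v = 0`.
    -- Conjugation by `t`, of diagonal `(2, d)` with `2 d = 1` modulo `p`, gives `4 u + m d² v = 0`.
    -- So `(4 - d²) u = 0`, and `15 u = 0`.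
    obtain ⟨-, m, hm⟩ := hmul (hle10 (m1 1))
    have hm1 : up 1 * lo (p * m) ∈ Gamma1 p := mul_mem (m1 1) (m2 m)
    have r1 := hE0 _ ⟨hm, hm1⟩
    rw [hE _ (m1 1) _ (m2 m), ← lo_zpow, hE.map_zpow m3] at r1
    have r2 := hE0 _ ⟨Γ.mul_mem (Γ.mul_mem hn hm) (Γ.inv_mem hn), tconj hm1⟩
    have e : t * (up 1 * lo (p * m)) * t⁻¹ = (t * up 1 * t⁻¹) * (t * lo p * t⁻¹) ^ m := by
      rw [conj_zpow, ← lo_zpow]; group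
    rw [e, hE _ (tconj (m1 1)) _ (zpow_mem (tconj m3) _), hE.map_zpow (tconj m3),
      hE.eq_of_Gamma1 hE0' (tconj (m1 1)) (c := -p)
        (by simp [mul_apply_one_zero, mul_apply_one_one, inv_apply_zero_zero, inv_apply_one_zero,
              t00, t10]; ring),
      hE.eq_of_Gamma1 hE0' (tconj m3) (c := t 1 1 ^ 2)
        (by simp [mul_apply_one_zero, mul_apply_one_one, inv_apply_zero_zero, inv_apply_one_zero,
              t00, t10]; ring)] at r2
    simp only [mul_apply_zero_zero, mul_apply_zero_one, inv_apply_zero_one, inv_apply_one_one,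
      up_zero_zero, up_zero_one, up_one_zero, up_one_one, lo_zero_zero, lo_zero_one, lo_one_zero,
      lo_one_one, t00] at r2
    push_cast at r2
    rw [CharP.cast_eq_zero (ZMod p) p] at r2
    have hd := congrArg (Int.cast : ℤ → ZMod p) (det_eq t)
    rw [t00, t10] at hd
    push_cast at hd
    rw [CharP.cast_eq_zero (ZMod p) p] at hd
    have h15 : (15 : ZMod p) * E (up 1) = 0 := by
      set d : ZMod p := ((t 1 1 : ℤ) : ZMod p)
      have h2d : (2 : ZMod p) * d = 1 := by linear_combination hd
      have e1 : (4 - d ^ 2) * E (up 1) = 0 := by linear_combination r2 - d ^ 2 * r1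
      linear_combination 4 * e1 + (2 * d + 1) * E (up 1) * h2d
    have h15' : ((15 : ℕ) : ZMod p) = 0 := by
      exact_mod_cast (mul_eq_zero.1 h15).resolve_right hu
    rw [ZMod.natCast_eq_zero_iff, show 15 = 3 * 5 by norm_num, hp.dvd_mul,
      Nat.prime_dvd_prime_iff_eq hp Nat.prime_three, Nat.prime_dvd_prime_iff_eq hp Nat.prime_five]
      at h15'
    exact h15'
  · intro g hg hg1 c hc
    have h2 := hE0 _ ⟨hg, hg1⟩
    rw [hE.eq_of_Gamma1 hE0' hg1 hc] at h2
    field_simp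
    linear_combination h2

end GammaZero

end ModCurve

namespace ModCurve

open Matrix Matrix.SpecialLinearGroup CongruenceSubgroup

/-! ### Excluding `p = 5` -/

section Five

lemma exists_pow_four_eq {a : ℤ} (ha : ¬ (5 : ℤ) ∣ a) : ∃ A, a ^ 4 = 1 + 5 * A := by
  have h : (5 : ℤ) ∣ a ^ 4 - 1 := by
    have ha' : (a : ZMod 5) ≠ 0 := by rwa [Ne, ZMod.intCast_zmod_eq_zero_iff_dvd]
    rw [← Nat.cast_ofNat (R := ℤ), ← ZMod.intCast_zmod_eq_zero_iff_dvd]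
    push_cast
    revert ha'
    generalize (a : ZMod 5) = x
    revert x
    decide
  obtain ⟨A, hA⟩ := h
  exact ⟨A, by linarith⟩

lemma not_dvd_of_five_dvd {g : SL(2, ℤ)} {c : ℤ} (hc : g 1 0 = 5 * c) : ¬ (5 : ℤ) ∣ g 0 0 := by
  rintro ⟨a, ha⟩
  have := det_eq g
  rw [hc, ha] at this
  have h1 : (5 : ℤ) ∣ 1 := ⟨a * g 1 1 - g 0 1 * c, by linarith⟩
  omega

lemma cast_five_mul (x : ℤ) : ((5 * x : ℤ) : ZMod 5) = 0 := by
  rw [ZMod.intCast_zmod_eq_zero_iff_dvd]; exact ⟨x, rfl⟩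

/-- A subgroup of `Γ₀(5)` of level `25`. -/
def quadGroup (κ : ZMod 5) : Subgroup SL(2, ℤ) where
  carrier := {g | ∃ c : ℤ, g 1 0 = 5 * c ∧ (c : ZMod 5) = κ * g 0 0 ^ 2 * g 0 1}
  one_mem' := ⟨0, by simp⟩
  mul_mem' := by
    rintro g h ⟨c, hc, hcκ⟩ ⟨c', hc', hcκ'⟩
    have hg := congrArg (Int.cast : ℤ → ZMod 5) (det_eq g)
    have hh := congrArg (Int.cast : ℤ → ZMod 5) (det_eq h)
    obtain ⟨A, hA⟩ := exists_pow_four_eq (not_dvd_of_five_dvd hc)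
    have hA := congrArg (Int.cast : ℤ → ZMod 5) hA
    rw [hc, mul_left_comm, Int.cast_sub, cast_five_mul] at hg
    rw [hc', mul_left_comm, Int.cast_sub, cast_five_mul] at hh
    rw [Int.cast_add, cast_five_mul] at hA
    refine ⟨c * h 0 0 + g 1 1 * c', by rw [mul_apply_one_zero, hc, hc']; ring, ?_⟩
    rw [mul_apply_zero_zero, mul_apply_zero_one, hc', mul_left_comm, Int.cast_add (g 0 0 * h 0 0),
      cast_five_mul]
    push_cast at *
    rw [hcκ, hcκ']
    generalize (g 0 0 : ZMod 5) = a at *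
    generalize (g 0 1 : ZMod 5) = b at *
    generalize (g 1 1 : ZMod 5) = d at *
    generalize (h 0 0 : ZMod 5) = a' at *
    generalize (h 0 1 : ZMod 5) = b' at *
    generalize (h 1 1 : ZMod 5) = d' at *
    have hd : d = a ^ 3 := by linear_combination a ^ 3 * hg - d * hA
    rw [hd]
    linear_combination (-κ * a ^ 2 * b * a') * hh
  inv_mem' := by
    rintro g ⟨c, hc, hcκ⟩
    have hg := congrArg (Int.cast : ℤ → ZMod 5) (det_eq g)
    obtain ⟨A, hA⟩ := exists_pow_four_eq (not_dvd_of_five_dvd hc)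
    have hA := congrArg (Int.cast : ℤ → ZMod 5) hA
    obtain ⟨c2, hc2, rfl⟩ : ∃ c2, g 1 0 = 5 * c2 ∧ c2 = c := ⟨c, hc, rfl⟩
    rw [hc, mul_left_comm, Int.cast_sub, cast_five_mul] at hg
    rw [Int.cast_add, cast_five_mul] at hA
    refine ⟨-c2, by rw [inv_apply_one_zero, hc]; ring, ?_⟩
    rw [inv_apply_zero_zero, inv_apply_zero_one]
    push_cast at *
    rw [hcκ]
    generalize (g 0 0 : ZMod 5) = a at *
    generalize (g 0 1 : ZMod 5) = b at *
    generalize (g 1 1 : ZMod 5) = d at *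
    have hd : d ^ 2 = a ^ 2 := by linear_combination a ^ 2 * (a * d + 1) * hg - d ^ 2 * hA
    rw [hd]; ring

/-- An additive function on `quadGroup`. -/
noncomputable def quadFun (κ : ZMod 5) (g : SL(2, ℤ)) : ZMod 5 :=
  ((g 0 0 ^ 4 - 1) / 5 : ℤ) - 2 * κ * g 0 0 ^ 2 * g 0 1 ^ 2

lemma quadFun_eq {κ : ZMod 5} {g : SL(2, ℤ)} {A : ℤ} (h : g 0 0 ^ 4 = 1 + 5 * A) :
    quadFun κ g = A - 2 * κ * g 0 0 ^ 2 * g 0 1 ^ 2 := by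
  rw [quadFun, h, add_sub_cancel_left, Int.mul_ediv_cancel_left _ (by norm_num)]

/-- The quotient `(a⁴ - 1)/5` is additive except for the term `4 a³ a'³ b c'` caused by the product
entry `a a' + 5 b c'`. Since `c' = κ a'² b'`, this is the cross term of the quadratic expression `2
κ a² b²`, which is subtracted. -/
lemma additiveOn_quadFun (κ : ZMod 5) : AdditiveOn (quadFun κ) (quadGroup κ) := by
  rintro g ⟨c, hc, hcκ⟩ h ⟨c', hc', hcκ'⟩
  obtain ⟨A, hA⟩ := exists_pow_four_eq (not_dvd_of_five_dvd hc)
  obtain ⟨A', hA'⟩ := exists_pow_four_eq (not_dvd_of_five_dvd hc')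
  have hh := congrArg (Int.cast : ℤ → ZMod 5) (det_eq h)
  rw [hc', mul_left_comm, Int.cast_sub, cast_five_mul] at hh
  set w := g 0 1 * c'
  have e : (g * h) 0 0 ^ 4 = 1 + 5 * (A + A' + 5 * (A * A') + 4 * g 0 0 ^ 3 * h 0 0 ^ 3 * w +
      5 * (6 * g 0 0 ^ 2 * h 0 0 ^ 2 * w ^ 2 + 20 * g 0 0 * h 0 0 * w ^ 3 + 25 * w ^ 4)) := by
    rw [mul_apply_zero_zero, hc', mul_left_comm]
    linear_combination (h 0 0 ^ 4) * hA + (1 + 5 * A) * hA'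
  rw [quadFun_eq hA, quadFun_eq hA', quadFun_eq e, mul_apply_zero_one, mul_apply_zero_zero, hc',
    mul_left_comm (g 0 1), Int.cast_add (g 0 0 * h 0 0), cast_five_mul]
  have hA := congrArg (Int.cast : ℤ → ZMod 5) hA
  have hA' := congrArg (Int.cast : ℤ → ZMod 5) hA'
  rw [Int.cast_add, cast_five_mul] at hA hA'
  rw [Int.cast_add, cast_five_mul, Int.cast_add, Int.cast_add, cast_five_mul]
  push_cast [w] at *
  rw [hcκ']
  generalize (g 0 0 : ZMod 5) = a at *
  generalize (g 0 1 : ZMod 5) = b at *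
  generalize (h 0 0 : ZMod 5) = a' at *
  generalize (h 0 1 : ZMod 5) = b' at *
  generalize (h 1 1 : ZMod 5) = d' at *
  have hd : d' = a' ^ 3 := by linear_combination a' ^ 3 * hh - d' * hA'
  rw [hd]
  linear_combination (-2 * κ * a ^ 2 * b ^ 2 * (a' ^ 4 + 1)) * hA' + (-2 * κ * b' ^ 2 * a' ^ 2) * hA

/-- On `Γ ∩ Γ₁(5)` the defining relation is the hypothesis. The rest of `Γ` is reached by one
element `t` with diagonal entry `2`, a generator of the units modulo `5`; conjugation by a
translation, which changes its upper right entry, brings `t` into `quadGroup β`. -/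
lemma exists_conjBy_le_quadGroup {Γ : Subgroup SL(2, ℤ)} (h1 : -1 ∈ Γ) (htwo : TwoCusps Γ)
    (hle : Γ ≤ Gamma0 5) {β : ZMod 5} (hβ : β ≠ 0)
    (hΓ : ∀ g ∈ Γ, g ∈ Gamma1 5 → ∀ c, g 1 0 = (5 : ℕ) * c → (c : ZMod 5) = β * g 0 1) :
    ∃ k, conjBy k Γ ≤ quadGroup β := by
  obtain ⟨⟨n, hn⟩, -⟩ := htwo.exists_mul_mem (p := 5) (by norm_num) h1 hle (g := mk 2 1 5 3 (by ring))
    (by rw [mem_Gamma0_iff]; simp)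
  set t := mk 2 1 5 3 (by ring) * up n with ht
  -- After conjugation by `up i` the element `t` has entries `a = 2`, `b = 1 + 2n + i` modulo `5`
  -- and `c = 1`, so the condition `c = β a² b` is linear in `i`.
  obtain ⟨i, hi⟩ : ∃ i : ℤ, β * 4 * (1 + 2 * n + i) = 1 := by
    have hinv : ∀ x : ZMod 5, x ≠ 0 → ∃ y, x * 4 * y = 1 := by decide
    obtain ⟨y, hy⟩ := hinv β hβ
    obtain ⟨i, hi⟩ := ZMod.intCast_surjective (y - 1 - 2 * (n : ZMod 5))
    exact ⟨i, by rw [hi, ← hy]; ring⟩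
  refine ⟨up i, ?_⟩
  have t00 : t 0 0 = 2 := by simp [ht, mul_apply_zero_zero]
  have t01 : t 0 1 = 2 * n + 1 := by simp [ht, mul_apply_zero_one]
  have t10 : t 1 0 = 5 := by simp [ht, mul_apply_one_zero]
  have t11 : t 1 1 = 5 * n + 3 := by simp [ht, mul_apply_one_one]
  set t' := up i * t * (up i)⁻¹ with ht'
  have s00 : t' 0 0 = 2 + 5 * i := by
    simp [ht', mul_apply_zero_zero, mul_apply_zero_one, mul_apply_one_zero, mul_apply_one_one,
      inv_apply_zero_zero, inv_apply_zero_one, inv_apply_one_zero, inv_apply_one_one, t00, t01,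
      t10, t11]
    try ring
  have s01 : t' 0 1 = 1 + 2 * n + i + 5 * (i * n - i ^ 2) := by
    simp [ht', mul_apply_zero_zero, mul_apply_zero_one, mul_apply_one_zero, mul_apply_one_one,
      inv_apply_zero_zero, inv_apply_zero_one, inv_apply_one_zero, inv_apply_one_one, t00, t01,
      t10, t11]
    try ring
  have s10 : t' 1 0 = 5 * 1 := by
    simp [ht', mul_apply_zero_zero, mul_apply_zero_one, mul_apply_one_zero, mul_apply_one_one,
      inv_apply_zero_zero, inv_apply_zero_one, inv_apply_one_zero, inv_apply_one_one, t00, t01,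
      t10, t11]
  have htΓ : t' ∈ conjBy (up i) Γ := by
    rw [mem_conjBy, ht']; simpa [mul_assoc] using hn
  have htQ : t' ∈ quadGroup β := by
    refine ⟨1, s10, ?_⟩
    rw [s00, s01, Int.cast_add, cast_five_mul, Int.cast_add _ (5 * _), cast_five_mul]
    push_cast
    linear_combination -hi
  have hmem : ∀ g ∈ conjBy (up i) Γ, ∃ c, g 1 0 = 5 * c := by
    intro g hg
    have h2 := mem_Gamma0_iff.1 (hle (mem_conjBy.1 hg))
    simp only [mul_apply_zero_zero, mul_apply_zero_one, mul_apply_one_zero, mul_apply_one_one,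
      inv_apply_zero_zero, inv_apply_zero_one, inv_apply_one_zero, inv_apply_one_one, up_zero_zero,
      up_one_zero, up_one_one] at h2
    obtain ⟨c, hc⟩ := h2
    push_cast at hc
    exact ⟨c, by linarith⟩
  have hbase : ∀ g ∈ conjBy (up i) Γ, (g 0 0 : ZMod 5) = 1 → g ∈ quadGroup β := by
    intro g hg hg0
    obtain ⟨c, hc⟩ := hmem g hg
    have hdet := congrArg (Int.cast : ℤ → ZMod 5) (det_eq g)
    rw [hc, mul_left_comm, Int.cast_sub, cast_five_mul] at hdet
    push_cast at hdet
    rw [hg0] at hdet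
    have hg1 : ((g 1 1 : ℤ) : ZMod 5) = 1 := by linear_combination hdet
    have hg' : (up i)⁻¹ * g * up i ∈ Gamma1 5 := by
      rw [mem_Gamma1_iff, ← ZMod.intCast_zmod_eq_zero_iff_dvd, ← ZMod.intCast_zmod_eq_zero_iff_dvd,
        ← ZMod.intCast_zmod_eq_zero_iff_dvd]
      simp only [mul_apply_zero_zero, mul_apply_zero_one, mul_apply_one_zero, mul_apply_one_one,
        inv_apply_zero_zero, inv_apply_zero_one, inv_apply_one_zero, inv_apply_one_one,
        up_zero_zero, up_zero_one, up_one_zero, up_one_one]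
      have h50 : (g 1 0 : ZMod 5) = 0 := by rw [hc]; exact cast_five_mul c
      push_cast
      rw [hg0, hg1, h50]
      simp
    have h3 := hΓ _ (mem_conjBy.1 hg) hg' c (by
      simp [mul_apply_zero_zero, mul_apply_zero_one, mul_apply_one_zero, mul_apply_one_one,
        inv_apply_zero_zero, inv_apply_zero_one, inv_apply_one_zero, inv_apply_one_one, hc])
    refine ⟨c, hc, ?_⟩
    rw [h3, hg0]
    simp only [mul_apply_zero_zero, mul_apply_zero_one, mul_apply_one_zero, mul_apply_one_one,
      inv_apply_zero_zero, inv_apply_zero_one, inv_apply_one_zero, inv_apply_one_one,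
      up_zero_zero, up_zero_one, up_one_zero, up_one_one]
    have h50 : (g 1 0 : ZMod 5) = 0 := by rw [hc]; exact cast_five_mul c
    push_cast
    rw [hg0, hg1, h50]
    ring
  intro g hg
  obtain ⟨c, hc⟩ := hmem g hg
  have ha : ((g 0 0 : ℤ) : ZMod 5) ≠ 0 := by
    rw [Ne, ZMod.intCast_zmod_eq_zero_iff_dvd]; exact not_dvd_of_five_dvd hc
  have hstep : ∀ x : SL(2, ℤ), ((x * t') 0 0 : ZMod 5) = 2 * (x 0 0 : ℤ) := by
    intro x
    rw [mul_apply_zero_zero, s00, s10, mul_left_comm, Int.cast_add, cast_five_mul]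
    push_cast
    have : (5 : ZMod 5) = 0 := rfl
    linear_combination (x 0 0 * i : ZMod 5) * this
  have hback : ∀ x : SL(2, ℤ), x * t' ∈ quadGroup β → x ∈ quadGroup β := fun x hx =>
    ((quadGroup β).mul_mem_cancel_right htQ).1 hx
  have hfwd : ∀ x : SL(2, ℤ), x ∈ conjBy (up i) Γ → x * t' ∈ conjBy (up i) Γ := fun x hx =>
    Subgroup.mul_mem _ hx htΓ
  have hcases : ∀ x : ZMod 5, x ≠ 0 → x = 1 ∨ 2 * x = 1 ∨ 2 * (2 * x) = 1 ∨
      2 * (2 * (2 * x)) = 1 := by decide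
  rcases hcases _ ha with h | h | h | h
  · exact hbase g hg h
  · exact hback _ (hbase _ (hfwd _ hg) (by rw [hstep, h]))
  · exact hback _ (hback _ (hbase _ (hfwd _ (hfwd _ hg)) (by rw [hstep, hstep, h])))
  · exact hback _ (hback _ (hback _ (hbase _ (hfwd _ (hfwd _ (hfwd _ hg)))
      (by rw [hstep, hstep, hstep, h]))))

/-- `quadFun β` vanishes on the translations in `quadGroup β` (there `5 ∣ n` because `β ≠ 0`), on
`-1`, and on the elliptic elements, whose squares are `-1`. Its kernel in `Γ` is thus an admissible
subgroup with more than two cusps. -/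
lemma not_le_quadGroup {Γ : Subgroup SL(2, ℤ)} {β : ZMod 5} (hβ : β ≠ 0) (h : FewCusps Γ)
    (hcong : IsCongruenceSubgroup Γ) : ¬ Γ ≤ quadGroup β := by
  intro hle
  have hE := (additiveOn_quadFun β)
  have hneg : (-1 : SL(2, ℤ)) ∈ quadGroup β := ⟨0, by simp, by simp⟩
  have hneg0 : quadFun β (-1) = 0 := by
    rw [quadFun_eq (A := 0) (by simp)]; simp
  have hup : ∀ n, up n ∈ quadGroup β → quadFun β (up n) = 0 := by
    rintro n ⟨c, hc, hcβ⟩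
    rw [quadFun_eq (A := 0) (by simp)]
    have hc0 : c = 0 := by simpa using hc
    rw [hc0] at hcβ
    have h0 : β = 0 ∨ (n : ZMod 5) = 0 := by
      have : Fact (Nat.Prime 5) := ⟨by norm_num⟩
      simpa using hcβ
    have h0 : (n : ZMod 5) = 0 := h0.resolve_left hβ
    simp [h0]
  have hker : ∀ g ∈ Γ ⊓ hE.ker, (g ∈ quadGroup β ∧ quadFun β g = 0) ∨
      (-g ∈ quadGroup β ∧ quadFun β (-g) = 0) := fun g hg => Or.inl hg.2
  refine not_twoCusps_of_additiveOn (p := 5) (hp := ⟨by norm_num⟩) (by norm_num) hE hup ?_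
    (k := mk 6 5 25 21 (by norm_num)) ⟨5, by simp, ?_⟩ ?_ hker
    (((fewCusps_iff Γ).1 h).2 _ ?_ inf_le_left ?_)
  · intro n hn
    have hn' : up n ∈ quadGroup β := by
      have := Subgroup.mul_mem _ hneg hn
      simpa using this
    have e : -up n = -1 * up n := by simp
    rw [e, hE _ hneg _ hn', hneg0, hup n hn', add_zero]
  · simp only [mk_zero_zero, mk_zero_one]
    have : ((5 : ℤ) : ZMod 5) = 0 := rfl
    rw [this, mul_zero]
  -- `6⁴ = 1 + 5 * 259`, and `259` is not divisible by `5`; the entry `b = 5` makes the other term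
  -- vanish.
  · rw [quadFun_eq (A := 259) (by simp)]
    simp only [mk_zero_zero, mk_zero_one]
    have : ((5 : ℤ) : ZMod 5) = 0 := rfl
    rw [this]
    simp
    decide
  · obtain ⟨N, hN, hle'⟩ := hcong
    refine ⟨25 * N, mul_ne_zero (by norm_num) hN, fun g hg => ?_⟩
    have hgN := Gamma_le_of_dvd (Dvd.intro_left 25 rfl) hg
    have hg25 := mem_Gamma_iff.1 (Gamma_le_of_dvd (Dvd.intro N rfl) hg)
    refine ⟨hle' hgN, hle (hle' hgN), ?_⟩
    obtain ⟨⟨a, ha⟩, ⟨b, hb⟩, -⟩ := hg25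
    have ha' : g 0 0 = 1 + 25 * a := by push_cast at ha; linarith
    rw [quadFun_eq (A := 5 * (4 * a + 25 * (6 * a ^ 2) + 25 * 25 * (4 * a ^ 3) +
      25 * 25 * 25 * a ^ 4)) (by rw [ha']; ring), cast_five_mul, hb]
    have h25 : (25 : ZMod 5) = 0 := rfl
    push_cast
    rw [h25]
    ring
  · intro γ hγ hell
    refine ⟨hγ, hle hγ, ?_⟩
    obtain ⟨c, hc, -⟩ := hle hγ
    have hdet := det_eq γ
    have hsq : γ * γ = -1 := by
      -- Trace `±1` would make `-3` a square modulo `5`.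
      have htr : γ 1 1 = -γ 0 0 := by
        rw [isElliptic_iff] at hell
        have hz : ∀ t : ℤ, γ 0 0 + γ 1 1 = t → (γ 0 0 : ZMod 5) * (t - γ 0 0) = 1 := by
          intro t ht
          have h2 : γ 1 1 = t - γ 0 0 := by linarith
          have hdet := congrArg (Int.cast : ℤ → ZMod 5) hdet
          rw [hc, mul_left_comm, Int.cast_sub, cast_five_mul, h2] at hdet
          push_cast at hdet
          linear_combination hdet
        rcases hell with ht | ht | ht
        · linarith
        · have h2 := hz _ ht
          exfalso
          revert h2
          push_cast
          generalize (γ 0 0 : ZMod 5) = x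
          revert x; decide
        · have h2 := hz _ ht
          exfalso
          revert h2
          push_cast
          generalize (γ 0 0 : ZMod 5) = x
          revert x; decide
      rw [htr] at hdet
      apply sl_ext <;> simp only [mul_apply_zero_zero, mul_apply_zero_one, mul_apply_one_zero,
        mul_apply_one_one, htr, neg_apply]
      · have : (1 : SL(2, ℤ)) 0 0 = 1 := rfl
        rw [this]; linarith
      · have : (1 : SL(2, ℤ)) 0 1 = 0 := rfl
        rw [this]; ring
      · have : (1 : SL(2, ℤ)) 1 0 = 0 := rfl
        rw [this]; ring
      · have : (1 : SL(2, ℤ)) 1 1 = 1 := rfl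
        rw [this]; linarith
    have h2 := hE _ (hle hγ) _ (hle hγ)
    rw [hsq, hneg0] at h2
    generalize quadFun β γ = x at h2
    revert x
    decide

end Five

end ModCurve

namespace ModCurve

open Matrix Matrix.SpecialLinearGroup CongruenceSubgroup

/-! ### The groups of levels `9` and `27` -/

section Three

lemma int_three_cases (a : ℤ) (ha : ¬ (3 : ℤ) ∣ a) :
    ∃ ε k : ℤ, (ε = 1 ∨ ε = -1) ∧ a = ε + 3 * k := by
  rcases (show a % 3 = 1 ∨ a % 3 = 2 by omega) with h | h
  · exact ⟨1, a / 3, Or.inl rfl, by omega⟩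
  · exact ⟨-1, (a + 1) / 3, Or.inr rfl, by omega⟩

lemma exists_sub_cube (b : ℤ) : ∃ β, b - b ^ 3 = 3 * β := by
  have h : ((3 : ℕ) : ℤ) ∣ b - b ^ 3 := by
    rw [← ZMod.intCast_zmod_eq_zero_iff_dvd]
    push_cast
    generalize (b : ZMod 3) = x
    revert x; decide
  exact h

lemma not_dvd_of_three_dvd {g : SL(2, ℤ)} (hc : (3 : ℤ) ∣ g 1 0) : ¬ (3 : ℤ) ∣ g 0 0 := by
  rintro ⟨a, ha⟩
  obtain ⟨c, hc⟩ := hc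
  have := det_eq g
  rw [hc, ha] at this
  have h1 : (3 : ℤ) ∣ 1 := ⟨a * g 1 1 - g 0 1 * c, by linarith⟩
  omega

lemma mem_Gamma1_three_or {g : SL(2, ℤ)} (hc : (3 : ℤ) ∣ g 1 0) :
    g ∈ Gamma1 3 ∨ -g ∈ Gamma1 3 := by
  simp only [mem_Gamma1_iff, neg_apply]
  obtain ⟨c, hc⟩ := hc
  obtain ⟨ε, k, hε, hk⟩ := int_three_cases _ (not_dvd_of_three_dvd ⟨c, hc⟩)
  have hdet := det_eq g
  rw [hc, hk] at hdet
  rcases hε with rfl | rfl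
  · exact Or.inl ⟨⟨k, by push_cast; linarith⟩, ⟨c, hc⟩,
      ⟨g 0 1 * c - k * g 1 1, by push_cast; linarith⟩⟩
  · exact Or.inr ⟨⟨-k, by push_cast; linarith⟩, ⟨-c, by push_cast; linarith⟩,
      ⟨g 0 1 * c - k * g 1 1, by push_cast; linarith⟩⟩

lemma neg_up_notMem_Gamma1_three (n : ℤ) : -up n ∉ Gamma1 3 := by
  rw [mem_Gamma1_iff]
  intro h
  have := h.1
  simp at this

lemma trace_of_isElliptic_of_mem_Gamma1 {g : SL(2, ℤ)} (hg : g ∈ Gamma1 3)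
    (h : (g : Matrix (Fin 2) (Fin 2) ℤ).IsElliptic) : g 0 0 + g 1 1 = -1 := by
  obtain ⟨h1, -, h2⟩ := mem_Gamma1_iff.1 hg
  rw [isElliptic_iff] at h
  omega

/-- The elements of trace `-1` in `Γ₁(3)`. -/
lemma exists_of_trace_eq {g : SL(2, ℤ)} (hg : g ∈ Gamma1 3) (ht : g 0 0 + g 1 1 = -1) :
    ∃ k c : ℤ, g 0 0 = 1 + 3 * k ∧ g 1 0 = 3 * c ∧ g 1 1 = -2 - 3 * k ∧
      g 0 1 * c = -1 - 3 * k - 3 * k ^ 2 := by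
  obtain ⟨⟨k, h1⟩, ⟨c, h2⟩, -⟩ := mem_Gamma1_iff.1 hg
  push_cast at h1 h2
  have hdet := det_eq g
  have ha : g 0 0 = 1 + 3 * k := by linarith
  have hd : g 1 1 = -2 - 3 * k := by linarith
  refine ⟨k, c, ha, h2, hd, ?_⟩
  rw [ha, hd, h2] at hdet
  linarith

lemma isElliptic_neg {g : SL(2, ℤ)} (h : (g : Matrix (Fin 2) (Fin 2) ℤ).IsElliptic) :
    ((-g : SL(2, ℤ)) : Matrix (Fin 2) (Fin 2) ℤ).IsElliptic := by
  rw [isElliptic_iff] at h ⊢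
  simp only [neg_apply]
  omega

/-- The lower left entry divided by `3` is additive modulo `3` on `Γ₁(3)`; it kills translations and
`Γ(9)`, but not `lo 3`. -/
lemma not_twoCusps_Gamma {n : ℕ} (hn : 9 ∣ n) : ¬ TwoCusps (Gamma n) := by
  have h9 : ∀ g ∈ Gamma n, g ∈ Gamma 9 := Gamma_le_of_dvd hn
  have hE : AdditiveOn (p := 3) (fun g => ((g 1 0 / 3 : ℤ) : ZMod 3)) (Gamma1 3) := by
    intro g hg h hh
    obtain ⟨-, ⟨c, h2⟩, ⟨d, h3⟩⟩ := mem_Gamma1_iff.1 hg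
    obtain ⟨⟨a', h1'⟩, ⟨c', h2'⟩, -⟩ := mem_Gamma1_iff.1 hh
    push_cast at h1' h2 h2' h3
    have e : (g * h) 1 0 = 3 * (c + c' + 3 * (c * a' + d * c')) := by
      rw [mul_apply_one_zero, h2, h2', show h 0 0 = 1 + 3 * a' by linarith,
        show g 1 1 = 1 + 3 * d by linarith]
      ring
    simp only
    rw [e, h2, h2', Int.mul_ediv_cancel_left _ (by norm_num),
      Int.mul_ediv_cancel_left _ (by norm_num), Int.mul_ediv_cancel_left _ (by norm_num)]
    push_cast
    have : (3 : ZMod 3) = 0 := rfl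
    rw [this]; ring
  refine not_twoCusps_of_additiveOn (p := 3) (by norm_num) hE (fun m _ => by simp)
    (fun m hm => (neg_up_notMem_Gamma1_three m hm).elim) (k := lo 3)
    (by rw [mem_Gamma1_iff]; simp) (by simp) fun γ hγ => Or.inl ⟨?_, ?_⟩
  · exact Gamma_le_Gamma1 3 (Gamma_le_of_dvd (by norm_num) (h9 γ hγ))
  · obtain ⟨c, hc⟩ := (mem_Gamma_iff.1 (h9 γ hγ)).2.2.1
    rw [hc]
    push_cast
    rw [show (9 : ℤ) * c = 3 * (3 * c) by ring, Int.mul_ediv_cancel_left _ (by norm_num)]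
    push_cast
    have : (3 : ZMod 3) = 0 := rfl
    rw [this, zero_mul]

/-- A congruence subgroup with elliptic elements is needed in order to have few cusps. -/
lemma FewCusps.exists_isElliptic {Γ : Subgroup SL(2, ℤ)} (h : FewCusps Γ) {e : ℕ}
    (he : Gamma (3 ^ e) ≤ Γ) : ∃ γ ∈ Γ, (γ : Matrix (Fin 2) (Fin 2) ℤ).IsElliptic := by
  -- Without elliptic elements the condition on `Γ'` is empty, and `Γ(3 ^ (e + 2))` would have to
  -- have at most two cusps.
  by_contra! hcon
  refine not_twoCusps_Gamma (n := 3 ^ (e + 2)) (by rw [pow_add]; exact Dvd.intro_left _ rfl)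
    (((fewCusps_iff Γ).1 h).2 _ ⟨3 ^ (e + 2), by positivity, le_rfl⟩
      ((Gamma_le_of_dvd (pow_dvd_pow 3 (by omega))).trans he) fun γ hγ hell => ?_)
  exact (hcon γ hγ hell).elim

/-- The group of level `9`. -/
def levelNine : Subgroup SL(2, ℤ) where
  carrier := {g | (9 : ℤ) ∣ g 1 0 + 3 * g 0 1}
  one_mem' := by simp
  mul_mem' := by
    rintro g h ⟨m, hm⟩ ⟨m', hm'⟩
    have hg := not_dvd_of_three_dvd (g := g) ⟨3 * m - g 0 1, by linarith⟩
    have hh := not_dvd_of_three_dvd (g := h) ⟨3 * m' - h 0 1, by linarith⟩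
    obtain ⟨ε, k, hε, hk⟩ := int_three_cases _ hg
    obtain ⟨ε', k', hε', hk'⟩ := int_three_cases _ hh
    have d1 := det_eq g
    have d2 := det_eq h
    have hc : g 1 0 = -3 * g 0 1 + 9 * m := by linarith
    have hc' : h 1 0 = -3 * h 0 1 + 9 * m' := by linarith
    rw [hc, hk] at d1
    rw [hc', hk'] at d2
    have hd : ∃ l, g 1 1 = ε + 3 * l := by
      rcases hε with rfl | rfl
      · exact ⟨-k * g 1 1 - g 0 1 ^ 2 + 3 * m * g 0 1, by linarith⟩
      · exact ⟨k * g 1 1 + g 0 1 ^ 2 - 3 * m * g 0 1, by linarith⟩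
    have hd' : ∃ l, h 1 1 = ε' + 3 * l := by
      rcases hε' with rfl | rfl
      · exact ⟨-k' * h 1 1 - h 0 1 ^ 2 + 3 * m' * h 0 1, by linarith⟩
      · exact ⟨k' * h 1 1 + h 0 1 ^ 2 - 3 * m' * h 0 1, by linarith⟩
    obtain ⟨l, hl⟩ := hd
    obtain ⟨l', hl'⟩ := hd'
    change (9 : ℤ) ∣ (g * h) 1 0 + 3 * (g * h) 0 1
    rw [mul_apply_one_zero, mul_apply_zero_one, hc, hc', hk, hk', hl, hl']
    exact ⟨m * (ε' + 3 * k') + (ε + 3 * l) * m' + g 0 1 * (l' - k') + h 0 1 * (k - l), by ring⟩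
  inv_mem' := by
    rintro g ⟨m, hm⟩
    exact ⟨-m, by rw [inv_apply_one_zero, inv_apply_zero_one]; linarith⟩

lemma mem_levelNine {g : SL(2, ℤ)} : g ∈ levelNine ↔ (9 : ℤ) ∣ g 1 0 + 3 * g 0 1 := Iff.rfl

lemma levelNine_le_Gamma0 : levelNine ≤ Gamma0 3 := by
  rintro g ⟨m, hm⟩
  rw [mem_Gamma0_iff]
  exact ⟨3 * m - g 0 1, by push_cast; linarith⟩

lemma Gamma_nine_le_levelNine : Gamma 9 ≤ levelNine := by
  intro g hg
  obtain ⟨-, ⟨b, hb⟩, ⟨c, hc⟩, -⟩ := mem_Gamma_iff.1 hg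
  exact ⟨c + 3 * b, by rw [hb, hc]; push_cast; ring⟩

lemma neg_one_mem_levelNine : (-1 : SL(2, ℤ)) ∈ levelNine := ⟨0, by simp⟩

/-- The entries of an element of the group of level `9`. -/
lemma exists_of_mem_levelNine {g : SL(2, ℤ)} (hg : g ∈ levelNine) :
    ∃ ε k m n β : ℤ, (ε = 1 ∨ ε = -1) ∧ g 0 0 = ε + 3 * k ∧ g 1 0 = -3 * g 0 1 + 9 * m ∧
      g 0 1 - g 0 1 ^ 3 = 3 * β ∧ g 1 1 = ε + 3 * (-k - ε * g 0 1 ^ 2 - 3 * ε * n) := by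
  have h3 := mem_Gamma0_iff.1 (levelNine_le_Gamma0 hg)
  obtain ⟨m, hm⟩ := hg
  obtain ⟨ε, k, hε, hk⟩ := int_three_cases _ (not_dvd_of_three_dvd h3)
  obtain ⟨β, hβ⟩ := exists_sub_cube (g 0 1)
  have hc : g 1 0 = -3 * g 0 1 + 9 * m := by linarith
  have hdet := det_eq g
  rw [hc, hk] at hdet
  obtain ⟨l, hl⟩ : ∃ l, g 1 1 = ε + 3 * l := by
    rcases hε with rfl | rfl
    · exact ⟨-k * g 1 1 - g 0 1 ^ 2 + 3 * m * g 0 1, by linarith⟩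
    · exact ⟨k * g 1 1 + g 0 1 ^ 2 - 3 * m * g 0 1, by linarith⟩
  refine ⟨ε, k, m, k * l - g 0 1 * m, β, hε, hk, hc, hβ, ?_⟩
  rw [hl] at hdet ⊢
  rcases hε with rfl | rfl
  · linarith
  · linarith

/-- The first of three additive functions on the group of level `9`. -/
noncomputable def ellOne (g : SL(2, ℤ)) : ZMod 3 := (g 0 0 * g 0 1 : ℤ)

/-- The second of three additive functions on the group of level `9`. -/
noncomputable def ellTwo (g : SL(2, ℤ)) : ZMod 3 := ((1 - g 0 0 ^ 2) / 3 - g 0 1 ^ 2 : ℤ)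

/-- The third of three additive functions on the group of level `9`. -/
noncomputable def ellThree (g : SL(2, ℤ)) : ZMod 3 :=
  (g 0 0 * ((g 1 0 + 6 * g 0 1 - 3 * g 0 1 ^ 3) / 9) : ℤ)

lemma ellTwo_eq {g : SL(2, ℤ)} {A : ℤ} (h : 1 - g 0 0 ^ 2 = 3 * A) :
    ellTwo g = A - (g 0 1 : ZMod 3) ^ 2 := by
  rw [ellTwo, h, Int.mul_ediv_cancel_left _ (by norm_num)]; push_cast; rfl

lemma ellThree_eq {g : SL(2, ℤ)} {M : ℤ} (h : g 1 0 + 6 * g 0 1 - 3 * g 0 1 ^ 3 = 9 * M) :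
    ellThree g = (g 0 0 : ZMod 3) * M := by
  rw [ellThree, h, Int.mul_ediv_cancel_left _ (by norm_num)]; push_cast; rfl

lemma three_eq_zero : (3 : ZMod 3) = 0 := rfl

lemma additiveOn_ellOne : AdditiveOn ellOne levelNine := by
  intro g hg h hh
  obtain ⟨ε, k, m, n, β, hε, ha, hc, hb, hd⟩ := exists_of_mem_levelNine hg
  obtain ⟨ε', k', m', n', β', hε', ha', hc', hb', hd'⟩ := exists_of_mem_levelNine hh
  rw [ellOne, ellOne, ellOne, mul_apply_zero_zero, mul_apply_zero_one, ha, ha', hc', hd']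
  push_cast
  rw [three_eq_zero]
  rcases hε with rfl | rfl <;> rcases hε' with rfl | rfl <;> push_cast <;> grind

/-- The defect of additivity of `(1 - a²)/3` is the product of `b` with `c'/3`, and `c'/3 ≡ -b'` in
this group; the term `-b²` has the opposite cross term. -/
lemma additiveOn_ellTwo : AdditiveOn ellTwo levelNine := by
  intro g hg h hh
  obtain ⟨ε, k, m, n, β, hε, ha, hc, hb, hd⟩ := exists_of_mem_levelNine hg
  obtain ⟨ε', k', m', n', β', hε', ha', hc', hb', hd'⟩ := exists_of_mem_levelNine hh
  have h1 : ε ^ 2 = 1 := by rcases hε with rfl | rfl <;> rfl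
  have h1' : ε' ^ 2 = 1 := by rcases hε' with rfl | rfl <;> rfl
  have e1 : 1 - g 0 0 ^ 2 = 3 * (-2 * ε * k - 3 * k ^ 2) := by
    rw [ha]; linear_combination -h1
  have e2 : 1 - h 0 0 ^ 2 = 3 * (-2 * ε' * k' - 3 * k' ^ 2) := by
    rw [ha']; linear_combination -h1'
  set A := -2 * ε * k - 3 * k ^ 2
  set A' := -2 * ε' * k' - 3 * k' ^ 2
  set w := g 0 1 * (-h 0 1 + 3 * m')
  have e3 : 1 - (g * h) 0 0 ^ 2 =
      3 * (A + A' - 3 * A * A' - 2 * g 0 0 * h 0 0 * w - 3 * w ^ 2) := by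
    rw [mul_apply_zero_zero, hc']
    linear_combination h 0 0 ^ 2 * e1 + (1 - 3 * A) * e2
  rw [ellTwo_eq e1, ellTwo_eq e2, ellTwo_eq e3, mul_apply_zero_one, ha, ha', hd']
  push_cast [w]
  rw [three_eq_zero]
  rcases hε with rfl | rfl <;> rcases hε' with rfl | rfl <;> push_cast <;> grind

/-- With `c = -3b + 9m` and `b - b³ = 3β`, the expression `c + 6b - 3b³` equals `9(β + m)`.
Additivity of its ninth part modulo `3` is a congruence modulo `27` in which the cubic term absorbs
the products of entries. -/
lemma ellThree_identity (ε k l b n m β ε' k' l' b' n' m' β' : ZMod 27) (hε : ε ^ 2 = 1)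
    (hε' : ε' ^ 2 = 1) (hb : b - b ^ 3 = 3 * β) (hb' : b' - b' ^ 3 = 3 * β')
    (hl : l = -k - ε * b ^ 2 - 3 * ε * n) (hl' : l' = -k' - ε' * b' ^ 2 - 3 * ε' * n') :
    ((-3 * b + 9 * m) * (ε' + 3 * k') + (ε + 3 * l) * (-3 * b' + 9 * m')) +
      6 * ((ε + 3 * k) * b' + b * (ε' + 3 * l'))
      - 3 * ((ε + 3 * k) * b' + b * (ε' + 3 * l')) ^ 3 = 9 * ((β + m) * ε' + (β' + m') * ε) := by
  subst hl hl'
  grind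

lemma additiveOn_ellThree : AdditiveOn ellThree levelNine := by
  intro g hg h hh
  obtain ⟨ε, k, m, n, β, hε, ha, hc, hb, hd⟩ := exists_of_mem_levelNine hg
  obtain ⟨ε', k', m', n', β', hε', ha', hc', hb', hd'⟩ := exists_of_mem_levelNine hh
  have h1 : ε ^ 2 = 1 := by rcases hε with rfl | rfl <;> rfl
  have h1' : ε' ^ 2 = 1 := by rcases hε' with rfl | rfl <;> rfl
  have e1 : g 1 0 + 6 * g 0 1 - 3 * g 0 1 ^ 3 = 9 * (β + m) := by
    rw [hc]; linear_combination 3 * hb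
  have e2 : h 1 0 + 6 * h 0 1 - 3 * h 0 1 ^ 3 = 9 * (β' + m') := by
    rw [hc']; linear_combination 3 * hb'
  obtain ⟨q, hq⟩ : ((27 : ℕ) : ℤ) ∣ ((g * h) 1 0 + 6 * (g * h) 0 1 - 3 * (g * h) 0 1 ^ 3)
      - 9 * ((β + m) * ε' + (β' + m') * ε) := by
    rw [← ZMod.intCast_zmod_eq_zero_iff_dvd, mul_apply_one_zero, mul_apply_zero_one, hc, ha, hd,
      hc', ha', hd', Int.cast_sub, sub_eq_zero]
    have hb2 := congrArg (Int.cast : ℤ → ZMod 27) hb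
    have hb2' := congrArg (Int.cast : ℤ → ZMod 27) hb'
    have h2 := congrArg (Int.cast : ℤ → ZMod 27) h1
    have h2' := congrArg (Int.cast : ℤ → ZMod 27) h1'
    push_cast at hb2 hb2' h2 h2' ⊢
    exact ellThree_identity _ _ _ _ _ _ _ _ _ _ _ _ _ _ h2 h2' hb2 hb2' rfl rfl
  have e3 : (g * h) 1 0 + 6 * (g * h) 0 1 - 3 * (g * h) 0 1 ^ 3 =
      9 * ((β + m) * ε' + (β' + m') * ε + 3 * q) := by push_cast at hq; linarith
  rw [ellThree_eq e1, ellThree_eq e2, ellThree_eq e3, mul_apply_zero_zero, ha, ha', hc']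
  push_cast
  rw [three_eq_zero]
  rcases hε with rfl | rfl <;> rcases hε' with rfl | rfl <;> push_cast <;> grind

/-- The group of level `27`. -/
noncomputable def levelTwentySeven : Subgroup SL(2, ℤ) := additiveOn_ellThree.ker

lemma levelTwentySeven_le : levelTwentySeven ≤ levelNine := fun _ h => h.1

lemma mem_levelTwentySeven {g : SL(2, ℤ)} :
    g ∈ levelTwentySeven ↔ (27 : ℤ) ∣ g 1 0 + 6 * g 0 1 - 3 * g 0 1 ^ 3 := by
  constructor
  · rintro ⟨hg, h0⟩
    obtain ⟨ε, k, m, n, β, hε, ha, hc, hb, hd⟩ := exists_of_mem_levelNine hg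
    have e1 : g 1 0 + 6 * g 0 1 - 3 * g 0 1 ^ 3 = 9 * (β + m) := by
      rw [hc]; linear_combination 3 * hb
    rw [ellThree_eq e1, ha] at h0
    have h2 : ((β + m : ℤ) : ZMod 3) = 0 := by
      push_cast at h0 ⊢
      rw [three_eq_zero] at h0
      rcases hε with rfl | rfl <;> push_cast at h0 <;> grind
    obtain ⟨q, hq⟩ := (ZMod.intCast_zmod_eq_zero_iff_dvd _ 3).1 h2
    exact ⟨q, by rw [e1, hq]; push_cast; ring⟩
  · rintro ⟨q, hq⟩
    obtain ⟨β, hβ⟩ := exists_sub_cube (g 0 1)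
    refine ⟨⟨3 * q - β, by linarith⟩, ?_⟩
    rw [ellThree_eq (M := 3 * q) (by rw [hq]; ring)]
    push_cast
    rw [three_eq_zero]; ring

lemma neg_one_mem_levelTwentySeven : (-1 : SL(2, ℤ)) ∈ levelTwentySeven := by
  rw [mem_levelTwentySeven]; simp

lemma Gamma_le_levelTwentySeven : Gamma 27 ≤ levelTwentySeven := by
  intro g hg
  obtain ⟨-, ⟨b, hb⟩, ⟨c, hc⟩, -⟩ := mem_Gamma_iff.1 hg
  rw [mem_levelTwentySeven]
  exact ⟨c + 6 * b - 3 * b * g 0 1 ^ 2, by rw [hb, hc]; push_cast; ring⟩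

end Three

end ModCurve

namespace ModCurve

open Matrix Matrix.SpecialLinearGroup CongruenceSubgroup

/-! ### Parabolic elements as words in elements of order 3 -/

section Words

lemma mk_mul_mk {a b c d a' b' c' d' : ℤ} (h : a * d - b * c = 1) (h' : a' * d' - b' * c' = 1) :
    mk a b c d h * mk a' b' c' d' h' =
      mk (a * a' + b * c') (a * b' + b * d') (c * a' + d * c') (c * b' + d * d')
        (by linear_combination (a' * d' - b' * c') * h + h') := by
  apply sl_ext <;>
  simp [mul_apply_zero_zero, mul_apply_zero_one, mul_apply_one_zero, mul_apply_one_one]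

lemma mk_inv {a b c d : ℤ} (h : a * d - b * c = 1) :
    (mk a b c d h)⁻¹ = mk d (-b) (-c) a (by linarith) := by
  apply sl_ext <;>
  simp [inv_apply_zero_zero, inv_apply_zero_one, inv_apply_one_zero, inv_apply_one_one]

/-- An element of order `3` of `Γ₁(3)`. -/
def al₀ : SL(2, ℤ) := mk (-2) 1 (-3) 1 (by norm_num)

/-- A conjugate of `al₀`. -/
def al₁ : SL(2, ℤ) := mk (-5) 7 (-3) 4 (by norm_num)

/-- A conjugate of `al₀`. -/
def al₂ : SL(2, ℤ) := mk (-8) 19 (-3) 7 (by norm_num)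

/-- The exponents `2, -1, -1` are all `-1` modulo `3`: an additive function takes at `up 3` minus
the sum of its values at `al₀`, `al₁`, `al₂`. -/
lemma red_up_three : red 27 (up 3) = red 27 (al₀ * al₂⁻¹ * al₀ * al₁⁻¹) := by
  simp only [al₀, al₁, al₂, mk_inv, mk_mul_mk, up, red_eq_iff, mk_zero_zero, mk_zero_one,
    mk_one_zero, mk_one_one]
  norm_num

/-- Both exponent sums are zero, so additive functions vanish at `up 9` whatever their values at
`al₀` and `al₂`. This is why nothing with few cusps lies below level `27`. The congruence modulo
`81` suffices, since additive functions on a group containing `Γ(27)` vanish on `Γ(81)` by descent.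
-/
lemma red_up_nine : red 81 (up 9) = red 81 (al₀ * al₂⁻¹ * al₀⁻¹ * al₂ * al₀⁻¹ * al₂ * al₀ *
    al₂⁻¹ * al₀⁻¹ * al₂ * al₀ * al₂⁻¹) := by
  simp only [al₀, al₂, mk_inv, mk_mul_mk, up, red_eq_iff, mk_zero_zero, mk_zero_one,
    mk_one_zero, mk_one_one]
  norm_num

lemma red_lo_twentySeven : red 81 (lo 27) = red 81 (al₀ * al₂⁻¹ * al₀ * al₂⁻¹ * al₀⁻¹ * al₂ *
    al₀ * al₂⁻¹ * al₀⁻¹ * al₂ * al₀⁻¹ * al₂) := by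
  simp only [al₀, al₂, mk_inv, mk_mul_mk, lo, red_eq_iff, mk_zero_zero, mk_zero_one,
    mk_one_zero, mk_one_one]
  norm_num

lemma red_lo_mul_up : red 27 (lo 9 * up 3) = red 27 (al₂⁻¹ * al₀ * al₂ * al₀⁻¹) := by
  simp only [al₀, al₂, mk_inv, mk_mul_mk, lo, up, red_eq_iff, mk_zero_zero, mk_zero_one,
    mk_one_zero, mk_one_one]
  norm_num

lemma red_diag : red 27 (mk 10 27 27 73 (by norm_num)) =
    red 27 (al₀ * al₂ * al₀⁻¹ * al₂ * al₀⁻¹ * al₂ * al₀) := by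
  simp only [al₀, al₂, mk_inv, mk_mul_mk, red_eq_iff, mk_zero_zero, mk_zero_one,
    mk_one_zero, mk_one_one]
  norm_num

lemma red_pow_nine : red 81 (mk 28 27 729 703 (by norm_num)) = red 81 ((al₀⁻¹ * al₂) ^ 9) := by
  simp only [pow_succ, pow_zero, one_mul, al₀, al₂, mk_inv, mk_mul_mk, red_eq_iff, mk_zero_zero,
    mk_zero_one, mk_one_zero, mk_one_one]
  norm_num

end Words

/-! ### Characters of the group of level `9` -/

section LevelNine

/-- The intersection of the group of level `9` with `Γ₁(3)`. -/
def levelNineOne : Subgroup SL(2, ℤ) := levelNine ⊓ Gamma1 3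

lemma Gamma_nine_le : Gamma 9 ≤ levelNineOne :=
  le_inf Gamma_nine_le_levelNine ((Gamma_le_of_dvd (by norm_num)).trans (Gamma_le_Gamma1 3))

lemma mem_levelNineOne {g : SL(2, ℤ)} : g ∈ levelNineOne ↔ g ∈ levelNine ∧ g ∈ Gamma1 3 := Iff.rfl

lemma up_mem_levelNine_iff {n : ℤ} : up n ∈ levelNine ↔ 3 ∣ n := by
  rw [mem_levelNine]; simp; omega

lemma up_mem_Gamma1 (m : ℕ) (n : ℤ) : up n ∈ Gamma1 m := by rw [mem_Gamma1_iff]; simp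

lemma up_three_mem : up 3 ∈ levelNineOne := ⟨up_mem_levelNine_iff.2 dvd_rfl, up_mem_Gamma1 _ _⟩

lemma al₀_mem : al₀ ∈ levelNineOne := by
  rw [mem_levelNineOne, mem_levelNine, mem_Gamma1_iff]; simp [al₀]

lemma al₁_mem : al₁ ∈ levelNineOne := by
  rw [mem_levelNineOne, mem_levelNine, mem_Gamma1_iff]; simp [al₁]

lemma al₂_mem : al₂ ∈ levelNineOne := by
  rw [mem_levelNineOne, mem_levelNine, mem_Gamma1_iff]; simp [al₂]

lemma ellOne_al₀ : ellOne al₀ = 1 := by simp [ellOne, al₀]; rfl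

lemma ellTwo_al₀ : ellTwo al₀ = 1 := by simp [ellTwo, al₀]; rfl

lemma ellThree_al₀ : ellThree al₀ = 0 := by simp [ellThree, al₀]

lemma ellOne_al₁ : ellOne al₁ = 1 := by simp [ellOne, al₁]; rfl

lemma ellTwo_al₁ : ellTwo al₁ = 0 := by simp [ellTwo, al₁]; rfl

lemma ellThree_al₁ : ellThree al₁ = 1 := by simp [ellThree, al₁]; rfl

lemma ellOne_al₂ : ellOne al₂ = 1 := by simp [ellOne, al₂]; rfl

lemma ellTwo_al₂ : ellTwo al₂ = -1 := by simp [ellTwo, al₂]; rfl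

lemma ellThree_al₂ : ellThree al₂ = 0 := by simp [ellThree, al₂]; rfl

/-- An additive function on the group of level `9` vanishes if it vanishes on the elements
of order `3`. -/
lemma AdditiveOn.eq_zero_levelNine {E : SL(2, ℤ) → ZMod 3} (hE : AdditiveOn E levelNineOne)
    {e : ℕ} (he : ∀ g ∈ Gamma (3 ^ e), E g = 0) (h₀ : E al₀ = 0) (h₁ : E al₁ = 0)
    (h₂ : E al₂ = 0) {g : SL(2, ℤ)} (hg : g ∈ levelNineOne) : E g = 0 := by
  have h27 : ∀ g ∈ Gamma (9 * 3), E g = 0 :=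
    hE.eq_zero_of_mem_Gamma (k := 2) (by norm_num; exact Gamma_nine_le) he
  have hle : Gamma (9 * 3) ≤ levelNineOne := (Gamma_le_of_dvd (Dvd.intro _ rfl)).trans Gamma_nine_le
  have hs : E (up 3) = 0 := by
    rw [hE.eq_of_red_eq hle h27 up_three_mem red_up_three,
      hE _ (mul_mem (mul_mem al₀_mem (inv_mem al₂_mem)) al₀_mem) _ (inv_mem al₁_mem),
      hE _ (mul_mem al₀_mem (inv_mem al₂_mem)) _ al₀_mem, hE _ al₀_mem _ (inv_mem al₂_mem),
      hE.map_inv al₁_mem, hE.map_inv al₂_mem, h₀, h₁, h₂]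
    simp
  have hup (n : ℤ) : up (3 * n) ∈ levelNineOne ∧ E (up (3 * n)) = 0 := by
    rw [← up_zpow, hE.map_zpow up_three_mem, hs, mul_zero]
    exact ⟨zpow_mem up_three_mem n, rfl⟩
  obtain ⟨x, y, z, hlin⟩ := (hE.mono Gamma_nine_le).exists_linear (p := 3) (by norm_num) h27
  have hy : y = 0 := by
    have := hlin (up 9) (up_mem_Gamma dvd_rfl) 0 1 0 (by simp) (by simp) (by simp)
    rw [show (9 : ℤ) = 3 * 3 by norm_num, (hup 3).2] at this
    simpa using this.symm
  -- Two words that lie in `Γ(9)`. Since `y = 0` they give `19 x + 7 z = 0` and `-2 x - 7 z = 0`,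
  -- that is `x + z = 0` and `x - z = 0` modulo `3`.
  have hv1 : E (al₂ * al₀ * al₁) = 0 := by
    rw [hE _ (mul_mem al₂_mem al₀_mem) _ al₁_mem, hE _ al₂_mem _ al₀_mem, h₀, h₁, h₂]; simp
  have hv2 : E (al₀⁻¹ * al₂⁻¹ * al₁⁻¹) = 0 := by
    rw [hE _ (mul_mem (inv_mem al₀_mem) (inv_mem al₂_mem)) _ (inv_mem al₁_mem),
      hE _ (inv_mem al₀_mem) _ (inv_mem al₂_mem), hE.map_inv al₀_mem, hE.map_inv al₁_mem,
      hE.map_inv al₂_mem, h₀, h₁, h₂]; simp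
  have e1 : al₂ * al₀ * al₁ = mk 172 (-243) 63 (-89) (by norm_num) := by
    simp only [al₀, al₁, al₂, mk_mul_mk]
    norm_num
  have e2 : al₀⁻¹ * al₂⁻¹ * al₁⁻¹ = mk (-17) 27 (-63) 100 (by norm_num) := by
    simp only [al₀, al₁, al₂, mk_mul_mk, mk_inv]
    norm_num
  rw [e1, hlin _ (by rw [mem_Gamma_iff]; norm_num) 19 (-27) 7 (by norm_num) (by norm_num)
    (by norm_num), hy] at hv1
  rw [e2, hlin _ (by rw [mem_Gamma_iff]; norm_num) (-2) 3 (-7) (by norm_num) (by norm_num)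
    (by norm_num), hy] at hv2
  have hxz : x = 0 ∧ z = 0 := by
    clear hlin hy
    revert x z
    push_cast
    decide
  -- Vanishing of `ellOne` and `ellTwo` makes `g` an element of `Γ(9)` up to a power of `up 3`.
  have key : ∀ g ∈ levelNineOne, ellOne g = 0 → ellTwo g = 0 → E g = 0 := by
    intro g hg h1 h2
    obtain ⟨⟨m, hm⟩, hg1⟩ := id hg
    obtain ⟨⟨k, hk⟩, -, ⟨l, hl⟩⟩ := mem_Gamma1_iff.1 hg1
    push_cast at hk hl
    have hk' : g 0 0 = 1 + 3 * k := by linarith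
    have hb : ((g 0 1 : ℤ) : ZMod 3) = 0 := by
      rw [ellOne, hk'] at h1
      push_cast at h1
      rw [three_eq_zero] at h1
      simpa using h1
    have hk0 : ((k : ℤ) : ZMod 3) = 0 := by
      rw [ellTwo_eq (A := -2 * k - 3 * k ^ 2) (by rw [hk']; ring), hb] at h2
      push_cast at h2
      rw [three_eq_zero] at h2
      grind
    obtain ⟨b, hb⟩ := (ZMod.intCast_zmod_eq_zero_iff_dvd _ 3).1 hb
    obtain ⟨k', rfl⟩ := (ZMod.intCast_zmod_eq_zero_iff_dvd _ 3).1 hk0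
    push_cast at hb hk'
    have e := hE g hg _ (hup (-b)).1
    rw [(hup (-b)).2, add_zero] at e
    have hc : g 1 0 = 9 * (m - b) := by linarith
    have hdet := det_eq g
    rw [← e, hlin _ _ k' (-3 * b * k') (m - b), hy, hxz.1, hxz.2]
    · ring
    · rw [mul_apply_zero_zero]; simp [hk']; ring
    · rw [mul_apply_zero_one]; simp [hk', hb]; ring
    · rw [mul_apply_one_zero]; simp [hc]
    · rw [hb, hc, hk'] at hdet
      rw [mem_Gamma_iff, mul_apply_zero_zero, mul_apply_zero_one, mul_apply_one_zero,
        mul_apply_one_one]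
      simp only [up_zero_zero, up_zero_one, up_one_zero, up_one_one, hk', hb, hc]
      exact ⟨⟨k', by push_cast; ring⟩, ⟨-3 * b * k', by push_cast; ring⟩,
        ⟨m - b, by push_cast; ring⟩, ⟨-k' * g 1 1, by push_cast; linarith⟩⟩
  have v1 := additiveOn_ellOne.mono (inf_le_left : levelNineOne ≤ levelNine)
  have v2 := additiveOn_ellTwo.mono (inf_le_left : levelNineOne ≤ levelNine)
  -- The pairs `(ellOne, ellTwo)` at `al₀` and `al₂` are `(1, 1)` and `(1, -1)`, a basis over `ℤ/3`.
  obtain ⟨i, j, h1, h2⟩ : ∃ i j : ℕ, ellOne g + i + j = 0 ∧ ellTwo g + i - j = 0 := by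
    generalize ellOne g = x
    generalize ellTwo g = y
    have : ∀ x y : ZMod 3, ∃ i j : Fin 3, x + (i.val : ℕ) + (j.val : ℕ) = 0 ∧
      y + (i.val : ℕ) - (j.val : ℕ) = 0 := by decide
    obtain ⟨i, j, h⟩ := this x y
    exact ⟨i, j, h⟩
  have mi : al₀ ^ i ∈ levelNineOne := pow_mem al₀_mem i
  have mj : al₂ ^ j ∈ levelNineOne := pow_mem al₂_mem j
  have := key (g * al₀ ^ i * al₂ ^ j) (mul_mem (mul_mem hg mi) mj)
    (by rw [v1 _ (mul_mem hg mi) _ mj, v1 _ hg _ mi, v1.map_pow al₀_mem, v1.map_pow al₂_mem,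
          ellOne_al₀, ellOne_al₂, mul_one, mul_one, h1])
    (by rw [v2 _ (mul_mem hg mi) _ mj, v2 _ hg _ mi, v2.map_pow al₀_mem, v2.map_pow al₂_mem,
          ellTwo_al₀, ellTwo_al₂, mul_one, mul_neg_one, ← sub_eq_add_neg, h2])
  rw [hE _ (mul_mem hg mi) _ mj, hE _ hg _ mi, hE.map_pow al₀_mem, hE.map_pow al₂_mem, h₀, h₂,
    mul_zero, mul_zero, add_zero, add_zero] at this
  exact this

lemma ell_eq_zero {g : SL(2, ℤ)} (hg : g ∈ Gamma 27) :
    ellOne g = 0 ∧ ellTwo g = 0 ∧ ellThree g = 0 := by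
  have h3 := (Gamma_le_levelTwentySeven hg).2
  obtain ⟨⟨a, ha⟩, ⟨b, hb⟩, ⟨c, hc⟩, -⟩ := mem_Gamma_iff.1 hg
  have ha' : g 0 0 = 1 + 27 * a := by push_cast at ha; linarith
  have h27 : (27 : ZMod 3) = 0 := rfl
  refine ⟨?_, ?_, h3⟩
  · rw [ellOne, hb]; push_cast; rw [h27]; ring
  · rw [ellTwo_eq (A := 3 * (-6 * a - 27 * 3 * a ^ 2)) (by rw [ha']; ring), hb]
    push_cast
    rw [h27, three_eq_zero]; ring

/-- The additive functions on the group of level `9`. -/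
lemma AdditiveOn.eq_levelNine {E : SL(2, ℤ) → ZMod 3} (hE : AdditiveOn E levelNineOne)
    {e : ℕ} (he : ∀ g ∈ Gamma (3 ^ e), E g = 0) : ∃ x y z : ZMod 3,
    (x = 2 * (E al₀ + E al₂) ∧ x + y = E al₀ ∧ x + z = E al₁) ∧
    ∀ g ∈ levelNineOne, E g = x * ellOne g + y * ellTwo g + z * ellThree g := by
  have v1 := additiveOn_ellOne.mono (inf_le_left : levelNineOne ≤ levelNine)
  have v2 := additiveOn_ellTwo.mono (inf_le_left : levelNineOne ≤ levelNine)
  have v3 := additiveOn_ellThree.mono (inf_le_left : levelNineOne ≤ levelNine)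
  -- Solution of `x + y = E al₀`, `x + z = E al₁`, `x - y = E al₂`; modulo `3` the inverse of `2` is
  -- `2`.
  refine ⟨2 * (E al₀ + E al₂), E al₀ - 2 * (E al₀ + E al₂), E al₁ - 2 * (E al₀ + E al₂),
    ⟨rfl, by ring, by ring⟩, ?_⟩
  set x := 2 * (E al₀ + E al₂) with hx
  set y := E al₀ - x with hy
  set z := E al₁ - x with hz
  have hD : AdditiveOn (fun g => E g - (x * ellOne g + y * ellTwo g + z * ellThree g))
      levelNineOne := by
    intro g hg h hh
    simp only [hE g hg h hh, v1 g hg h hh, v2 g hg h hh, v3 g hg h hh]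
    ring
  intro g hg
  refine sub_eq_zero.1 (hD.eq_zero_levelNine (e := e + 3) (fun g hg => ?_) ?_ ?_ ?_ hg)
  · obtain ⟨h1, h2, h3⟩ := ell_eq_zero (Gamma_le_of_dvd (m := 27)
      (by rw [pow_add]; exact Dvd.intro_left _ rfl) hg)
    rw [he g (Gamma_le_of_dvd (pow_dvd_pow 3 (by omega)) hg), h1, h2, h3]
    ring
  · simp only [ellOne_al₀, ellTwo_al₀, ellThree_al₀]; rw [hy]; ring
  · simp only [ellOne_al₁, ellTwo_al₁, ellThree_al₁]; rw [hz]; ring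
  · simp only [ellOne_al₂, ellTwo_al₂, ellThree_al₂]
    rw [hy, hx]
    generalize E al₀ = a
    generalize E al₂ = b
    revert a b
    simp only [mul_one, mul_zero]
    decide

end LevelNine

end ModCurve

namespace ModCurve

open Matrix Matrix.SpecialLinearGroup CongruenceSubgroup

/-! ### Subgroups of the group of level `9` with few cusps -/

section Classification

/-- The values of the additive functions on elements of trace `-1`. -/
lemma ell_of_trace_eq {g : SL(2, ℤ)} (hg : g ∈ levelNineOne) (ht : g 0 0 + g 1 1 = -1) :
    ∃ β k : ZMod 3, β ≠ 0 ∧ ellOne g = β ∧ ellTwo g = k - 1 ∧ β * ellThree g = -k - k ^ 2 := by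
  obtain ⟨⟨m, hm⟩, hg1⟩ := hg
  obtain ⟨k, c, ha, hc, hd, hbc⟩ := exists_of_trace_eq hg1 ht
  have hc' : c = -g 0 1 + 3 * m := by linarith
  obtain ⟨β, hβ⟩ := exists_sub_cube (g 0 1)
  have h1 : ellOne g = (g 0 1 : ℤ) := by
    rw [ellOne, ha]; push_cast; rw [three_eq_zero]; ring
  have hb2 : ((g 0 1 : ℤ) : ZMod 3) ^ 2 = 1 := by
    have := congrArg (Int.cast : ℤ → ZMod 3) hbc
    rw [hc'] at this
    push_cast at this
    rw [three_eq_zero] at this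
    linear_combination -this
  refine ⟨(g 0 1 : ℤ), k, ?_, h1, ?_, ?_⟩
  · intro h0
    rw [h0] at hb2
    revert hb2; decide
  · rw [ellTwo_eq (A := -2 * k - 3 * k ^ 2) (by rw [ha]; ring), hb2]
    push_cast
    rw [three_eq_zero]
    grind
  · rw [ellThree_eq (M := β + m) (by rw [hc, hc']; linear_combination 3 * hβ), ha]
    rw [hc'] at hbc
    obtain ⟨q, hq⟩ : (3 : ℤ) ∣ g 0 1 ^ 2 - 1 := by
      rw [← Nat.cast_ofNat (R := ℤ), ← ZMod.intCast_zmod_eq_zero_iff_dvd]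
      push_cast
      rw [hb2, sub_self]
    have e : g 0 1 * (β + m) = -k - k ^ 2 - 3 * q ^ 2 := by
      have h3 : (3 : ℤ) * (g 0 1 * (β + m)) = 3 * (-k - k ^ 2 - 3 * q ^ 2) := by
        linear_combination hbc - g 0 1 * hβ - (g 0 1 ^ 2 - 1 + 3 * q) * hq
      linarith
    have := congrArg (Int.cast : ℤ → ZMod 3) e
    push_cast at this ⊢
    rw [three_eq_zero] at this ⊢
    linear_combination this

variable {Γ : Subgroup SL(2, ℤ)} {e : ℕ} {E : SL(2, ℤ) → ZMod 3}

lemma mem_or_neg_mem (h1 : -1 ∈ Γ) (hle : Γ ≤ Gamma0 3) {g : SL(2, ℤ)} (hg : g ∈ Γ) :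
    g ∈ Γ ⊓ Gamma1 3 ∨ -g ∈ Γ ⊓ Gamma1 3 := by
  rcases mem_Gamma1_three_or (mem_Gamma0_iff.1 (hle hg)) with h | h
  · exact Or.inl ⟨hg, h⟩
  · exact Or.inr ⟨neg_mem_of h1 hg, h⟩

lemma exists_trace_eq (h1 : -1 ∈ Γ) (hle : Γ ≤ Gamma0 3) {g : SL(2, ℤ)} (hg : g ∈ Γ)
    (hell : (g : Matrix (Fin 2) (Fin 2) ℤ).IsElliptic) :
    ∃ h ∈ Γ ⊓ Gamma1 3, h 0 0 + h 1 1 = -1 ∧ (g = h ∨ g = -h) := by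
  rcases mem_or_neg_mem h1 hle hg with h | h
  · exact ⟨g, h, trace_of_isElliptic_of_mem_Gamma1 h.2 hell, Or.inl rfl⟩
  · exact ⟨-g, h, trace_of_isElliptic_of_mem_Gamma1 h.2 (isElliptic_neg hell), Or.inr (by simp)⟩

/-- An additive function that is trivial on a group with few cusps is not trivial on the
stabilizer of `∞`. -/
lemma FewCusps.exists_up_ne_zero (hfew : FewCusps Γ) (hcong : IsCongruenceSubgroup Γ)
    (hle : Γ ≤ Gamma0 3) {A : Subgroup SL(2, ℤ)} (hA : A ≤ Gamma1 3) (hE : AdditiveOn E A)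
    (h0 : ∀ g ∈ Γ ⊓ Gamma1 3, g ∈ A ∧ E g = 0) {k : SL(2, ℤ)} (hk : k ∈ A) (hEk : E k ≠ 0) :
    ∃ n, up n ∈ A ∧ E (up n) ≠ 0 := by
  by_contra! hcon
  refine not_twoCusps_of_additiveOn (p := 3) (by norm_num) hE hcon
    (fun n hn => (neg_up_notMem_Gamma1_three n (hA hn)).elim) hk hEk (fun γ hγ => ?_)
    (hfew.twoCusps hcong)
  rcases mem_or_neg_mem hfew.1 hle hγ with h | h
  · exact Or.inl (h0 _ h)
  · exact Or.inr (h0 _ h)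

variable (hfew : FewCusps Γ) (he : Gamma (3 ^ e) ≤ Γ) (hle : Γ ≤ levelNine)
  (hE : AdditiveOn E levelNineOne) (h0 : ∀ g ∈ Γ ⊓ Gamma1 3, E g = 0)
include hfew he hle hE h0

lemma exists_combination : ∃ x y z : ZMod 3,
    (x = 2 * (E al₀ + E al₂) ∧ x + y = E al₀ ∧ x + z = E al₁) ∧
    ∀ g ∈ levelNineOne, E g = x * ellOne g + y * ellTwo g + z * ellThree g := by
  refine hE.eq_levelNine (e := e + 1) fun g hg => h0 g ⟨he ?_, ?_⟩
  · exact Gamma_le_of_dvd (pow_dvd_pow 3 (by omega)) hg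
  · exact Gamma_le_Gamma1 3 (Gamma_le_of_dvd (dvd_pow_self 3 (by omega)) hg)

/-- Modulo `3` the coefficient `z` of `ellThree` is this sum. The functions `ellOne` and `ellTwo`
vanish on the translations in `levelNine`, so `z = 0` would let `E` vanish on the stabilizer of `∞`.
-/
lemma sum_ne_zero {k : SL(2, ℤ)} (hk : k ∈ levelNineOne) (hEk : E k ≠ 0) :
    E al₀ + E al₁ + E al₂ ≠ 0 := by
  obtain ⟨x, y, z, ⟨h1, h2, h3⟩, hxyz⟩ := exists_combination hfew he hle hE h0
  obtain ⟨n, hn, hne⟩ := hfew.exists_up_ne_zero ⟨3 ^ e, by positivity, he⟩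
    (hle.trans levelNine_le_Gamma0) inf_le_right hE (fun g hg => ⟨⟨hle hg.1, hg.2⟩, h0 g hg⟩) hk hEk
  intro hsum
  apply hne
  obtain ⟨m, rfl⟩ := up_mem_levelNine_iff.1 hn.1
  have hz : z = 0 := by
    have : z = E al₁ - 2 * (E al₀ + E al₂) := by rw [← h3, ← h1]; ring
    rw [this]
    have h4 : E al₁ = -E al₀ - E al₂ := by linear_combination hsum
    rw [h4]
    linear_combination (-E al₀ - E al₂) * three_eq_zero
  rw [hxyz _ hn, hz, ellOne, ellTwo_eq (A := 0) (by simp)]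
  simp only [up_zero_zero, up_zero_one]
  push_cast
  rw [three_eq_zero]; ring

/-- By `ell_of_trace_eq` an element of trace `-1` has the same three character values as some `al₀`,
`al₁`, `al₂` or an inverse. Since `Γ` contains an elliptic element, `E` vanishes at the
corresponding one; the finite check over `ℤ/3` encodes this. -/
lemma exists_eq_zero : E al₀ = 0 ∨ E al₁ = 0 ∨ E al₂ = 0 := by
  obtain ⟨x, y, z, ⟨h1, h2, h3⟩, hxyz⟩ := exists_combination hfew he hle hE h0
  obtain ⟨γ, hγ, hell⟩ := hfew.exists_isElliptic he
  obtain ⟨g, hg, ht, -⟩ := exists_trace_eq hfew.1 (hle.trans levelNine_le_Gamma0) hγ hell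
  have hg' : g ∈ levelNineOne := ⟨hle hg.1, hg.2⟩
  obtain ⟨β, k, hβ, r1, r2, r3⟩ := ell_of_trace_eq hg' ht
  have hv := hxyz g hg'
  rw [h0 g hg, r1, r2] at hv
  generalize ellThree g = w at hv r3
  generalize E al₀ = a at *
  generalize E al₁ = b at *
  generalize E al₂ = c at *
  have hy : y = a - x := by rw [← h2]; ring
  have hz : z = b - x := by rw [← h3]; ring
  subst hy hz h1
  have : ∀ a b c w β k : ZMod 3, β ≠ 0 → β * w = -k - k ^ 2 →
    0 = 2 * (a + c) * β + (a - 2 * (a + c)) * (k - 1) + (b - 2 * (a + c)) * w →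
    a = 0 ∨ b = 0 ∨ c = 0 := by decide
  exact this _ _ _ _ _ _ hβ r3 hv

/-- As `E` vanishes only at `al₁` among the three, all elements of trace `-1` in `Γ` have the
character values of `al₁` or its inverse, and `ellTwo` kills them. It kills the translations too, so
`Γ ∩ ker ellTwo` is an admissible subgroup with more than two cusps. -/
lemma false_of_eq_zero (h₀ : E al₀ ≠ 0) (h₁ : E al₁ = 0) (h₂ : E al₂ ≠ 0)
    (hsum : E al₀ + E al₁ + E al₂ ≠ 0) : False := by
  obtain ⟨x, y, z, ⟨h1, h2, h3⟩, hxyz⟩ := exists_combination hfew he hle hE h0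
  have hcong : IsCongruenceSubgroup (Γ ⊓ additiveOn_ellTwo.ker) := by
    refine ⟨3 ^ (e + 3), by positivity, le_inf ?_ fun g hg => ?_⟩
    · exact (Gamma_le_of_dvd (pow_dvd_pow 3 (by omega))).trans he
    · have h27 := Gamma_le_of_dvd (m := 27) (by rw [pow_add]; exact Dvd.intro_left _ rfl) hg
      exact ⟨Gamma_nine_le_levelNine (Gamma_le_of_dvd (by norm_num) h27), (ell_eq_zero h27).2.1⟩
  have hneg : ellTwo (-1) = 0 := by rw [ellTwo_eq (A := 0) (by simp)]; simp
  have hell : ∀ γ ∈ Γ, (γ : Matrix (Fin 2) (Fin 2) ℤ).IsElliptic →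
      γ ∈ Γ ⊓ additiveOn_ellTwo.ker := by
    intro γ hγ hell
    refine ⟨hγ, hle hγ, ?_⟩
    obtain ⟨g, hg, ht, hgγ⟩ := exists_trace_eq hfew.1 (hle.trans levelNine_le_Gamma0) hγ hell
    have hg' : g ∈ levelNineOne := ⟨hle hg.1, hg.2⟩
    have h5 : ellTwo g = 0 := by
      obtain ⟨β, k, hβ, r1, r2, r3⟩ := ell_of_trace_eq hg' ht
      have hv := hxyz g hg'
      rw [h0 g hg, r1, r2] at hv
      rw [r2]
      generalize ellThree g = w at hv r3
      generalize E al₀ = a at *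
      generalize E al₁ = b at *
      generalize E al₂ = c at *
      have hy : y = a - x := by rw [← h2]; ring
      have hz : z = b - x := by rw [← h3]; ring
      subst hy hz h1 h₁
      have : ∀ a c w β k : ZMod 3, (β ≠ 0 ∧ β * w = -k - k ^ 2) ∧ (a ≠ 0 ∧ c ≠ 0 ∧ a + 0 + c ≠ 0) ∧
        0 = 2 * (a + c) * β + (a - 2 * (a + c)) * (k - 1) + (0 - 2 * (a + c)) * w →
        k - 1 = 0 := by decide
      exact this _ _ _ _ _ ⟨⟨hβ, r3⟩, ⟨h₀, h₂, hsum⟩, hv⟩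
    rcases hgγ with rfl | rfl
    · exact h5
    · rw [← neg_one_mul, additiveOn_ellTwo _ neg_one_mem_levelNine _ hg'.1, hneg, h5, add_zero]
  refine not_twoCusps_of_additiveOn (p := 3) (by norm_num) additiveOn_ellTwo (fun n hn => ?_)
    (fun n hn => ?_)
    (Γ := Γ ⊓ additiveOn_ellTwo.ker) al₀_mem.1 (by rw [ellTwo_al₀]; decide) (fun γ hγ => Or.inl hγ.2)
    (((fewCusps_iff Γ).1 hfew).2 _ hcong inf_le_left hell)
  · obtain ⟨m, rfl⟩ := up_mem_levelNine_iff.1 hn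
    rw [ellTwo_eq (A := 0) (by simp)]
    simp only [up_zero_one]
    push_cast
    rw [three_eq_zero]; ring
  · have hn' := neg_mem_of neg_one_mem_levelNine hn
    rw [neg_neg] at hn'
    obtain ⟨m, rfl⟩ := up_mem_levelNine_iff.1 hn'
    rw [ellTwo_eq (A := 0) (by simp)]
    simp only [neg_apply, up_zero_one]
    push_cast
    rw [three_eq_zero]; ring

/-- These values force the coefficients of `ellOne` and `ellTwo` to vanish, so `E` is a nonzero
multiple of `ellThree`. -/
lemma le_levelTwentySeven (h₀ : E al₀ = 0) (h₁ : E al₁ ≠ 0) (h₂ : E al₂ = 0) :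
    Γ ≤ levelTwentySeven := by
  obtain ⟨x, y, z, ⟨h1, h2, h3⟩, hxyz⟩ := exists_combination hfew he hle hE h0
  have hx : x = 0 := by rw [h1, h₀, h₂]; simp
  have hy : y = 0 := by rw [hx, h₀] at h2; simpa using h2
  have hz : z ≠ 0 := by rw [hx, zero_add] at h3; rwa [h3]
  have hmem : ∀ g ∈ Γ ⊓ Gamma1 3, g ∈ levelTwentySeven := by
    intro g hg
    refine ⟨hle hg.1, ?_⟩
    have := hxyz g ⟨hle hg.1, hg.2⟩
    rw [h0 g hg, hx, hy, zero_mul, zero_mul, zero_add, zero_add] at this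
    exact (mul_eq_zero.1 this.symm).resolve_left hz
  intro g hg
  rcases mem_or_neg_mem hfew.1 (hle.trans levelNine_le_Gamma0) hg with h | h
  · exact hmem g h
  · have := neg_mem_of neg_one_mem_levelTwentySeven (hmem _ h)
    rwa [neg_neg] at this

omit hfew he hle hE h0

lemma conj_up_mem_levelNineOne (j : ℤ) {g : SL(2, ℤ)} (hg : g ∈ levelNineOne) :
    (up j)⁻¹ * g * up j ∈ levelNineOne := by
  obtain ⟨⟨m, hm⟩, hg1⟩ := hg
  obtain ⟨⟨k, hk⟩, ⟨c, hc⟩, ⟨l, hl⟩⟩ := mem_Gamma1_iff.1 hg1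
  push_cast at hk hc hl
  have hk' : g 0 0 = 1 + 3 * k := by linarith
  have hl' : g 1 1 = 1 + 3 * l := by linarith
  rw [hc] at hm
  rw [mem_levelNineOne, mem_levelNine, mem_Gamma1_iff]
  simp only [mul_apply_zero_zero, mul_apply_zero_one, mul_apply_one_zero, mul_apply_one_one,
    inv_apply_zero_zero, inv_apply_zero_one, inv_apply_one_zero, inv_apply_one_one, up_zero_zero,
    up_zero_one, up_one_zero, up_one_one, hk', hl', hc]
  push_cast
  exact ⟨⟨m + j * (k - l - j * c), by linear_combination hm⟩, ⟨k - j * c, by ring⟩, ⟨c, by ring⟩,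
    ⟨l + c * j, by ring⟩⟩

lemma conjBy_up_le (hle : Γ ≤ levelNine) (h1 : -1 ∈ Γ) (j : ℤ) :
    conjBy (up j) Γ ≤ levelNine := by
  intro g hg
  have h2 := mem_conjBy.1 hg
  have e (x : SL(2, ℤ)) : (up (-j))⁻¹ * ((up j)⁻¹ * x * up j) * up (-j) = x := by
    rw [up_neg]; group
  rcases mem_or_neg_mem h1 (hle.trans levelNine_le_Gamma0) h2 with h | h
  · have := conj_up_mem_levelNineOne (-j) ⟨hle h.1, h.2⟩
    rw [e] at this
    exact this.1
  · have := conj_up_mem_levelNineOne (-j) ⟨hle h.1, h.2⟩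
    rw [show -((up j)⁻¹ * g * up j) = (up j)⁻¹ * (-g) * up j by simp, e] at this
    have := neg_mem_of neg_one_mem_levelNine this.1
    rwa [neg_neg] at this

/-- A subgroup of the group of level `9` with few cusps. -/
lemma exists_conjBy_le_levelTwentySeven (hfew : FewCusps Γ) (he : Gamma (3 ^ e) ≤ Γ)
    (hle : Γ ≤ levelNine) (hne : Γ ≠ levelNine) : ∃ k, conjBy k Γ ≤ levelTwentySeven := by
  have hlt : Γ ⊓ Gamma1 3 < levelNineOne := by
    refine lt_of_le_of_ne (inf_le_inf_right _ hle) fun h => hne (le_antisymm hle fun g hg => ?_)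
    rcases mem_or_neg_mem neg_one_mem_levelNine levelNine_le_Gamma0 hg with h2 | h2
    · exact (h.ge h2).1
    · have := neg_mem_of hfew.1 (h.ge h2).1
      rwa [neg_neg] at this
  have he' : Gamma (3 ^ (e + 1)) ≤ Γ ⊓ Gamma1 3 := le_inf
    ((Gamma_le_of_dvd (pow_dvd_pow 3 (by omega))).trans he)
    ((Gamma_le_of_dvd (dvd_pow_self 3 (by omega))).trans (Gamma_le_Gamma1 3))
  obtain ⟨E, hE, h0, k, hk, hEk⟩ := exists_additiveOn he' hlt
    fun g hg => exists_pow_mem_Gamma_of_mem_Gamma1 _ hg.2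
  have hsum := sum_ne_zero hfew he hle hE h0 hk hEk
  have hzero := exists_eq_zero hfew he hle hE h0
  -- Replacing `Γ` by its conjugate under `up j` replaces `E` by its composite with conjugation,
  -- which permutes the values at `al₀`, `al₁`, `al₂`.
  have main : ∀ j : ℤ, ∀ a b c : SL(2, ℤ), E ((up j)⁻¹ * al₀ * up j) = E a →
      E ((up j)⁻¹ * al₁ * up j) = E b → E ((up j)⁻¹ * al₂ * up j) = E c →
      E a + E b + E c ≠ 0 → ((E a ≠ 0 ∧ E b = 0 ∧ E c ≠ 0) ∨ (E a = 0 ∧ E b ≠ 0 ∧ E c = 0)) →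
      ∃ k, conjBy k Γ ≤ levelTwentySeven := by
    intro j a b c ha hb hc hs hcase
    have hle' := conjBy_up_le hle hfew.1 j
    have hE' : AdditiveOn (fun g => E ((up j)⁻¹ * g * up j)) levelNineOne := by
      intro g hg h hh
      simp only
      rw [← hE _ (conj_up_mem_levelNineOne j hg) _ (conj_up_mem_levelNineOne j hh)]
      congr 1
      group
    have h0' : ∀ g ∈ conjBy (up j) Γ ⊓ Gamma1 3, E ((up j)⁻¹ * g * up j) = 0 := by
      intro g hg
      exact h0 _ ⟨mem_conjBy.1 hg.1, (conj_up_mem_levelNineOne j ⟨hle' hg.1, hg.2⟩).2⟩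
    rcases hcase with ⟨c1, c2, c3⟩ | ⟨c1, c2, c3⟩
    · refine (false_of_eq_zero (hfew.conjBy _) (Gamma_le_conjBy.2 he) hle' hE' h0' ?_ ?_ ?_ ?_).elim
      · simpa only [ha] using c1
      · simpa only [hb] using c2
      · simpa only [hc] using c3
      · simpa only [ha, hb, hc] using hs
    · refine ⟨_, le_levelTwentySeven (hfew.conjBy _) (Gamma_le_conjBy.2 he) hle' hE' h0' ?_ ?_ ?_⟩
      · simpa only [ha] using c1
      · simpa only [hb] using c2
      · simpa only [hc] using c3
  -- Conjugation by `up 1` permutes the three elements cyclically, up to conjugation by `up 3`,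
  -- which `E` does not notice.
  have c10 : (up 1)⁻¹ * al₀ * up 1 = (up 3)⁻¹ * al₂ * up 3 := by
    simp only [al₀, al₂, up, mk_inv, mk_mul_mk]; norm_num
  have c11 : (up 1)⁻¹ * al₁ * up 1 = al₀ := by
    simp only [al₀, al₁, up, mk_inv, mk_mul_mk]; norm_num
  have c12 : (up 1)⁻¹ * al₂ * up 1 = al₁ := by
    simp only [al₁, al₂, up, mk_inv, mk_mul_mk]; norm_num
  have c20 : (up (-1))⁻¹ * al₀ * up (-1) = al₁ := by
    simp only [al₀, al₁, up, mk_inv, mk_mul_mk]; norm_num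
  have c21 : (up (-1))⁻¹ * al₁ * up (-1) = al₂ := by
    simp only [al₁, al₂, up, mk_inv, mk_mul_mk]; norm_num
  have c22 : (up (-1))⁻¹ * al₂ * up (-1) = up 3 * al₀ * (up 3)⁻¹ := by
    simp only [al₀, al₂, up, mk_inv, mk_mul_mk]; norm_num
  have s0 := main 0 al₀ al₁ al₂ (by simp) (by simp) (by simp) hsum
  have s1 := main 1 al₂ al₀ al₁
    (by rw [c10]; simpa using hE.map_conj al₂_mem (inv_mem up_three_mem)) (by rw [c11])
    (by rw [c12]) (by intro h; apply hsum; rw [← h]; ring)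
  have s2 := main (-1) al₁ al₂ al₀ (by rw [c20]) (by rw [c21])
    (by rw [c22]; exact hE.map_conj al₀_mem up_three_mem)
    (by intro h; apply hsum; rw [← h]; ring)
  -- At least one value is zero and not all are. A cyclic shift makes `al₁` the index whose value is
  -- exceptional.
  by_cases z0 : E al₀ = 0 <;> by_cases z1 : E al₁ = 0 <;> by_cases z2 : E al₂ = 0 <;>
  simp only [z0, z1, z2, ne_eq, not_true_eq_false, not_false_eq_true, and_true, and_false,
    or_false, false_or, true_and, and_self, false_and, true_or, or_true, forall_const,
    false_implies, add_zero] at s0 s1 s2 hsum hzero <;>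
  assumption

lemma red_up_nine_mem {A : Subgroup SL(2, ℤ)} (hE : AdditiveOn E A) (hA : Gamma 27 ≤ A)
    (h₀ : al₀ ∈ A) (h₂ : al₂ ∈ A) (he : ∀ g ∈ Gamma (3 ^ e), E g = 0) :
    up 9 ∈ A ∧ E (up 9) = 0 := by
  have h81 : ∀ g ∈ Gamma 81, E g = 0 :=
    hE.eq_zero_of_mem_Gamma (k := 3) (by norm_num; exact hA) he
  have hle : Gamma 81 ≤ A := (Gamma_le_of_dvd (by norm_num)).trans hA
  have i₀ := inv_mem h₀
  have i₂ := inv_mem h₂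
  have hmem : up 9 ∈ A := mem_of_red_eq hle (by
    repeat' apply mul_mem
    all_goals assumption) red_up_nine.symm
  refine ⟨hmem, ?_⟩
  rw [hE.eq_of_red_eq hle h81 hmem red_up_nine]
  repeat rw [hE _ (by repeat' apply mul_mem
                      all_goals assumption) _ (by assumption)]
  rw [hE.map_inv h₀, hE.map_inv h₂]
  ring

/-- The intersection of the group of level `27` with `Γ₁(3)`. -/
noncomputable def levelTwentySevenOne : Subgroup SL(2, ℤ) := levelTwentySeven ⊓ Gamma1 3

lemma Gamma_twentySeven_le : Gamma 27 ≤ levelTwentySevenOne :=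
  le_inf Gamma_le_levelTwentySeven ((Gamma_le_of_dvd (by norm_num)).trans (Gamma_le_Gamma1 3))

lemma al₀_mem' : al₀ ∈ levelTwentySevenOne := ⟨⟨al₀_mem.1, ellThree_al₀⟩, al₀_mem.2⟩

lemma al₂_mem' : al₂ ∈ levelTwentySevenOne := ⟨⟨al₂_mem.1, ellThree_al₂⟩, al₂_mem.2⟩

lemma nine_dvd_of_up_mem {n : ℤ} (h : up n ∈ levelTwentySeven) : 9 ∣ n := by
  rw [mem_levelTwentySeven] at h
  simp only [up_one_zero, up_zero_one] at h
  obtain ⟨q, hq⟩ := h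
  obtain ⟨β, hβ⟩ := exists_sub_cube n
  obtain ⟨m, rfl⟩ : (3 : ℤ) ∣ n := ⟨3 * q - β, by linarith⟩
  exact ⟨m - q - 3 * m ^ 3, by linarith⟩

/-- A subgroup of the group of level `27` with few cusps. -/
lemma eq_levelTwentySeven (hfew : FewCusps Γ) (he : Gamma (3 ^ e) ≤ Γ)
    (hle : Γ ≤ levelTwentySeven) : Γ = levelTwentySeven := by
  have hle0 : levelTwentySeven ≤ Gamma0 3 := levelTwentySeven_le.trans levelNine_le_Gamma0
  by_contra hne
  have hlt : Γ ⊓ Gamma1 3 < levelTwentySevenOne := by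
    refine lt_of_le_of_ne (inf_le_inf_right _ hle) fun h => hne (le_antisymm hle fun g hg => ?_)
    rcases mem_or_neg_mem neg_one_mem_levelTwentySeven hle0 hg with h2 | h2
    · exact (h.ge h2).1
    · have := neg_mem_of hfew.1 (h.ge h2).1
      rwa [neg_neg] at this
  have he' : Gamma (3 ^ (e + 1)) ≤ Γ ⊓ Gamma1 3 := le_inf
    ((Gamma_le_of_dvd (pow_dvd_pow 3 (by omega))).trans he)
    ((Gamma_le_of_dvd (dvd_pow_self 3 (by omega))).trans (Gamma_le_Gamma1 3))
  obtain ⟨E, hE, h0, k, hk, hEk⟩ := exists_additiveOn he' hlt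
    fun g hg => exists_pow_mem_Gamma_of_mem_Gamma1 _ hg.2
  obtain ⟨n, hn, hne⟩ := hfew.exists_up_ne_zero ⟨3 ^ e, by positivity, he⟩ (hle.trans hle0)
    inf_le_right hE (fun g hg => ⟨⟨hle hg.1, hg.2⟩, h0 g hg⟩) hk hEk
  -- The translations in this group are powers of `up 9`, where every additive function vanishes;
  -- this contradicts `hne`.
  obtain ⟨m, rfl⟩ := nine_dvd_of_up_mem hn.1
  have h9 := red_up_nine_mem hE Gamma_twentySeven_le al₀_mem' al₂_mem' fun g hg => h0 g (he' hg)
  rw [← up_zpow, hE.map_zpow h9.1, h9.2, mul_zero] at hne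
  exact hne rfl

end Classification

end ModCurve

namespace ModCurve

open Matrix Matrix.SpecialLinearGroup CongruenceSubgroup

/-! ### A sufficient condition for few cusps -/

section Existence

lemma red_eq_of_coprime {a b : ℕ} (hab : Nat.Coprime a b) {g h : SL(2, ℤ)}
    (e : red a g = red a h) (e' : red b g = red b h) : red (a * b) g = red (a * b) h := by
  rw [red_eq_iff] at *
  have hc : IsCoprime (a : ℤ) b := Nat.isCoprime_iff_coprime.2 hab
  push_cast
  exact ⟨hc.mul_dvd e.1 e'.1, hc.mul_dvd e.2.1 e'.2.1, hc.mul_dvd e.2.2.1 e'.2.2.1,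
    hc.mul_dvd e.2.2.2 e'.2.2.2⟩

lemma red_up_eq {m : ℕ} {x y : ℤ} (h : (m : ℤ) ∣ x - y) : red m (up x) = red m (up y) := by
  rw [red_eq_iff]; simpa using (dvd_sub_comm.1 h)

lemma red_lo_eq {m : ℕ} {x y : ℤ} (h : (m : ℤ) ∣ x - y) : red m (lo x) = red m (lo y) := by
  rw [red_eq_iff]; simpa using (dvd_sub_comm.1 h)

/-- `SL(2, ℤ/m)` is generated by the unipotent elements. -/
lemma exists_mem_closure_red_eq {m : ℕ} {j : ℤ} (hj : (m : ℤ) ∣ j - 1) (g : SL(2, ℤ)) :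
    ∃ h ∈ Subgroup.closure {up j, lo j}, red m h = red m g := by
  set C := Subgroup.closure {up j, lo j}
  have hu : up j ∈ C := Subgroup.subset_closure (Or.inl rfl)
  have hl : lo j ∈ C := Subgroup.subset_closure (Or.inr rfl)
  have htop : (C.map (red m)).comap (red m) = ⊤ := by
    rw [eq_top_iff, ← SpecialLinearGroup.SL2Z_generators, Subgroup.closure_le]
    rintro x (rfl | rfl)
    · refine ⟨(up j)⁻¹ * lo j * (up j)⁻¹, mul_mem (mul_mem (inv_mem hu) hl) (inv_mem hu), ?_⟩
      have : ModularGroup.S = (up 1)⁻¹ * lo 1 * (up 1)⁻¹ := by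
        apply sl_ext <;> simp [ModularGroup.S, mul_apply_zero_zero, mul_apply_zero_one,
          mul_apply_one_zero, mul_apply_one_one, inv_apply_zero_zero, inv_apply_zero_one,
          inv_apply_one_zero, inv_apply_one_one]
      rw [this]
      simp only [_root_.map_mul, _root_.map_inv, red_up_eq hj, red_lo_eq hj]
    · refine ⟨up j, hu, ?_⟩
      have : ModularGroup.T = up 1 := by
        apply sl_ext <;> simp [ModularGroup.T]
      rw [this, red_up_eq hj]
  exact (Subgroup.mem_top g).rec (htop.ge (Subgroup.mem_top g))

/-- A criterion for a group to have few cusps. -/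
lemma fewCusps_of {Γ : Subgroup SL(2, ℤ)} (h1 : -1 ∈ Γ) (hle : Γ ≤ Gamma0 3) (h27 : Gamma 27 ≤ Γ)
    (hal : al₀ ∈ Γ)
    (hgen : ∀ (e : ℕ) (E : SL(2, ℤ) → ZMod 3), AdditiveOn E (Γ ⊓ Gamma1 3) →
      (∀ g ∈ Gamma (3 ^ e), E g = 0) → (∀ g ∈ Γ ⊓ Gamma1 3, g 0 0 + g 1 1 = -1 → E g = 0) →
      ∀ g ∈ Γ ⊓ Gamma1 3, E g = 0)
    (hcos : ∀ g, ∃ γ ∈ Γ, ∃ n : ℤ, g = γ * up n ∨ g = γ * sw * up n) : FewCusps Γ := by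
  refine (fewCusps_iff Γ).2 ⟨h1, fun Γ' hΓ' hΓ hell => ?_⟩
  obtain ⟨N₀, hN₀, hle'⟩ := hΓ'
  -- The level of `Γ'` may involve primes other than `3`; they are collected in `m` and treated
  -- separately.
  obtain ⟨e₀, m, hm, rfl⟩ := Nat.exists_eq_pow_mul_and_not_dvd hN₀ 3 (by norm_num)
  obtain ⟨e, he⟩ : ∃ e, e = e₀ + 3 := ⟨_, rfl⟩
  have hcop : Nat.Coprime 3 m := (Nat.Prime.coprime_iff_not_dvd Nat.prime_three).2 hm
  have hcop' : Nat.Coprime (3 ^ e) m := Nat.Coprime.pow_left e hcop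
  have hMle : Gamma (3 ^ e * m) ≤ Γ' := (Gamma_le_of_dvd
    (mul_dvd_mul_right (pow_dvd_pow 3 (by omega)) m)).trans hle'
  have h3e : Gamma (3 ^ e) ≤ Γ :=
    (Gamma_le_of_dvd (by rw [he, pow_add]; exact Dvd.intro_left _ rfl)).trans h27
  -- the subgroup generated by the elliptic elements and `Γ(3 ^ e * m)`
  set S : Set SL(2, ℤ) := {γ | γ ∈ Γ ∧ (γ : Matrix (Fin 2) (Fin 2) ℤ).IsElliptic} ∪
    (Gamma (3 ^ e * m) : Set SL(2, ℤ)) with hS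
  set N := Subgroup.closure S with hN
  have hSN : ∀ g ∈ Γ, (g : Matrix (Fin 2) (Fin 2) ℤ).IsElliptic → g ∈ N := fun g hg h =>
    Subgroup.subset_closure (Or.inl ⟨hg, h⟩)
  have hMN : Gamma (3 ^ e * m) ≤ N := fun g hg => Subgroup.subset_closure (Or.inr hg)
  have hNΓ' : N ≤ Γ' := by
    rw [hN, Subgroup.closure_le]
    rintro g (⟨hg, h⟩ | hg)
    · exact hell g hg h
    · exact hMle hg
  have hNΓ : N ≤ Γ := hNΓ'.trans hΓ
  have hconj : ∀ g ∈ Γ, ∀ n ∈ N, g * n * g⁻¹ ∈ N := by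
    intro g hg n hn
    induction hn using Subgroup.closure_induction with
    | mem x hx =>
      rcases hx with ⟨hx, h⟩ | hx
      · exact hSN _ (mul_mem (mul_mem hg hx) (inv_mem hg)) (isElliptic_conj h g)
      · exact hMN (conj_mem_Gamma hx g)
    | one => simp
    | mul x y _ _ hx hy =>
      have := mul_mem hx hy
      rwa [conj_mul] at this
    | inv x _ hx =>
      have := inv_mem hx
      rwa [conj_inv] at this
  have hnorm : (N.subgroupOf Γ).Normal := by
    refine ⟨fun n hn g => ?_⟩
    rw [Subgroup.mem_subgroupOf] at hn ⊢
    exact hconj _ g.2 _ hn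
  set π : Γ →* Γ ⧸ N.subgroupOf Γ := QuotientGroup.mk' _ with hπ
  have hker (x y : Γ) : π x = π y ↔ (x : SL(2, ℤ)) * (y : SL(2, ℤ))⁻¹ ∈ N := by
    rw [← mul_inv_eq_one, ← _root_.map_inv, ← _root_.map_mul, hπ, QuotientGroup.mk'_apply,
      QuotientGroup.eq_one_iff, Subgroup.mem_subgroupOf]
    rfl
  have hred (x y : Γ) (h : red (3 ^ e * m) x = red (3 ^ e * m) y) : π x = π y := by
    rw [hker]
    apply hMN
    rw [Gamma_mem', _root_.map_mul, _root_.map_inv, h, mul_inv_cancel]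
  -- By the choice of `j`, the elements `up j` and `lo j` are trivial at `3` and standard unipotents
  -- modulo `m`. They generate `Γ(3 ^ e)` modulo `Γ(3 ^ e * m)`.
  obtain ⟨j, hj1, hj2⟩ : ∃ j : ℤ, ((3 ^ e : ℕ) : ℤ) ∣ j ∧ (m : ℤ) ∣ j - 1 := by
    obtain ⟨u, v, huv⟩ := Nat.isCoprime_iff_coprime.2 hcop'
    exact ⟨u * (3 ^ e : ℕ), Dvd.intro_left _ rfl, ⟨-v, by linear_combination huv⟩⟩
  have hu : up j ∈ Gamma (3 ^ e) := up_mem_Gamma hj1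
  have hl : lo j ∈ Gamma (3 ^ e) := lo_mem_Gamma hj1
  set U : Γ := ⟨up j, h3e hu⟩ with hU
  set L : Γ := ⟨lo j, h3e hl⟩ with hL
  set A : Γ := ⟨al₀, hal⟩ with hA
  have hellA : ((al₀ : SL(2, ℤ)) : Matrix (Fin 2) (Fin 2) ℤ).IsElliptic := by
    rw [isElliptic_iff]; simp [al₀]
  have hπA : π A = 1 := by
    rw [← _root_.map_one π, hker]
    simpa using hSN _ hal hellA
  have hneg : (-1 : SL(2, ℤ)) ∈ N := by
    have h2 := mul_mem (hSN _ (neg_mem_of h1 hal) (isElliptic_neg hellA)) (inv_mem (hSN _ hal hellA))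
    simpa using h2
  have rU : red (3 ^ e) (up j) = 1 := (Gamma_mem' (N := 3 ^ e)).1 hu
  have rL : red (3 ^ e) (lo j) = 1 := (Gamma_mem' (N := 3 ^ e)).1 hl
  have rU' : red m (up j) = red m (up 1) := red_up_eq hj2
  have rL' : red m (lo j) = red m (lo 1) := red_lo_eq hj2
  -- The element `al₀ = up 1 * lo (-3)` is elliptic, hence trivial in the quotient. On elements
  -- trivial at `3` it acts like `U L⁻³`, which therefore commutes with `U`.
  have hcomm3 : Commute (π U) (π L ^ 3) := by
    have hal' : al₀ = up 1 * (lo 1)⁻¹ ^ 3 := by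
      simp only [← lo_neg, lo_pow]
      simp only [al₀, up, lo, mk_mul_mk]; norm_num
    have h2 : π (A * U * A⁻¹ * U⁻¹) = π ((U * L⁻¹ ^ 3) * U * (U * L⁻¹ ^ 3)⁻¹ * U⁻¹) := by
      apply hred
      apply red_eq_of_coprime hcop'
      · simp [hU, hL, hA, rU, rL]
      · simp only [hU, hL, hA, hal', Subgroup.coe_mul, Subgroup.coe_inv, Subgroup.coe_pow,
          _root_.map_mul, _root_.map_inv, _root_.map_pow, rU', rL']
    simp only [_root_.map_mul, _root_.map_inv, _root_.map_pow, hπA] at h2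
    have h3 : π U * (π L)⁻¹ ^ 3 = (π L)⁻¹ ^ 3 * π U := by
      have h4 : π U * (π L)⁻¹ ^ 3 * π U * (π U * (π L)⁻¹ ^ 3)⁻¹ * (π U)⁻¹ = 1 := by
        rw [← h2]; simp
      rw [mul_inv_eq_one, mul_inv_eq_iff_eq_mul, mul_assoc (π U), mul_right_inj] at h4
      exact h4.symm
    have h4 : Commute (π U) ((π L)⁻¹ ^ 3) := h3
    rw [inv_pow] at h4
    exact Commute.inv_right_iff.1 h4
  have hLm : π L ^ m = 1 := by
    rw [← _root_.map_pow, ← _root_.map_one π]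
    apply hred
    apply red_eq_of_coprime hcop'
    · simp [hL, rL]
    · simp only [hL, Subgroup.coe_pow, lo_pow, Subgroup.coe_one]
      rw [← lo_zero]
      exact red_lo_eq ⟨j, by ring⟩
  -- The order of `L` in the quotient divides `m`, which is prime to `3`, so `L` is a power of `L³`.
  have hcomm : Commute (π U) (π L) := by
    obtain ⟨u, v, huv⟩ := Nat.isCoprime_iff_coprime.2 hcop
    have : π L = (π L ^ 3) ^ u := by
      have h5 : π L ^ (u * (3 : ℕ) + v * m) = (π L ^ 3) ^ u := by
        rw [_root_.zpow_add, mul_comm u, mul_comm v, _root_.zpow_mul, _root_.zpow_mul (π L) m,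
          zpow_natCast, zpow_natCast, hLm, _root_.one_zpow, mul_one]
      rw [← h5, huv, zpow_one]
    rw [this]
    exact hcomm3.zpow_right u
  -- The Weyl element `U L⁻¹ U` conjugates `L` to `U⁻¹` modulo `m`; in the quotient it commutes with
  -- `L`.
  have hLU : π L = (π U)⁻¹ := by
    have h2 : π ((U * L⁻¹ * U) * L * (U * L⁻¹ * U)⁻¹) = π U⁻¹ := by
      apply hred
      apply red_eq_of_coprime hcop'
      · simp [hU, hL, rU, rL]
      · have h6 : (up 1 * (lo 1)⁻¹ * up 1) * lo 1 * (up 1 * (lo 1)⁻¹ * up 1)⁻¹ = (up 1)⁻¹ := by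
          simp only [up, lo, mk_mul_mk, mk_inv]; norm_num
        have h7 := congrArg (red m) h6
        simp only [hU, hL, Subgroup.coe_mul, Subgroup.coe_inv, _root_.map_mul, _root_.map_inv,
          rU', rL'] at h7 ⊢
        exact h7
    simp only [_root_.map_mul, _root_.map_inv] at h2
    have h8 : Commute (π U * (π L)⁻¹ * π U) (π L) :=
      (hcomm.mul_left (Commute.refl _).inv_left).mul_left hcomm
    rw [h8.eq, mul_inv_cancel_right] at h2
    exact h2
  -- every element is a power of `U` modulo `N`
  have hpow3 : ∀ x : Γ, (x : SL(2, ℤ)) ∈ Gamma (3 ^ e) → ∃ i : ℤ, π x = π U ^ i := by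
    intro x hx
    obtain ⟨h, hh, hhx⟩ := exists_mem_closure_red_eq hj2 (x : SL(2, ℤ))
    have hclos : ∀ y ∈ Subgroup.closure {up j, lo j}, y ∈ Gamma (3 ^ e) ∧
        ∃ z : Γ, (z : SL(2, ℤ)) = y ∧ ∃ i : ℤ, π z = π U ^ i := by
      intro y hy
      induction hy using Subgroup.closure_induction with
      | mem y hy =>
        rcases hy with rfl | rfl
        · exact ⟨hu, U, rfl, 1, by simp⟩
        · exact ⟨hl, L, rfl, -1, by rw [hLU, _root_.zpow_neg_one]⟩
      | one => exact ⟨one_mem _, 1, rfl, 0, by simp⟩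
      | mul y y' _ _ h1 h2 =>
        obtain ⟨m1, z, rfl, i, hz⟩ := h1
        obtain ⟨m2, z', rfl, i', hz'⟩ := h2
        exact ⟨mul_mem m1 m2, z * z', rfl, i + i', by rw [_root_.map_mul, hz, hz', _root_.zpow_add]⟩
      | inv y _ h1 =>
        obtain ⟨m1, z, rfl, i, hz⟩ := h1
        exact ⟨inv_mem m1, z⁻¹, rfl, -i, by rw [_root_.map_inv, hz, _root_.zpow_neg]⟩
    obtain ⟨m1, z, rfl, i, hz⟩ := hclos h hh
    refine ⟨i, ?_⟩
    rw [← hz]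
    apply hred
    exact red_eq_of_coprime hcop' (((Gamma_mem' (N := 3 ^ e)).1 hx).trans
      ((Gamma_mem' (N := 3 ^ e)).1 m1).symm) hhx.symm
  have hpow : ∀ x : Γ, ∃ i : ℤ, π x = π U ^ i := by
    have h3e1 : Gamma (3 ^ e) ≤ Gamma1 3 :=
      (Gamma_le_of_dvd (dvd_pow_self 3 (by omega))).trans (Gamma_le_Gamma1 3)
    -- At the prime `3` the hypothesis `hgen` says that the elliptic elements leave no characters,
    -- so they generate together with `Γ(3 ^ e)`.
    have hsup : (N ⊓ Gamma1 3) ⊔ Gamma (3 ^ e) = Γ ⊓ Gamma1 3 := by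
      refine eq_of_forall_additiveOn (p := 3) (e := e) le_sup_right
        (sup_le (inf_le_inf_right _ hNΓ) (le_inf h3e h3e1)) inf_le_right fun E hE h0 => ?_
      refine hgen e E hE (fun g hg => h0 g (le_sup_right (a := N ⊓ Gamma1 3) hg)) fun g hg ht => ?_
      refine h0 g (le_sup_left (b := Gamma (3 ^ e)) ⟨hSN g hg.1 ?_, hg.2⟩)
      rw [isElliptic_iff]; exact Or.inr (Or.inr ht)
    have h1case : ∀ x : Γ, (x : SL(2, ℤ)) ∈ Gamma1 3 → ∃ i : ℤ, π x = π U ^ i := by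
      intro x hx
      have hx' : (x : SL(2, ℤ)) ∈ (N ⊓ Gamma1 3) ⊔ Gamma (3 ^ e) := hsup.ge ⟨x.2, hx⟩
      have := Gamma_normal (3 ^ e)
      obtain ⟨y, hy, z, hz, hyz⟩ := Subgroup.mem_sup_of_normal_right.1 hx'
      obtain ⟨i, hi⟩ := hpow3 ⟨z, h3e hz⟩ hz
      refine ⟨i, ?_⟩
      rw [← hi, hker, ← hyz]
      simpa using hy.1
    intro x
    rcases mem_Gamma1_three_or (mem_Gamma0_iff.1 (hle x.2)) with h | h
    · exact h1case x h
    · obtain ⟨i, hi⟩ := h1case ⟨-x, neg_mem_of h1 x.2⟩ h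
      refine ⟨i, ?_⟩
      rw [← hi, hker]
      simpa using hneg
  -- Each `γ` is an element of `N` times `U ^ i`, and also one times `L ^ (-i)`. The first factor is
  -- absorbed by the stabilizer of `∞`, the second by that of `0`.
  refine TwoCusps.mono (Γ := N) ⟨1, sw, fun g => ?_⟩ hNΓ'
  obtain ⟨γ, hγ, n, hg⟩ := hcos g
  obtain ⟨i, hi⟩ := hpow ⟨γ, hγ⟩
  have hν : γ * (up (j * i))⁻¹ ∈ N := by
    rw [← _root_.map_zpow, hker] at hi
    simpa [hU, up_zpow] using hi
  have hν' : γ * (lo (-(j * i)))⁻¹ ∈ N := by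
    have h9 : π ⟨γ, hγ⟩ = π (L ^ (-i)) := by
      rw [hi, _root_.map_zpow, hLU, _root_.inv_zpow, _root_.zpow_neg, inv_inv]
    rw [hker] at h9
    simpa [hL, lo_zpow, lo_neg] using h9
  rcases hg with hg | hg
  · refine ⟨_, hν, j * i + n, Or.inl ?_⟩
    rw [hg, up_add]; group
  · refine ⟨_, hν', j * i + n, Or.inr (Or.inr (Or.inl ?_))⟩
    rw [hg, up_add, ← mul_assoc, mul_assoc (γ * _), sw_mul_up]; group

end Existence

end ModCurve

namespace ModCurve

open Matrix Matrix.SpecialLinearGroup CongruenceSubgroup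

/-! ### The group of level `27` and the classification up to conjugacy -/

section LevelTwentySeven

/-- An additive function on the group of level `27` vanishes if it vanishes on the elements
of order `3`. -/
lemma AdditiveOn.eq_zero_levelTwentySeven {E : SL(2, ℤ) → ZMod 3}
    (hE : AdditiveOn E levelTwentySevenOne) {e : ℕ} (he : ∀ g ∈ Gamma (3 ^ e), E g = 0)
    (h₀ : E al₀ = 0) (h₂ : E al₂ = 0) {g : SL(2, ℤ)} (hg : g ∈ levelTwentySevenOne) : E g = 0 := by
  have h81 : ∀ g ∈ Gamma (27 * 3), E g = 0 :=
    hE.eq_zero_of_mem_Gamma (k := 3) (by norm_num; exact Gamma_twentySeven_le) he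
  have hle : Gamma (27 * 3) ≤ levelTwentySevenOne :=
    (Gamma_le_of_dvd (Dvd.intro _ rfl)).trans Gamma_twentySeven_le
  have m₀ := al₀_mem'
  have m₂ := al₂_mem'
  have i₀ := inv_mem m₀
  have i₂ := inv_mem m₂
  have hup := red_up_nine_mem hE Gamma_twentySeven_le m₀ m₂ he
  have hK : AdditiveOn E hE.ker := hE.mono fun _ h => h.1
  have k₀ : al₀ ∈ hE.ker := ⟨m₀, h₀⟩
  have k₂ : al₂ ∈ hE.ker := ⟨m₂, h₂⟩
  have j₀ := inv_mem k₀
  have j₂ := inv_mem k₂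
  have kup : up 9 ∈ hE.ker := hup
  obtain ⟨x, y, z, hlin⟩ := (hE.mono Gamma_twentySeven_le).exists_linear (p := 3) (by norm_num) h81
  have hy : y = 0 := by
    have := hlin (up 27) (up_mem_Gamma dvd_rfl) 0 1 0 (by simp) (by simp) (by simp)
    rw [show (27 : ℤ) = 9 * 3 by norm_num, ← up_zpow, (zpow_mem kup 3).2] at this
    simpa using this.symm
  have h27 : lo 27 ∈ levelTwentySevenOne := Gamma_twentySeven_le (lo_mem_Gamma dvd_rfl)
  have hz : z = 0 := by
    have := hlin (lo 27) (lo_mem_Gamma dvd_rfl) 0 0 1 (by simp) (by simp) (by simp)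
    have hk : E (lo 27) = 0 := by
      rw [hE.eq_of_red_eq hle h81 h27 red_lo_twentySeven]
      refine AdditiveOn.mem_ker hE |>.1 ?_ |>.2
      repeat' apply mul_mem
      all_goals assumption
    rw [hk] at this
    simpa using this.symm
  -- Modulo `81` this matrix is `(al₀⁻¹ * al₂) ^ 9`, where `E` vanishes, and it has a nonzero
  -- diagonal component `a = 1`.
  have hx : x = 0 := by
    have hm : mk 28 27 729 703 (by norm_num) ∈ Gamma 27 := by rw [mem_Gamma_iff]; norm_num
    have := hlin _ hm 1 1 27 (by norm_num) (by norm_num) (by norm_num)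
    have hk : E (mk 28 27 729 703 (by norm_num)) = 0 := by
      rw [hE.eq_of_red_eq hle h81 (Gamma_twentySeven_le hm) red_pow_nine]
      exact (pow_mem (mul_mem j₀ k₂) 9).2
    rw [hk, hy, hz] at this
    simpa using this.symm
  have hzero : ∀ g ∈ Gamma 27, E g = 0 := by
    intro g hg
    obtain ⟨⟨a, ha⟩, ⟨b, hb⟩, ⟨c, hc⟩, -⟩ := mem_Gamma_iff.1 hg
    rw [hlin g hg a b c (by linarith) hb hc, hx, hy, hz]; simp
  have hW : lo 9 * up 3 ∈ levelTwentySevenOne ∧ E (lo 9 * up 3) = 0 := by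
    have h1 : al₂⁻¹ * al₀ * al₂ * al₀⁻¹ ∈ hE.ker := by
      repeat' apply mul_mem
      all_goals assumption
    have h2 : lo 9 * up 3 ∈ levelTwentySevenOne :=
      mem_of_red_eq Gamma_twentySeven_le h1.1 red_lo_mul_up.symm
    exact ⟨h2, by rw [hE.eq_of_red_eq Gamma_twentySeven_le hzero h2 red_lo_mul_up, h1.2]⟩
  have hD : mk 10 27 27 73 (by norm_num) ∈ levelTwentySevenOne ∧
      E (mk 10 27 27 73 (by norm_num)) = 0 := by
    have h1 : al₀ * al₂ * al₀⁻¹ * al₂ * al₀⁻¹ * al₂ * al₀ ∈ hE.ker := by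
      repeat' apply mul_mem
      all_goals assumption
    have h2 := mem_of_red_eq Gamma_twentySeven_le h1.1 red_diag.symm
    exact ⟨h2, by rw [hE.eq_of_red_eq Gamma_twentySeven_le hzero h2 red_diag, h1.2]⟩
  have hWpow (n : ℤ) : red 27 ((lo 9 * up 3) ^ n) = red 27 (lo (9 * n) * up (3 * n)) := by
    have hc : Commute (red 27 (lo 9)) (red 27 (up 3)) := by
      change _ * _ = _ * _
      rw [← _root_.map_mul, ← _root_.map_mul, red_eq_iff]
      simp [mul_apply_zero_zero, mul_apply_zero_one, mul_apply_one_zero, mul_apply_one_one]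
    rw [_root_.map_zpow, _root_.map_mul, hc.mul_zpow, ← _root_.map_zpow, ← _root_.map_zpow,
      lo_zpow, up_zpow, _root_.map_mul]
  -- Modulo `27` such an element is a power of `lo 9 * up 3` times a power of the matrix with
  -- entries `10, 27, 27, 73`, which is diagonal modulo `27`; both are words on which `E` vanishes.
  have key : ∀ g ∈ levelTwentySevenOne, ellOne g = 0 → ellTwo g = 0 → E g = 0 := by
    intro g hg h1 h2
    obtain ⟨hg0, hg1⟩ := id hg
    obtain ⟨m, hm⟩ := mem_levelTwentySeven.1 hg0
    obtain ⟨⟨k, hk⟩, -, ⟨l, hl⟩⟩ := mem_Gamma1_iff.1 hg1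
    push_cast at hk hl
    have hk' : g 0 0 = 1 + 3 * k := by linarith
    have hb : ((g 0 1 : ℤ) : ZMod 3) = 0 := by
      rw [ellOne, hk'] at h1
      push_cast at h1
      rw [three_eq_zero] at h1
      simpa using h1
    have hk0 : ((k : ℤ) : ZMod 3) = 0 := by
      rw [ellTwo_eq (A := -2 * k - 3 * k ^ 2) (by rw [hk']; ring), hb] at h2
      push_cast at h2
      rw [three_eq_zero] at h2
      grind
    obtain ⟨b, hb⟩ := (ZMod.intCast_zmod_eq_zero_iff_dvd _ 3).1 hb
    obtain ⟨k', rfl⟩ := (ZMod.intCast_zmod_eq_zero_iff_dvd _ 3).1 hk0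
    push_cast at hb hk'
    have hc : g 1 0 = 9 * b + 27 * (m - b + 3 * b ^ 3) := by rw [hb] at hm; linarith
    have hdet := det_eq g
    rw [hb, hc, hk'] at hdet
    have hd : ∃ d, g 1 1 = 1 - 9 * k' + 27 * d := by
      refine ⟨b * (b + 3 * (m - b + 3 * b ^ 3)) - 9 * k' * (b * (b + 3 * (m - b + 3 * b ^ 3)))
        + 3 * k' ^ 2 * g 1 1, ?_⟩
      linear_combination (1 - 9 * k') * hdet
    obtain ⟨d, hd⟩ := hd
    obtain ⟨r, hr, q, hq⟩ : ∃ r : ℤ, (r = 0 ∨ r = 1 ∨ r = 2) ∧ ∃ q, k' = r + 3 * q :=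
      ⟨k' % 3, by omega, k' / 3, by omega⟩
    obtain ⟨n, hn⟩ : ∃ n : ℕ, red 27 g =
        red 27 (lo (9 * b) * up (3 * b) * mk 10 27 27 73 (by norm_num) ^ n) := by
      rcases hr with rfl | rfl | rfl
      · refine ⟨0, ?_⟩
        rw [pow_zero, mul_one, red_eq_iff]
        simp only [mul_apply_zero_zero, mul_apply_zero_one, mul_apply_one_zero, mul_apply_one_one,
          up_zero_zero, up_zero_one, up_one_zero, up_one_one, lo_zero_zero, lo_zero_one,
          lo_one_zero, lo_one_one, hk', hb, hc, hd, hq]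
        push_cast
        exact ⟨⟨-q, by ring⟩, ⟨0, by ring⟩, ⟨-(m - b + 3 * b ^ 3), by ring⟩,
          ⟨b ^ 2 + q - d, by ring⟩⟩
      · refine ⟨1, ?_⟩
        rw [pow_one, red_eq_iff]
        simp only [mul_apply_zero_zero, mul_apply_zero_one, mul_apply_one_zero, mul_apply_one_one,
          up_zero_zero, up_zero_one, up_one_zero, up_one_one, lo_zero_zero, lo_zero_one,
          lo_one_zero, lo_one_one, hk', hb, hc, hd, hq, mk_zero_zero, mk_zero_one, mk_one_zero,
          mk_one_one]
        push_cast
        exact ⟨⟨3 * b - q, by ring⟩, ⟨1 + 8 * b, by ring⟩,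
          ⟨3 * b + 27 * b ^ 2 + 1 - (m - b + 3 * b ^ 3), by ring⟩,
          ⟨9 * b + 73 * b ^ 2 + 3 + q - d, by ring⟩⟩
      · refine ⟨2, ?_⟩
        rw [pow_two, mk_mul_mk, red_eq_iff]
        simp only [mul_apply_zero_zero, mul_apply_zero_one, mul_apply_one_zero, mul_apply_one_one,
          up_zero_zero, up_zero_one, up_one_zero, up_one_one, lo_zero_zero, lo_zero_one,
          lo_one_zero, lo_one_one, hk', hb, hc, hd, hq, mk_zero_zero, mk_zero_one, mk_one_zero,
          mk_one_one]
        push_cast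
        exact ⟨⟨30 + 249 * b - q, by ring⟩, ⟨83 + 673 * b, by ring⟩,
          ⟨276 * b + 83 * 27 * b ^ 2 + 83 - (m - b + 3 * b ^ 3), by ring⟩,
          ⟨747 * b + 6058 * b ^ 2 + 225 + q - d, by ring⟩⟩
    have hred : red 27 g = red 27 ((lo 9 * up 3) ^ b * mk 10 27 27 73 (by norm_num) ^ n) := by
      rw [hn, _root_.map_mul, _root_.map_mul _ (_ ^ b), hWpow]
    rw [hE.eq_of_red_eq Gamma_twentySeven_le hzero hg hred]
    exact (mul_mem (zpow_mem (show lo 9 * up 3 ∈ hE.ker from hW) b)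
      (pow_mem (show mk 10 27 27 73 (by norm_num) ∈ hE.ker from hD) n)).2
  have hB : levelTwentySevenOne ≤ levelNine := fun g hg => levelTwentySeven_le hg.1
  have v1 := additiveOn_ellOne.mono hB
  have v2 := additiveOn_ellTwo.mono hB
  obtain ⟨i, j, h1, h2⟩ : ∃ i j : ℕ, ellOne g + i + j = 0 ∧ ellTwo g + i - j = 0 := by
    generalize ellOne g = x
    generalize ellTwo g = y
    have : ∀ x y : ZMod 3, ∃ i j : Fin 3, x + (i.val : ℕ) + (j.val : ℕ) = 0 ∧
      y + (i.val : ℕ) - (j.val : ℕ) = 0 := by decide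
    obtain ⟨i, j, h⟩ := this x y
    exact ⟨i, j, h⟩
  have mi := pow_mem m₀ i
  have mj := pow_mem m₂ j
  have := key (g * al₀ ^ i * al₂ ^ j) (mul_mem (mul_mem hg mi) mj)
    (by rw [v1 _ (mul_mem hg mi) _ mj, v1 _ hg _ mi, v1.map_pow m₀, v1.map_pow m₂,
          ellOne_al₀, ellOne_al₂, mul_one, mul_one, h1])
    (by rw [v2 _ (mul_mem hg mi) _ mj, v2 _ hg _ mi, v2.map_pow m₀, v2.map_pow m₂,
          ellTwo_al₀, ellTwo_al₂, mul_one, mul_neg_one, ← sub_eq_add_neg, h2])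
  rw [hE _ (mul_mem hg mi) _ mj, hE _ hg _ mi, hE.map_pow m₀, hE.map_pow m₂, h₀, h₂,
    mul_zero, mul_zero, add_zero, add_zero] at this
  exact this

/-- Representatives of the cosets of the group of level `27`. -/
lemma exists_coset_levelTwentySeven (g : SL(2, ℤ)) :
    ∃ γ ∈ levelTwentySeven, ∃ n : ℤ, g = γ * up n ∨ g = γ * sw * up n := by
  have hcop : ∀ d c : ℤ, (∃ x y : ℤ, d * x + 3 * y = 1) → ∃ i, (27 : ℤ) ∣ c * 3 + d * 3 * i := by
    rintro d c ⟨x, y, hxy⟩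
    have : IsCoprime d 9 := by
      have h3 : IsCoprime d (3 ^ 2 : ℤ) := IsCoprime.pow_right ⟨x, y, by linarith⟩
      norm_num at h3
      exact h3
    obtain ⟨u, v, huv⟩ := this
    exact ⟨-u * c, ⟨c * v, by linear_combination (-3 * c) * huv⟩⟩
  by_cases hc : (3 : ℤ) ∣ g 1 0
  · obtain ⟨c, hc⟩ := hc
    have hdet := det_eq g
    have h9 : IsCoprime (g 0 0) (9 : ℤ) := by
      have h3 : IsCoprime (g 0 0) (3 ^ 2 : ℤ) :=
        IsCoprime.pow_right ⟨g 1 1, -g 0 1 * c, by rw [hc] at hdet; linarith⟩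
      norm_num at h3
      exact h3
    -- The membership condition for `g * up n` becomes a cubic equation modulo `9` for its upper
    -- right entry. It is solvable because the derivative `2 - 3x²` is a unit. The inverse `u` of
    -- the diagonal entry modulo `9` then gives the translation.
    obtain ⟨x, hx⟩ : ∃ x : ℤ, (9 : ℤ) ∣ c + 2 * x - x ^ 3 := by
      have : ∀ c : ZMod 9, ∃ x, c + 2 * x - x ^ 3 = 0 := by decide
      obtain ⟨x, hx⟩ := this c
      obtain ⟨x, rfl⟩ := ZMod.intCast_surjective x
      refine ⟨x, (ZMod.intCast_zmod_eq_zero_iff_dvd _ 9).1 ?_⟩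
      push_cast
      exact hx
    obtain ⟨q, hq⟩ := hx
    obtain ⟨u, v, huv⟩ := h9
    refine ⟨g * up (u * (x - g 0 1)), ?_, -(u * (x - g 0 1)), Or.inl ?_⟩
    · rw [mem_levelTwentySeven, mul_apply_one_zero, mul_apply_zero_one]
      simp only [up_zero_zero, up_zero_one, up_one_zero, up_one_one]
      have e : g 0 0 * (u * (x - g 0 1)) + g 0 1 * 1 = x - 9 * (v * (x - g 0 1)) := by
        linear_combination (x - g 0 1) * huv
      rw [e, hc]
      set w := v * (x - g 0 1)
      refine ⟨q - 2 * w + 3 * x ^ 2 * w - 27 * x * w ^ 2 + 81 * w ^ 3, ?_⟩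
      linear_combination 3 * hq
    · rw [up_neg, mul_inv_cancel_right]
  · obtain ⟨n, hn⟩ : ∃ n, (3 : ℤ) ∣ g 1 1 - g 1 0 * n := by
      have h3 : (g 1 0) % 3 = 1 ∨ (g 1 0) % 3 = 2 := by omega
      rcases h3 with h | h
      · exact ⟨g 1 1, by
          obtain ⟨q, hq⟩ : ∃ q, g 1 0 = 1 + 3 * q := ⟨g 1 0 / 3, by omega⟩
          exact ⟨-q * g 1 1, by rw [hq]; ring⟩⟩
      · exact ⟨-g 1 1, by
          obtain ⟨q, hq⟩ : ∃ q, g 1 0 = 2 + 3 * q := ⟨g 1 0 / 3, by omega⟩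
          exact ⟨(1 + q) * g 1 1, by rw [hq]; ring⟩⟩
    obtain ⟨c, hc'⟩ := (dvd_sub_comm).1 hn
    -- the element `g * up (-n) * sw⁻¹` is in `Γ₀(3)`
    set h := g * up (-n) * sw⁻¹ with hh
    have hg : g = h * sw * up n := by rw [hh, up_neg]; group
    have h10 : h 1 0 = 3 * c := by
      rw [hh]
      simp only [mul_apply_one_zero, mul_apply_one_one, inv_apply_zero_zero, inv_apply_one_zero,
        up_zero_zero, up_zero_one, up_one_zero, up_one_one, sw_one_zero, sw_one_one]
      linarith
    have hdet := det_eq h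
    obtain ⟨i, q, hi⟩ := hcop (h 1 1) (c + 2 * h 0 1 - h 0 1 ^ 3)
      ⟨h 0 0, -h 0 1 * c, by rw [h10] at hdet; linarith⟩
    refine ⟨h * lo (3 * i), ?_, n + 3 * i, Or.inr ?_⟩
    · rw [mem_levelTwentySeven, mul_apply_one_zero, mul_apply_zero_one]
      simp only [lo_zero_zero, lo_zero_one, lo_one_zero, lo_one_one, h10]
      exact ⟨q, by linear_combination hi⟩
    · rw [hg, add_comm, up_add, ← mul_assoc, mul_assoc (h * _) sw, sw_mul_up, lo_neg]
      group

lemma mem_closure_of_trace (E : SL(2, ℤ) → ZMod 3) {Γ : Subgroup SL(2, ℤ)}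
    (h : ∀ g ∈ Γ ⊓ Gamma1 3, g 0 0 + g 1 1 = -1 → E g = 0) :
    (al₀ ∈ Γ → E al₀ = 0) ∧ (al₁ ∈ Γ → E al₁ = 0) ∧ (al₂ ∈ Γ → E al₂ = 0) :=
  ⟨fun h' => h _ ⟨h', al₀_mem.2⟩ (by simp [al₀]), fun h' => h _ ⟨h', al₁_mem.2⟩ (by simp [al₁]),
    fun h' => h _ ⟨h', al₂_mem.2⟩ (by simp [al₂])⟩

lemma fewCusps_levelTwentySeven : FewCusps levelTwentySeven := by
  refine fewCusps_of neg_one_mem_levelTwentySeven (levelTwentySeven_le.trans levelNine_le_Gamma0)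
    Gamma_le_levelTwentySeven al₀_mem'.1 (fun e E hE he ht g hg => ?_) exists_coset_levelTwentySeven
  obtain ⟨h0, -, h2⟩ := mem_closure_of_trace E ht
  exact hE.eq_zero_levelTwentySeven he (h0 al₀_mem'.1) (h2 al₂_mem'.1) hg

lemma fewCusps_levelNine : FewCusps levelNine := by
  refine fewCusps_of neg_one_mem_levelNine levelNine_le_Gamma0
    ((Gamma_le_of_dvd (by norm_num)).trans Gamma_nine_le_levelNine) al₀_mem.1
    (fun e E hE he ht g hg => ?_) fun g => ?_
  · obtain ⟨h0, h1, h2⟩ := mem_closure_of_trace E ht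
    exact hE.eq_zero_levelNine he (h0 al₀_mem.1) (h1 al₁_mem.1) (h2 al₂_mem.1) hg
  · obtain ⟨γ, hγ, n, h⟩ := exists_coset_levelTwentySeven g
    exact ⟨γ, levelTwentySeven_le hγ, n, h⟩

lemma hasExactLevel_levelNine : HasExactLevel levelNine 9 := by
  refine ⟨⟨by norm_num, Gamma_nine_le_levelNine⟩, fun m hm => ?_⟩
  have h := hm.2 (lo_mem_Gamma (n := m) (m := m) dvd_rfl)
  rw [mem_levelNine] at h
  have h9 : (9 : ℤ) ∣ m := by simpa using h
  exact Nat.le_of_dvd hm.1 (by exact_mod_cast h9)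

lemma hasExactLevel_levelTwentySeven : HasExactLevel levelTwentySeven 27 := by
  refine ⟨⟨by norm_num, Gamma_le_levelTwentySeven⟩, fun m hm => ?_⟩
  have h := hm.2 (lo_mem_Gamma (n := m) (m := m) dvd_rfl)
  rw [mem_levelTwentySeven] at h
  have h9 : (27 : ℤ) ∣ m := by simpa using h
  exact Nat.le_of_dvd hm.1 (by exact_mod_cast h9)

lemma three_dvd_card_reduction {Γ : Subgroup SL(2, ℤ)} (h : al₀ ∈ Γ) :
    3 ∣ Nat.card (reduction Γ 3) := by
  have hord : orderOf (red 3 al₀) = 3 := by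
    have : Fact (Nat.Prime 3) := ⟨Nat.prime_three⟩
    refine orderOf_eq_prime ?_ ?_
    · rw [← _root_.map_pow, ← _root_.map_one (red 3), red_eq_iff]
      simp only [pow_succ, pow_zero, one_mul, al₀, mk_mul_mk, mk_zero_zero, mk_zero_one,
        mk_one_zero, mk_one_one]
      norm_num
    · rw [← _root_.map_one (red 3), Ne, red_eq_iff]
      simp [al₀]
  have hdvd := Subgroup.orderOf_dvd_natCard _ (show red 3 al₀ ∈ reduction Γ 3 from ⟨al₀, h, rfl⟩)
  rwa [hord] at hdvd

lemma isUnipotentOfLevel_levelNine : IsUnipotentOfLevel levelNine 3 2 :=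
  ⟨Nat.prime_three, by norm_num, by norm_num, hasExactLevel_levelNine,
    three_dvd_card_reduction al₀_mem.1, fewCusps_levelNine⟩

lemma isUnipotentOfLevel_levelTwentySeven : IsUnipotentOfLevel levelTwentySeven 3 3 :=
  ⟨Nat.prime_three, by norm_num, by norm_num, hasExactLevel_levelTwentySeven,
    three_dvd_card_reduction al₀_mem'.1, fewCusps_levelTwentySeven⟩

/-- The groups as in the theorem, up to conjugacy. -/
lemma IsUnipotentOfLevel.exists_conjBy_eq {Γ : Subgroup SL(2, ℤ)} {p e : ℕ}
    (h : IsUnipotentOfLevel Γ p e) :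
    ∃ k, conjBy k Γ = levelNine ∨ conjBy k Γ = levelTwentySeven := by
  obtain ⟨hp, hp2, he, hlev, hcard, hfew⟩ := h
  obtain ⟨k, hk⟩ := exists_conjBy_le_Gamma0 hp hp2 he hlev hcard hfew
  have hf := hfew.conjBy k
  have hl := hlev.conjBy k
  have hcong : IsCongruenceSubgroup (conjBy k Γ) := ⟨p ^ e, hl.1.1.ne', hl.1.2⟩
  obtain ⟨hp35, β, hβ, hrel⟩ := exists_additiveOn_Gamma1 hp hp2 he hl hf.1
    (hf.twoCusps hcong) hk
  rcases hp35 with rfl | rfl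
  · have hle : conjBy k Γ ≤ levelNine := by
      have hβ1 : β = -1 := by
        have : ∀ β : ZMod 3, β ≠ 0 → β = 1 ∨ β = -1 := by decide
        -- An element of trace `-1` in `Γ₁(3)` has `b c ≡ -1` modulo `3` with `c = β b`; for `β = 1`
        -- this would make `-1` a square modulo `3`.
        refine (this β hβ).resolve_left fun hβ1 => ?_
        obtain ⟨γ, hγ, hell⟩ := hf.exists_isElliptic hl.1.2
        obtain ⟨g, hg, ht, -⟩ := exists_trace_eq hf.1 hk hγ hell
        obtain ⟨k, c, ha, hc, hd, hbc⟩ := exists_of_trace_eq hg.2 ht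
        have h2 := hrel g hg.1 hg.2 c hc
        have h3 := congrArg (Int.cast : ℤ → ZMod 3) hbc
        push_cast at h3
        rw [h2, hβ1, three_eq_zero] at h3
        generalize ((g 0 1 : ℤ) : ZMod 3) = b at h3
        have : ∀ b k : ZMod 3, ¬ b * (1 * b) = -1 - 0 * k - 0 * k ^ 2 := by decide
        exact this _ _ h3
      have hmem : ∀ g ∈ conjBy k Γ ⊓ Gamma1 3, g ∈ levelNine := by
        intro g hg
        obtain ⟨c, hc⟩ := (mem_Gamma1_iff.1 hg.2).2.1
        have h2 := hrel g hg.1 hg.2 c hc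
        rw [hβ1] at h2
        obtain ⟨q, hq⟩ := (ZMod.intCast_zmod_eq_zero_iff_dvd (c + g 0 1) 3).1 (by
          push_cast; rw [h2]; ring)
        push_cast at hc hq
        exact ⟨q, by linarith⟩
      intro g hg
      rcases mem_or_neg_mem hf.1 hk hg with h | h
      · exact hmem g h
      · have := neg_mem_of neg_one_mem_levelNine (hmem _ h)
        rwa [neg_neg] at this
    by_cases hne : conjBy k Γ = levelNine
    · exact ⟨k, Or.inl hne⟩
    · obtain ⟨k', hk'⟩ := exists_conjBy_le_levelTwentySeven hf hl.1.2 hle hne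
      refine ⟨k' * k, Or.inr ?_⟩
      rw [conjBy_mul]
      exact eq_levelTwentySeven (hf.conjBy k') (Gamma_le_conjBy.2 hl.1.2) hk'
  · obtain ⟨k', hk'⟩ := exists_conjBy_le_quadGroup hf.1 (hf.twoCusps hcong) hk hβ hrel
    exact (not_le_quadGroup hβ (hf.conjBy k') (isCongruenceSubgroup_conjBy hcong) hk').elim

end LevelTwentySeven

end ModCurve

namespace ModCurve

open UpperHalfPlane hiding I
open Filter Topology
open scoped ModularForm Manifold

/-! ### Topology of the modular curve -/

section Curve

lemma smul_interior (γ : SL(2, ℤ)) (τ : ℍ) :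
    γ • ExtHalfPlane.interior τ = ExtHalfPlane.interior (γ • τ) := rfl

lemma smul_cusp (γ : SL(2, ℤ)) (c : OnePoint ℚ) :
    γ • ExtHalfPlane.cusp c = ExtHalfPlane.cusp (Matrix.SpecialLinearGroup.mapGL ℚ γ • c) := rfl

lemma isOpen_extHalfPlane_iff {U : Set ExtHalfPlane} :
    IsOpen U ↔ IsOpen (ExtHalfPlane.interior ⁻¹' U) ∧
    ∀ γ : SL(2, ℤ), γ • ExtHalfPlane.cusp OnePoint.infty ∈ U →
      ∃ M : ℝ, ∀ τ : ℍ, M < τ.im → γ • ExtHalfPlane.interior τ ∈ U := Iff.rfl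

instance : ContinuousConstSMul SL(2, ℤ) ℍ where
  continuous_const_smul γ := continuous_const_smul (γ : GL (Fin 2) ℝ)

instance : ContinuousConstSMul SL(2, ℤ) ExtHalfPlane where
  continuous_const_smul γ := by
    refine continuous_def.2 fun U hU => ?_
    rw [isOpen_extHalfPlane_iff] at hU ⊢
    refine ⟨hU.1.preimage (continuous_const_smul γ), fun δ hδ => ?_⟩
    rw [Set.mem_preimage, ← mul_smul] at hδ
    obtain ⟨M, hM⟩ := hU.2 _ hδ
    exact ⟨M, fun τ hτ => by rw [Set.mem_preimage, ← mul_smul]; exact hM τ hτ⟩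

variable {Γ : Subgroup SL(2, ℤ)}

lemma isOpen_curve_iff {U : Set (Curve Γ)} : IsOpen U ↔ IsOpen (toCurve Γ ⁻¹' U) := Iff.rfl

lemma toCurve_eq_iff {x y : ExtHalfPlane} : toCurve Γ x = toCurve Γ y ↔ ∃ γ ∈ Γ, γ • y = x := by
  refine Quotient.eq.trans ?_
  rw [MulAction.orbitRel_apply, MulAction.mem_orbit_iff]
  exact ⟨fun ⟨γ, h⟩ => ⟨γ, γ.2, h⟩, fun ⟨γ, hγ, h⟩ => ⟨⟨γ, hγ⟩, h⟩⟩

lemma toCurve_smul {γ : SL(2, ℤ)} (hγ : γ ∈ Γ) (x : ExtHalfPlane) :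
    toCurve Γ (γ • x) = toCurve Γ x := toCurve_eq_iff.2 ⟨γ, hγ, rfl⟩

lemma toCurve_surjective : Function.Surjective (toCurve Γ) := Quotient.mk_surjective

lemma isOpenMap_toCurve : IsOpenMap (toCurve Γ) := by
  intro V hV
  rw [isOpen_curve_iff]
  have : toCurve Γ ⁻¹' (toCurve Γ '' V) = ⋃ γ ∈ Γ, (γ • ·) ⁻¹' V := by
    ext x
    simp only [Set.mem_preimage, Set.mem_image, toCurve_eq_iff, Set.mem_iUnion]
    exact ⟨fun ⟨y, hy, γ, hγ, h⟩ => ⟨γ, hγ, h ▸ hy⟩, fun ⟨γ, hγ, h⟩ => ⟨_, h, γ, hγ, rfl⟩⟩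
  rw [this]
  exact isOpen_biUnion fun γ _ => hV.preimage (continuous_const_smul γ)

/-- A function on an open subset of the extended upper half-plane which is invariant as far as this
makes sense descends to `X_Γ`. -/
lemma exists_descent {V : Set ExtHalfPlane} (hV : IsOpen V) {G : ExtHalfPlane → ℂ}
    (hG : ContinuousOn G V) (hinv : ∀ γ ∈ Γ, ∀ x ∈ V, γ • x ∈ V → G (γ • x) = G x) :
    ∃ F : Curve Γ → ℂ, ContinuousOn F (toCurve Γ '' V) ∧ ∀ x ∈ V, F (toCurve Γ x) = G x := by
  classical
  let F : Curve Γ → ℂ := fun y => if h : ∃ x ∈ V, toCurve Γ x = y then G h.choose else 0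
  have hF : ∀ x ∈ V, F (toCurve Γ x) = G x := by
    intro x hx
    have h : ∃ x' ∈ V, toCurve Γ x' = toCurve Γ x := ⟨x, hx, rfl⟩
    have h1 : F (toCurve Γ x) = G h.choose := dif_pos h
    obtain ⟨γ, hγ, e⟩ := toCurve_eq_iff.1 h.choose_spec.2
    rw [h1, ← e]
    exact hinv γ hγ x hx (e ▸ h.choose_spec.1)
  refine ⟨F, (continuousOn_open_iff (isOpenMap_toCurve V hV)).2 fun t ht => ?_, hF⟩
  have : toCurve Γ '' V ∩ F ⁻¹' t = toCurve Γ '' (V ∩ G ⁻¹' t) := by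
    ext y
    constructor
    · rintro ⟨⟨x, hx, rfl⟩, hy⟩
      exact ⟨x, ⟨hx, by rwa [Set.mem_preimage, hF x hx] at hy⟩, rfl⟩
    · rintro ⟨x, ⟨hx, hx'⟩, rfl⟩
      exact ⟨⟨x, hx, rfl⟩, by rwa [Set.mem_preimage, hF x hx]⟩
  rw [this]
  exact isOpenMap_toCurve _ (hG.isOpen_inter_preimage hV ht)

end Curve

/-! ### Derivatives and the weight 2 action -/

section Slash

/-- The derivative of a fractional linear transformation. -/
lemma hasDerivAt_smul (γ : SL(2, ℤ)) (τ : ℍ) :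
    HasDerivAt (fun w : ℂ => ((γ • ofComplex w : ℍ) : ℂ)) (denom γ τ ^ (-2 : ℤ)) τ := by
  have hd : (γ : GL (Fin 2) ℝ).val.det = 1 := by
    rw [← Matrix.GeneralLinearGroup.val_det_apply]; simp
  have h := (hasStrictDerivAt_smul (g := (γ : GL (Fin 2) ℝ)) (by rw [hd]; exact one_pos) τ).hasDerivAt
  rw [hd] at h
  convert! h using 1
  rw [zpow_neg]
  simp

lemma eventually_coe_ofComplex (τ : ℍ) : ∀ᶠ w in 𝓝 (τ : ℂ), ((ofComplex w : ℍ) : ℂ) = w := by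
  filter_upwards [isOpen_upperHalfPlaneSet.mem_nhds τ.im_pos] with w hw
  rw [ofComplex_apply_of_im_pos hw]

/-- The pull-back of a primitive. -/
lemma hasDerivAt_comp_smul {φ : ℍ → ℂ} {c : ℂ} (γ : SL(2, ℤ)) (τ : ℍ)
    (h : HasDerivAt (fun w : ℂ => φ (ofComplex w)) c (γ • τ : ℍ)) :
    HasDerivAt (fun w : ℂ => φ (γ • ofComplex w)) (c * denom γ τ ^ (-2 : ℤ)) τ := by
  have h1 := hasDerivAt_smul γ τ
  have h2 : HasDerivAt (fun w : ℂ => φ (ofComplex w)) c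
      ((fun w : ℂ => ((γ • ofComplex w : ℍ) : ℂ)) (τ : ℂ)) := by
    simpa using h
  have h3 := h2.comp (τ : ℂ) h1
  simpa [Function.comp_def] using h3

lemma exists_ball_subset {V : Set ℍ} (hV : IsOpen V) {τ : ℍ} (hτ : τ ∈ V) :
    ∃ r > 0, ∀ w ∈ Metric.ball (τ : ℂ) r, 0 < w.im ∧ ofComplex w ∈ V := by
  have h1 : IsOpen ((↑) '' V : Set ℂ) := isOpenEmbedding_coe.isOpenMap V hV
  obtain ⟨r, hr, h⟩ := Metric.isOpen_iff.1 h1 τ ⟨τ, hτ, rfl⟩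
  refine ⟨r, hr, fun w hw => ?_⟩
  obtain ⟨z, hz, rfl⟩ := h hw
  exact ⟨z.im_pos, by simpa using hz⟩

/-- A function with an antiderivative near each point is holomorphic. -/
lemma mdifferentiable_of_hasDerivAt {h : ℍ → ℂ}
    (hh : ∀ τ : ℍ, ∃ V : Set ℍ, IsOpen V ∧ τ ∈ V ∧ ∃ φ : ℂ → ℂ, ∀ z ∈ V,
      HasDerivAt φ (h z) (z : ℂ)) : MDiff h := by
  intro τ
  rw [UpperHalfPlane.mdifferentiableAt_iff]
  obtain ⟨V, hV, hτ, φ, hφ⟩ := hh τ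
  obtain ⟨r, hr, hb⟩ := exists_ball_subset hV hτ
  have h1 : ∀ w ∈ Metric.ball (τ : ℂ) r, HasDerivAt φ (h (ofComplex w)) w := by
    intro w hw
    have := hφ _ (hb w hw).2
    rwa [ofComplex_apply_of_im_pos (hb w hw).1] at this ⊢
  have h2 : DifferentiableOn ℂ φ (Metric.ball (τ : ℂ) r) := fun w hw =>
    (h1 w hw).differentiableAt.differentiableWithinAt
  have h3 := (h2.deriv Metric.isOpen_ball).differentiableAt
    (Metric.isOpen_ball.mem_nhds (Metric.mem_ball_self hr))
  refine h3.congr_of_eventuallyEq ?_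
  filter_upwards [Metric.isOpen_ball.mem_nhds (Metric.mem_ball_self hr)] with w hw
  exact ((h1 w hw).deriv).symm

end Slash

/-! ### Differentials are cusp forms of weight 2 -/

section Differentials

variable {Γ : Subgroup SL(2, ℤ)} {h : ℍ → ℂ}

lemma mdifferentiable_of_mem (hh : h ∈ holomorphicDifferentials Γ) : MDiff h := by
  refine mdifferentiable_of_hasDerivAt fun τ => ?_
  obtain ⟨U, hU, hx, F, hF⟩ := hh (toCurve Γ (ExtHalfPlane.interior τ))
  exact ⟨_, (isOpen_extHalfPlane_iff.1 (isOpen_curve_iff.1 hU)).1, hx, _, fun z hz => hF.2 z hz⟩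

/-- A local primitive pulled back to `ℍ` is `Γ`-invariant; differentiate this invariance. -/
lemma slash_eq_of_mem (hh : h ∈ holomorphicDifferentials Γ) {γ : SL(2, ℤ)} (hγ : γ ∈ Γ) :
    h ∣[(2 : ℤ)] γ = h := by
  ext τ
  obtain ⟨U, hU, hx, F, hF⟩ := hh (toCurve Γ (ExtHalfPlane.interior τ))
  have h1 := hF.2 τ hx
  have h2 := hF.2 (γ • τ) (by rwa [← smul_interior, toCurve_smul hγ])
  have h3 := hasDerivAt_comp_smul (φ := fun z => F (toCurve Γ (ExtHalfPlane.interior z))) γ τ h2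
  simp only [← smul_interior, toCurve_smul hγ] at h3
  rw [ModularForm.SL_slash_apply]
  exact h3.unique h1

/-- By continuity at the cusp, the primitive stays within `ε` of its value there on a half-plane `M
< Im τ`. Cauchy's estimate on discs of radius `1` then bounds the derivative by `ε`. -/
lemma slash_isZeroAtImInfty_of_mem (hh : h ∈ holomorphicDifferentials Γ) (δ : SL(2, ℤ)) :
    IsZeroAtImInfty (h ∣[(2 : ℤ)] δ) := by
  obtain ⟨U, hU, hx, F, hF⟩ := hh (toCurve Γ (δ • ExtHalfPlane.cusp OnePoint.infty))
  rw [UpperHalfPlane.isZeroAtImInfty_iff]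
  intro ε hε
  have hW : IsOpen (U ∩ F ⁻¹' Metric.ball (F (toCurve Γ (δ • ExtHalfPlane.cusp OnePoint.infty))) ε) :=
    hF.1.isOpen_inter_preimage hU Metric.isOpen_ball
  obtain ⟨M, hM⟩ := (isOpen_extHalfPlane_iff.1 (isOpen_curve_iff.1 hW)).2 δ
    ⟨hx, Metric.mem_ball_self hε⟩
  set y := F (toCurve Γ (δ • ExtHalfPlane.cusp OnePoint.infty))
  have hder : ∀ τ : ℍ, M < τ.im → HasDerivAt
      (fun w : ℂ => F (toCurve Γ (ExtHalfPlane.interior (δ • ofComplex w))))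
      ((h ∣[(2 : ℤ)] δ) τ) τ := by
    intro τ hτ
    rw [ModularForm.SL_slash_apply]
    exact hasDerivAt_comp_smul (φ := fun z => F (toCurve Γ (ExtHalfPlane.interior z))) δ τ
      (hF.2 (δ • τ) (hM τ hτ).1)
  refine ⟨max M 0 + 2, fun τ hτ => ?_⟩
  have him : ∀ w ∈ Metric.closedBall (τ : ℂ) 1, 0 < w.im ∧ M < w.im := by
    intro w hw
    have h1 : |(w - τ).im| ≤ 1 := (Complex.abs_im_le_norm _).trans (by simpa [dist_eq_norm] using hw)
    rw [Complex.sub_im, abs_le] at h1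
    have := le_max_left M 0
    have := le_max_right M 0
    rw [coe_im] at h1
    constructor <;> linarith
  have hd : ∀ w ∈ Metric.closedBall (τ : ℂ) 1, DifferentiableAt ℂ
      (fun w : ℂ => F (toCurve Γ (ExtHalfPlane.interior (δ • ofComplex w)))) w := by
    intro w hw
    exact (hder ⟨w, (him w hw).1⟩ (him w hw).2).differentiableAt
  have key := Complex.norm_deriv_le_of_forall_mem_sphere_norm_le (c := (τ : ℂ)) (R := 1) (C := ε)
    (f := fun w : ℂ => F (toCurve Γ (ExtHalfPlane.interior (δ • ofComplex w))) - y) one_pos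
    (DifferentiableOn.diffContOnCl (by
      rw [closure_ball _ one_ne_zero]
      exact fun w hw => ((hd w hw).sub_const y).differentiableWithinAt)) (by
      intro w hw
      have hw' := Metric.sphere_subset_closedBall hw
      have := (hM ⟨w, (him w hw').1⟩ (him w hw').2).2
      rw [Set.mem_preimage, Metric.mem_ball, dist_eq_norm] at this
      rw [ofComplex_apply_of_im_pos (him w hw').1]
      exact this.le)
  have h2 := ((hder τ (him _ (by simp)).2).sub_const y).deriv
  rw [div_one, h2] at key
  exact key

end Differentials

end ModCurve

namespace ModCurve

open UpperHalfPlane hiding I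
open Filter Topology
open scoped ModularForm Manifold

/-! ### Cusp forms have primitives near interior points -/

section Primitive

variable {Γ : Subgroup SL(2, ℤ)} {h : ℍ → ℂ}

lemma eq_of_slash_eq (hinv : ∀ γ ∈ Γ, h ∣[(2 : ℤ)] γ = h) {γ : SL(2, ℤ)} (hγ : γ ∈ Γ) (τ : ℍ) :
    h (γ • τ) * denom γ τ ^ (-2 : ℤ) = h τ := by
  rw [← ModularForm.SL_slash_apply, hinv γ hγ]

/-- A local primitive on the extended upper half-plane descends to one on `X_Γ`. -/
lemma exists_isPrimitiveOn (hinv : ∀ γ ∈ Γ, h ∣[(2 : ℤ)] γ = h) {V : Set ExtHalfPlane}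
    (hV : IsOpen V) {G : ExtHalfPlane → ℂ} (hG : ContinuousOn G V)
    (hGinv : ∀ γ ∈ Γ, ∀ x ∈ V, γ • x ∈ V → G (γ • x) = G x)
    (hd : ∀ τ : ℍ, ExtHalfPlane.interior τ ∈ V →
      HasDerivAt (fun w : ℂ => G (ExtHalfPlane.interior (ofComplex w))) (h τ) τ) :
    ∃ F : Curve Γ → ℂ, IsPrimitiveOn Γ (toCurve Γ '' V) F h := by
  obtain ⟨F, hF, hFG⟩ := exists_descent hV hG hGinv
  refine ⟨F, hF, fun τ hτ => ?_⟩
  obtain ⟨x, hx, e⟩ := hτ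
  obtain ⟨γ, hγ, rfl⟩ := toCurve_eq_iff.1 e
  rw [smul_interior] at hx
  have h1 := hasDerivAt_comp_smul (φ := fun z => G (ExtHalfPlane.interior z)) γ τ (hd _ hx)
  rw [eq_of_slash_eq hinv hγ] at h1
  refine h1.congr_of_eventuallyEq ?_
  have hW : IsOpen ((γ • ·) ⁻¹' (ExtHalfPlane.interior ⁻¹' V) : Set ℍ) :=
    (isOpen_extHalfPlane_iff.1 hV).1.preimage (continuous_const_smul γ)
  obtain ⟨r, hr, hb⟩ := exists_ball_subset hW (τ := τ) hx
  filter_upwards [Metric.isOpen_ball.mem_nhds (Metric.mem_ball_self hr)] with w hw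
  rw [← hFG _ (hb w hw).2, ← smul_interior, toCurve_smul hγ]

/-- On a small hyperbolic ball only the stabilizer of `τ₀` identifies points. The ball is also a
Euclidean disc, so `h` has a primitive `g` there; invariance of `h` makes `g ∘ γ - g` constant, and
the constant is zero at the fixed point `τ₀`. -/
lemma exists_isPrimitiveOn_interior (hinv : ∀ γ ∈ Γ, h ∣[(2 : ℤ)] γ = h) (hh : MDiff h) (τ₀ : ℍ) :
    ∃ U : Set (Curve Γ), IsOpen U ∧ toCurve Γ (ExtHalfPlane.interior τ₀) ∈ U ∧
      ∃ F : Curve Γ → ℂ, IsPrimitiveOn Γ U F h := by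
  obtain ⟨U, hU, hUγ⟩ :=
    ProperlyDiscontinuousSMul.exists_nhds_image_smul_eq_self (𝒮ℒ) τ₀
  obtain ⟨r, hr, hrU⟩ := Metric.mem_nhds_iff.1 hU
  have hfix : ∀ γ : SL(2, ℤ), ∀ τ ∈ Metric.ball τ₀ r, γ • τ ∈ Metric.ball τ₀ r → γ • τ₀ = τ₀ := by
    intro γ τ hτ hγ
    exact hUγ ⟨(γ : GL (Fin 2) ℝ), γ, rfl⟩ ⟨_, ⟨τ, hrU hτ, rfl⟩, hrU hγ⟩
  have hb := image_coe_ball τ₀ r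
  have hball : ∀ w ∈ Metric.ball (τ₀.center r : ℂ) (τ₀.im * Real.sinh r),
      0 < w.im ∧ ofComplex w ∈ Metric.ball τ₀ r := by
    intro w hw
    obtain ⟨z, hz, rfl⟩ := hb.symm ▸ hw
    exact ⟨z.im_pos, by simpa using hz⟩
  have hball' : ∀ z ∈ Metric.ball τ₀ r,
      (z : ℂ) ∈ Metric.ball (τ₀.center r : ℂ) (τ₀.im * Real.sinh r) := by
    intro z hz
    rw [← hb]
    exact ⟨z, hz, rfl⟩
  have hdiff : DifferentiableOn ℂ (h ∘ ofComplex)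
      (Metric.ball (τ₀.center r : ℂ) (τ₀.im * Real.sinh r)) :=
    (UpperHalfPlane.mdifferentiable_iff.1 hh).mono fun w hw => (hball w hw).1
  obtain ⟨g, hg⟩ := hdiff.isExactOn_ball
  have hg' : ∀ z ∈ Metric.ball τ₀ r, HasDerivAt (fun w => g (ofComplex w : ℍ)) (h z) (z : ℂ) := by
    intro z hz
    have h1 := hg z (hball' z hz)
    simp only [Function.comp_apply, ofComplex_apply] at h1
    refine h1.congr_of_eventuallyEq ?_
    filter_upwards [eventually_coe_ofComplex z] with w hw
    rw [hw]
  let G : ExtHalfPlane → ℂ := fun x => match x with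
    | .interior τ => g τ
    | .cusp _ => 0
  have hV : IsOpen (ExtHalfPlane.interior '' Metric.ball τ₀ r) := by
    rw [isOpen_extHalfPlane_iff]
    refine ⟨?_, fun γ hγ => ?_⟩
    · rw [Set.preimage_image_eq _ (fun a b e => by cases e; rfl)]
      exact Metric.isOpen_ball
    · obtain ⟨z, _, e⟩ := hγ
      rw [smul_cusp] at e
      cases e
  have hmem : ∀ z : ℍ, ExtHalfPlane.interior z ∈ ExtHalfPlane.interior '' Metric.ball τ₀ r ↔
      z ∈ Metric.ball τ₀ r := fun z =>
    ⟨fun ⟨y, hy, e⟩ => by cases e; exact hy, fun hz => ⟨z, hz, rfl⟩⟩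
  refine ⟨_, isOpenMap_toCurve _ hV, ⟨_, (hmem _).2 (Metric.mem_ball_self hr), rfl⟩,
    exists_isPrimitiveOn hinv hV (G := G) ?_ ?_ fun τ hτ => hg' τ ((hmem τ).1 hτ)⟩
  · rw [continuousOn_open_iff hV]
    intro t ht
    rw [isOpen_extHalfPlane_iff]
    refine ⟨?_, fun γ hγ => ?_⟩
    · have : ExtHalfPlane.interior ⁻¹' (ExtHalfPlane.interior '' Metric.ball τ₀ r ∩ G ⁻¹' t) =
          Metric.ball τ₀ r ∩ (fun z : ℍ => g z) ⁻¹' t := by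
        ext z
        simp only [Set.mem_preimage, Set.mem_inter_iff, hmem, G]
      rw [this]
      refine ContinuousOn.isOpen_inter_preimage (fun z hz => ?_) Metric.isOpen_ball ht
      exact ((hg z (hball' z hz)).continuousAt.comp
        UpperHalfPlane.continuous_coe.continuousAt).continuousWithinAt
    · obtain ⟨z, _, e⟩ := hγ.1
      rw [smul_cusp] at e
      cases e
  · rintro γ hγ _ ⟨τ, hτ, rfl⟩ hγτ
    rw [smul_interior, hmem] at hγτ
    have h0 := hfix γ τ hτ hγτ
    have hpres : ∀ z ∈ Metric.ball τ₀ r, γ • z ∈ Metric.ball τ₀ r := by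
      intro z hz
      rw [Metric.mem_ball] at hz ⊢
      calc dist (γ • z) τ₀ = dist (γ • z) (γ • τ₀) := by rw [h0]
        _ = dist z τ₀ := by
          exact dist_smul (Matrix.SpecialLinearGroup.map (Int.castRingHom ℝ) γ) z τ₀
        _ < r := hz
    have hconst := (convex_ball (τ₀.center r : ℂ) (τ₀.im * Real.sinh r)).isPreconnected
    have hd : ∀ w ∈ Metric.ball (τ₀.center r : ℂ) (τ₀.im * Real.sinh r),
        HasDerivAt (fun w => g (γ • ofComplex w : ℍ) - g (ofComplex w : ℍ)) 0 w := by
      intro w hw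
      have hz := (hball w hw).2
      have e : (ofComplex w : ℂ) = w := by rw [ofComplex_apply_of_im_pos (hball w hw).1]
      have h1 := hasDerivAt_comp_smul (φ := fun z => g (z : ℂ)) γ _ (hg' _ (hpres _ hz))
      rw [eq_of_slash_eq hinv hγ] at h1
      have h2 := h1.sub (hg' _ hz)
      rw [sub_self, e] at h2
      exact h2
    have hcst := Metric.isOpen_ball.is_const_of_deriv_eq_zero hconst
      (fun w hw => (hd w hw).differentiableAt.differentiableWithinAt)
      (fun w hw => (hd w hw).deriv) (hball' τ hτ) (hball' τ₀ (Metric.mem_ball_self hr))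
    simp only [ofComplex_apply, h0, sub_self] at hcst
    exact sub_eq_zero.1 hcst

end Primitive

/-! ### Cusp forms have primitives near cusps -/

section Cusp

variable {Γ : Subgroup SL(2, ℤ)} {h : ℍ → ℂ}

/-- A primitive of a periodic function vanishing at `i∞` has a limit at `i∞`. -/
lemma exists_primitive_tendsto {N : ℝ} (hN : 0 < N) {f : ℍ → ℂ}
    (hper : Function.Periodic (f ∘ ofComplex) N) (hf : MDiff f) (hzero : IsZeroAtImInfty f) :
    ∃ (g : ℍ → ℂ) (L : ℂ), Tendsto g atImInfty (𝓝 L) ∧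
      ∀ τ : ℍ, HasDerivAt (fun w => g (ofComplex w)) (f τ) (τ : ℂ) := by
  have hdiff := differentiableOn_cuspFunction_ball hN hper hf hzero.isBoundedAtImInfty
  have h0 : cuspFunction N f 0 = 0 := hzero.cuspFunction_apply_zero hN
  -- In the coordinate `q` the differential is a constant times `(F(q)/q) dq`, holomorphic at `0`
  -- because `F(0) = 0`; the quotient is `dslope`.
  have hds : DifferentiableOn ℂ (dslope (cuspFunction N f) 0) (Metric.ball 0 1) :=
    (Complex.differentiableOn_dslope (Metric.isOpen_ball.mem_nhds (Metric.mem_ball_self one_pos))).2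
      hdiff
  obtain ⟨Φ, hΦ⟩ := hds.isExactOn_ball
  have hN' : (N : ℂ) ≠ 0 := by exact_mod_cast hN.ne'
  have hpi : (2 * Real.pi * Complex.I : ℂ) ≠ 0 := by simp [Real.pi_ne_zero]
  refine ⟨fun τ => N / (2 * Real.pi * Complex.I) * Φ (Function.Periodic.qParam N τ),
    N / (2 * Real.pi * Complex.I) * Φ 0, ?_, fun τ => ?_⟩
  · refine Tendsto.const_mul _ ?_
    exact (hΦ 0 (Metric.mem_ball_self one_pos)).continuousAt.tendsto.comp
      (qParam_tendsto_atImInfty hN)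
  · have hq : Function.Periodic.qParam N (τ : ℂ) ∈ Metric.ball (0 : ℂ) 1 := by
      rw [mem_ball_zero_iff]
      exact Function.Periodic.norm_qParam_lt_one hN τ.im_pos
    have h1 : HasDerivAt (Function.Periodic.qParam N)
        (2 * Real.pi * Complex.I / N * Function.Periodic.qParam N τ) τ := by
      have h2 := ModularForm.logDeriv_qParam N τ
      rw [logDeriv_apply, div_eq_iff (Function.Periodic.qParam_ne_zero _)] at h2
      rw [← h2]
      exact Function.Periodic.differentiable_qParam.differentiableAt.hasDerivAt
    have h2 := ((hΦ _ hq).comp (τ : ℂ) h1).const_mul (N / (2 * Real.pi * Complex.I) : ℂ)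
    have h3 : (N / (2 * Real.pi * Complex.I) : ℂ) *
        (dslope (cuspFunction N f) 0 (Function.Periodic.qParam N τ) *
        (2 * Real.pi * Complex.I / N * Function.Periodic.qParam N τ)) = f τ := by
      have h4 := sub_smul_dslope (cuspFunction N f) 0 (Function.Periodic.qParam N τ)
      rw [h0, sub_zero, sub_zero, eq_cuspFunction τ hN.ne' hper, smul_eq_mul] at h4
      rw [← h4]
      field_simp
    rw [h3] at h2
    refine h2.congr_of_eventuallyEq ?_
    filter_upwards [eventually_coe_ofComplex τ] with w hw
    simp [Function.comp_def, hw]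

lemma im_smul_of_one_zero_eq_zero {ε : SL(2, ℤ)} (hε : ε 1 0 = 0) (τ : ℍ) :
    (ε • τ).im = τ.im := by
  have h1 := Matrix.SpecialLinearGroup.det_coe ε
  rw [Matrix.det_fin_two, hε, mul_zero, sub_zero] at h1
  have h2 : ε 1 1 * ε 1 1 = 1 := by
    have := Int.isUnit_iff.1 (IsUnit.of_mul_eq_one (ε 0 0) (by rw [mul_comm]; exact h1))
    rcases this with h | h <;> simp [h]
  rw [ModularGroup.im_smul_eq_div_normSq, ModularGroup.denom_apply, hε]
  have h3 : Complex.normSq (((0 : ℤ) : ℂ) * (τ : ℂ) + (ε 1 1 : ℂ)) = 1 := by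
    rw [Int.cast_zero, zero_mul, zero_add, Complex.normSq_intCast]
    exact_mod_cast h2
  rw [h3, div_one]

/-- If the lower left entry `c` is not zero, then `Im (ε • τ) ≤ 1 / (c² Im τ) < 1`. -/
lemma one_zero_eq_zero_of_one_lt_im {ε : SL(2, ℤ)} {τ : ℍ} (h1 : 1 < τ.im) (h2 : 1 < (ε • τ).im) :
    ε 1 0 = 0 := by
  by_contra hc
  rw [ModularGroup.im_smul_eq_div_normSq, ModularGroup.denom_apply] at h2
  have h3 : τ.im ^ 2 ≤ Complex.normSq ((ε 1 0 : ℂ) * (τ : ℂ) + (ε 1 1 : ℂ)) := by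
    rw [Complex.normSq_apply]
    have e1 : ((ε 1 0 : ℂ) * (τ : ℂ) + (ε 1 1 : ℂ)).im = ε 1 0 * τ.im := by simp
    rw [e1]
    have h4 : (1 : ℝ) ≤ (ε 1 0 : ℝ) ^ 2 := by
      exact_mod_cast Int.one_le_abs (pow_ne_zero 2 hc) |>.trans_eq (abs_of_nonneg (sq_nonneg _))
    nlinarith [mul_self_nonneg ((ε 1 0 : ℂ) * (τ : ℂ) + (ε 1 1 : ℂ)).re, sq_nonneg τ.im]
  have h5 : 0 < Complex.normSq ((ε 1 0 : ℂ) * (τ : ℂ) + (ε 1 1 : ℂ)) := by nlinarith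
  rw [lt_div_iff₀ h5] at h2
  nlinarith

lemma mapGL_smul_infty_eq_iff (ε : SL(2, ℤ)) :
    Matrix.SpecialLinearGroup.mapGL ℚ ε • (OnePoint.infty : OnePoint ℚ) = OnePoint.infty ↔
      ε 1 0 = 0 := by
  rw [OnePoint.smul_infty_eq_self_iff]
  simp

/-- In the horoball `1 < Im τ` only elements fixing the cusp identify points. The primitive changes
by a constant under such an element, and since it has a limit at `i∞` the constant is zero. -/
lemma exists_isPrimitiveOn_cusp (hinv : ∀ γ ∈ Γ, h ∣[(2 : ℤ)] γ = h) (hh : MDiff h)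
    (δ : SL(2, ℤ)) (hzero : IsZeroAtImInfty (h ∣[(2 : ℤ)] δ)) {N : ℝ} (hN : 0 < N)
    (hper : Function.Periodic ((h ∣[(2 : ℤ)] δ) ∘ ofComplex) N) :
    ∃ U : Set (Curve Γ), IsOpen U ∧ toCurve Γ (δ • ExtHalfPlane.cusp OnePoint.infty) ∈ U ∧
      ∃ F : Curve Γ → ℂ, IsPrimitiveOn Γ U F h := by
  have hf : MDiff (h ∣[(2 : ℤ)] δ) := by
    rw [ModularForm.SL_slash]
    exact hh.slash 2 _
  obtain ⟨g, L, hgL, hg⟩ := exists_primitive_tendsto hN hper hf hzero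
  let G₀ : ExtHalfPlane → ℂ := fun x => match x with
    | .interior τ => g τ
    | .cusp _ => L
  let V₀ : Set ExtHalfPlane := {x | match x with
    | .interior τ => 1 < τ.im
    | .cusp c => c = OnePoint.infty}
  have hcusp : ∀ ε : SL(2, ℤ), ε • ExtHalfPlane.cusp OnePoint.infty ∈ V₀ ↔ ε 1 0 = 0 :=
    fun ε => mapGL_smul_infty_eq_iff ε
  have hV₀ : IsOpen V₀ := by
    rw [isOpen_extHalfPlane_iff]
    refine ⟨isOpen_lt continuous_const UpperHalfPlane.continuous_im, fun ε hε => ⟨1, fun τ hτ => ?_⟩⟩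
    rw [hcusp] at hε
    change 1 < (ε • τ).im
    rwa [im_smul_of_one_zero_eq_zero hε]
  have hgc : Continuous g := by
    rw [continuous_iff_continuousAt]
    intro τ
    have := (hg τ).continuousAt.comp UpperHalfPlane.continuous_coe.continuousAt
    simpa [Function.comp_def] using this
  have hG₀ : ContinuousOn G₀ V₀ := by
    rw [continuousOn_open_iff hV₀]
    intro t ht
    rw [isOpen_extHalfPlane_iff]
    refine ⟨(isOpen_lt continuous_const UpperHalfPlane.continuous_im).inter (ht.preimage hgc),
      fun ε hε => ?_⟩
    have hc := (hcusp ε).1 hε.1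
    obtain ⟨A, hA⟩ := (atImInfty_mem _).1 (hgL.eventually (ht.mem_nhds hε.2))
    refine ⟨max A 1, fun τ hτ => ?_⟩
    have him := im_smul_of_one_zero_eq_zero hc τ
    exact ⟨show 1 < (ε • τ).im from him ▸ (le_max_right _ _).trans_lt hτ,
      hA _ (him ▸ (le_max_left _ _).trans hτ.le)⟩
  have hV : IsOpen ((δ⁻¹ • ·) ⁻¹' V₀) := hV₀.preimage (continuous_const_smul δ⁻¹)
  refine ⟨_, isOpenMap_toCurve _ hV, ⟨_, ?_, rfl⟩, exists_isPrimitiveOn hinv hV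
    (G := fun x => G₀ (δ⁻¹ • x)) (hG₀.comp (continuous_const_smul δ⁻¹).continuousOn
      fun x hx => hx) ?_ fun τ _ => ?_⟩
  · rw [Set.mem_preimage, inv_smul_smul]
    exact rfl
  · intro γ hγ x hx hγx
    obtain ⟨y, rfl⟩ : ∃ y, δ • y = x := ⟨δ⁻¹ • x, smul_inv_smul _ _⟩
    set ε := δ⁻¹ * γ * δ with hε
    have e1 : δ⁻¹ • γ • δ • y = ε • y := by rw [hε, mul_smul, mul_smul]
    rw [Set.mem_preimage, inv_smul_smul] at hx
    rw [Set.mem_preimage, e1] at hγx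
    simp only [e1, inv_smul_smul]
    cases y with
    | cusp c => rfl
    | interior τ =>
      have hc : ε 1 0 = 0 := one_zero_eq_zero_of_one_lt_im (τ := τ) hx hγx
      have hslash : (h ∣[(2 : ℤ)] δ) ∣[(2 : ℤ)] ε = h ∣[(2 : ℤ)] δ := by
        rw [← SlashAction.slash_mul, hε, ← mul_assoc, ← mul_assoc, mul_inv_cancel, one_mul,
          SlashAction.slash_mul, hinv γ hγ]
      have hd : ∀ w ∈ upperHalfPlaneSet,
          HasDerivAt (fun w => g (ε • ofComplex w) - g (ofComplex w)) 0 w := by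
        intro w hw
        have e : (ofComplex w : ℂ) = w := by rw [ofComplex_apply_of_im_pos hw]
        have h1 := hasDerivAt_comp_smul (φ := g) ε (ofComplex w) (hg _)
        rw [← ModularForm.SL_slash_apply, hslash] at h1
        have h2 := h1.sub (hg (ofComplex w))
        rw [sub_self, e] at h2
        exact h2
      have hcst : ∀ z : ℍ, g (ε • z) - g z = g (ε • τ) - g τ := by
        intro z
        have := isOpen_upperHalfPlaneSet.is_const_of_deriv_eq_zero
          (Complex.isConnected_of_upperHalfPlane subset_rfl (by grind)).isPreconnected
          (fun w hw => (hd w hw).differentiableAt.differentiableWithinAt)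
          (fun w hw => (hd w hw).deriv) z.im_pos τ.im_pos
        simpa using this
      have ht : Tendsto (fun z => g (ε • z) - g z) atImInfty (𝓝 (L - L)) := by
        refine Tendsto.sub (hgL.comp ?_) hgL
        rw [atImInfty, tendsto_comap_iff]
        exact tendsto_comap.congr fun z => (im_smul_of_one_zero_eq_zero hc z).symm
      have h3 := tendsto_nhds_unique ht (tendsto_const_nhds.congr fun z => (hcst z).symm)
      rw [sub_self] at h3
      exact sub_eq_zero.1 h3.symm
  · have h1 := hasDerivAt_comp_smul (φ := g) δ⁻¹ τ (hg _)
    rw [← ModularForm.SL_slash_apply, ← SlashAction.slash_mul, mul_inv_cancel,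
      SlashAction.slash_one] at h1
    exact h1

lemma up_smul_coe (n : ℤ) (τ : ℍ) : ((up n • τ : ℍ) : ℂ) = τ + n := by
  rw [coe_specialLinearGroup_apply]
  simp [up]

lemma denom_up (n : ℤ) (τ : ℍ) : denom (up n) τ = 1 := by
  rw [ModularGroup.denom_apply]
  simp [up]

/-- Invariance under a translation is periodicity. -/
lemma periodic_of_smul_up {f : ℍ → ℂ} {n : ℤ} (hf : ∀ τ, f (up n • τ) = f τ) :
    Function.Periodic (f ∘ ofComplex) ((n : ℝ) : ℂ) := by
  intro w
  by_cases hw : 0 < w.im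
  · have h1 : 0 < (w + ((n : ℝ) : ℂ)).im := by simpa using hw
    simp only [Function.comp_apply]
    rw [ofComplex_apply_of_im_pos hw, ofComplex_apply_of_im_pos h1]
    refine Eq.trans (congrArg f ?_) (hf _)
    apply UpperHalfPlane.ext
    rw [up_smul_coe]
    simp
  · have h1 : (w + ((n : ℝ) : ℂ)).im ≤ 0 := by simpa using hw
    simp only [Function.comp_apply]
    rw [ofComplex_apply_of_im_nonpos (not_lt.1 hw), ofComplex_apply_of_im_nonpos h1]

lemma periodic_of_slash_up {f : ℍ → ℂ} {k n : ℤ} (hf : f ∣[k] up n = f) :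
    Function.Periodic (f ∘ ofComplex) ((n : ℝ) : ℂ) := by
  refine periodic_of_smul_up fun τ => ?_
  conv_rhs => rw [← hf, ModularForm.SL_slash_apply, denom_up]
  simp

lemma periodic_slash {N : ℕ} (hN : CongruenceSubgroup.Gamma N ≤ Γ) {k : ℤ}
    (hinv : ∀ γ ∈ Γ, h ∣[k] γ = h) (δ : SL(2, ℤ)) :
    Function.Periodic ((h ∣[k] δ) ∘ ofComplex) (N : ℝ) := by
  have h1 : up N ∈ CongruenceSubgroup.Gamma N := by
    rw [CongruenceSubgroup.Gamma_mem]
    simp [up]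
  have h2 : δ * up N * δ⁻¹ ∈ Γ :=
    hN ((CongruenceSubgroup.Gamma_normal N).conj_mem _ h1 δ)
  have h3 := periodic_of_slash_up (f := h ∣[k] δ) (k := k) (n := N) (by
    rw [← SlashAction.slash_mul]
    conv_rhs => rw [← hinv _ h2]
    rw [← SlashAction.slash_mul, inv_mul_cancel_right])
  simpa using h3

/-- Holomorphic differentials on `X_Γ` are cusp forms of weight `2`. -/
theorem mem_holomorphicDifferentials_iff {N : ℕ} (hN0 : N ≠ 0)
    (hN : CongruenceSubgroup.Gamma N ≤ Γ) :
    h ∈ holomorphicDifferentials Γ ↔ MDiff h ∧ (∀ γ ∈ Γ, h ∣[(2 : ℤ)] γ = h) ∧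
      ∀ δ : SL(2, ℤ), IsZeroAtImInfty (h ∣[(2 : ℤ)] δ) := by
  refine ⟨fun hh => ⟨mdifferentiable_of_mem hh, fun γ hγ => slash_eq_of_mem hh hγ,
    slash_isZeroAtImInfty_of_mem hh⟩, fun ⟨hd, hinv, hz⟩ x => ?_⟩
  obtain ⟨y, rfl⟩ := toCurve_surjective x
  cases y with
  | interior τ => exact exists_isPrimitiveOn_interior hinv hd τ
  | cusp c =>
    obtain ⟨δ, rfl⟩ := OnePoint.exists_mem_SL2 ℤ c
    exact exists_isPrimitiveOn_cusp hinv hd δ (hz δ) (Nat.cast_pos.2 (Nat.pos_of_ne_zero hN0))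
      (periodic_slash hN hinv δ)

lemma slash_mem_holomorphicDifferentials {N : ℕ} (hN0 : N ≠ 0)
    (hN : CongruenceSubgroup.Gamma N ≤ Γ) (k : SL(2, ℤ)) (hh : h ∈ holomorphicDifferentials Γ) :
    h ∣[(2 : ℤ)] k⁻¹ ∈ holomorphicDifferentials (conjBy k Γ) := by
  obtain ⟨h1, h2, h3⟩ := (mem_holomorphicDifferentials_iff hN0 hN).1 hh
  have hN' : CongruenceSubgroup.Gamma N ≤ conjBy k Γ := fun g hg => by
    rw [mem_conjBy]
    refine hN ?_
    simpa using (CongruenceSubgroup.Gamma_normal N).conj_mem _ hg k⁻¹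
  refine (mem_holomorphicDifferentials_iff hN0 hN').2 ⟨?_, fun γ hγ => ?_, fun δ => ?_⟩
  · rw [ModularForm.SL_slash]
    exact h1.slash 2 _
  · rw [mem_conjBy] at hγ
    conv_rhs => rw [← h2 _ hγ]
    rw [← SlashAction.slash_mul, ← SlashAction.slash_mul]
    congr 1
    group
  · rw [← SlashAction.slash_mul]
    exact h3 _

/-- The genus of a congruence subgroup only depends on its conjugacy class. -/
lemma genus_conjBy {N : ℕ} (hN0 : N ≠ 0) (hN : CongruenceSubgroup.Gamma N ≤ Γ) (k : SL(2, ℤ)) :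
    genus (conjBy k Γ) = genus Γ := by
  have hN' : CongruenceSubgroup.Gamma N ≤ conjBy k Γ := fun g hg => by
    rw [mem_conjBy]
    refine hN ?_
    simpa using (CongruenceSubgroup.Gamma_normal N).conj_mem _ hg k⁻¹
  refine LinearEquiv.rank_eq (LinearEquiv.symm ?_)
  refine
    { toFun := fun h => ⟨h.1 ∣[(2 : ℤ)] k⁻¹, slash_mem_holomorphicDifferentials hN0 hN k h.2⟩
      invFun := fun h => ⟨h.1 ∣[(2 : ℤ)] k, by
        have := slash_mem_holomorphicDifferentials hN0 hN' k⁻¹ h.2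
        rwa [conjBy_inv_conjBy, inv_inv] at this⟩
      map_add' := fun a b => Subtype.ext (SlashAction.add_slash _ _ _ _)
      map_smul' := fun c a => Subtype.ext (ModularForm.SL_smul_slash _ _ _ _)
      left_inv := fun a => Subtype.ext ?_
      right_inv := fun a => Subtype.ext ?_ }
  · change (a.1 ∣[(2 : ℤ)] k⁻¹) ∣[(2 : ℤ)] k = a.1
    rw [← SlashAction.slash_mul, inv_mul_cancel, SlashAction.slash_one]
  · change (a.1 ∣[(2 : ℤ)] k) ∣[(2 : ℤ)] k⁻¹ = a.1
    rw [← SlashAction.slash_mul, mul_inv_cancel, SlashAction.slash_one]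

end Cusp

end ModCurve

namespace ModCurve

open UpperHalfPlane hiding I
open Filter Topology Complex
open scoped ModularForm Manifold Real

noncomputable section

/-! ### Scaling by 3 and the Fricke involution -/

section Scaling

/-- Multiplication by `3`. -/
def tri (τ : ℍ) : ℍ := ⟨3 * τ, by simpa using τ.im_pos⟩

/-- Division by `3`. -/
def third (τ : ℍ) : ℍ := ⟨τ / 3, by simpa using τ.im_pos⟩

/-- The Fricke involution of level `3`. -/
def fricke (τ : ℍ) : ℍ := sw • tri τ

@[simp] lemma coe_tri (τ : ℍ) : (tri τ : ℂ) = 3 * τ := rfl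

@[simp] lemma coe_third (τ : ℍ) : (third τ : ℂ) = τ / 3 := rfl

@[simp] lemma tri_third (τ : ℍ) : tri (third τ) = τ := by ext; simp; ring

@[simp] lemma im_tri (τ : ℍ) : (tri τ).im = 3 * τ.im := by
  rw [← coe_im, coe_tri]; simp

@[simp] lemma im_third (τ : ℍ) : (third τ).im = τ.im / 3 := by
  rw [← coe_im, coe_third]; simp

lemma coe_sw_smul (τ : ℍ) : ((sw • τ : ℍ) : ℂ) = -1 / τ := by
  rw [coe_specialLinearGroup_apply]
  simp

lemma denom_sw (τ : ℍ) : denom sw τ = τ := by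
  rw [ModularGroup.denom_apply]
  simp

lemma coe_fricke (τ : ℍ) : (fricke τ : ℂ) = -1 / (3 * τ) := by
  rw [fricke, coe_sw_smul, coe_tri]

lemma sw_smul (τ : ℍ) : sw • τ = fricke (third τ) := by rw [fricke, tri_third]

lemma tri_fricke (τ : ℍ) : tri (fricke τ) = sw • τ := by
  ext
  rw [coe_tri, coe_fricke, coe_sw_smul]
  have := τ.ne_zero
  field_simp

lemma tri_up_smul (n : ℤ) (τ : ℍ) : tri (up n • τ) = up (3 * n) • tri τ := by
  ext
  rw [coe_tri, up_smul_coe, up_smul_coe, coe_tri]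
  push_cast
  ring

lemma tendsto_tri : Tendsto tri atImInfty atImInfty := by
  rw [atImInfty, tendsto_comap_iff]
  simp only [Function.comp_def, im_tri]
  exact tendsto_comap.const_mul_atTop (by norm_num)

lemma tendsto_third : Tendsto third atImInfty atImInfty := by
  rw [atImInfty, tendsto_comap_iff]
  simp only [Function.comp_def, im_third]
  exact tendsto_comap.atTop_div_const (by norm_num)

lemma tendsto_up_smul (n : ℤ) : Tendsto (fun τ : ℍ => up n • τ) atImInfty atImInfty := by
  rw [atImInfty, tendsto_comap_iff]
  refine tendsto_comap.congr fun τ => ?_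
  rw [Function.comp_apply, im_smul_of_one_zero_eq_zero (by simp [up])]

end Scaling

/-! ### Closure properties of holomorphic functions -/

section MDiffLemmas

lemma mdiff_div {f g : ℍ → ℂ} (hf : MDiff f) (hg : MDiff g) (h0 : ∀ τ, g τ ≠ 0) :
    MDiff (fun τ => f τ / g τ) := by
  rw [UpperHalfPlane.mdifferentiable_iff] at *
  exact hf.div hg fun w _ => h0 _

lemma mdiff_mul {f g : ℍ → ℂ} (hf : MDiff f) (hg : MDiff g) : MDiff (fun τ => f τ * g τ) := by
  rw [UpperHalfPlane.mdifferentiable_iff] at *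
  exact hf.mul hg

lemma mdiff_sub {f g : ℍ → ℂ} (hf : MDiff f) (hg : MDiff g) : MDiff (fun τ => f τ - g τ) := by
  rw [UpperHalfPlane.mdifferentiable_iff] at *
  exact hf.sub hg

lemma mdiff_add {f g : ℍ → ℂ} (hf : MDiff f) (hg : MDiff g) : MDiff (fun τ => f τ + g τ) := by
  rw [UpperHalfPlane.mdifferentiable_iff] at *
  exact hf.add hg

lemma mdiff_pow {f : ℍ → ℂ} (hf : MDiff f) (n : ℕ) : MDiff (fun τ => f τ ^ n) := by
  rw [UpperHalfPlane.mdifferentiable_iff] at *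
  exact hf.pow n

lemma mdiff_const (c : ℂ) : MDiff (fun _ : ℍ => c) := by
  rw [UpperHalfPlane.mdifferentiable_iff]
  exact differentiableOn_const c

lemma mdiff_const_mul (c : ℂ) {f : ℍ → ℂ} (hf : MDiff f) : MDiff (fun τ => c * f τ) :=
  mdiff_mul (mdiff_const c) hf

lemma mdiff_comp_tri {f : ℍ → ℂ} (hf : MDiff f) : MDiff (fun τ => f (tri τ)) := by
  rw [UpperHalfPlane.mdifferentiable_iff] at *
  have h1 : DifferentiableOn ℂ (fun w : ℂ => (f ∘ ofComplex) (3 * w)) {z | 0 < z.im} :=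
    hf.comp (by fun_prop) fun w hw => by simpa using hw
  refine h1.congr fun w hw => ?_
  have hw' : 0 < (3 * w).im := by simpa using hw
  simp only [Function.comp_apply]
  rw [ofComplex_apply_of_im_pos hw, ofComplex_apply_of_im_pos hw']
  rfl

lemma mdiff_comp_smul {f : ℍ → ℂ} (hf : MDiff f) (γ : SL(2, ℤ)) : MDiff (fun τ => f (γ • τ)) := by
  have h := mdifferentiable_smul (g := (γ : GL (Fin 2) ℝ)) (by simp)
  exact hf.comp h

end MDiffLemmas

/-! ### The square of the eta function and `E2` -/

section Eta

/-- The square of the Dedekind eta function. -/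
def etaSq (τ : ℍ) : ℂ := ModularForm.eta τ ^ 2

lemma etaSq_ne_zero (τ : ℍ) : etaSq τ ≠ 0 := pow_ne_zero 2 (ModularForm.eta_ne_zero τ.2)

lemma hasDerivAt_etaSq (τ : ℍ) : HasDerivAt (fun w => etaSq (ofComplex w))
    (π * I / 6 * EisensteinSeries.E2 τ * etaSq τ) τ := by
  have h1 := ModularForm.logDeriv_eta_eq_E2 τ
  rw [logDeriv_apply, div_eq_iff (ModularForm.eta_ne_zero τ.2)] at h1
  have h2 := (ModularForm.differentiableAt_eta_of_mem_upperHalfPlaneSet τ.2).hasDerivAt.pow 2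
  rw [h1] at h2
  refine (h2.congr_of_eventuallyEq ?_).congr_deriv ?_
  · filter_upwards [eventually_coe_ofComplex τ] with w hw
    simp [etaSq, hw]
  · simp only [etaSq]
    push_cast
    ring

lemma mdiff_etaSq : MDiff etaSq := fun τ => by
  rw [UpperHalfPlane.mdifferentiableAt_iff]
  exact (hasDerivAt_etaSq τ).differentiableAt

/-- Squaring removes the branch of the square root from the transformation law of eta. -/
lemma etaSq_sw_smul (τ : ℍ) : etaSq (sw • τ) = -I * τ * etaSq τ := by
  have h := ModularForm.eta_comp_eq_csqrt_I_inv τ.2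
  simp only [Function.comp_apply, Pi.smul_apply, Pi.mul_apply, smul_eq_mul] at h
  have hsq (z : ℂ) (hz : z ≠ 0) : z.sqrt ^ 2 = z := by
    rw [_root_.sqrt_eq_exp hz, ← Complex.exp_nat_mul]
    rw [show ((2 : ℕ) : ℂ) * (Complex.log z / 2) = Complex.log z by push_cast; ring,
      Complex.exp_log hz]
  rw [etaSq, coe_sw_smul, h, mul_pow, mul_pow, inv_pow, hsq _ I_ne_zero, hsq _ τ.ne_zero, inv_I,
    etaSq]
  ring

lemma qParam_up_smul (h : ℝ) (n : ℤ) (τ : ℍ) : Function.Periodic.qParam h (up n • τ : ℍ) =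
    exp (2 * π * I * n / h) * Function.Periodic.qParam h τ := by
  rw [Function.Periodic.qParam, Function.Periodic.qParam, up_smul_coe, ← Complex.exp_add]
  congr 1
  ring

lemma qParam_one_up_smul (n : ℤ) (τ : ℍ) :
    Function.Periodic.qParam 1 (up n • τ : ℍ) = Function.Periodic.qParam 1 τ := by
  rw [qParam_up_smul]
  have : exp (2 * π * I * n / (1 : ℝ)) = 1 := by
    rw [Complex.exp_eq_one_iff]
    exact ⟨n, by push_cast; ring⟩
  rw [this, one_mul]

lemma etaSq_up_smul (n : ℤ) (τ : ℍ) : etaSq (up n • τ) = exp (2 * π * I * n / 12) * etaSq τ := by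
  simp only [etaSq, ModularForm.eta, ModularForm.eta_q, qParam_one_up_smul]
  rw [qParam_up_smul 24]
  rw [mul_assoc, mul_pow, ← Complex.exp_nat_mul]
  congr 2
  push_cast
  ring

/-- The infinite product `∏ (1 - q^n)^2`, as a function on the upper half-plane. -/
def etaProd (τ : ℍ) : ℂ := (∏' n, (1 - ModularForm.eta_q n τ)) ^ 2

lemma etaSq_eq (τ : ℍ) : etaSq τ = Function.Periodic.qParam 12 τ * etaProd τ := by
  rw [etaSq, ModularForm.eta, mul_pow, etaProd]
  congr 1
  simp only [Function.Periodic.qParam]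
  rw [← Complex.exp_nat_mul]
  congr 1
  push_cast
  ring

lemma etaProd_ne_zero (τ : ℍ) : etaProd τ ≠ 0 := pow_ne_zero 2 (ModularForm.eta_tprod_ne_zero τ.2)

lemma hasDerivAt_etaProd_zero : ∃ c : ℂ,
    HasDerivAt (fun q : ℂ => ∏' n : ℕ, (1 - q ^ (n + 1))) c 0 ∧
    (fun q : ℂ => ∏' n : ℕ, (1 - q ^ (n + 1))) 0 = 1 := by
  refine ⟨_, (ModularForm.differentiableOn_tprod_one_sub_pow.differentiableAt
    (Metric.isOpen_ball.mem_nhds (Metric.mem_ball_self one_pos))).hasDerivAt, by simp⟩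

lemma tendsto_etaProd : Tendsto etaProd atImInfty (𝓝 1) := by
  obtain ⟨c, hc, h1⟩ := hasDerivAt_etaProd_zero
  have h2 := hc.continuousAt.tendsto
  beta_reduce at h1 h2
  rw [h1] at h2
  have h3 := (h2.comp (qParam_tendsto_atImInfty one_pos)).pow 2
  rw [one_pow] at h3
  exact h3

/-- As a logarithmic derivative of eta, `E2` equals `1 + 24 q P'(q)/P(q)` with `P` the Euler
product, and this is continuous at `q = 0`. -/
lemma tendsto_E2 : Tendsto EisensteinSeries.E2 atImInfty (𝓝 1) := by
  set P : ℂ → ℂ := fun q : ℂ => ∏' n : ℕ, (1 - q ^ (n + 1)) with hP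
  have hdiff : DifferentiableOn ℂ P (Metric.ball 0 1) := ModularForm.differentiableOn_tprod_one_sub_pow
  have hmem : Metric.ball (0 : ℂ) 1 ∈ 𝓝 (0 : ℂ) :=
    Metric.isOpen_ball.mem_nhds (Metric.mem_ball_self one_pos)
  have hP0 : P 0 = 1 := by simp [hP]
  have hPc : Tendsto P (𝓝 0) (𝓝 1) := by
    have := (hdiff.differentiableAt hmem).continuousAt.tendsto
    rwa [hP0] at this
  have hP'c := ((hdiff.deriv Metric.isOpen_ball).differentiableAt hmem).continuousAt.tendsto
  have hlim : Tendsto (fun q => 1 + 24 * (q * deriv P q / P q)) (𝓝 0) (𝓝 1) := by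
    have h1 : Tendsto (fun q => 1 + 24 * (q * deriv P q / P q)) (𝓝 0)
        (𝓝 (1 + 24 * (0 * deriv P 0 / 1))) :=
      tendsto_const_nhds.add (((tendsto_id.mul hP'c).div hPc one_ne_zero).const_mul _)
    simpa using h1
  refine (hlim.comp (qParam_tendsto_atImInfty one_pos)).congr fun τ => ?_
  have hq : Function.Periodic.qParam 1 (τ : ℂ) ∈ Metric.ball (0 : ℂ) 1 := by
    rw [mem_ball_zero_iff]
    exact Function.Periodic.norm_qParam_lt_one one_pos τ.im_pos
  have hne : P (Function.Periodic.qParam 1 (τ : ℂ)) ≠ 0 := ModularForm.eta_tprod_ne_zero τ.2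
  have hqd (h : ℝ) : HasDerivAt (Function.Periodic.qParam h)
      (2 * π * I / h * Function.Periodic.qParam h τ) τ := by
    have h2 := ModularForm.logDeriv_qParam h τ
    rw [logDeriv_apply, div_eq_iff (Function.Periodic.qParam_ne_zero _)] at h2
    rw [← h2]
    exact Function.Periodic.differentiable_qParam.differentiableAt.hasDerivAt
  have h1 : HasDerivAt ModularForm.eta _ (τ : ℂ) := (hqd 24).mul
    (((hdiff.differentiableAt (Metric.isOpen_ball.mem_nhds hq)).hasDerivAt.comp (τ : ℂ) (hqd 1)))
  have h2 := ModularForm.logDeriv_eta_eq_E2 τ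
  rw [logDeriv_apply, h1.deriv] at h2
  have h3 : ModularForm.eta τ = Function.Periodic.qParam 24 (τ : ℂ) *
    P (Function.Periodic.qParam 1 (τ : ℂ)) := rfl
  rw [h3] at h2
  have hpi : (π : ℂ) ≠ 0 := by exact_mod_cast Real.pi_ne_zero
  have hq24 := Function.Periodic.qParam_ne_zero (h := 24) (τ : ℂ)
  have hI := I_ne_zero
  simp only [Function.comp_apply]
  have h4 : π * I / 12 * EisensteinSeries.E2 τ = π * I / 12 *
      (1 + 24 * (Function.Periodic.qParam 1 (τ : ℂ) * deriv P (Function.Periodic.qParam 1 (τ : ℂ)) /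
        P (Function.Periodic.qParam 1 (τ : ℂ)))) := by
    rw [← h2]
    field_simp
    push_cast
    ring
  exact (mul_left_cancel₀ (by simp [hpi]) h4).symm

lemma E2_sw_smul (τ : ℍ) : EisensteinSeries.E2 (sw • τ) =
    τ ^ 2 * EisensteinSeries.E2 τ + 6 * τ / (π * I) := by
  have h := congrFun (EisensteinSeries.E2_slash_action sw) τ
  have hpi : (π : ℂ) ≠ 0 := by exact_mod_cast Real.pi_ne_zero
  have h0 := τ.ne_zero
  have hI := I_ne_zero
  rw [ModularForm.SL_slash_apply, denom_sw] at h
  simp only [Pi.sub_apply, Pi.smul_apply, EisensteinSeries.D2, riemannZeta_two, smul_eq_mul,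
    denom_sw, sw_one_zero] at h
  rw [zpow_neg, ← div_eq_mul_inv, div_eq_iff (by positivity)] at h
  rw [h]
  have e : (1 / (2 * ((π : ℂ) ^ 2 / 6)) * (2 * π * I * ((1 : ℤ) : ℂ) / τ)) * (τ : ℂ) ^ 2 =
      -(6 * τ / (π * I)) := by
    field_simp
    push_cast
    linear_combination I_sq
  have e2 : (τ : ℂ) ^ (2 : ℤ) = (τ : ℂ) ^ 2 := by norm_cast
  rw [e2, sub_mul, e]
  ring

lemma E2_up_smul (n : ℤ) (τ : ℍ) : EisensteinSeries.E2 (up n • τ) = EisensteinSeries.E2 τ := by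
  have h := congrFun (EisensteinSeries.E2_slash_action (up n)) τ
  rw [ModularForm.SL_slash_apply, denom_up] at h
  simp only [Pi.sub_apply, Pi.smul_apply, EisensteinSeries.D2] at h
  simpa [up] using h

end Eta

end

end ModCurve

namespace ModCurve

open UpperHalfPlane hiding I
open Filter Topology Complex
open scoped ModularForm Manifold Real

noncomputable section

/-! ### Eta quotients of level 3 -/

section EtaQuotients

/-- The function `(η(τ) / η(3τ))^4`. -/
def etaQuot (τ : ℍ) : ℂ := etaSq τ ^ 2 / etaSq (tri τ) ^ 2

/-- The Hauptmodul `(η(τ) / η(3τ))^12` of `Γ₀(3)`. -/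
def hauptmodul (τ : ℍ) : ℂ := etaQuot τ ^ 3

/-- The modular form `η(3τ)^18 / η(τ)^6` of weight `6`. -/
def formInfty (τ : ℍ) : ℂ := etaSq (tri τ) ^ 9 / etaSq τ ^ 3

/-- The modular form `η(τ)^18 / η(3τ)^6` of weight `6`. -/
def formZero (τ : ℍ) : ℂ := etaSq τ ^ 9 / etaSq (tri τ) ^ 3

/-- The Eisenstein series of weight `2` and level `3`. -/
def eisThree (τ : ℍ) : ℂ := 3 * EisensteinSeries.E2 (tri τ) - EisensteinSeries.E2 τ

/-- A primitive cube root of unity. -/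
def om : ℂ := exp (2 * π * I / 3)

lemma om_pow_three : om ^ 3 = 1 := by
  rw [om, ← Complex.exp_nat_mul, Complex.exp_eq_one_iff]
  exact ⟨1, by push_cast; ring⟩

lemma om_ne_zero : om ≠ 0 := Complex.exp_ne_zero _

lemma isPrimitiveRoot_om : IsPrimitiveRoot om 3 := by
  have := Complex.isPrimitiveRoot_exp 3 (by norm_num)
  simpa [om] using this

lemma om_ne_one : om ≠ 1 := isPrimitiveRoot_om.ne_one (by norm_num)

lemma om_rel : om ^ 2 + om + 1 = 0 := by
  have h : (om - 1) * (om ^ 2 + om + 1) = 0 := by linear_combination om_pow_three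
  exact (mul_eq_zero.1 h).resolve_left (sub_ne_zero.2 om_ne_one)

lemma etaQuot_ne_zero (τ : ℍ) : etaQuot τ ≠ 0 :=
  div_ne_zero (pow_ne_zero _ (etaSq_ne_zero _)) (pow_ne_zero _ (etaSq_ne_zero _))

lemma hauptmodul_ne_zero (τ : ℍ) : hauptmodul τ ≠ 0 := pow_ne_zero _ (etaQuot_ne_zero _)

lemma formInfty_ne_zero (τ : ℍ) : formInfty τ ≠ 0 :=
  div_ne_zero (pow_ne_zero _ (etaSq_ne_zero _)) (pow_ne_zero _ (etaSq_ne_zero _))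

lemma formZero_ne_zero (τ : ℍ) : formZero τ ≠ 0 :=
  div_ne_zero (pow_ne_zero _ (etaSq_ne_zero _)) (pow_ne_zero _ (etaSq_ne_zero _))

/-- Neither form vanishes on `ℍ`; `formInfty` has its zeros at the cusp `∞` and `formZero` at the
cusp `0`, so they differ by the square of the Hauptmodul. -/
lemma formZero_eq (τ : ℍ) : formZero τ = formInfty τ * hauptmodul τ ^ 2 := by
  have h1 := etaSq_ne_zero τ
  have h2 := etaSq_ne_zero (tri τ)
  simp only [formZero, formInfty, hauptmodul, etaQuot]
  field_simp

lemma mdiff_etaQuot : MDiff etaQuot :=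
  mdiff_div (mdiff_pow mdiff_etaSq 2) (mdiff_pow (mdiff_comp_tri mdiff_etaSq) 2)
    fun τ => pow_ne_zero _ (etaSq_ne_zero _)

lemma mdiff_hauptmodul : MDiff hauptmodul := mdiff_pow mdiff_etaQuot 3

lemma mdiff_formInfty : MDiff formInfty :=
  mdiff_div (mdiff_pow (mdiff_comp_tri mdiff_etaSq) 9) (mdiff_pow mdiff_etaSq 3)
    fun τ => pow_ne_zero _ (etaSq_ne_zero _)

lemma mdiff_eisThree : MDiff eisThree :=
  mdiff_sub (mdiff_const_mul 3 (mdiff_comp_tri E2_mdifferentiable)) E2_mdifferentiable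

lemma etaQuot_up_smul (n : ℤ) (τ : ℍ) : etaQuot (up n • τ) = om ^ (-n) * etaQuot τ := by
  have h1 := etaSq_ne_zero τ
  have h2 := etaSq_ne_zero (tri τ)
  have e : om ^ (-n) = exp (2 * π * I * n / 12) ^ 2 / exp (2 * π * I * ((3 * n : ℤ)) / 12) ^ 2 := by
    rw [om, ← Complex.exp_int_mul, ← Complex.exp_nat_mul, ← Complex.exp_nat_mul, ← Complex.exp_sub]
    congr 1
    push_cast
    ring
  have h3 := Complex.exp_ne_zero (2 * π * I * ((3 * n : ℤ)) / 12)
  rw [etaQuot, tri_up_smul, etaSq_up_smul, etaSq_up_smul, e, etaQuot]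
  field_simp

lemma etaSq_fricke (τ : ℍ) : etaSq (fricke τ) = -3 * I * τ * etaSq (tri τ) := by
  rw [fricke, etaSq_sw_smul, coe_tri]
  ring

lemma etaSq_tri_fricke (τ : ℍ) : etaSq (tri (fricke τ)) = -I * τ * etaSq τ := by
  rw [tri_fricke, etaSq_sw_smul]

lemma etaQuot_fricke (τ : ℍ) : etaQuot (fricke τ) = 9 / etaQuot τ := by
  have h1 := etaSq_ne_zero τ
  have h2 := etaSq_ne_zero (tri τ)
  have h3 := τ.ne_zero
  have h4 := I_ne_zero
  rw [etaQuot, etaSq_fricke, etaSq_tri_fricke, etaQuot]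
  field_simp
  norm_num

lemma hauptmodul_fricke (τ : ℍ) : hauptmodul (fricke τ) = 729 / hauptmodul τ := by
  rw [hauptmodul, etaQuot_fricke, hauptmodul, div_pow]
  norm_num

lemma hauptmodul_up_smul (n : ℤ) (τ : ℍ) : hauptmodul (up n • τ) = hauptmodul τ := by
  have : (om ^ (-n)) ^ 3 = 1 := by
    rw [← zpow_natCast, ← zpow_mul, mul_comm, zpow_mul]
    norm_cast
    rw [om_pow_three, one_zpow]
  rw [hauptmodul, etaQuot_up_smul, mul_pow, this, one_mul, hauptmodul]

lemma I_pow_six : I ^ 6 = -1 := by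
  linear_combination (I ^ 4 - I ^ 2 + 1) * I_sq

lemma formInfty_fricke (τ : ℍ) : formInfty (fricke τ) = -τ ^ 6 / 27 * formZero τ := by
  have h1 := etaSq_ne_zero τ
  have h2 := etaSq_ne_zero (tri τ)
  have h3 := τ.ne_zero
  have h4 := I_ne_zero
  rw [formInfty, etaSq_fricke, etaSq_tri_fricke, formZero]
  field_simp
  linear_combination 27 * I_pow_six

lemma formZero_fricke (τ : ℍ) : formZero (fricke τ) = -19683 * τ ^ 6 * formInfty τ := by
  have h1 := etaSq_ne_zero τ
  have h2 := etaSq_ne_zero (tri τ)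
  have h3 := τ.ne_zero
  have h4 := I_ne_zero
  rw [formZero, etaSq_fricke, etaSq_tri_fricke, formInfty]
  field_simp
  linear_combination 19683 * I_pow_six

lemma formZero_up_smul (n : ℤ) (τ : ℍ) : formZero (up n • τ) = formZero τ := by
  have h2 := etaSq_ne_zero (tri τ)
  have h3 := Complex.exp_ne_zero (2 * π * I * n / 12)
  have e : exp (2 * π * I * ((3 * n : ℤ)) / 12) = exp (2 * π * I * n / 12) ^ 3 := by
    rw [← Complex.exp_nat_mul]
    congr 1
    push_cast
    ring
  rw [formZero, tri_up_smul, etaSq_up_smul, etaSq_up_smul, e, formZero]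
  field_simp

lemma formInfty_up_smul (n : ℤ) (τ : ℍ) : formInfty (up n • τ) = formInfty τ := by
  have h := formZero_up_smul n τ
  rw [formZero_eq, formZero_eq, hauptmodul_up_smul] at h
  exact mul_right_cancel₀ (pow_ne_zero 2 (hauptmodul_ne_zero τ)) h

lemma eisThree_up_smul (n : ℤ) (τ : ℍ) : eisThree (up n • τ) = eisThree τ := by
  rw [eisThree, tri_up_smul, E2_up_smul, E2_up_smul, eisThree]

lemma eisThree_fricke (τ : ℍ) : eisThree (fricke τ) = -3 * τ ^ 2 * eisThree τ := by
  have h3 := τ.ne_zero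
  rw [eisThree, tri_fricke, E2_sw_smul, fricke, E2_sw_smul, coe_tri, eisThree]
  ring

/-- The Fricke involution conjugates `lo 3` into a translation. So the behaviour of the eta
quotients under `Γ₀(3)` follows from translations and the Fricke involution. -/
lemma lo_three_smul (τ : ℍ) : lo 3 • τ = fricke (up (-1) • fricke τ) := by
  ext
  have h0 := τ.ne_zero
  have h1 : (3 * (τ : ℂ) + 1) ≠ 0 := by
    have := denom_ne_zero (lo 3 : GL (Fin 2) ℝ) τ
    have h := ModularGroup.denom_apply (lo 3) τ
    simp [lo] at h
    rw [← h]
    exact this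
  have h2 : (-1 / (3 * (τ : ℂ)) + ((-1 : ℤ) : ℂ)) ≠ 0 := by
    rw [← coe_fricke, ← up_smul_coe]
    exact ne_zero _
  rw [coe_specialLinearGroup_apply, coe_fricke, up_smul_coe, coe_fricke]
  have e : (-1 / (3 * (τ : ℂ)) + ((-1 : ℤ) : ℂ)) = -(3 * τ + 1) / (3 * τ) := by
    field_simp
    push_cast
    ring
  rw [e]
  simp only [lo]
  simp
  rw [show (-1 + -(3 * (τ : ℂ))) = -(3 * τ + 1) by ring]
  field_simp

lemma denom_lo_three (τ : ℍ) : denom (lo 3) τ = 3 * τ + 1 := by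
  rw [ModularGroup.denom_apply]
  simp [lo]

lemma coe_up_fricke_mul (τ : ℍ) : ((up (-1) • fricke τ : ℍ) : ℂ) * τ * 3 = -(denom (lo 3) τ) := by
  have h0 := τ.ne_zero
  rw [up_smul_coe, coe_fricke, denom_lo_three]
  field_simp
  push_cast
  ring

lemma etaQuot_lo_three_smul (τ : ℍ) : etaQuot (lo 3 • τ) = om ^ 2 * etaQuot τ := by
  have h1 := etaQuot_ne_zero τ
  have h2 := om_ne_zero
  rw [lo_three_smul, etaQuot_fricke, etaQuot_up_smul, etaQuot_fricke]
  norm_num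
  field_simp
  linear_combination -om_pow_three

lemma formInfty_lo_three_smul (τ : ℍ) :
    formInfty (lo 3 • τ) = denom (lo 3) τ ^ 6 * formInfty τ := by
  have e : denom (lo 3) τ ^ 6 = (((up (-1) • fricke τ : ℍ) : ℂ) * τ * 3) ^ 6 := by
    rw [coe_up_fricke_mul]
    ring
  rw [e, lo_three_smul, formInfty_fricke, formZero_up_smul, formZero_fricke]
  ring

lemma eisThree_lo_three_smul (τ : ℍ) :
    eisThree (lo 3 • τ) = denom (lo 3) τ ^ 2 * eisThree τ := by
  have e : denom (lo 3) τ ^ 2 = (((up (-1) • fricke τ : ℍ) : ℂ) * τ * 3) ^ 2 := by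
    rw [coe_up_fricke_mul]
    ring
  rw [e, lo_three_smul, eisThree_fricke, eisThree_up_smul, eisThree_fricke]
  ring

lemma etaQuot_sw_smul (τ : ℍ) : etaQuot (sw • τ) = 9 / etaQuot (third τ) := by
  rw [sw_smul, etaQuot_fricke]

lemma hauptmodul_sw_smul (τ : ℍ) : hauptmodul (sw • τ) = 729 / hauptmodul (third τ) := by
  rw [sw_smul, hauptmodul_fricke]

lemma formInfty_sw_smul (τ : ℍ) :
    formInfty (sw • τ) = -τ ^ 6 / 19683 * formZero (third τ) := by
  rw [sw_smul, formInfty_fricke, coe_third]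
  ring

lemma eisThree_sw_smul (τ : ℍ) : eisThree (sw • τ) = -τ ^ 2 / 3 * eisThree (third τ) := by
  rw [sw_smul, eisThree_fricke, coe_third]
  ring

/-- The logarithmic derivative of the Hauptmodul. -/
lemma hasDerivAt_hauptmodul (τ : ℍ) : HasDerivAt (fun w => hauptmodul (ofComplex w))
    (-(π * I) * eisThree τ * hauptmodul τ) τ := by
  have h1 := hasDerivAt_etaSq τ
  have h2 : HasDerivAt (fun w => etaSq (tri (ofComplex w)))
      (π * I / 6 * EisensteinSeries.E2 (tri τ) * etaSq (tri τ) * 3) τ := by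
    have h3 : HasDerivAt (fun w : ℂ => 3 * w) 3 (τ : ℂ) := by
      simpa using (hasDerivAt_id (τ : ℂ)).const_mul 3
    have h4 := (hasDerivAt_etaSq (tri τ)).comp (τ : ℂ) h3
    refine h4.congr_of_eventuallyEq ?_
    filter_upwards [eventually_coe_ofComplex τ] with w hw
    simp only [Function.comp_apply]
    rw [show (3 * w : ℂ) = (tri (ofComplex w) : ℂ) by rw [coe_tri, hw], ofComplex_apply]
  have n1 := etaSq_ne_zero τ
  have n2 := etaSq_ne_zero (tri τ)
  have h5 := ((h1.pow 2).div (h2.pow 2) (by simpa using pow_ne_zero 2 n2)).pow 3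
  refine h5.congr_deriv ?_
  simp only [Pi.div_apply, Pi.pow_apply, ofComplex_apply, hauptmodul, etaQuot, eisThree]
  norm_num
  field_simp
  ring

lemma qParam_tri (h : ℝ) (τ : ℍ) : Function.Periodic.qParam h (tri τ : ℍ) =
    Function.Periodic.qParam h τ ^ 3 := by
  rw [Function.Periodic.qParam, Function.Periodic.qParam, ← Complex.exp_nat_mul, coe_tri]
  congr 1
  push_cast
  ring

lemma qParam_pow {h h' : ℝ} {n : ℕ} (hn : h = n * h') (hh : h ≠ 0) (τ : ℂ) :
    Function.Periodic.qParam h τ ^ n = Function.Periodic.qParam h' τ := by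
  rw [Function.Periodic.qParam, Function.Periodic.qParam, ← Complex.exp_nat_mul, hn]
  congr 1
  rw [hn] at hh
  have h1 : (n : ℂ) ≠ 0 := by
    rintro h
    apply hh
    have : (n : ℝ) = 0 := by exact_mod_cast h
    rw [this, zero_mul]
  have h2 : (h' : ℂ) ≠ 0 := by
    rintro h
    apply hh
    have : h' = 0 := by exact_mod_cast h
    rw [this, mul_zero]
  push_cast
  field_simp

/-- The leading exponent of `(η(τ)/η(3τ))⁴` is `(4 - 12)/24 = -1/3`. -/
lemma tendsto_etaQuot_mul :
    Tendsto (fun τ : ℍ => etaQuot τ * Function.Periodic.qParam 3 τ) atImInfty (𝓝 1) := by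
  have h1 := (tendsto_etaProd.pow 2).div ((tendsto_etaProd.comp tendsto_tri).pow 2) (by norm_num)
  rw [one_pow, div_one] at h1
  refine h1.congr fun τ => ?_
  have n1 := etaProd_ne_zero (tri τ)
  have n2 := Function.Periodic.qParam_ne_zero (h := 12) (τ : ℂ)
  simp only [Pi.div_apply, Pi.pow_apply, Function.comp_apply, etaQuot, etaSq_eq, qParam_tri]
  rw [← qParam_pow (h := 12) (h' := 3) (n := 4) (by norm_num) (by norm_num)]
  field_simp

lemma tendsto_hauptmodul_mul :
    Tendsto (fun τ : ℍ => hauptmodul τ * Function.Periodic.qParam 1 τ) atImInfty (𝓝 1) := by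
  have h1 := tendsto_etaQuot_mul.pow 3
  rw [one_pow] at h1
  refine h1.congr fun τ => ?_
  rw [mul_pow, qParam_pow (h := 3) (h' := 1) (n := 3) (by norm_num) (by norm_num), hauptmodul]

lemma tendsto_formZero : Tendsto formZero atImInfty (𝓝 1) := by
  have h1 := (tendsto_etaProd.pow 9).div ((tendsto_etaProd.comp tendsto_tri).pow 3) (by norm_num)
  rw [one_pow, one_pow, div_one] at h1
  refine h1.congr fun τ => ?_
  have n1 := etaProd_ne_zero (tri τ)
  have n2 := Function.Periodic.qParam_ne_zero (h := 12) (τ : ℂ)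
  simp only [Pi.div_apply, Pi.pow_apply, Function.comp_apply, formZero, etaSq_eq, qParam_tri]
  field_simp

lemma tendsto_eisThree : Tendsto eisThree atImInfty (𝓝 2) := by
  have h1 := ((tendsto_E2.comp tendsto_tri).const_mul 3).sub tendsto_E2
  norm_num at h1
  exact h1

end EtaQuotients

end

end ModCurve

namespace ModCurve

open CongruenceSubgroup

/-! ### Generators of `Γ₀(3)` and of `levelNineOne` -/

section Generators

lemma sw_eq_S : sw = ModularGroup.S := by
  apply sl_ext <;> simp [ModularGroup.S]

lemma up_one_eq_T : up 1 = ModularGroup.T := by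
  apply sl_ext <;> simp [ModularGroup.T]

lemma sw_mul_sw : sw * sw = -1 := by
  apply sl_ext <;>
  simp [mul_apply_zero_zero, mul_apply_zero_one, mul_apply_one_zero, mul_apply_one_one]

/-- The subgroup generated by `-1`, `τ ↦ τ + 1` and `τ ↦ τ / (3τ + 1)`. -/
def genThree : Subgroup SL(2, ℤ) := Subgroup.closure {-1, up 1, lo 3}

lemma neg_one_mem_genThree : -1 ∈ genThree := Subgroup.subset_closure (by simp)

lemma up_mem_genThree (n : ℤ) : up n ∈ genThree := by
  have h := zpow_mem (Subgroup.subset_closure (by simp) : up 1 ∈ genThree) n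
  rwa [up_zpow, one_mul] at h

lemma lo_mem_genThree (n : ℤ) : lo (3 * n) ∈ genThree := by
  have h := zpow_mem (Subgroup.subset_closure (by simp) : lo 3 ∈ genThree) n
  rwa [lo_zpow] at h

lemma neg_mem_genThree {g : SL(2, ℤ)} (hg : g ∈ genThree) : -g ∈ genThree := by
  rw [← neg_one_mul]
  exact mul_mem neg_one_mem_genThree hg

/-- Only `n` modulo `3` matters, as `sw * up (3k) = lo (-3k) * sw`; the three residues are explicit
identities. -/
lemma sw_mul_up_mul_sw (n : ℤ) : ∃ h ∈ genThree, sw * up n * sw = h ∨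
    ∃ m : ℤ, sw * up n * sw = h * sw * up m := by
  have key (k : ℤ) : sw * up (3 * k) = lo (3 * (-k)) * sw := by
    rw [sw_mul_up]; congr 2; ring
  have hn := Int.emod_add_mul_ediv n 3
  have hsplit (r : ℤ) : sw * up (r + 3 * (n / 3)) * sw = lo (3 * (-(n / 3))) * (sw * up r * sw) := by
    rw [add_comm, up_add, ← mul_assoc, key]
    simp only [mul_assoc]
  rw [← hn, hsplit]
  have hr : n % 3 = 0 ∨ n % 3 = 1 ∨ n % 3 = 2 := by omega
  rcases hr with hr | hr | hr <;> rw [hr]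
  · refine ⟨_, mul_mem (lo_mem_genThree (-(n / 3))) neg_one_mem_genThree, Or.inl ?_⟩
    rw [up_zero, mul_one, sw_mul_sw]
  · refine ⟨lo (3 * (-(n / 3))) * up (-1),
      mul_mem (lo_mem_genThree _) (up_mem_genThree _), Or.inr ⟨-1, ?_⟩⟩
    have : sw * up 1 * sw = up (-1) * sw * up (-1) := by
      apply sl_ext <;>
      simp [mul_apply_zero_zero, mul_apply_zero_one, mul_apply_one_zero, mul_apply_one_one]
    rw [this]
    simp only [mul_assoc]
  · refine ⟨lo (3 * (-(n / 3))) * -(lo (3 * (-1)) * up 1),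
      mul_mem (lo_mem_genThree _) (neg_mem_genThree
        (mul_mem (lo_mem_genThree _) (up_mem_genThree _))), Or.inr ⟨1, ?_⟩⟩
    have : sw * up 2 * sw = -(lo (3 * (-1)) * up 1) * sw * up 1 := by
      apply sl_ext <;>
      simp [mul_apply_zero_zero, mul_apply_zero_one, mul_apply_one_zero, mul_apply_one_one,
        Matrix.mul_apply]
    rw [this]
    simp only [mul_assoc]

/-- The union of the cosets of `1` and `sw * up n` is stable under right multiplication by the
generators of `SL(2, ℤ)` and their inverses, so it is the whole group. -/
lemma exists_coset_genThree (g : SL(2, ℤ)) :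
    ∃ h ∈ genThree, g = h ∨ ∃ n : ℤ, g = h * sw * up n := by
  have hS (h : SL(2, ℤ)) (hh : h ∈ genThree) (n : ℤ) :
      ∃ h' ∈ genThree, h * sw * up n * sw = h' ∨ ∃ m : ℤ, h * sw * up n * sw = h' * sw * up m := by
    obtain ⟨k, hk, e | ⟨m, e⟩⟩ := sw_mul_up_mul_sw n
    · exact ⟨h * k, mul_mem hh hk, Or.inl (by rw [← e]; group)⟩
    · refine ⟨h * k, mul_mem hh hk, Or.inr ⟨m, ?_⟩⟩
      rw [mul_assoc h, mul_assoc h, e]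
      group
  have hsinv : (sw)⁻¹ = sw * -1 := by
    rw [inv_eq_iff_mul_eq_one, ← mul_assoc, sw_mul_sw]
    simp
  have hg : g ∈ Subgroup.closure {ModularGroup.S, ModularGroup.T} := by
    rw [SpecialLinearGroup.SL2Z_generators]
    exact Subgroup.mem_top g
  rw [← sw_eq_S, ← up_one_eq_T] at hg
  have hneg (x : SL(2, ℤ)) (hx : ∃ h ∈ genThree, x = h ∨ ∃ n : ℤ, x = h * sw * up n) :
      ∃ h ∈ genThree, -x = h ∨ ∃ n : ℤ, -x = h * sw * up n := by
    obtain ⟨h, hh, e | ⟨n, e⟩⟩ := hx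
    · exact ⟨-h, neg_mem_genThree hh, Or.inl (by rw [e])⟩
    · exact ⟨-h, neg_mem_genThree hh, Or.inr ⟨n, by rw [e]; simp⟩⟩
  have hmulS (x : SL(2, ℤ)) (hx : ∃ h ∈ genThree, x = h ∨ ∃ n : ℤ, x = h * sw * up n) :
      ∃ h ∈ genThree, x * sw = h ∨ ∃ n : ℤ, x * sw = h * sw * up n := by
    obtain ⟨h, hh, rfl | ⟨n, rfl⟩⟩ := hx
    · exact ⟨x, hh, Or.inr ⟨0, by simp⟩⟩
    · exact hS h hh n
  have hmulT (k : ℤ) (x : SL(2, ℤ)) (hx : ∃ h ∈ genThree, x = h ∨ ∃ n : ℤ, x = h * sw * up n) :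
      ∃ h ∈ genThree, x * up k = h ∨ ∃ n : ℤ, x * up k = h * sw * up n := by
    obtain ⟨h, hh, rfl | ⟨n, rfl⟩⟩ := hx
    · exact ⟨x * up k, mul_mem hh (up_mem_genThree k), Or.inl rfl⟩
    · exact ⟨h, hh, Or.inr ⟨n + k, by rw [up_add, mul_assoc, mul_assoc]⟩⟩
  induction hg using Subgroup.closure_induction_right with
  | one => exact ⟨1, one_mem _, Or.inl rfl⟩
  | mul_right x _ y hy ih =>
    rcases hy with hy | hy <;> subst hy
    · exact hmulS x ih
    · exact hmulT 1 x ih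
  | mul_inv_cancel x _ y hy ih =>
    rcases hy with hy | hy <;> subst hy
    · have := hneg _ (hmulS x ih)
      rw [hsinv]
      simpa using this
    · rw [← up_neg]
      exact hmulT (-1) x ih

lemma genThree_le : genThree ≤ Gamma0 3 := by
  rw [genThree, Subgroup.closure_le]
  rintro g (rfl | rfl | rfl)
  all_goals rw [SetLike.mem_coe, mem_Gamma0_iff]; simp

lemma mem_genThree_iff {g : SL(2, ℤ)} : g ∈ genThree ↔ g ∈ Gamma0 3 := by
  refine ⟨fun h => genThree_le h, fun hg => ?_⟩
  obtain ⟨h, hh, e | ⟨n, e⟩⟩ := exists_coset_genThree g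
  · rwa [e]
  · exfalso
    subst e
    have h1 : sw * up n ∈ Gamma0 3 := by
      have := mul_mem (inv_mem (genThree_le hh)) hg
      rwa [mul_assoc, inv_mul_cancel_left] at this
    rw [mem_Gamma0_iff] at h1
    simp [mul_apply_one_zero] at h1

lemma Gamma0_three_induction {P : SL(2, ℤ) → Prop} (hneg : P (-1)) (hup : P (up 1)) (hlo : P (lo 3))
    (hone : P 1) (hmul : ∀ g h, P g → P h → P (g * h)) (hinv : ∀ g, P g → P g⁻¹) {g : SL(2, ℤ)}
    (hg : g ∈ Gamma0 3) : P g := by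
  rw [← mem_genThree_iff] at hg
  induction hg using Subgroup.closure_induction with
  | mem x hx => rcases hx with rfl | rfl | rfl <;> assumption
  | one => exact hone
  | mul x y _ _ hx hy => exact hmul x y hx hy
  | inv x _ hx => exact hinv x hx

/-- The subgroup generated by the given elements of `levelNineOne`. -/
def genNine : Subgroup SL(2, ℤ) := Subgroup.closure {al₀, al₁, al₂, up 3}

lemma up_mul_al_mem (m : ℤ) : up m * al₀ * (up m)⁻¹ ∈ genNine := by
  have hs : up 3 ∈ genNine := Subgroup.subset_closure (by simp)
  have h0 : al₀ ∈ genNine := Subgroup.subset_closure (by simp)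
  have h1 : up 1 * al₀ * (up 1)⁻¹ ∈ genNine := by
    have : al₁ ∈ genNine := Subgroup.subset_closure (by simp)
    convert this using 1
    rw [← up_neg]
    apply sl_ext <;> simp [mul_apply_zero_zero, mul_apply_zero_one, mul_apply_one_zero,
      mul_apply_one_one, al₀, al₁]
  have h2 : up 2 * al₀ * (up 2)⁻¹ ∈ genNine := by
    have : al₂ ∈ genNine := Subgroup.subset_closure (by simp)
    convert this using 1
    rw [← up_neg]
    apply sl_ext <;> simp [mul_apply_zero_zero, mul_apply_zero_one, mul_apply_one_zero,
      mul_apply_one_one, al₀, al₂]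
  have hm := Int.emod_add_mul_ediv m 3
  have key (r : ℤ) (hr : up r * al₀ * (up r)⁻¹ ∈ genNine) :
      up (r + 3 * (m / 3)) * al₀ * (up (r + 3 * (m / 3)))⁻¹ ∈ genNine := by
    have h3 := zpow_mem hs (m / 3)
    rw [up_zpow] at h3
    have h4 := mul_mem (mul_mem h3 hr) (inv_mem h3)
    convert h4 using 1
    rw [add_comm, up_add, _root_.mul_inv_rev]
    group
  rw [← hm]
  have hr : m % 3 = 0 ∨ m % 3 = 1 ∨ m % 3 = 2 := by omega
  rcases hr with hr | hr | hr <;> rw [hr]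
  · exact key 0 (by simpa using h0)
  · exact key 1 h1
  · exact key 2 h2

lemma genNine_le : genNine ≤ levelNineOne := by
  rw [genNine, Subgroup.closure_le]
  rintro g (rfl | rfl | rfl | rfl)
  exacts [al₀_mem, al₁_mem, al₂_mem, up_three_mem]

lemma lo_three_eq : lo 3 = al₀⁻¹ * up 1 := by
  apply sl_ext <;> simp [mul_apply_zero_zero, mul_apply_zero_one, mul_apply_one_zero,
      mul_apply_one_one, inv_apply_zero_zero, inv_apply_zero_one, inv_apply_one_zero,
      inv_apply_one_one, al₀]

/-- Since `lo 3 = al₀⁻¹ * up 1`, the group `Γ₀(3)` is generated by `-1`, `up 1` and `al₀`; moving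
the translations to the right leaves conjugates of `al₀` by translations, all in `genNine`. -/
lemma exists_coset_genNine {g : SL(2, ℤ)} (hg : g ∈ Gamma0 3) :
    ∃ h ∈ genNine, ∃ n : ℤ, g = h * up n ∨ g = -(h * up n) := by
  rw [← mem_genThree_iff, genThree] at hg
  induction hg using Subgroup.closure_induction_right with
  | one => exact ⟨1, one_mem _, 0, Or.inl (by simp)⟩
  | mul_right x _ y hy ih =>
    obtain ⟨h, hh, n, e⟩ := ih
    rcases hy with hy | hy | hy <;> subst hy
    · refine ⟨h, hh, n, ?_⟩
      rcases e with rfl | rfl <;> simp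
    · refine ⟨h, hh, n + 1, ?_⟩
      rw [up_add]
      rcases e with rfl | rfl <;> simp [mul_assoc]
    · refine ⟨h * (up n * al₀ * (up n)⁻¹)⁻¹, mul_mem hh (inv_mem (up_mul_al_mem n)), n + 1, ?_⟩
      rw [lo_three_eq, up_add]
      rcases e with rfl | rfl
      · left; group
      · right; rw [neg_mul]; congr 1; group
  | mul_inv_cancel x _ y hy ih =>
    obtain ⟨h, hh, n, e⟩ := ih
    rcases hy with hy | hy | hy <;> subst hy
    · refine ⟨h, hh, n, ?_⟩
      rw [show (-1 : SL(2, ℤ))⁻¹ = -1 by rw [inv_eq_iff_mul_eq_one]; simp]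
      rcases e with rfl | rfl <;> simp
    · refine ⟨h, hh, n - 1, ?_⟩
      rw [sub_eq_add_neg, up_add, ← up_neg]
      rcases e with rfl | rfl <;> simp [mul_assoc]
    · refine ⟨h * (up (n - 1) * al₀ * (up (n - 1))⁻¹), mul_mem hh (up_mul_al_mem _), n - 1, ?_⟩
      rw [lo_three_eq, sub_eq_add_neg, up_add, up_neg]
      rcases e with rfl | rfl
      · left; group
      · right; rw [neg_mul]; congr 1; group

lemma levelNineOne_le : levelNineOne ≤ genNine := by
  intro g hg
  obtain ⟨h, hh, n, e⟩ := exists_coset_genNine (levelNine_le_Gamma0 hg.1)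
  have hup : up n ∈ levelNineOne := by
    rcases e with e | e
    · have := mul_mem (inv_mem (genNine_le hh)) hg
      rwa [e, inv_mul_cancel_left] at this
    · exfalso
      have h1 := mul_mem (inv_mem (genNine_le hh)) hg
      rw [e, mul_neg, inv_mul_cancel_left] at h1
      have h2 : -up n ∈ Gamma1 3 := h1.2
      rw [mem_Gamma1_iff] at h2
      simp at h2
  have h3 : up n ∈ genNine := by
    obtain ⟨k, rfl⟩ := up_mem_levelNine_iff.1 hup.1
    have := zpow_mem (Subgroup.subset_closure (by simp) : up 3 ∈ genNine) k
    rwa [up_zpow] at this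
  rcases e with rfl | e
  · exact mul_mem hh h3
  · exfalso
    have h1 := mul_mem (inv_mem (genNine_le (mul_mem hh h3))) hg
    rw [e, mul_neg, inv_mul_cancel] at h1
    have h2 : (-1 : SL(2, ℤ)) ∈ Gamma1 3 := h1.2
    rw [mem_Gamma1_iff] at h2
    simp at h2

lemma levelNineOne_induction {P : SL(2, ℤ) → Prop} (h0 : P al₀) (h1 : P al₁) (h2 : P al₂)
    (hup : P (up 3)) (hone : P 1) (hmul : ∀ g ∈ levelNineOne, ∀ h ∈ levelNineOne,
      P g → P h → P (g * h)) (hinv : ∀ g ∈ levelNineOne, P g → P g⁻¹) {g : SL(2, ℤ)}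
    (hg : g ∈ levelNineOne) : P g := by
  have hg' := levelNineOne_le hg
  clear hg
  induction hg' using Subgroup.closure_induction with
  | mem x hx => rcases hx with rfl | rfl | rfl | rfl <;> assumption
  | one => exact hone
  | mul x y hx' hy' hx hy => exact hmul x (genNine_le hx') y (genNine_le hy') hx hy
  | inv x hx' hx => exact hinv x (genNine_le hx') hx

end Generators

/-! ### Invariant functions of weight 0 -/

section WeightZero

open UpperHalfPlane hiding I
open Filter Topology
open scoped ModularForm Manifold

/-- A function of weight `0` which is holomorphic on `ℍ` and at the cusps is constant. -/
lemma exists_const_of_invariant {Γ : Subgroup SL(2, ℤ)} {N : ℕ} (hN0 : N ≠ 0) (hN : Gamma N ≤ Γ)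
    {Ψ : ℍ → ℂ} (hΨ : MDiff Ψ) (hinv : ∀ γ ∈ Γ, ∀ τ, Ψ (γ • τ) = Ψ τ)
    (hbdd : ∀ δ : SL(2, ℤ), IsBoundedAtImInfty (fun τ => Ψ (δ • τ))) : ∃ c, ∀ τ, Ψ τ = c := by
  have : NeZero N := ⟨hN0⟩
  have : Γ.FiniteIndex := Subgroup.finiteIndex_of_le hN
  have hslash (δ : SL(2, ℤ)) : Ψ ∣[(0 : ℤ)] δ = fun τ => Ψ (δ • τ) := by
    ext τ
    rw [ModularForm.SL_slash_apply]
    simp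
  let f : ModularForm (Γ : Subgroup (GL (Fin 2) ℝ)) 0 :=
    { toFun := Ψ
      slash_action_eq' := by
        rintro _ ⟨γ, hγ, rfl⟩
        change Ψ ∣[(0 : ℤ)] γ = Ψ
        rw [hslash]
        ext τ
        exact hinv γ hγ τ
      holo' := hΨ
      bdd_at_cusps' := by
        intro c hc
        rw [Subgroup.IsArithmetic.isCusp_iff_isCusp_SL2Z] at hc
        rw [OnePoint.isBoundedAt_iff_forall_SL2Z hc]
        intro δ _
        rw [hslash]
        exact hbdd δ }
  obtain ⟨c, hc⟩ := ModularForm.eq_const_of_weight_zero f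
  exact ⟨c, fun τ => congrFun hc τ⟩

end WeightZero

end ModCurve

namespace ModCurve

open UpperHalfPlane hiding I
open Filter Topology Complex CongruenceSubgroup
open scoped ModularForm Manifold Real

noncomputable section

/-! ### Orders of vanishing -/

section Order

/-- The order of vanishing of a holomorphic function at a point of `ℍ`. -/
def ordAt (f : ℍ → ℂ) (z : ℍ) : ℕ∞ := analyticOrderAt (fun w => f (ofComplex w)) (z : ℂ)

lemma analyticAt_comp_ofComplex {f : ℍ → ℂ} (hf : MDiff f) (z : ℍ) :
    AnalyticAt ℂ (fun w => f (ofComplex w)) (z : ℂ) := by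
  rw [UpperHalfPlane.mdifferentiable_iff] at hf
  exact hf.analyticAt (isOpen_upperHalfPlaneSet.mem_nhds z.2)

lemma ordAt_mul {f g : ℍ → ℂ} (hf : MDiff f) (hg : MDiff g) (z : ℍ) :
    ordAt (fun τ => f τ * g τ) z = ordAt f z + ordAt g z :=
  analyticOrderAt_mul (analyticAt_comp_ofComplex hf z) (analyticAt_comp_ofComplex hg z)

lemma ordAt_pow {f : ℍ → ℂ} (hf : MDiff f) (n : ℕ) (z : ℍ) :
    ordAt (fun τ => f τ ^ n) z = n • ordAt f z :=
  analyticOrderAt_pow (analyticAt_comp_ofComplex hf z) n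

lemma ordAt_eq_zero {f : ℍ → ℂ} {z : ℍ} (h : f z ≠ 0) : ordAt f z = 0 := by
  rw [ordAt, analyticOrderAt_eq_zero]
  right
  rwa [ofComplex_apply]

lemma ordAt_ne_top {f : ℍ → ℂ} (hf : MDiff f) (h0 : ∃ τ, f τ ≠ 0) (z : ℍ) : ordAt f z ≠ ⊤ := by
  obtain ⟨τ, hτ⟩ := h0
  intro h
  rw [ordAt, analyticOrderAt_eq_top] at h
  have h1 : ∀ᶠ τ in 𝓝 z, f τ = 0 := by
    filter_upwards [continuous_coe.continuousAt.eventually h] with τ hτ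
    simpa using hτ
  have h2 := eq_zero_of_frequently hf (h1.filter_mono nhdsWithin_le_nhds).frequently
  exact hτ (congrFun h2 τ)

end Order

/-! ### Forms of weight 6 on `Γ₀(3)` -/

section WeightSix

lemma Gamma_three_le_Gamma0 : CongruenceSubgroup.Gamma 3 ≤ Gamma0 3 := fun γ hγ => by
  rw [Gamma_mem] at hγ
  rw [Gamma0_mem]
  exact hγ.2.2.1

lemma isBigO_qParam_iff {f : ℍ → ℂ} {h : ℝ} :
    (f =O[atImInfty] fun τ => Function.Periodic.qParam h τ) ↔
      f =O[atImInfty] fun τ => Real.exp (-2 * π * τ.im / h) := by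
  rw [← Asymptotics.isBigO_norm_right]
  simp only [Function.Periodic.norm_qParam]
  rfl

/-- Subtracting the value at `i∞` leaves `O(q)`, while the Hauptmodul is `O(1/q)`. -/
lemma exists_isBoundedAtImInfty_sub_mul {f : ℍ → ℂ} (hf : MDiff f)
    (hper : ∀ τ, f (up 1 • τ) = f τ) (hb : IsBoundedAtImInfty f) :
    ∃ k, IsBoundedAtImInfty (fun τ => (f τ - k) * hauptmodul τ) := by
  refine ⟨valueAtInfty f, ?_⟩
  have hper' := periodic_of_smul_up hper
  have h1 := isBigO_qParam_iff.2
    (UpperHalfPlane.exp_decay_sub_atImInfty (h := 1) one_pos (by simpa using hper') hf hb)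
  have h2 := h1.mul (Asymptotics.isBigO_refl hauptmodul atImInfty)
  refine h2.trans ?_
  have h3 := tendsto_hauptmodul_mul.isBigO_one ℝ
  exact h3.congr_left fun τ => mul_comm _ _

lemma hauptmodul_smul {γ : SL(2, ℤ)} (hγ : γ ∈ Gamma0 3) :
    ∀ τ, hauptmodul (γ • τ) = hauptmodul τ := by
  refine Gamma0_three_induction (P := fun γ => ∀ τ, hauptmodul (γ • τ) = hauptmodul τ)
    (fun τ => ?_) (hauptmodul_up_smul 1) (fun τ => ?_) (fun τ => by rw [one_smul])
    (fun g h hg hh τ => by rw [mul_smul, hg, hh])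
    (fun g hg τ => by rw [← hg (g⁻¹ • τ), smul_inv_smul]) hγ
  · rw [ModularGroup.SL_neg_smul, one_smul]
  · rw [hauptmodul, etaQuot_lo_three_smul, mul_pow, hauptmodul]
    rw [show (om ^ 2) ^ 3 = (om ^ 3) ^ 2 by ring, om_pow_three, one_pow, one_mul]

/-- Up to a constant, `eisThree` is the logarithmic derivative of the invariant function
`hauptmodul`. -/
lemma eisThree_smul {γ : SL(2, ℤ)} (hγ : γ ∈ Gamma0 3) (τ : ℍ) :
    eisThree (γ • τ) = denom γ τ ^ 2 * eisThree τ := by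
  have h1 := hasDerivAt_comp_smul γ τ (hasDerivAt_hauptmodul (γ • τ))
  simp only [hauptmodul_smul hγ] at h1
  have h2 := h1.unique (hasDerivAt_hauptmodul τ)
  have h3 := hauptmodul_ne_zero τ
  have h4 : denom γ τ ≠ 0 := denom_ne_zero _ _
  have h5 : (π * I : ℂ) ≠ 0 := mul_ne_zero (by exact_mod_cast Real.pi_ne_zero) I_ne_zero
  rw [zpow_neg] at h2
  have h6 : (π * I : ℂ) * hauptmodul τ * (eisThree (γ • τ)) =
      (π * I : ℂ) * hauptmodul τ * (denom γ τ ^ 2 * eisThree τ) := by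
    field_simp at h2
    have e : (denom γ τ) ^ (2 : ℤ) = denom γ τ ^ 2 := by norm_cast
    try rw [e] at h2
    linear_combination (-(π * I) * hauptmodul τ) * h2
  exact mul_left_cancel₀ (mul_ne_zero h5 h3) h6

/-- Forms of weight `6` are polynomials in the Hauptmodul, up to a factor without zeros. -/
lemma exists_eq_formInfty_mul {F F₀ : ℍ → ℂ} (hF : MDiff F) (hup : ∀ τ, F (up 1 • τ) = F τ)
    (hlo : ∀ τ, F (lo 3 • τ) = denom (lo 3) τ ^ 6 * F τ) (hb : IsBoundedAtImInfty F)
    (hsw : ∀ τ, F (sw • τ) = τ ^ 6 * F₀ τ) (hb₀ : IsBoundedAtImInfty F₀) :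
    ∃ a b c : ℂ, ∀ τ, F τ = formInfty τ * (a * hauptmodul τ ^ 2 + b * hauptmodul τ + c) := by
  have hC := formInfty_ne_zero
  have ht := hauptmodul_ne_zero
  have hinvb : IsBoundedAtImInfty fun τ => (formZero τ)⁻¹ :=
    (tendsto_formZero.inv₀ one_ne_zero).isBigO_one ℝ
  have htinv : IsBoundedAtImInfty fun τ => (hauptmodul τ)⁻¹ := by
    have h1 := (tendsto_hauptmodul_mul.inv₀ one_ne_zero).isBigO_one ℝ
    have h2 : IsBoundedAtImInfty fun τ : ℍ => Function.Periodic.qParam 1 τ := by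
      refine Asymptotics.IsBigO.of_bound 1 (Eventually.of_forall fun τ => ?_)
      simpa using (Function.Periodic.norm_qParam_lt_one one_pos τ.2).le
    refine (h2.mul h1).congr (fun τ => ?_) fun τ => by simp
    have := Function.Periodic.qParam_ne_zero (h := 1) (τ : ℂ)
    have h3 := ht τ
    simp only [Pi.mul_apply]
    field_simp
  have hA : MDiff fun τ => F τ / formZero τ :=
    mdiff_div hF (by
      rw [show formZero = fun τ => formInfty τ * hauptmodul τ ^ 2 from funext formZero_eq]
      exact mdiff_mul mdiff_formInfty (mdiff_pow mdiff_hauptmodul 2)) formZero_ne_zero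
  -- The quotient by `formZero` behaves like `a + b/t + O(1/t²)` in the Hauptmodul `t`. Removing `a`
  -- and `b` leaves an invariant function bounded at both cusps: at `0` the form `formInfty` does
  -- not vanish and `t` is bounded.
  obtain ⟨a, ha⟩ := exists_isBoundedAtImInfty_sub_mul hA
    (fun τ => by rw [hup, formZero_up_smul]) (by
      refine (hb.mul hinvb).congr (fun τ => ?_) fun τ => ?_
      · rw [div_eq_mul_inv, Pi.mul_apply]
      · simp)
  have hA1 : MDiff fun τ => (F τ / formZero τ - a) * hauptmodul τ :=
    mdiff_mul (mdiff_sub hA (mdiff_const a)) mdiff_hauptmodul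
  obtain ⟨b, hb⟩ := exists_isBoundedAtImInfty_sub_mul hA1
    (fun τ => by rw [hup, formZero_up_smul, hauptmodul_up_smul]) ha
  let Ψ : ℍ → ℂ := fun τ =>
    F τ / formInfty τ - a * hauptmodul τ ^ 2 - b * hauptmodul τ
  have hΨ : MDiff Ψ := mdiff_sub (mdiff_sub (mdiff_div hF mdiff_formInfty hC)
    (mdiff_const_mul a (mdiff_pow mdiff_hauptmodul 2))) (mdiff_const_mul b mdiff_hauptmodul)
  have hΨb : IsBoundedAtImInfty Ψ := by
    refine hb.congr (fun τ => ?_) fun τ => rfl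
    have h1 := hC τ
    have h2 := ht τ
    simp only [Ψ, formZero_eq]
    field_simp
  have hΨsw : IsBoundedAtImInfty fun τ => Ψ (sw • τ) := by
    have h1 : IsBoundedAtImInfty fun τ => (formZero (third τ))⁻¹ := hinvb.comp_tendsto tendsto_third
    have h2 : IsBoundedAtImInfty fun τ => (hauptmodul (third τ))⁻¹ :=
      htinv.comp_tendsto tendsto_third
    have h3 : IsBoundedAtImInfty fun τ => F₀ τ * (formZero (third τ))⁻¹ :=
      (hb₀.mul h1).congr (fun τ => rfl) fun τ => by simp
    have h4 : IsBoundedAtImInfty fun τ => (hauptmodul (third τ))⁻¹ * (hauptmodul (third τ))⁻¹ :=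
      (h2.mul h2).congr (fun τ => rfl) fun τ => by simp
    refine (((h3.const_mul_left (-19683)).sub (h4.const_mul_left (a * 729 ^ 2))).sub
      (h2.const_mul_left (b * 729))).congr (fun τ => ?_) fun τ => rfl
    have n1 := formZero_ne_zero (third τ)
    have n2 := ht (third τ)
    have n3 : (τ : ℂ) ≠ 0 := ne_zero τ
    simp only [Ψ, hsw, formInfty_sw_smul, hauptmodul_sw_smul]
    field_simp
  have hinv : ∀ γ ∈ Gamma0 3, ∀ τ, Ψ (γ • τ) = Ψ τ := by
    intro γ hγ
    refine Gamma0_three_induction (P := fun γ => ∀ τ, Ψ (γ • τ) = Ψ τ)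
      (fun τ => ?_) (fun τ => ?_) (fun τ => ?_) (fun τ => by rw [one_smul])
      (fun g h hg hh τ => by rw [mul_smul, hg, hh])
      (fun g hg τ => by rw [← hg (g⁻¹ • τ), smul_inv_smul]) hγ
    · rw [ModularGroup.SL_neg_smul, one_smul]
    · simp only [Ψ, hup, formInfty_up_smul, hauptmodul_up_smul]
    · have h1 : hauptmodul (lo 3 • τ) = hauptmodul τ := hauptmodul_smul (by
        rw [mem_Gamma0_iff]; simp [lo]) τ
      have h4 : denom (lo 3) τ ≠ 0 := denom_ne_zero _ _
      simp only [Ψ, hlo, formInfty_lo_three_smul, h1]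
      rw [mul_div_mul_left _ _ (pow_ne_zero 6 h4)]
  obtain ⟨c, hc⟩ := exists_const_of_invariant (N := 3) (by norm_num) Gamma_three_le_Gamma0 hΨ hinv
    fun δ => by
      obtain ⟨h, hh, e | ⟨n, e⟩⟩ := exists_coset_genThree δ
      · refine hΨb.congr (fun τ => ?_) fun τ => rfl
        rw [e, hinv h (genThree_le hh)]
      · refine (hΨsw.comp_tendsto (tendsto_up_smul n)).congr (fun τ => ?_) fun τ => rfl
        rw [Function.comp_apply, e, mul_smul, mul_smul, hinv h (genThree_le hh)]
  refine ⟨a, b, c, fun τ => ?_⟩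
  have h1 := hc τ
  have h2 := hC τ
  simp only [Ψ] at h1
  field_simp at h1
  linear_combination h1

end WeightSix

/-! ### A fixed point of `al₁` -/

section EllipticPoint

/-- A fixed point of the elliptic element `al₁`. -/
def ellPoint : ℍ := ⟨(9 + I * Real.sqrt 3) / 6, by
  have h1 : 0 < Real.sqrt 3 := by positivity
  have h2 : ((9 + I * Real.sqrt 3) / 6 : ℂ) = (3 / 2 : ℝ) + (Real.sqrt 3 / 6 : ℝ) * I := by
    push_cast; ring
  rw [h2]
  simpa using h1⟩

lemma ellPoint_rel : 3 * (ellPoint : ℂ) ^ 2 - 9 * ellPoint + 7 = 0 := by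
  have h1 : (Real.sqrt 3 : ℂ) ^ 2 = 3 := by
    rw [← ofReal_pow, Real.sq_sqrt (by norm_num)]
    norm_num
  change 3 * ((9 + I * Real.sqrt 3) / 6 : ℂ) ^ 2 - 9 * ((9 + I * Real.sqrt 3) / 6) + 7 = 0
  linear_combination (3 / 36 * (Real.sqrt 3 : ℂ) ^ 2) * I_sq - 3 / 36 * h1

lemma denom_al₁ (τ : ℍ) : denom al₁ τ = -3 * τ + 4 := by
  rw [ModularGroup.denom_apply]
  simp [al₁]

lemma al₁_smul_ellPoint : al₁ • ellPoint = ellPoint := by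
  have h1 := denom_ne_zero (al₁ : GL (Fin 2) ℝ) ellPoint
  change denom al₁ ellPoint ≠ 0 at h1
  rw [denom_al₁] at h1
  ext
  rw [coe_specialLinearGroup_apply]
  have h2 : ((algebraMap ℤ ℝ (al₁ 0 0)) * (ellPoint : ℂ) + (algebraMap ℤ ℝ (al₁ 0 1)))
      / ((algebraMap ℤ ℝ (al₁ 1 0)) * (ellPoint : ℂ) + (algebraMap ℤ ℝ (al₁ 1 1))) =
      (-5 * (ellPoint : ℂ) + 7) / (-3 * ellPoint + 4) := by
    simp [al₁]
  rw [h2, div_eq_iff h1]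
  linear_combination ellPoint_rel

lemma al₁_mem_Gamma0 : al₁ ∈ Gamma0 3 := by
  rw [mem_Gamma0_iff]; simp [al₁]

/-- At a fixed point of `al₁` the automorphy factor of weight `2` is not `1`, so the form vanishes.
-/
lemma eisThree_ellPoint : eisThree ellPoint = 0 := by
  have h1 := eisThree_smul al₁_mem_Gamma0 ellPoint
  rw [al₁_smul_ellPoint, denom_al₁] at h1
  have h2 : ((ellPoint : ℂ) - 2) ≠ 0 := by
    intro h
    have h3 := ellPoint_rel
    rw [sub_eq_zero.1 h] at h3
    norm_num at h3
  have h3 : ((ellPoint : ℂ) - 2) * eisThree ellPoint = 0 := by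
    have h4 := ellPoint_rel
    linear_combination -(1 / 3 : ℂ) * h1 - eisThree ellPoint * h4
  exact (mul_eq_zero.1 h3).resolve_left h2

end EllipticPoint

/-! ### Zeros of the Eisenstein series of weight 2 -/

section Zeros

lemma exists_eisThree_ne_zero : ∃ τ, eisThree τ ≠ 0 :=
  (tendsto_eisThree.eventually_ne two_ne_zero).exists

/-- The derivative of the Hauptmodul is `eisThree` times a function without zeros. -/
lemma ordAt_hauptmodul_sub (z : ℍ) :
    ordAt (fun τ => hauptmodul τ - hauptmodul z) z = ordAt eisThree z + 1 := by
  have h1 := (analyticAt_comp_ofComplex mdiff_hauptmodul z).analyticOrderAt_deriv_add_one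
  rw [ofComplex_apply] at h1
  rw [ordAt, ← h1]
  congr 1
  have h2 : ordAt (fun τ => -(π * I) * eisThree τ * hauptmodul τ) z = ordAt eisThree z := by
    rw [ordAt_mul (mdiff_const_mul _ mdiff_eisThree) mdiff_hauptmodul,
      ordAt_mul (mdiff_const _) mdiff_eisThree, ordAt_eq_zero (hauptmodul_ne_zero z),
      ordAt_eq_zero (f := fun _ => -(π * I : ℂ)), zero_add, add_zero]
    exact neg_ne_zero.2 (mul_ne_zero (by exact_mod_cast Real.pi_ne_zero) I_ne_zero)
  rw [← h2, ordAt]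
  refine analyticOrderAt_congr ?_
  filter_upwards [eventually_coe_ofComplex z] with w hw
  have h3 := (hasDerivAt_hauptmodul (ofComplex w)).deriv
  rwa [hw] at h3

lemma isBoundedAtImInfty_eisThree : IsBoundedAtImInfty eisThree := tendsto_eisThree.isBigO_one ℝ

lemma isBoundedAtImInfty_mul {f g : ℍ → ℂ} (hf : IsBoundedAtImInfty f)
    (hg : IsBoundedAtImInfty g) : IsBoundedAtImInfty (fun τ => f τ * g τ) :=
  (Asymptotics.IsBigO.mul hf hg).congr (fun _ => rfl) fun τ => by simp

/-- The cube has weight `6`, so it is `formInfty` times a quadratic polynomial in the Hauptmodul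
with a root at its value `r` at `ellPoint`. A simple root would give `3n = n + 1` for the order `n`
of `eisThree` there, so the root is double. -/
lemma exists_eisThree_pow_three_eq : ∃ a : ℂ, a ≠ 0 ∧ ∀ τ, eisThree τ ^ 3 =
    a * formInfty τ * (hauptmodul τ - hauptmodul ellPoint) ^ 2 := by
  have hb := isBoundedAtImInfty_eisThree
  have hb3 : IsBoundedAtImInfty fun τ => eisThree (third τ) := hb.comp_tendsto tendsto_third
  obtain ⟨a, b, c, h⟩ := exists_eq_formInfty_mul (F := fun τ => eisThree τ ^ 3)
    (F₀ := fun τ => -1 / 27 * (eisThree (third τ) * eisThree (third τ) * eisThree (third τ)))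
    (mdiff_pow mdiff_eisThree 3)
    (fun τ => by rw [eisThree_up_smul]) (fun τ => by rw [eisThree_lo_three_smul]; ring)
    (by
      refine (isBoundedAtImInfty_mul (isBoundedAtImInfty_mul hb hb) hb).congr_left fun τ => ?_
      ring)
    (fun τ => by rw [eisThree_sw_smul]; ring)
    ((isBoundedAtImInfty_mul (isBoundedAtImInfty_mul hb3 hb3) hb3).const_mul_left _)
  have hC := formInfty_ne_zero
  set r := hauptmodul ellPoint with hr
  have h0 : a * r ^ 2 + b * r + c = 0 := by
    have h1 := h ellPoint
    rw [eisThree_ellPoint, zero_pow (by norm_num)] at h1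
    exact (mul_eq_zero.1 h1.symm).resolve_left (hC _)
  have h1 (τ : ℍ) : eisThree τ ^ 3 = formInfty τ *
      ((hauptmodul τ - r) * (a * (hauptmodul τ - r) + (2 * a * r + b))) := by
    rw [h]
    linear_combination formInfty τ * h0
  have m1 : MDiff fun τ => hauptmodul τ - r := mdiff_sub mdiff_hauptmodul (mdiff_const r)
  have m2 : MDiff fun τ => a * (hauptmodul τ - r) + (2 * a * r + b) :=
    mdiff_add (mdiff_const_mul a m1) (mdiff_const _)
  have hd : 2 * a * r + b = 0 := by
    by_contra hd
    have h2 : 3 • ordAt eisThree ellPoint = ordAt eisThree ellPoint + 1 := by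
      rw [← ordAt_pow mdiff_eisThree, ← ordAt_hauptmodul_sub]
      simp only [h1]
      rw [ordAt_mul mdiff_formInfty (mdiff_mul m1 m2), ordAt_mul m1 m2,
        ordAt_eq_zero (hC ellPoint), ordAt_eq_zero (f := fun τ =>
          a * (hauptmodul τ - r) + (2 * a * r + b)) (by simpa [hr] using hd), zero_add, add_zero]
    have h3 := ordAt_ne_top mdiff_eisThree exists_eisThree_ne_zero ellPoint
    rw [nsmul_eq_mul] at h2
    lift ordAt eisThree ellPoint to ℕ using h3 with n
    norm_cast at h2
    omega
  refine ⟨a, ?_, fun τ => by rw [h1, hd]; ring⟩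
  rintro rfl
  obtain ⟨τ, hτ⟩ := exists_eisThree_ne_zero
  have h2 := h1 τ
  rw [hd, zero_mul, add_zero, mul_zero, mul_zero] at h2
  exact hτ (pow_eq_zero_iff (by norm_num) |>.1 h2)

lemma eisThree_eq_zero_iff {z : ℍ} : eisThree z = 0 ↔ hauptmodul z = hauptmodul ellPoint := by
  obtain ⟨a, ha, h⟩ := exists_eisThree_pow_three_eq
  rw [← pow_eq_zero_iff (n := 3) (by norm_num), h]
  simp [ha, formInfty_ne_zero, sub_eq_zero]

/-- Comparing orders in the formula for the cube gives `3n = 2(n + 1)`. -/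
lemma ordAt_eisThree {z : ℍ} (hz : hauptmodul z = hauptmodul ellPoint) : ordAt eisThree z = 2 := by
  obtain ⟨a, ha, h⟩ := exists_eisThree_pow_three_eq
  have m1 : MDiff fun τ => hauptmodul τ - hauptmodul z := mdiff_sub mdiff_hauptmodul (mdiff_const _)
  have h2 : 3 • ordAt eisThree z = 2 • (ordAt eisThree z + 1) := by
    rw [← ordAt_pow mdiff_eisThree, ← ordAt_hauptmodul_sub, ← ordAt_pow m1]
    simp only [h, ← hz]
    rw [ordAt_mul (mdiff_const_mul a mdiff_formInfty) (mdiff_pow m1 2),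
      ordAt_eq_zero (f := fun τ => a * formInfty τ) (mul_ne_zero ha (formInfty_ne_zero z)), zero_add]
  have h3 := ordAt_ne_top mdiff_eisThree exists_eisThree_ne_zero z
  rw [nsmul_eq_mul, nsmul_eq_mul] at h2
  lift ordAt eisThree z to ℕ using h3 with n
  norm_cast at h2 ⊢
  omega

lemma ordAt_hauptmodul_sub_eq_three {z : ℍ} (hz : hauptmodul z = hauptmodul ellPoint) :
    ordAt (fun τ => hauptmodul τ - hauptmodul ellPoint) z = 3 := by
  rw [← hz, ordAt_hauptmodul_sub, ordAt_eisThree hz]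
  norm_num

end Zeros

end

end ModCurve

namespace ModCurve

open UpperHalfPlane hiding I
open Filter Topology Complex
open scoped ModularForm Manifold Real ArithmeticFunction.sigma

noncomputable section

/-! ### Zeros of `E₄`, and elliptic points of `Γ₀(3)` -/

section EisensteinSeriesFour

lemma eisFour_smul (γ : SL(2, ℤ)) (τ : ℍ) :
    ModularForm.E₄ (γ • τ) = denom γ τ ^ 4 * ModularForm.E₄ τ := by
  have h := SlashInvariantForm.slash_action_eqn ModularForm.E₄
    (Matrix.SpecialLinearGroup.mapGL ℝ γ) ⟨γ, rfl⟩
  have h1 : (ModularForm.E₄ : ℍ → ℂ) ∣[(4 : ℤ)] γ = ModularForm.E₄ := h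
  have h2 := congrFun h1 τ
  rw [ModularForm.SL_slash_apply] at h2
  have h4 : denom γ τ ≠ 0 := denom_ne_zero _ _
  rw [zpow_neg, ← div_eq_mul_inv, div_eq_iff (zpow_ne_zero _ h4)] at h2
  rw [h2, mul_comm]
  norm_cast

lemma tsum_sigma_eq_of_eisFour_eq_zero {z : ℍ} (hz : ModularForm.E₄ z = 0) :
    ∑' n : ℕ, (σ 3 (n + 1) : ℂ) * exp (2 * π * I * z) ^ (n + 1) = -1 / 240 := by
  have h := EisensteinSeries.q_expansion_bernoulli (k := 4) (by norm_num) (by decide) z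
  have h1 := tsum_pnat_eq_tsum_succ (f := fun n : ℕ => (σ 3 n : ℂ) * exp (2 * π * I * z) ^ n)
  have h2 : ∑' n : ℕ+, (σ (4 - 1) n : ℂ) * exp (2 * π * I * z) ^ (n : ℤ) =
      ∑' n : ℕ+, (σ 3 n : ℂ) * exp (2 * π * I * z) ^ (n : ℕ) := by
    refine tsum_congr fun n => ?_
    norm_cast
  rw [← h1]
  have hb : bernoulli 4 = -1 / 30 := by
    rw [bernoulli_eq_bernoulli'_of_ne_one (by norm_num), bernoulli'_four]
  rw [show ModularForm.E (k := 4) (by norm_num) z = 0 from hz, hb, h2] at h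
  push_cast at h
  linear_combination (-1 / 240 : ℂ) * h

lemma norm_pow_sub_pow_le {q q' : ℂ} {R : ℝ} (hq : ‖q‖ ≤ R) (hq' : ‖q'‖ ≤ R) (n : ℕ) :
    ‖q ^ (n + 1) - q' ^ (n + 1)‖ ≤ (n + 1) * R ^ n * ‖q - q'‖ := by
  have hR : 0 ≤ R := (norm_nonneg q).trans hq
  induction n with
  | zero => simp
  | succ n ih =>
    have h : q ^ (n + 1 + 1) - q' ^ (n + 1 + 1) =
        q * (q ^ (n + 1) - q' ^ (n + 1)) + (q - q') * q' ^ (n + 1) := by ring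
    rw [h]
    refine (norm_add_le _ _).trans ?_
    rw [norm_mul, norm_mul, norm_pow]
    have h1 : ‖q‖ * ‖q ^ (n + 1) - q' ^ (n + 1)‖ ≤ R * ((n + 1) * R ^ n * ‖q - q'‖) := by gcongr
    have h2 : ‖q - q'‖ * ‖q'‖ ^ (n + 1) ≤ ‖q - q'‖ * R ^ (n + 1) := by gcongr
    push_cast
    calc _ ≤ _ := add_le_add h1 h2
      _ = _ := by ring

lemma pow_five_mul_pow_le (n : ℕ) : ((n : ℝ) + 2) ^ 5 * (1 / 128) ^ (n + 1) ≤ (1 / 4) ^ (n + 1) := by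
  have h : (n : ℝ) + 2 ≤ 2 ^ (n + 1) := by
    have : n + 2 ≤ 2 ^ (n + 1) := Nat.lt_two_pow_self (n := n + 1)
    exact_mod_cast this
  calc ((n : ℝ) + 2) ^ 5 * (1 / 128) ^ (n + 1)
      ≤ (2 ^ (n + 1)) ^ 5 * (1 / 128) ^ (n + 1) := by gcongr
    _ = (1 / 4) ^ (n + 1) := by
      rw [← pow_mul, mul_comm (n + 1) 5, pow_mul, ← mul_pow]
      norm_num

/-- On this small disc the linear term dominates. With `σ₃(n) ≤ n⁴` and the Lipschitz bound for
powers, the remaining terms change by at most a third of `‖q - q'‖`, so the series is injective. -/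
lemma eq_of_tsum_sigma_eq {q q' : ℂ} (hq : ‖q‖ ≤ 1 / 128) (hq' : ‖q'‖ ≤ 1 / 128)
    (hs : Summable fun n : ℕ => (σ 3 (n + 1) : ℂ) * q ^ (n + 1))
    (hs' : Summable fun n : ℕ => (σ 3 (n + 1) : ℂ) * q' ^ (n + 1))
    (h : ∑' n : ℕ, (σ 3 (n + 1) : ℂ) * q ^ (n + 1) = ∑' n : ℕ, (σ 3 (n + 1) : ℂ) * q' ^ (n + 1)) :
    q = q' := by
  have h1 := hs.sub hs'
  have h2 := hs.tsum_sub hs'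
  rw [h, sub_self, h1.tsum_eq_zero_add] at h2
  have h3 : ‖∑' n : ℕ, ((σ 3 (n + 1 + 1) : ℂ) * q ^ (n + 1 + 1) -
      (σ 3 (n + 1 + 1) : ℂ) * q' ^ (n + 1 + 1))‖ ≤ 1 / 3 * ‖q - q'‖ := by
    have hg : HasSum (fun n : ℕ => (1 / 4 : ℝ) ^ (n + 1) * ‖q - q'‖) (1 / 3 * ‖q - q'‖) := by
      have h4 := hasSum_geometric_of_lt_one (r := (1 / 4 : ℝ)) (by norm_num) (by norm_num)
      have h5 := (h4.mul_left (1 / 4)).mul_right ‖q - q'‖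
      rw [show (fun n : ℕ => (1 / 4 : ℝ) ^ (n + 1) * ‖q - q'‖) =
        fun n : ℕ => 1 / 4 * (1 / 4 : ℝ) ^ n * ‖q - q'‖ by ext n; ring]
      rwa [show (1 / 4 : ℝ) * (1 - 1 / 4)⁻¹ = 1 / 3 by norm_num] at h5
    refine tsum_of_norm_bounded hg fun n => ?_
    rw [← mul_sub, norm_mul]
    have h6 : ‖(σ 3 (n + 1 + 1) : ℂ)‖ ≤ ((n : ℝ) + 2) ^ 4 := by
      rw [Complex.norm_natCast]
      have := ArithmeticFunction.sigma_le_pow_succ 3 (n + 1 + 1)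
      calc ((σ 3 (n + 1 + 1) : ℕ) : ℝ) ≤ (((n + 1 + 1) ^ (3 + 1) : ℕ) : ℝ) := by exact_mod_cast this
        _ = _ := by push_cast; ring
    have h7 := norm_pow_sub_pow_le hq hq' (n + 1)
    push_cast at h7
    calc _ ≤ ((n : ℝ) + 2) ^ 4 * (((n : ℝ) + 1 + 1) * (1 / 128) ^ (n + 1) * ‖q - q'‖) := by gcongr
      _ = ((n : ℝ) + 2) ^ 5 * (1 / 128) ^ (n + 1) * ‖q - q'‖ := by ring
      _ ≤ _ := by gcongr; exact pow_five_mul_pow_le n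
  have h8 : σ 3 (0 + 1) = 1 := by simp
  rw [h8] at h2
  have h9 : q - q' = -∑' n : ℕ, ((σ 3 (n + 1 + 1) : ℂ) * q ^ (n + 1 + 1) -
      (σ 3 (n + 1 + 1) : ℂ) * q' ^ (n + 1 + 1)) := by
    rw [eq_neg_iff_add_eq_zero, ← h2]
    simp
  have h10 : ‖q - q'‖ ≤ 1 / 3 * ‖q - q'‖ := by
    conv_lhs => rw [h9, norm_neg]
    exact h3
  have h11 : ‖q - q'‖ = 0 := le_antisymm (by linarith) (norm_nonneg _)
  exact sub_eq_zero.1 (norm_eq_zero.1 h11)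

lemma norm_exp_le_of_mem_fd {z : ℍ} (hz : 3 ≤ 4 * z.im ^ 2) : ‖exp (2 * π * I * z)‖ ≤ 1 / 128 := by
  rw [Complex.norm_exp]
  have h1 : (2 * π * I * z : ℂ).re = -(2 * π * z.im) := by
    simp [mul_assoc]
  rw [h1, Real.exp_neg, one_div]
  gcongr
  -- `0.86` is just below `√3/2`; then `2π Im z ≥ 5` and `e⁵ > 128`.
  have h2 : (0.86 : ℝ) ≤ z.im := by
    by_contra hlt
    push Not at hlt
    have := z.im_pos
    nlinarith
  have h3 := Real.pi_gt_d2
  have h4 : (5 : ℝ) ≤ 2 * π * z.im := by nlinarith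
  calc (128 : ℝ) ≤ 2.7 ^ 5 := by norm_num
    _ ≤ Real.exp 1 ^ 5 := by
      gcongr
      have := Real.exp_one_gt_d9
      linarith
    _ = Real.exp 5 := by rw [← Real.exp_nat_mul]; norm_num
    _ ≤ _ := Real.exp_le_exp.2 h4

lemma exists_up_smul_eq {z w : ℍ} (hz : ModularForm.E₄ z = 0) (hw : ModularForm.E₄ w = 0)
    (hz3 : 3 ≤ 4 * z.im ^ 2) (hw3 : 3 ≤ 4 * w.im ^ 2) : ∃ n : ℤ, z = up n • w := by
  have hs (z : ℍ) : Summable fun n : ℕ => (σ 3 (n + 1) : ℂ) * exp (2 * π * I * z) ^ (n + 1) :=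
    (summable_nat_add_iff 1).2
      (EisensteinSeries.summable_sigma_mul_cexp_pow (k := 4) (by norm_num) z)
  have h := eq_of_tsum_sigma_eq (norm_exp_le_of_mem_fd hz3) (norm_exp_le_of_mem_fd hw3) (hs z) (hs w)
    ((tsum_sigma_eq_of_eisFour_eq_zero hz).trans (tsum_sigma_eq_of_eisFour_eq_zero hw).symm)
  obtain ⟨n, hn⟩ := Complex.exp_eq_exp_iff_exists_int.1 h
  refine ⟨n, ?_⟩
  ext
  rw [up_smul_coe]
  have h1 := Complex.two_pi_I_ne_zero
  refine mul_left_cancel₀ h1 ?_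
  rw [hn]
  ring

/-- The automorphy factor of `al₁` at its fixed point is a primitive cube root of unity, whose
fourth power is not `1`. -/
lemma eisFour_ellPoint : ModularForm.E₄ ellPoint = 0 := by
  have h1 := eisFour_smul al₁ ellPoint
  rw [al₁_smul_ellPoint, denom_al₁] at h1
  have h3 := ellPoint_rel
  have h2 : ((ellPoint : ℂ) - 2) ≠ 0 := by
    intro h
    rw [sub_eq_zero.1 h] at h3
    norm_num at h3
  have h4 : (-3 * (ellPoint : ℂ) + 4) ^ 4 = -3 * ellPoint + 4 := by
    linear_combination (27 * (ellPoint : ℂ) ^ 2 - 63 * ellPoint + 36) * h3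
  rw [h4] at h1
  have h5 : ((ellPoint : ℂ) - 1) * ModularForm.E₄ ellPoint = 0 := by
    linear_combination (-1 / 3 : ℂ) * h1 * (-1)
  have h6 : ((ellPoint : ℂ) - 1) ≠ 0 := by
    intro h
    rw [sub_eq_zero.1 h] at h3
    norm_num at h3
  exact (mul_eq_zero.1 h5).resolve_left h6

/-- In the fundamental domain any zero of `E₄` has the same `q` as the translate of `ellPoint` lying
there. So every zero is equivalent to `ellPoint`, and a conjugate of `al₁` fixes it. -/
lemma exists_smul_eq_of_eisFour_eq_zero {z : ℍ} (hz : ModularForm.E₄ z = 0) :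
    ∃ δ : SL(2, ℤ), δ 0 0 + δ 1 1 = -1 ∧ δ • z = z := by
  obtain ⟨g, hg⟩ := ModularGroup.exists_smul_mem_fd z
  obtain ⟨h, hh⟩ := ModularGroup.exists_smul_mem_fd ellPoint
  obtain ⟨n, hn⟩ := exists_up_smul_eq (by rw [eisFour_smul, hz, mul_zero])
    (by rw [eisFour_smul, eisFour_ellPoint, mul_zero])
    (ModularGroup.three_le_four_mul_im_sq_of_mem_fd hg)
    (ModularGroup.three_le_four_mul_im_sq_of_mem_fd hh)
  have h1 : z = (g⁻¹ * up n * h) • ellPoint := by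
    rw [mul_smul, mul_smul, ← hn, inv_smul_smul]
  set k := g⁻¹ * up n * h
  refine ⟨k * al₁ * k⁻¹, ?_, ?_⟩
  · have h2 := Matrix.trace_fin_two ((k * al₁ * k⁻¹ : SL(2, ℤ)) : Matrix (Fin 2) (Fin 2) ℤ)
    rw [← h2, Matrix.SpecialLinearGroup.coe_mul, Matrix.trace_mul_comm,
      ← Matrix.SpecialLinearGroup.coe_mul, ← mul_assoc, inv_mul_cancel, one_mul,
      Matrix.trace_fin_two]
    simp [al₁]
  · rw [h1, mul_smul, inv_smul_smul, mul_smul, al₁_smul_ellPoint]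

/-- The product of `E₄` and `eisThree` has weight `6`, and as a polynomial in the Hauptmodul it is
divisible by `t - r`, which has order `3` at `z`. But `eisThree` has only order `2` there. -/
lemma eisFour_eq_zero {z : ℍ} (hz : eisThree z = 0) : ModularForm.E₄ z = 0 := by
  have hb := ModularFormClass.bdd_at_infty ModularForm.E₄
  have hG3 : IsBoundedAtImInfty fun τ => eisThree (third τ) :=
    isBoundedAtImInfty_eisThree.comp_tendsto tendsto_third
  have hE : MDiff (ModularForm.E₄ : ℍ → ℂ) := ModularForm.E₄.holo'
  obtain ⟨a, b, c, h⟩ := exists_eq_formInfty_mul (F := fun τ => ModularForm.E₄ τ * eisThree τ)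
    (F₀ := fun τ => -1 / 3 * (ModularForm.E₄ τ * eisThree (third τ)))
    (mdiff_mul hE mdiff_eisThree)
    (fun τ => by rw [eisThree_up_smul, eisFour_smul, denom_up, one_pow, one_mul])
    (fun τ => by rw [eisThree_lo_three_smul, eisFour_smul]; ring)
    (isBoundedAtImInfty_mul hb isBoundedAtImInfty_eisThree)
    (fun τ => by rw [eisThree_sw_smul, eisFour_smul, denom_sw]; ring)
    ((isBoundedAtImInfty_mul hb hG3).const_mul_left _)
  have hC := formInfty_ne_zero
  by_contra hne
  have ht := eisThree_eq_zero_iff.1 hz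
  set r := hauptmodul ellPoint with hr
  have h0 : a * r ^ 2 + b * r + c = 0 := by
    have h1 := h ellPoint
    rw [eisThree_ellPoint, mul_zero] at h1
    exact (mul_eq_zero.1 h1.symm).resolve_left (hC _)
  have m1 : MDiff fun τ => hauptmodul τ - r := mdiff_sub mdiff_hauptmodul (mdiff_const r)
  have m2 : MDiff fun τ => formInfty τ * (a * (hauptmodul τ - r) + (2 * a * r + b)) :=
    mdiff_mul mdiff_formInfty (mdiff_add (mdiff_const_mul a m1) (mdiff_const _))
  have h1 (τ : ℍ) : ModularForm.E₄ τ * eisThree τ = (hauptmodul τ - r) *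
      (formInfty τ * (a * (hauptmodul τ - r) + (2 * a * r + b))) := by
    rw [h]
    linear_combination formInfty τ * h0
  have h2 : ordAt (fun τ => ModularForm.E₄ τ * eisThree τ) z = 2 := by
    rw [ordAt_mul hE mdiff_eisThree, ordAt_eq_zero hne, ordAt_eisThree ht, zero_add]
  simp only [h1] at h2
  rw [ordAt_mul m1 m2, ordAt_hauptmodul_sub_eq_three ht] at h2
  have h3 : (3 : ℕ∞) ≤ 2 := h2 ▸ le_self_add
  norm_num at h3

lemma smul_eq_self_rel {δ : SL(2, ℤ)} {z : ℍ} (h : δ • z = z) :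
    (δ 1 0 : ℂ) * z ^ 2 + ((δ 1 1 : ℂ) - δ 0 0) * z - δ 0 1 = 0 := by
  have h1 := congrArg UpperHalfPlane.coe h
  have h2 := denom_ne_zero (δ : GL (Fin 2) ℝ) z
  change denom δ z ≠ 0 at h2
  rw [ModularGroup.denom_apply] at h2
  rw [coe_specialLinearGroup_apply] at h1
  simp only [algebraMap_int_eq, eq_intCast, ofReal_intCast] at h1
  rw [div_eq_iff h2] at h1
  linear_combination -h1

lemma int_eq_zero_of_mul_eq {z : ℍ} {m n : ℤ} (h : (m : ℂ) * z = n) : m = 0 ∧ n = 0 := by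
  have h1 := congrArg Complex.im h
  simp at h1
  have hm : m = 0 := h1.resolve_right z.im_ne_zero
  refine ⟨hm, ?_⟩
  rw [hm] at h
  simp at h
  exact_mod_cast h.symm

/-- The zeros of `eisThree` are elliptic points. -/
lemma exists_smul_eq_of_eisThree_eq_zero {z : ℍ} (hz : eisThree z = 0) :
    ∃ δ ∈ CongruenceSubgroup.Gamma1 3, δ 0 0 + δ 1 1 = -1 ∧ δ • z = z := by
  obtain ⟨δ, hδ, hfix⟩ := exists_smul_eq_of_eisFour_eq_zero (eisFour_eq_zero hz)
  -- The zeros of `eisThree` are stable under the Fricke involution, so `E₄` vanishes at `3z` as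
  -- well.
  have hz' : ModularForm.E₄ (tri z) = 0 := by
    have h1 : ModularForm.E₄ (fricke z) = 0 := eisFour_eq_zero (by
      rw [eisThree_fricke, hz, mul_zero])
    rw [fricke, eisFour_smul] at h1
    exact (mul_eq_zero.1 h1).resolve_left (pow_ne_zero 4 (denom_ne_zero _ _))
  obtain ⟨δ', hδ', hfix'⟩ := exists_smul_eq_of_eisFour_eq_zero hz'
  refine ⟨δ, ?_, hδ, hfix⟩
  have e1 := smul_eq_self_rel hfix
  have e2 := smul_eq_self_rel hfix'
  rw [coe_tri] at e2
  have d1 := Matrix.SpecialLinearGroup.det_coe δ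
  have d2 := Matrix.SpecialLinearGroup.det_coe δ'
  rw [Matrix.det_fin_two] at d1 d2
  rw [mem_Gamma1_iff]
  generalize δ 0 0 = a at *
  generalize δ 0 1 = b at *
  generalize δ 1 0 = c at *
  generalize δ 1 1 = d at *
  generalize δ' 0 0 = a' at *
  generalize δ' 0 1 = b' at *
  generalize δ' 1 0 = c' at *
  generalize δ' 1 1 = d' at *
  -- The fixed point equations of `z` under `δ` and of `3z` under `δ'` are proportional quadratic
  -- equations for `z`. Both matrices have discriminant `-3`, and comparison gives `c² = 9 c'²`, so
  -- `3 ∣ c`.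
  have h1 : ((9 * c' * (d - a) - 3 * (d' - a') * c : ℤ) : ℂ) * z =
      ((9 * c' * b - b' * c : ℤ) : ℂ) := by
    push_cast
    linear_combination 9 * c' * e1 - c * e2
  obtain ⟨h2, h3⟩ := int_eq_zero_of_mul_eq h1
  have h4 : c ^ 2 = 9 * c' ^ 2 := by
    have k1 : (d - a) ^ 2 + 4 * b * c = -3 := by
      linear_combination (a + d - 1) * hδ - 4 * d1
    have k2 : (d' - a') ^ 2 + 4 * b' * c' = -3 := by
      linear_combination (a' + d' - 1) * hδ' - 4 * d2
    have k3 : 27 * (c ^ 2 - 9 * c' ^ 2) = 0 := by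
      have k4 : 9 * c' * (d - a) = 3 * (d' - a') * c := by linarith
      have k5 : 9 * c' * b = b' * c := by linarith
      linear_combination (-81 * c' ^ 2) * k1 + 9 * c ^ 2 * k2 +
        (9 * c' * (d - a) + 3 * (d' - a') * c) * k4 + 36 * c * c' * k5
    linarith
  have h5 : (3 : ℤ) ∣ c := by
    refine Int.prime_three.dvd_of_dvd_pow (n := 2) ?_
    rw [h4]
    exact ⟨3 * c' ^ 2, by ring⟩
  obtain ⟨m, rfl⟩ := h5
  have h6 : a * (-1 - a) = 1 + 3 * (b * m) := by
    have : d = -1 - a := by linarith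
    rw [this] at d1
    linarith
  have h7 : (3 : ℤ) ∣ (a - 1) := by
    refine Int.prime_three.dvd_of_dvd_pow (n := 2) ⟨-a - b * m, ?_⟩
    linear_combination -h6
  push_cast
  refine ⟨h7, ⟨m, rfl⟩, ?_⟩
  omega

end EisensteinSeriesFour

end

end ModCurve

namespace ModCurve

open UpperHalfPlane hiding I
open Filter Topology Complex Metric
open scoped Manifold Real

noncomputable section

/-! ### Holomorphic cube roots -/

section CubeRoots

/-- Integrate the logarithmic derivative, normalized at the centre; then `exp (-L) * g` is constant.
-/
lemma exists_exp_eq_on_ball {g : ℂ → ℂ} {c : ℂ} {R : ℝ} (hg : DifferentiableOn ℂ g (ball c R))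
    (h0 : ∀ z ∈ ball c R, g z ≠ 0) :
    ∃ L : ℂ → ℂ, DifferentiableOn ℂ L (ball c R) ∧ ∀ z ∈ ball c R, exp (L z) = g z := by
  rcases le_or_gt R 0 with hR | hR
  · rw [ball_eq_empty.2 hR]
    exact ⟨0, differentiableOn_empty, by simp⟩
  have hc : c ∈ ball c R := mem_ball_self hR
  have hd : DifferentiableOn ℂ (fun z => deriv g z / g z) (ball c R) :=
    (hg.deriv isOpen_ball).div hg h0
  obtain ⟨L, hL0, hL⟩ := hd.isExactOn_ball.with_val_at c (log (g c))
  have hLd : DifferentiableOn ℂ L (ball c R) := fun z hz =>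
    (hL z hz).differentiableAt.differentiableWithinAt
  refine ⟨L, hLd, fun z hz => ?_⟩
  have hder (w : ℂ) (hw : w ∈ ball c R) : HasDerivAt (fun z => exp (-L z) * g z) 0 w := by
    have h1 := (hL w hw).neg.cexp
    have h2 := (hg.differentiableAt (isOpen_ball.mem_nhds hw)).hasDerivAt
    refine (h1.mul h2).congr_deriv ?_
    have h3 := h0 w hw
    simp only [Pi.neg_apply]
    field_simp
    ring
  have h1 := isOpen_ball.is_const_of_deriv_eq_zero (convex_ball c R).isPreconnected
    (fun w hw => (hder w hw).differentiableAt.differentiableWithinAt)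
    (fun w hw => (hder w hw).deriv) hz hc
  simp only [hL0] at h1
  rw [exp_neg (log _), exp_log (h0 c hc), inv_mul_cancel₀ (h0 c hc), exp_neg] at h1
  have h2 := exp_ne_zero (L z)
  field_simp at h1
  exact h1.symm

/-- The closed ball is compact, so there are finitely many zeros. Dividing out the cube of a
polynomial leaves a function without zeros, which is an exponential. -/
lemma exists_pow_three_eq_on_ball {g : ℂ → ℂ} {c : ℂ} {R : ℝ}
    (hg : AnalyticOnNhd ℂ g (closedBall c R))
    (hord : ∀ z ∈ closedBall c R, ∃ n : ℕ, analyticOrderAt g z = (3 * n : ℕ)) :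
    ∃ f : ℂ → ℂ, DifferentiableOn ℂ f (ball c R) ∧ ∀ z ∈ ball c R, f z ^ 3 = g z := by
  have hm : MeromorphicOn g (closedBall c R) := fun z hz => (hg z hz).meromorphicAt
  have hordm (z : ℂ) (hz : z ∈ closedBall c R) : ∃ n : ℕ, meromorphicOrderAt g z = ((3 * n : ℕ) : ℤ) := by
    obtain ⟨n, hn⟩ := hord z hz
    refine ⟨n, ?_⟩
    rw [(hg z hz).meromorphicOrderAt_eq, hn]
    rfl
  set D := MeromorphicOn.divisor g (closedBall c R) with hD
  have hfin : D.support.Finite := D.finiteSupport (isCompact_closedBall c R)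
  obtain ⟨u, hu, hu0, hgu⟩ := hm.extract_zeros_poles (fun z => by
    obtain ⟨n, hn⟩ := hordm z z.2
    rw [hn]
    exact WithTop.coe_ne_top) hfin
  have hDk (z : ℂ) : ∃ k : ℕ, D z = (3 * k : ℕ) := by
    by_cases hz : z ∈ closedBall c R
    · obtain ⟨n, hn⟩ := hordm z hz
      refine ⟨n, ?_⟩
      rw [hD, MeromorphicOn.divisor_apply hm hz, hn]
      rfl
    · exact ⟨0, by simpa using D.apply_eq_zero_of_notMem hz⟩
  choose k hk using hDk
  have hprod : (∏ᶠ w, (fun z : ℂ => z - w) ^ D w) =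
      fun z => (∏ w ∈ hfin.toFinset, (z - w) ^ k w) ^ 3 := by
    rw [finprod_eq_prod_of_mulSupport_subset (s := hfin.toFinset)]
    · ext z
      rw [Finset.prod_apply, ← Finset.prod_pow]
      refine Finset.prod_congr rfl fun w _ => ?_
      rw [Pi.pow_apply, hk, zpow_natCast, mul_comm, pow_mul]
    · intro w hw
      rw [Set.Finite.coe_toFinset, Function.mem_support]
      rintro h
      exact hw (by beta_reduce; rw [h, zpow_zero])
  rw [hprod] at hgu
  obtain ⟨L, hL, hLe⟩ := exists_exp_eq_on_ball
    (fun z hz => (hu z (ball_subset_closedBall hz)).differentiableAt.differentiableWithinAt)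
    (fun z hz => hu0 ⟨z, ball_subset_closedBall hz⟩)
  refine ⟨fun z => (∏ w ∈ hfin.toFinset, (z - w) ^ k w) * exp (L z / 3), ?_, fun z hz => ?_⟩
  · have : Differentiable ℂ fun z => ∏ w ∈ hfin.toFinset, (z - w) ^ k w := by fun_prop
    exact this.differentiableOn.mul (hL.div_const 3).cexp
  · have h1 : g =ᶠ[𝓝[≠] z] fun z => (∏ w ∈ hfin.toFinset, (z - w) ^ k w) ^ 3 * u z := by
      have h2 := mem_codiscreteWithin_iff_forall_mem_nhdsNE.1 hgu z (ball_subset_closedBall hz)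
      filter_upwards [h2, nhdsWithin_le_nhds (isOpen_ball.mem_nhds hz)] with w hw hw'
      exact hw.resolve_right fun h => h (ball_subset_closedBall hw')
    have h3 : Continuous fun z => (∏ w ∈ hfin.toFinset, (z - w) ^ k w) ^ 3 := by fun_prop
    have h2 := ((hg z (ball_subset_closedBall hz)).continuousAt.eventuallyEq_nhds_iff_eventuallyEq_nhdsNE
      (h3.continuousAt.mul (hu z (ball_subset_closedBall hz)).continuousAt)).1 h1
    rw [h2.self_of_nhds, mul_pow, ← exp_nat_mul]
    push_cast
    rw [mul_div_cancel₀ _ (three_ne_zero), hLe z hz, Pi.mul_apply]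

lemma eventuallyEq_of_pow_three_eq {f g : ℂ → ℂ} {z : ℂ} (hf : ContinuousAt f z)
    (hg : ContinuousAt g z) (h : ∀ᶠ w in 𝓝 z, f w ^ 3 = g w ^ 3) (hz : f z = g z) (h0 : f z ≠ 0) :
    f =ᶠ[𝓝 z] g := by
  have h1 : ContinuousAt (fun w => f w ^ 2 + f w * g w + g w ^ 2) z := by fun_prop
  have h2 : f z ^ 2 + f z * g z + g z ^ 2 ≠ 0 := by
    rw [← hz]
    have : f z ^ 2 + f z * f z + f z ^ 2 = 3 * f z ^ 2 := by ring
    rw [this]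
    exact mul_ne_zero three_ne_zero (pow_ne_zero 2 h0)
  filter_upwards [h, h1.eventually_ne h2] with w hw hw'
  have h3 : (f w - g w) * (f w ^ 2 + f w * g w + g w ^ 2) = 0 := by linear_combination hw
  exact sub_eq_zero.1 ((mul_eq_zero.1 h3).resolve_right hw')

/-- Balls that exhaust the upper half-plane. -/
def hBall (n : ℕ) : Set ℂ := ball ((n + 1 : ℝ) * I) (n + 1 - 1 / (n + 1 : ℝ))

lemma mem_hBall_iff {n : ℕ} {z : ℂ} :
    z ∈ hBall n ↔ ‖z - (n + 1 : ℝ) * I‖ < n + 1 - 1 / (n + 1 : ℝ) := by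
  rw [hBall, mem_ball, dist_eq_norm]

lemma hBall_mono {m n : ℕ} (h : m ≤ n) : hBall m ⊆ hBall n := by
  refine ball_subset_ball' ?_
  have h1 : (m : ℝ) ≤ n := by exact_mod_cast h
  have h2 : dist (((m + 1 : ℝ) : ℂ) * I) ((n + 1 : ℝ) * I) = n - m := by
    rw [dist_eq_norm, ← sub_mul, ← ofReal_sub, norm_mul, norm_I, mul_one, norm_real,
      Real.norm_eq_abs, abs_of_nonpos (by linarith)]
    ring
  rw [h2]
  have h3 : 1 / (n + 1 : ℝ) ≤ 1 / (m + 1 : ℝ) := by gcongr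
  linarith

lemma exists_mem_hBall {z : ℂ} (hz : 0 < z.im) : ∃ n, z ∈ hBall n := by
  obtain ⟨n, hn⟩ := exists_nat_gt ((‖z‖ ^ 2 + 3) / (2 * z.im))
  refine ⟨n, ?_⟩
  rw [mem_hBall_iff]
  rw [div_lt_iff₀ (by positivity)] at hn
  have hpos : (0 : ℝ) ≤ n := Nat.cast_nonneg n
  have h0 : 1 / (n + 1 : ℝ) ≤ 1 := by
    rw [div_le_one (by linarith)]
    linarith
  have h0' : 1 / (n + 1 : ℝ) * (n + 1) = 1 := by field_simp
  refine lt_of_pow_lt_pow_left₀ 2 (by linarith) ?_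
  have h1 : ‖z - (n + 1 : ℝ) * I‖ ^ 2 = ‖z‖ ^ 2 - 2 * (n + 1) * z.im + (n + 1) ^ 2 := by
    rw [← normSq_eq_norm_sq, ← normSq_eq_norm_sq, normSq_apply, normSq_apply]
    simp
    ring
  rw [h1]
  have h2 : 0 ≤ 1 / (n + 1 : ℝ) := by positivity
  nlinarith [sq_nonneg (1 / (n + 1 : ℝ))]

lemma closedBall_subset (n : ℕ) :
    closedBall ((n + 1 : ℝ) * I) (n + 1 - 1 / (n + 1 : ℝ)) ⊆ {z : ℂ | 0 < z.im} := by
  intro z hz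
  rw [mem_closedBall, dist_eq_norm] at hz
  have h1 := (abs_im_le_norm (z - (n + 1 : ℝ) * I)).trans hz
  have h2 : (z - (n + 1 : ℝ) * I).im = z.im - (n + 1) := by simp
  rw [h2] at h1
  have h3 := (abs_le.1 h1).1
  have h4 : 0 < 1 / (n + 1 : ℝ) := by positivity
  change 0 < z.im
  linarith

/-- A holomorphic function on `ℍ` whose zeros have orders divisible by `3` is a cube. -/
lemma exists_pow_three_eq {g : ℍ → ℂ} (hg : MDiff g) (h0 : ∃ τ, g τ ≠ 0)
    (hord : ∀ z, ∃ n : ℕ, ordAt g z = (3 * n : ℕ)) : ∃ f : ℍ → ℂ, MDiff f ∧ ∀ τ, f τ ^ 3 = g τ := by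
  obtain ⟨t, ht⟩ := h0
  obtain ⟨w, hw⟩ := IsAlgClosed.exists_pow_nat_eq (g t) (n := 3) (by norm_num)
  have hw0 : w ≠ 0 := by
    rintro rfl
    exact ht (by rw [← hw, zero_pow (by norm_num)])
  obtain ⟨N, hN⟩ := exists_mem_hBall t.2
  -- Prescribing the value `w` at one point `t` makes the cube roots on the growing balls agree, so
  -- they glue.
  have hloc (n : ℕ) : ∃ f : ℂ → ℂ, DifferentiableOn ℂ f (hBall n) ∧
      (∀ z ∈ hBall n, f z ^ 3 = g (ofComplex z)) ∧ (N ≤ n → f t = w) := by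
    obtain ⟨f, hf, hfg⟩ := exists_pow_three_eq_on_ball (g := fun z => g (ofComplex z))
      (c := (n + 1 : ℝ) * I) (R := n + 1 - 1 / (n + 1 : ℝ))
      (fun z hz => analyticAt_comp_ofComplex hg ⟨z, closedBall_subset n hz⟩)
      (fun z hz => hord ⟨z, closedBall_subset n hz⟩)
    by_cases hn : N ≤ n
    · have htn := hBall_mono hn hN
      have h1 : f t ^ 3 = w ^ 3 := by rw [hfg _ htn, ofComplex_apply, hw]
      have hft : f t ≠ 0 := by
        intro h
        rw [h, zero_pow (by norm_num)] at h1
        exact hw0 (pow_eq_zero_iff (by norm_num) |>.1 h1.symm)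
      refine ⟨fun z => w / f t * f z, hf.const_mul _, fun z hz => ?_, fun _ => ?_⟩
      · rw [mul_pow, div_pow, h1, div_self (pow_ne_zero 3 hw0), one_mul, hfg z hz]
      · exact div_mul_cancel₀ _ hft
    · exact ⟨f, hf, hfg, fun h => absurd h hn⟩
  choose F hF hFg hFt using hloc
  have hcompat {m n : ℕ} (hm : N ≤ m) (hmn : m ≤ n) : Set.EqOn (F n) (F m) (hBall m) := by
    have htm := hBall_mono hm hN
    have hd : DifferentiableOn ℂ (F n) (hBall m) := (hF n).mono (hBall_mono hmn)
    refine (hd.analyticOnNhd isOpen_ball).eqOn_of_preconnected_of_eventuallyEq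
      ((hF m).analyticOnNhd isOpen_ball) (convex_ball _ _).isPreconnected htm ?_
    have hnb := isOpen_ball.mem_nhds htm
    refine eventuallyEq_of_pow_three_eq (hd.differentiableAt hnb).continuousAt
      ((hF m).differentiableAt hnb).continuousAt ?_ ?_ ?_
    · filter_upwards [hnb] with z hz
      rw [hFg n z (hBall_mono hmn hz), hFg m z hz]
    · rw [hFt n (hm.trans hmn), hFt m hm]
    · rwa [hFt n (hm.trans hmn)]
  have hex (τ : ℍ) : ∃ n, N ≤ n ∧ (τ : ℂ) ∈ hBall n := by
    obtain ⟨n, hn⟩ := exists_mem_hBall τ.2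
    exact ⟨max N n, le_max_left _ _, hBall_mono (le_max_right _ _) hn⟩
  choose ν hν hνb using hex
  have hval {n : ℕ} (hn : N ≤ n) (τ : ℍ) (hτ : (τ : ℂ) ∈ hBall n) : F (ν τ) τ = F n τ := by
    rcases le_total n (ν τ) with h | h
    · exact hcompat hn h hτ
    · exact (hcompat (hν τ) h (hνb τ)).symm
  refine ⟨fun τ => F (ν τ) τ, fun τ => ?_, fun τ => ?_⟩
  · rw [UpperHalfPlane.mdifferentiableAt_iff]
    have hnb := isOpen_ball.mem_nhds (hνb τ)
    refine ((hF (ν τ)).differentiableAt hnb).congr_of_eventuallyEq ?_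
    filter_upwards [hnb, eventually_coe_ofComplex τ] with z hz hz'
    have := hval (hν τ) (ofComplex z) (by rwa [hz'])
    rw [Function.comp_apply, this, hz']
  · rw [hFg _ _ (hνb τ), ofComplex_apply]

end CubeRoots

end

end ModCurve

namespace ModCurve

open UpperHalfPlane hiding I
open Filter Topology Complex
open scoped ModularForm Manifold Real

noncomputable section

/-! ### Automorphy factors at fixed points -/

section FixedPoints

lemma slash_eq_smul_iff {f : ℍ → ℂ} {k : ℕ} {γ : SL(2, ℤ)} {ζ : ℂ} :
    f ∣[(k : ℤ)] γ = ζ • f ↔ ∀ τ, f (γ • τ) = ζ * denom γ τ ^ k * f τ := by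
  rw [funext_iff]
  refine forall_congr' fun τ => ?_
  have h4 : denom γ τ ≠ 0 := denom_ne_zero _ _
  rw [ModularForm.SL_slash_apply, zpow_neg, zpow_natCast, ← div_eq_mul_inv,
    div_eq_iff (pow_ne_zero _ h4), Pi.smul_apply, smul_eq_mul]
  constructor <;> intro h <;> rw [h] <;> ring

lemma slash_eq_self_iff {f : ℍ → ℂ} {k : ℕ} {γ : SL(2, ℤ)} :
    f ∣[(k : ℤ)] γ = f ↔ ∀ τ, f (γ • τ) = denom γ τ ^ k * f τ := by
  have h := slash_eq_smul_iff (f := f) (k := k) (γ := γ) (ζ := 1)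
  simpa using h

/-- At a fixed point the automorphy factor is an eigenvalue of `δ`, hence a root of the
characteristic polynomial. -/
lemma denom_rel_of_smul_eq {δ : SL(2, ℤ)} {z : ℍ} (h : δ • z = z) (htr : δ 0 0 + δ 1 1 = -1) :
    denom δ z ^ 2 + denom δ z + 1 = 0 := by
  have h1 := smul_eq_self_rel h
  have h2 := Matrix.SpecialLinearGroup.det_coe δ
  rw [Matrix.det_fin_two] at h2
  have h3 : (δ 0 0 : ℂ) * δ 1 1 - δ 0 1 * δ 1 0 = 1 := by exact_mod_cast h2
  have h4 : (δ 0 0 : ℂ) + δ 1 1 = -1 := by exact_mod_cast htr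
  rw [ModularGroup.denom_apply]
  linear_combination (δ 1 0 : ℂ) * h1 - h3 + ((δ 1 0 : ℂ) * z + δ 1 1) * h4

lemma coe_smul_sub_coe_smul (δ : SL(2, ℤ)) (τ z : ℍ) :
    ((δ • τ : ℍ) : ℂ) - (δ • z : ℍ) = (τ - z) / (denom δ τ * denom δ z) := by
  have h1 : denom δ τ ≠ 0 := denom_ne_zero _ _
  have h2 : denom δ z ≠ 0 := denom_ne_zero _ _
  have h3 := Matrix.SpecialLinearGroup.det_coe δ
  rw [Matrix.det_fin_two] at h3
  have h4 : (δ 0 0 : ℂ) * δ 1 1 - δ 0 1 * δ 1 0 = 1 := by exact_mod_cast h3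
  rw [ModularGroup.denom_apply] at h1 h2 ⊢
  rw [ModularGroup.denom_apply]
  rw [coe_specialLinearGroup_apply, coe_specialLinearGroup_apply]
  simp only [algebraMap_int_eq, eq_intCast, ofReal_intCast]
  rw [div_sub_div _ _ h1 h2]
  congr 1
  linear_combination ((τ : ℂ) - z) * h4

/-- The relation between the order of a form at a fixed point and its automorphy factor. -/
lemma eq_one_of_smul_eq {h : ℍ → ℂ} (hh : MDiff h) {δ : SL(2, ℤ)} {z : ℍ} (hfix : δ • z = z)
    {ζ : ℂ} {k : ℕ} (hinv : ∀ τ, h (δ • τ) = ζ * denom δ τ ^ k * h τ) {n : ℕ} (hn : ordAt h z = n) :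
    ζ * denom δ z ^ (k + 2 * n) = 1 := by
  obtain ⟨u, hu, hu0, hev⟩ := (analyticAt_comp_ofComplex hh z).analyticOrderAt_eq_natCast.1 hn
  have hev' : ∀ᶠ τ : ℍ in 𝓝 z, h τ = ((τ : ℂ) - z) ^ n * u τ := by
    filter_upwards [continuous_coe.continuousAt.eventually hev] with τ hτ
    simpa using hτ
  have hcont : Tendsto (fun τ : ℍ => δ • τ) (𝓝 z) (𝓝 z) := by
    have : Continuous fun τ : ℍ => δ • τ := continuous_const_smul δ
    simpa [hfix] using this.tendsto z
  have hucont : Tendsto (fun τ : ℍ => u τ) (𝓝 z) (𝓝 (u z)) :=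
    hu.continuousAt.tendsto.comp continuous_coe.continuousAt
  have hdcont : Tendsto (fun τ : ℍ => denom δ τ) (𝓝 z) (𝓝 (denom δ z)) := by
    have : Continuous fun τ : ℍ => denom δ τ := by
      simp only [ModularGroup.denom_apply]
      fun_prop
    exact this.tendsto z
  -- Writing `h = (τ - z) ^ n * u` and using `δ • τ - z = (τ - z) / (j(τ) j(z))` for the automorphy
  -- factor `j`, the powers of `τ - z` cancel; the limit at `z` compares `u z` with itself.
  have e1 : ∀ᶠ τ : ℍ in 𝓝[≠] z,
      u (δ • τ : ℍ) = ζ * denom δ τ ^ k * (denom δ τ * denom δ z) ^ n * u τ := by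
    filter_upwards [nhdsWithin_le_nhds hev', nhdsWithin_le_nhds (hcont.eventually hev'),
      self_mem_nhdsWithin] with τ h1 h2 h3
    have h4 : (τ : ℂ) - z ≠ 0 := sub_ne_zero.2 fun h => h3 (UpperHalfPlane.ext h)
    have h5 : denom δ τ ≠ 0 := denom_ne_zero _ _
    have h6 : denom δ z ≠ 0 := denom_ne_zero _ _
    rw [hinv, h1] at h2
    have h7 := coe_smul_sub_coe_smul δ τ z
    rw [hfix] at h7
    rw [h7, div_pow] at h2
    have h8 := pow_ne_zero n (mul_ne_zero h5 h6)
    have h9 := pow_ne_zero n h4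
    rw [div_mul_eq_mul_div, eq_div_iff h8] at h2
    refine mul_left_cancel₀ h9 ?_
    rw [← h2]
    ring
  have t1 : Tendsto (fun τ : ℍ => u (δ • τ : ℍ)) (𝓝[≠] z) (𝓝 (u z)) :=
    (hucont.comp hcont).mono_left nhdsWithin_le_nhds
  have t2 : Tendsto (fun τ : ℍ => ζ * denom δ τ ^ k * (denom δ τ * denom δ z) ^ n * u τ)
      (𝓝[≠] z) (𝓝 (ζ * denom δ z ^ k * (denom δ z * denom δ z) ^ n * u z)) :=
    (((hdcont.pow k).const_mul ζ |>.mul ((hdcont.mul_const _).pow n)).mul hucont).mono_left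
      nhdsWithin_le_nhds
  have h1 := tendsto_nhds_unique (t1.congr' e1) t2
  refine mul_right_cancel₀ hu0 ?_
  rw [one_mul]
  conv_rhs => rw [h1]
  ring

end FixedPoints

/-! ### The form of weight 6 and its cube root -/

section CubicForm

/-- One has `up 1 = al₀ * lo 3`, and both unipotents multiply `etaQuot` by the same factor `om⁻¹ =
om²`. -/
lemma etaQuot_al₀_smul (τ : ℍ) : etaQuot (al₀ • τ) = etaQuot τ := by
  have h : up 1 = al₀ * lo 3 := by rw [lo_three_eq]; group
  have h1 := etaQuot_up_smul 1 ((lo 3)⁻¹ • τ)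
  have h2 := etaQuot_lo_three_smul ((lo 3)⁻¹ • τ)
  rw [smul_inv_smul] at h2
  rw [h, mul_smul, smul_inv_smul] at h1
  rw [h1, h2]
  have h3 := om_ne_zero
  rw [zpow_neg, zpow_one, inv_mul_eq_iff_eq_mul₀ h3, ← mul_assoc, ← pow_succ', om_pow_three, one_mul]

lemma al₁_eq : al₁ = up 1 * al₀ * (up 1)⁻¹ := by
  rw [← up_neg]
  apply sl_ext <;> simp [mul_apply_zero_zero, mul_apply_zero_one, mul_apply_one_zero,
    mul_apply_one_one, al₀, al₁]

lemma al₂_eq : al₂ = up 1 * al₁ * (up 1)⁻¹ := by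
  rw [← up_neg]
  apply sl_ext <;> simp [mul_apply_zero_zero, mul_apply_zero_one, mul_apply_one_zero,
    mul_apply_one_one, al₂, al₁]

lemma etaQuot_conj_up_smul {γ : SL(2, ℤ)} (h : ∀ τ, etaQuot (γ • τ) = etaQuot τ) (n : ℤ) (τ : ℍ) :
    etaQuot ((up n * γ * (up n)⁻¹) • τ) = etaQuot τ := by
  rw [mul_smul, mul_smul, etaQuot_up_smul, h, ← up_neg, etaQuot_up_smul, ← mul_assoc,
    ← zpow_add₀ om_ne_zero, neg_neg, neg_add_cancel, zpow_zero, one_mul]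

lemma etaQuot_smul {γ : SL(2, ℤ)} (hγ : γ ∈ levelNineOne) : ∀ τ, etaQuot (γ • τ) = etaQuot τ := by
  have h1 : ∀ τ, etaQuot (al₁ • τ) = etaQuot τ := by
    rw [al₁_eq]; exact etaQuot_conj_up_smul etaQuot_al₀_smul 1
  refine levelNineOne_induction (P := fun γ => ∀ τ, etaQuot (γ • τ) = etaQuot τ)
    etaQuot_al₀_smul h1 ?_ (fun τ => ?_) (fun τ => by rw [one_smul])
    (fun g _ h _ hg hh τ => by rw [mul_smul, hg, hh])
    (fun g _ hg τ => by rw [← hg (g⁻¹ • τ), smul_inv_smul]) hγ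
  · rw [al₂_eq]; exact etaQuot_conj_up_smul h1 1
  · rw [etaQuot_up_smul, zpow_neg]
    have : om ^ (3 : ℤ) = 1 := by exact_mod_cast om_pow_three
    rw [this, inv_one, one_mul]

lemma formInfty_smul {γ : SL(2, ℤ)} (hγ : γ ∈ CongruenceSubgroup.Gamma0 3) :
    ∀ τ, formInfty (γ • τ) = denom γ τ ^ 6 * formInfty τ := by
  rw [← slash_eq_self_iff]
  refine Gamma0_three_induction (P := fun γ => formInfty ∣[((6 : ℕ) : ℤ)] γ = formInfty)
    ?_ ?_ ?_ (SlashAction.slash_one _ _) (fun g h hg hh => by rw [SlashAction.slash_mul, hg, hh])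
    (fun g hg => by
      conv_lhs => rw [← hg]
      rw [← SlashAction.slash_mul, mul_inv_cancel, SlashAction.slash_one]) hγ
  · rw [slash_eq_self_iff]
    intro τ
    rw [ModularGroup.SL_neg_smul, one_smul, ModularGroup.denom_apply]
    norm_num
  · rw [slash_eq_self_iff]
    intro τ
    rw [formInfty_up_smul, denom_up, one_pow, one_mul]
  · rw [slash_eq_self_iff]
    exact formInfty_lo_three_smul

/-- The value of `etaQuot` at `ellPoint`. -/
def ellValue : ℂ := etaQuot ellPoint

lemma ellValue_ne_zero : ellValue ≠ 0 := etaQuot_ne_zero _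

/-- The factor of `hauptmodul τ - hauptmodul ellPoint` complementary to
`etaQuot τ - etaQuot ellPoint`. -/
def quadFactor (τ : ℍ) : ℂ := etaQuot τ ^ 2 + ellValue * etaQuot τ + ellValue ^ 2

lemma mdiff_quadFactor : MDiff quadFactor :=
  mdiff_add (mdiff_add (mdiff_pow mdiff_etaQuot 2) (mdiff_const_mul _ mdiff_etaQuot))
    (mdiff_const _)

lemma hauptmodul_sub_eq (τ : ℍ) : hauptmodul τ - hauptmodul ellPoint =
    (etaQuot τ - ellValue) * quadFactor τ := by
  simp only [hauptmodul, quadFactor, ellValue]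
  ring

lemma hauptmodul_eq_of_quadFactor_eq_zero {z : ℍ} (hz : quadFactor z = 0) :
    hauptmodul z = hauptmodul ellPoint := by
  rw [← sub_eq_zero, hauptmodul_sub_eq, hz, mul_zero]

/-- The difference of Hauptmodul values has order `3` and is `(etaQuot - v) * quadFactor` for `v =
ellValue`. The factors have no common zero as `v ≠ 0`. -/
lemma ordAt_quadFactor {z : ℍ} (hz : quadFactor z = 0) : ordAt quadFactor z = 3 := by
  have h1 := ordAt_hauptmodul_sub_eq_three (hauptmodul_eq_of_quadFactor_eq_zero hz)
  simp only [hauptmodul_sub_eq] at h1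
  rw [ordAt_mul (mdiff_sub mdiff_etaQuot (mdiff_const _)) mdiff_quadFactor, ordAt_eq_zero, zero_add]
    at h1
  · exact h1
  · rw [sub_ne_zero]
    intro h
    rw [quadFactor, h] at hz
    have h2 : 3 * ellValue ^ 2 = 0 := by linear_combination hz
    exact mul_ne_zero three_ne_zero (pow_ne_zero 2 ellValue_ne_zero) h2

/-- A form of weight `6` which is a cube. -/
def cubicForm (τ : ℍ) : ℂ := etaQuot τ * formInfty τ * quadFactor τ ^ 2

lemma mdiff_cubicForm : MDiff cubicForm :=
  mdiff_mul (mdiff_mul mdiff_etaQuot mdiff_formInfty) (mdiff_pow mdiff_quadFactor 2)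

lemma cubicForm_eq_zero_iff {z : ℍ} : cubicForm z = 0 ↔ quadFactor z = 0 := by
  rw [cubicForm, mul_eq_zero, mul_eq_zero, pow_eq_zero_iff two_ne_zero]
  simp [etaQuot_ne_zero, formInfty_ne_zero]

lemma ordAt_cubicForm {z : ℍ} (hz : quadFactor z = 0) : ordAt cubicForm z = 6 := by
  have h1 : ordAt cubicForm z = _ := ordAt_mul (mdiff_mul mdiff_etaQuot mdiff_formInfty)
    (mdiff_pow mdiff_quadFactor 2) z
  rw [h1, ordAt_eq_zero (mul_ne_zero (etaQuot_ne_zero z) (formInfty_ne_zero z)),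
    ordAt_pow mdiff_quadFactor, ordAt_quadFactor hz]
  norm_num

lemma quadFactor_ellPoint : quadFactor ellPoint ≠ 0 := by
  have h2 : quadFactor ellPoint = 3 * ellValue ^ 2 := by
    rw [quadFactor, ← ellValue]
    ring
  rw [h2]
  exact mul_ne_zero three_ne_zero (pow_ne_zero 2 ellValue_ne_zero)

lemma cubicForm_smul {γ : SL(2, ℤ)} (hγ : γ ∈ levelNineOne) (τ : ℍ) :
    cubicForm (γ • τ) = denom γ τ ^ 6 * cubicForm τ := by
  rw [cubicForm, quadFactor, etaQuot_smul hγ, formInfty_smul (levelNine_le_Gamma0 hγ.1), cubicForm,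
    quadFactor]
  ring

lemma exists_cuspRoot : ∃ f : ℍ → ℂ, MDiff f ∧ ∀ τ, f τ ^ 3 = cubicForm τ := by
  refine exists_pow_three_eq mdiff_cubicForm
    ⟨ellPoint, fun h => quadFactor_ellPoint (cubicForm_eq_zero_iff.1 h)⟩ fun z => ?_
  by_cases hz : quadFactor z = 0
  · exact ⟨2, by rw [ordAt_cubicForm hz]; norm_num⟩
  · exact ⟨0, by rw [ordAt_eq_zero fun h => hz (cubicForm_eq_zero_iff.1 h)]; norm_num⟩

/-- A cube root of `cubicForm`, which is a cusp form of weight `2`. -/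
def cuspRoot : ℍ → ℂ := exists_cuspRoot.choose

lemma mdiff_cuspRoot : MDiff cuspRoot := exists_cuspRoot.choose_spec.1

lemma cuspRoot_pow_three (τ : ℍ) : cuspRoot τ ^ 3 = cubicForm τ := exists_cuspRoot.choose_spec.2 τ

lemma cuspRoot_eq_zero_iff {z : ℍ} : cuspRoot z = 0 ↔ quadFactor z = 0 := by
  rw [← cubicForm_eq_zero_iff, ← cuspRoot_pow_three, pow_eq_zero_iff three_ne_zero]

lemma cuspRoot_ellPoint : cuspRoot ellPoint ≠ 0 := fun h =>
  quadFactor_ellPoint (cuspRoot_eq_zero_iff.1 h)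

lemma ordAt_cuspRoot {z : ℍ} (hz : cuspRoot z = 0) : ordAt cuspRoot z = 2 := by
  have h1 : 3 • ordAt cuspRoot z = 6 := by
    rw [← ordAt_pow mdiff_cuspRoot]
    simp only [cuspRoot_pow_three]
    exact ordAt_cubicForm (cuspRoot_eq_zero_iff.1 hz)
  have h3 := ordAt_ne_top mdiff_cuspRoot ⟨_, cuspRoot_ellPoint⟩ z
  rw [nsmul_eq_mul] at h1
  lift ordAt cuspRoot z to ℕ using h3 with n
  norm_cast at h1 ⊢
  omega

/-- Two holomorphic functions with the same cube differ by a cube root of unity. -/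
lemma exists_eq_smul_of_pow_three_eq {f g : ℍ → ℂ} (hf : MDiff f) (hg : MDiff g)
    (h0 : ∃ t, g t ≠ 0) (h : ∀ τ, f τ ^ 3 = g τ ^ 3) : ∃ ζ : ℂ, ζ ^ 3 = 1 ∧ f = ζ • g := by
  obtain ⟨t, ht⟩ := h0
  have hζ : (f t / g t) ^ 3 = 1 := by rw [div_pow, h, div_self (pow_ne_zero 3 ht)]
  refine ⟨f t / g t, hζ, ?_⟩
  have hcf := (analyticAt_comp_ofComplex hf t).continuousAt
  have hcg := (analyticAt_comp_ofComplex hg t).continuousAt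
  have h1 := eventuallyEq_of_pow_three_eq (g := fun w => f t / g t * g (ofComplex w)) hcf
    (hcg.const_mul _) (Eventually.of_forall fun w => by
      simp only [mul_pow, hζ, one_mul]
      exact h _) (by simp only [ofComplex_apply]; rw [div_mul_cancel₀ _ ht]) (by
      simp only [ofComplex_apply]
      intro h0
      have := h t
      rw [h0, zero_pow three_ne_zero] at this
      exact ht (pow_eq_zero_iff three_ne_zero |>.1 this.symm))
  have h2 : ∀ᶠ τ : ℍ in 𝓝 t, f τ - f t / g t * g τ = 0 := by
    filter_upwards [continuous_coe.continuousAt.eventually h1] with τ hτ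
    simpa [sub_eq_zero] using hτ
  have h3 := eq_zero_of_frequently (mdiff_sub hf (mdiff_const_mul (f t / g t) hg))
    (h2.filter_mono nhdsWithin_le_nhds).frequently
  ext τ
  exact sub_eq_zero.1 (congrFun h3 τ)

/-- Both sides have the same cube up to the automorphy factor, by the invariance of `cubicForm`. -/
lemma exists_cuspRoot_smul {γ : SL(2, ℤ)} (hγ : γ ∈ levelNineOne) :
    ∃ ζ : ℂ, ζ ^ 3 = 1 ∧ ∀ τ, cuspRoot (γ • τ) = ζ * denom γ τ ^ 2 * cuspRoot τ := by
  have h1 : MDiff (fun τ : ℍ => denom γ τ ^ 2 * cuspRoot τ) := by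
    refine mdiff_mul (mdiff_pow ?_ 2) mdiff_cuspRoot
    simpa using mdifferentiable_denom_zpow (γ : GL (Fin 2) ℝ) 1
  obtain ⟨ζ, hζ, h⟩ := exists_eq_smul_of_pow_three_eq (mdiff_comp_smul mdiff_cuspRoot γ) h1
    ⟨ellPoint, mul_ne_zero (pow_ne_zero 2 (denom_ne_zero _ _)) cuspRoot_ellPoint⟩ fun τ => by
      rw [cuspRoot_pow_three, cubicForm_smul hγ, mul_pow, cuspRoot_pow_three]
      ring
  refine ⟨ζ, hζ, fun τ => ?_⟩
  rw [mul_assoc]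
  exact congrFun h τ

end CubicForm

end

end ModCurve

namespace ModCurve

open UpperHalfPlane hiding I
open Filter Topology Complex
open scoped ModularForm Manifold Real

noncomputable section

/-! ### Behaviour at the cusps -/

section Growth

lemma isBoundedAtImInfty_of_pow {f : ℍ → ℂ} {n : ℕ} (hn : n ≠ 0)
    (h : IsBoundedAtImInfty fun τ => f τ ^ n) : IsBoundedAtImInfty f := by
  obtain ⟨M, A, hM⟩ := isBoundedAtImInfty_iff.1 h
  refine isBoundedAtImInfty_iff.2 ⟨max M 1, A, fun τ hτ => ?_⟩
  by_contra hlt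
  push Not at hlt
  have h1 : 1 < ‖f τ‖ := (le_max_right _ _).trans_lt hlt
  have h2 := hM τ hτ
  rw [norm_pow] at h2
  have h3 := le_self_pow₀ h1.le hn
  exact absurd (h3.trans h2) (not_le.2 ((le_max_left _ _).trans_lt hlt))

/-- The leading exponents in `q` of `etaQuot`, `formInfty` and `quadFactor²` are `-1/3`, `2` and
`-4/3`, with sum `1/3`. -/
lemma tendsto_cubicForm_div :
    Tendsto (fun τ : ℍ => cubicForm τ / Function.Periodic.qParam 3 τ) atImInfty (𝓝 1) := by
  have hX := tendsto_etaQuot_mul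
  have hq := qParam_tendsto_atImInfty (h := 3) (by norm_num)
  have hp : Tendsto (fun τ : ℍ => (etaQuot τ * Function.Periodic.qParam 3 τ) ^ 2 +
      ellValue * (etaQuot τ * Function.Periodic.qParam 3 τ) * Function.Periodic.qParam 3 τ +
      ellValue ^ 2 * Function.Periodic.qParam 3 τ ^ 2) atImInfty
      (𝓝 (1 ^ 2 + ellValue * 1 * 0 + ellValue ^ 2 * 0 ^ 2)) :=
    ((hX.pow 2).add ((hX.const_mul _).mul hq)).add ((hq.pow 2).const_mul _)
  have h := (tendsto_formZero.mul (hp.pow 2)).div (hX.pow 5) (by norm_num)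
  norm_num at h
  refine h.congr fun τ => ?_
  have n1 := etaQuot_ne_zero τ
  have n2 := Function.Periodic.qParam_ne_zero (h := 3) (τ : ℂ)
  simp only [Pi.div_apply, Pi.mul_apply, Pi.pow_apply, cubicForm, quadFactor, formZero_eq,
    hauptmodul]
  field_simp

/-- At the cusp `0` the factor `etaQuot` behaves like `9 q ^ (1/9)`, `formInfty` like a constant
times `τ⁶`, and `quadFactor` tends to `ellValue²`. -/
lemma tendsto_cubicForm_sw_smul_div : ∃ c : ℂ, c ≠ 0 ∧
    Tendsto (fun τ : ℍ => cubicForm (sw • τ) / (τ ^ 6 * Function.Periodic.qParam 9 τ))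
      atImInfty (𝓝 c) := by
  have hqq (τ : ℍ) : Function.Periodic.qParam 3 (third τ) = Function.Periodic.qParam 9 τ := by
    rw [Function.Periodic.qParam, Function.Periodic.qParam, coe_third]
    congr 1
    push_cast
    ring
  have hX := tendsto_etaQuot_mul.comp tendsto_third
  have hq := (qParam_tendsto_atImInfty (h := 3) (by norm_num)).comp tendsto_third
  have hC := tendsto_formZero.comp tendsto_third
  have hy := (hq.const_mul 9).div hX one_ne_zero
  have h := ((hC.div hX one_ne_zero).const_mul (-9 / 19683)).mul
    (((hy.pow 2).add (hy.const_mul ellValue)).add_const (ellValue ^ 2) |>.pow 2)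
  refine ⟨_, ?_, h.congr fun τ => ?_⟩
  · have := ellValue_ne_zero
    norm_num
    exact this
  · have n1 := etaQuot_ne_zero (third τ)
    have n2 := Function.Periodic.qParam_ne_zero (h := 9) (τ : ℂ)
    have n3 : (τ : ℂ) ≠ 0 := τ.ne_zero
    simp only [Pi.div_apply, Function.comp_apply, cubicForm, quadFactor, etaQuot_sw_smul,
      formInfty_sw_smul, hqq]
    field_simp

/-- The behaviour of `cuspRoot` at the cusp `∞`. -/
lemma cuspRoot_growth : IsBoundedAtImInfty (fun τ => cuspRoot τ / Function.Periodic.qParam 9 τ) ∧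
    IsBoundedAtImInfty (fun τ => Function.Periodic.qParam 9 τ / cuspRoot τ) ∧
    ∀ᶠ τ in atImInfty, cuspRoot τ ≠ 0 := by
  have hpow (τ : ℍ) : Function.Periodic.qParam 9 (τ : ℂ) ^ 3 = Function.Periodic.qParam 3 τ :=
    qParam_pow (n := 3) (by norm_num) (by norm_num) _
  refine ⟨isBoundedAtImInfty_of_pow three_ne_zero ?_, isBoundedAtImInfty_of_pow three_ne_zero ?_,
    ?_⟩
  · simp only [div_pow, cuspRoot_pow_three, hpow]
    exact tendsto_cubicForm_div.isBigO_one ℝ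
  · simp only [div_pow, cuspRoot_pow_three, hpow]
    refine ((tendsto_cubicForm_div.inv₀ one_ne_zero).isBigO_one ℝ).congr_left fun τ => ?_
    rw [inv_div]
  · filter_upwards [tendsto_cubicForm_div.eventually_ne one_ne_zero] with τ hτ h0
    rw [← cuspRoot_pow_three, h0] at hτ
    simp at hτ

lemma slash_sw_apply (h : ℍ → ℂ) (τ : ℍ) : (h ∣[(2 : ℤ)] sw) τ = h (sw • τ) / τ ^ 2 := by
  rw [ModularForm.SL_slash_apply, denom_sw, zpow_neg, div_eq_mul_inv]
  norm_cast

/-- The behaviour of `cuspRoot` at the cusp `0`. -/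
lemma cuspRoot_slash_sw_growth :
    IsBoundedAtImInfty (fun τ => (cuspRoot ∣[(2 : ℤ)] sw) τ / Function.Periodic.qParam 27 τ) ∧
    IsBoundedAtImInfty (fun τ => Function.Periodic.qParam 27 τ / (cuspRoot ∣[(2 : ℤ)] sw) τ) ∧
    ∀ᶠ τ in atImInfty, (cuspRoot ∣[(2 : ℤ)] sw) τ ≠ 0 := by
  have hpow (τ : ℍ) : Function.Periodic.qParam 27 (τ : ℂ) ^ 3 = Function.Periodic.qParam 9 τ :=
    qParam_pow (n := 3) (by norm_num) (by norm_num) _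
  have e (τ : ℍ) : (cuspRoot ∣[(2 : ℤ)] sw) τ ^ 3 = cubicForm (sw • τ) / τ ^ 6 := by
    rw [slash_sw_apply, div_pow, cuspRoot_pow_three, ← pow_mul]
  obtain ⟨c, hc, h⟩ := tendsto_cubicForm_sw_smul_div
  refine ⟨isBoundedAtImInfty_of_pow three_ne_zero ?_, isBoundedAtImInfty_of_pow three_ne_zero ?_,
    ?_⟩
  · simp only [div_pow, e, hpow, div_div]
    exact h.isBigO_one ℝ
  · simp only [div_pow, e, hpow]
    refine ((h.inv₀ hc).isBigO_one ℝ).congr_left fun τ => ?_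
    rw [inv_div, div_div_eq_mul_div, mul_comm]
  · filter_upwards [h.eventually_ne hc] with τ hτ h0
    rw [← div_div, ← e, h0] at hτ
    simp at hτ

end Growth

/-! ### The character of `cuspRoot` on `levelNineOne` -/

section Character

/-- The characters of `ℤ/3ℤ` with values in `ℂ`. -/
def omChar (a : ZMod 3) : ℂ := om ^ (2 * a.val)

lemma omChar_zero : omChar 0 = 1 := by simp [omChar]

lemma omChar_add (a b : ZMod 3) : omChar (a + b) = omChar a * omChar b := by
  rw [omChar, omChar, omChar, ZMod.val_add, ← pow_add, ← mul_add,
    pow_eq_pow_mod (2 * (a.val + b.val)) om_pow_three,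
    pow_eq_pow_mod (2 * ((a.val + b.val) % 3)) om_pow_three]
  congr 1
  omega

lemma eq_zero_of_omChar_eq_one {a : ZMod 3} (h : omChar a = 1) : a = 0 := by
  rw [omChar, isPrimitiveRoot_om.pow_eq_one_iff_dvd] at h
  have h1 := ZMod.val_lt a
  rw [← ZMod.val_eq_zero]
  omega

lemma im_om_pos : 0 < om.im := by
  have h : om = exp ((2 * π / 3 : ℝ) * I) := by
    rw [om]
    congr 1
    push_cast
    ring
  rw [h, exp_ofReal_mul_I_im]
  have := Real.pi_pos
  exact Real.sin_pos_of_pos_of_lt_pi (by positivity) (by linarith)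

lemma pow_three_eq_one_of_rel {x : ℂ} (h : x ^ 2 + x + 1 = 0) : x ^ 3 = 1 := by
  linear_combination (x - 1) * h

/-- The factor `4 - 3z` is a primitive cube root of unity with negative imaginary part. -/
lemma denom_al₁_ellPoint : denom al₁ ellPoint = om ^ 2 := by
  have h1 := denom_rel_of_smul_eq al₁_smul_ellPoint (by simp [al₁])
  have h2 : (denom al₁ ellPoint - om) * (denom al₁ ellPoint - om ^ 2) = 0 := by
    linear_combination h1 - denom al₁ ellPoint * om_rel + om_pow_three
  rcases mul_eq_zero.1 h2 with h | h
  · exfalso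
    have h3 := im_om_pos
    rw [← sub_eq_zero.1 h, denom_al₁] at h3
    have h4 := ellPoint.im_pos
    simp at h3
    linarith
  · exact sub_eq_zero.1 h

lemma cuspRoot_al₁_smul (τ : ℍ) :
    cuspRoot (al₁ • τ) = omChar (ellThree al₁) * denom al₁ τ ^ 2 * cuspRoot τ := by
  obtain ⟨ζ, -, h⟩ := exists_cuspRoot_smul al₁_mem
  have h1 := eq_one_of_smul_eq mdiff_cuspRoot al₁_smul_ellPoint h (n := 0)
    (ordAt_eq_zero cuspRoot_ellPoint)
  rw [denom_al₁_ellPoint] at h1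
  have h2 : omChar (ellThree al₁) = om ^ 2 := by
    rw [ellThree_al₁, omChar]
    norm_num [ZMod.val_one]
  have h3 : ζ = om ^ 2 := by
    linear_combination om ^ 2 * h1 - ζ * (om ^ 3 + 1) * om_pow_three
  rw [h, h2, h3]

/-- A zero has order `2`, so the fixed point relation reads `ζ j⁶ = 1`, and `j³ = 1`. -/
lemma eq_one_of_cuspRoot_eq_zero {δ : SL(2, ℤ)} {z : ℍ} (hfix : δ • z = z)
    (htr : δ 0 0 + δ 1 1 = -1) (hz : cuspRoot z = 0) {ζ : ℂ}
    (h : ∀ τ, cuspRoot (δ • τ) = ζ * denom δ τ ^ 2 * cuspRoot τ) : ζ = 1 := by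
  have h1 := eq_one_of_smul_eq mdiff_cuspRoot hfix h (n := 2) (ordAt_cuspRoot hz)
  have h2 := pow_three_eq_one_of_rel (denom_rel_of_smul_eq hfix htr)
  rwa [show 2 + 2 * 2 = 3 * 2 by norm_num, pow_mul, h2, one_pow, mul_one] at h1

/-- Translation by `±1` multiplies `etaQuot` by a primitive cube root of unity, turning `ellValue`
into a root of `X² + v X + v²` with `v = ellValue`. -/
lemma cuspRoot_up_smul_ellPoint {n : ℤ} (hn : n = 1 ∨ n = -1) :
    cuspRoot (up n • ellPoint) = 0 := by
  rw [cuspRoot_eq_zero_iff, quadFactor, etaQuot_up_smul, ← ellValue]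
  rcases hn with rfl | rfl
  · have : om ^ (-1 : ℤ) = om ^ 2 := by
      rw [zpow_neg, zpow_one]
      exact inv_eq_of_mul_eq_one_right (by linear_combination om_pow_three)
    rw [this]
    linear_combination ellValue ^ 2 * om_rel + ellValue ^ 2 * om * om_pow_three
  · rw [neg_neg, zpow_one]
    linear_combination ellValue ^ 2 * om_rel

lemma cuspRoot_al₀_smul (τ : ℍ) :
    cuspRoot (al₀ • τ) = omChar (ellThree al₀) * denom al₀ τ ^ 2 * cuspRoot τ := by
  obtain ⟨ζ, -, h⟩ := exists_cuspRoot_smul al₀_mem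
  have hfix : al₀ • (up (-1) • ellPoint) = up (-1) • ellPoint := by
    conv_rhs => rw [← al₁_smul_ellPoint, al₁_eq, up_neg]
    rw [← mul_smul, ← mul_smul, up_neg]
    congr 1
    group
  have h1 := eq_one_of_cuspRoot_eq_zero hfix (by simp [al₀])
    (cuspRoot_up_smul_ellPoint (Or.inr rfl)) h
  rw [h, h1, ellThree_al₀, omChar_zero]

lemma cuspRoot_al₂_smul (τ : ℍ) :
    cuspRoot (al₂ • τ) = omChar (ellThree al₂) * denom al₂ τ ^ 2 * cuspRoot τ := by
  obtain ⟨ζ, -, h⟩ := exists_cuspRoot_smul al₂_mem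
  have hfix : al₂ • (up 1 • ellPoint) = up 1 • ellPoint := by
    rw [al₂_eq, mul_smul, mul_smul, inv_smul_smul, al₁_smul_ellPoint]
  have h1 := eq_one_of_cuspRoot_eq_zero hfix (by simp [al₂])
    (cuspRoot_up_smul_ellPoint (Or.inl rfl)) h
  rw [h, h1, ellThree_al₂, omChar_zero]

/-- The quotient of `cuspRoot` by `q ^ (1/9)` has a nonzero limit at `i∞` and is multiplied by `ζ /
om` under translation by `3`; hence `ζ = om`. -/
lemma cuspRoot_up_three_smul (τ : ℍ) :
    cuspRoot (up 3 • τ) = omChar (ellThree (up 3)) * denom (up 3) τ ^ 2 * cuspRoot τ := by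
  obtain ⟨ζ, hζ, h⟩ := exists_cuspRoot_smul up_three_mem
  simp only [denom_up, one_pow, mul_one] at h ⊢
  let φ : ℍ → ℂ := fun τ => cuspRoot τ / Function.Periodic.qParam 9 τ
  have hq (n : ℤ) (τ : ℍ) : Function.Periodic.qParam 9 (up (3 * n) • τ : ℍ) =
      om ^ n * Function.Periodic.qParam 9 τ := by
    rw [qParam_up_smul, om, ← exp_int_mul]
    congr 2
    push_cast
    ring
  have hφ3 (τ : ℍ) : φ (up 3 • τ) = ζ / om * φ τ := by
    have h1 := hq 1 τ
    rw [mul_one, zpow_one] at h1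
    simp only [φ]
    rw [h, h1, mul_div_mul_comm]
  have hφ9 (τ : ℍ) : φ (up 9 • τ) = φ τ := by
    rw [show (9 : ℤ) = 3 + 3 + 3 by norm_num, up_add, up_add, mul_smul, mul_smul, hφ3, hφ3, hφ3]
    have : (ζ / om) ^ 3 = 1 := by rw [div_pow, hζ, om_pow_three, div_one]
    linear_combination φ τ * this
  have hmq : MDiff fun τ : ℍ => Function.Periodic.qParam 9 τ := by
    rw [UpperHalfPlane.mdifferentiable_iff]
    refine (Function.Periodic.differentiable_qParam (h := 9)).differentiableOn.congr fun w hw => ?_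
    simp only [Function.comp_apply]
    rw [ofComplex_apply_of_im_pos hw]
  have hφm : MDiff φ := mdiff_div mdiff_cuspRoot hmq fun τ => Function.Periodic.qParam_ne_zero _
  have hlim := UpperHalfPlane.exp_decay_sub_atImInfty (h := 9) (by norm_num)
    (by simpa using periodic_of_smul_up hφ9) hφm cuspRoot_growth.1
  rw [← isBigO_qParam_iff] at hlim
  have hlim2 := hlim.trans_tendsto (qParam_tendsto_atImInfty (h := 9) (by norm_num))
  have hlim3 : Tendsto φ atImInfty (𝓝 (valueAtInfty φ)) := by
    simpa using hlim2.add_const (valueAtInfty φ)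
  set L := valueAtInfty φ
  have hL3 : L ^ 3 = 1 := by
    refine tendsto_nhds_unique (hlim3.pow 3) (tendsto_cubicForm_div.congr fun τ => ?_)
    simp only [φ, div_pow, cuspRoot_pow_three]
    rw [qParam_pow (n := 3) (h' := 3) (by norm_num) (by norm_num)]
  have hL0 : L ≠ 0 := by
    intro h0
    rw [h0] at hL3
    norm_num at hL3
  have hL := tendsto_nhds_unique (hlim3.comp (tendsto_up_smul 3))
    ((hlim3.const_mul (ζ / om)).congr fun τ => (hφ3 τ).symm)
  have h1 : ζ / om = 1 := mul_right_cancel₀ hL0 (by rw [one_mul]; exact hL.symm)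
  rw [div_eq_one_iff_eq om_ne_zero] at h1
  have h2 : ellThree (up 3) = 2 := by
    rw [ellThree_eq (M := -7) (by simp)]
    simp
    decide
  rw [h, h1, h2, omChar]
  congr 1
  have : (2 : ZMod 3).val = 2 := rfl
  rw [this]
  linear_combination -om * om_pow_three

/-- The transformation behaviour of `cuspRoot`. -/
lemma cuspRoot_smul {γ : SL(2, ℤ)} (hγ : γ ∈ levelNineOne) :
    ∀ τ, cuspRoot (γ • τ) = omChar (ellThree γ) * denom γ τ ^ 2 * cuspRoot τ := by
  have hE := additiveOn_ellThree
  rw [← slash_eq_smul_iff]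
  refine levelNineOne_induction
    (P := fun γ => cuspRoot ∣[((2 : ℕ) : ℤ)] γ = omChar (ellThree γ) • cuspRoot)
    (slash_eq_smul_iff.2 cuspRoot_al₀_smul) (slash_eq_smul_iff.2 cuspRoot_al₁_smul)
    (slash_eq_smul_iff.2 cuspRoot_al₂_smul) (slash_eq_smul_iff.2 cuspRoot_up_three_smul)
    ?_ ?_ ?_ hγ
  · rw [hE.map_one, omChar_zero, one_smul, SlashAction.slash_one]
  · intro g hg h hh eg eh
    rw [SlashAction.slash_mul, eg, ModularForm.SL_smul_slash, eh, hE g hg.1 h hh.1, omChar_add,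
      smul_smul]
  · intro g hg eg
    have h1 : omChar (ellThree g⁻¹) * omChar (ellThree g) = 1 := by
      rw [hE.map_inv hg.1, ← omChar_add, neg_add_cancel, omChar_zero]
    have h2 : cuspRoot = omChar (ellThree g) • (cuspRoot ∣[((2 : ℕ) : ℤ)] g⁻¹) := by
      rw [← ModularForm.SL_smul_slash, ← eg, ← SlashAction.slash_mul, mul_inv_cancel,
        SlashAction.slash_one]
    conv_rhs => rw [h2, smul_smul, h1, one_smul]

end Character

end

end ModCurve

namespace ModCurve

open UpperHalfPlane hiding I
open Filter Topology Complex CongruenceSubgroup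
open scoped ModularForm Manifold Real

noncomputable section

/-! ### The genera -/

section Genus

lemma isZeroAtImInfty_of_isBoundedAtImInfty_div {f : ℍ → ℂ} {h : ℝ} (hh : 0 < h)
    (hf : IsBoundedAtImInfty fun τ => f τ / Function.Periodic.qParam h τ) :
    IsZeroAtImInfty f := by
  have hf' := hf.trans (Asymptotics.isBigO_const_const (1 : ℝ) (one_ne_zero (α := ℂ)) atImInfty)
  have h1 := hf'.mul
    (Asymptotics.isBigO_refl (fun τ : ℍ => Function.Periodic.qParam h τ) atImInfty)
  have h2 : f =O[atImInfty] fun τ : ℍ => Function.Periodic.qParam h τ := by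
    refine (h1.congr_left fun τ => ?_).trans ?_
    · exact div_mul_cancel₀ _ (Function.Periodic.qParam_ne_zero _)
    · refine Asymptotics.IsBigO.of_bound 1 (Eventually.of_forall fun τ => ?_)
      simp
  exact h2.trans_tendsto (qParam_tendsto_atImInfty hh)

lemma neg_one_slash_two (f : ℍ → ℂ) : f ∣[(2 : ℤ)] (-1 : SL(2, ℤ)) = f := by
  refine slash_eq_self_iff (k := 2).2 fun τ => ?_
  rw [ModularGroup.SL_neg_smul, one_smul, ModularGroup.denom_apply]
  norm_num

lemma levelTwentySeven_le_Gamma0 : levelTwentySeven ≤ Gamma0 3 :=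
  levelTwentySeven_le.trans levelNine_le_Gamma0

lemma ellThree_eq_zero {γ : SL(2, ℤ)} (hγ : γ ∈ levelTwentySeven) : ellThree γ = 0 := hγ.2

lemma cuspRoot_slash {γ : SL(2, ℤ)} (hγ : γ ∈ levelTwentySeven) :
    cuspRoot ∣[(2 : ℤ)] γ = cuspRoot := by
  have key (γ : SL(2, ℤ)) (hγ : γ ∈ levelTwentySevenOne) : cuspRoot ∣[(2 : ℤ)] γ = cuspRoot := by
    refine slash_eq_self_iff (k := 2).2 fun τ => ?_
    rw [cuspRoot_smul ⟨levelTwentySeven_le hγ.1, hγ.2⟩, ellThree_eq_zero hγ.1, omChar_zero, one_mul]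
  rcases mem_or_neg_mem neg_one_mem_levelTwentySeven levelTwentySeven_le_Gamma0 hγ with h | h
  · exact key γ h
  · have h1 := key (-γ) h
    rwa [← neg_one_mul, SlashAction.slash_mul, neg_one_slash_two] at h1

lemma slash_up_apply (f : ℍ → ℂ) (n : ℤ) : f ∣[(2 : ℤ)] up n = fun τ => f (up n • τ) := by
  ext τ
  rw [ModularForm.SL_slash_apply, denom_up]
  simp

lemma isZeroAtImInfty_slash_up {f : ℍ → ℂ} (hf : IsZeroAtImInfty f) (n : ℤ) :
    IsZeroAtImInfty (f ∣[(2 : ℤ)] up n) := by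
  rw [slash_up_apply]
  exact hf.comp (tendsto_up_smul n)

lemma cuspRoot_mem : cuspRoot ∈ holomorphicDifferentials levelTwentySeven := by
  rw [mem_holomorphicDifferentials_iff (N := 27) (by norm_num) Gamma_le_levelTwentySeven]
  refine ⟨mdiff_cuspRoot, fun γ hγ => cuspRoot_slash hγ, fun δ => ?_⟩
  obtain ⟨γ, hγ, n, e | e⟩ := exists_coset_levelTwentySeven δ
  · rw [e, SlashAction.slash_mul, cuspRoot_slash hγ]
    exact isZeroAtImInfty_slash_up
      (isZeroAtImInfty_of_isBoundedAtImInfty_div (by norm_num) cuspRoot_growth.1) n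
  · rw [e, SlashAction.slash_mul, SlashAction.slash_mul, cuspRoot_slash hγ]
    exact isZeroAtImInfty_slash_up
      (isZeroAtImInfty_of_isBoundedAtImInfty_div (by norm_num) cuspRoot_slash_sw_growth.1) n

/-- Elements of order `3` fixing a zero of `cuspRoot` leave `cuspRoot` invariant. -/
lemma exists_smul_eq_of_cuspRoot_eq_zero {z : ℍ} (hz : cuspRoot z = 0) :
    ∃ δ ∈ levelTwentySeven, δ 0 0 + δ 1 1 = -1 ∧ δ • z = z := by
  have hG : eisThree z = 0 := eisThree_eq_zero_iff.2
    (hauptmodul_eq_of_quadFactor_eq_zero (cuspRoot_eq_zero_iff.1 hz))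
  obtain ⟨δ, hδ, htr, hfix⟩ := exists_smul_eq_of_eisThree_eq_zero hG
  refine ⟨δ, ?_, htr, hfix⟩
  -- Up to sign `δ` is an element of `genNine` times `up n`, so `etaQuot` is multiplied by `om ^
  -- (-n)`. Since `δ` fixes `z` and `etaQuot z ≠ 0`, it follows that `3 ∣ n`.
  have hδ9 : δ ∈ levelNineOne := by
    have hδ0 : δ ∈ Gamma0 3 := mem_Gamma0_iff.2 (mem_Gamma1_iff.1 hδ).2.1
    obtain ⟨h, hh, n, e⟩ := exists_coset_genNine hδ0
    have hx : etaQuot (δ • z) = om ^ (-n) * etaQuot z := by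
      rcases e with e | e <;> rw [e]
      · rw [mul_smul, etaQuot_smul (genNine_le hh), etaQuot_up_smul]
      · rw [ModularGroup.SL_neg_smul, mul_smul, etaQuot_smul (genNine_le hh), etaQuot_up_smul]
    rw [hfix] at hx
    have h1 : om ^ (-n) = 1 := mul_right_cancel₀ (etaQuot_ne_zero z) (by rw [← hx, one_mul])
    have h2 := (isPrimitiveRoot_om.zpow_eq_one_iff_dvd _).1 h1
    obtain ⟨m, hm⟩ : (3 : ℤ) ∣ n := by rwa [dvd_neg] at h2
    have h3 : up n ∈ levelNineOne := by
      have := zpow_mem up_three_mem m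
      rwa [up_zpow, ← hm] at this
    have h4 := mul_mem (genNine_le hh) h3
    rcases e with e | e
    · rwa [e]
    · exfalso
      have h5 : (-1 : SL(2, ℤ)) ∈ Gamma1 3 := by
        have := mul_mem hδ (inv_mem h4.2)
        rwa [e, neg_mul, mul_inv_cancel] at this
      rw [mem_Gamma1_iff] at h5
      simp at h5
  refine ⟨hδ9.1, ?_⟩
  exact eq_zero_of_omChar_eq_one (eq_one_of_cuspRoot_eq_zero hfix htr hz (cuspRoot_smul hδ9))

/-- For order `n` the fixed point relation is `j ^ (2 + 2n) = 1` with `j` a primitive cube root of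
unity, which excludes `n = 0` and `n = 1`. -/
lemma two_le_ordAt {h : ℍ → ℂ} (hh : MDiff h) {δ : SL(2, ℤ)} {z : ℍ} (hfix : δ • z = z)
    (htr : δ 0 0 + δ 1 1 = -1) (hinv : h ∣[(2 : ℤ)] δ = h) : 2 ≤ ordAt h z := by
  have hrel := denom_rel_of_smul_eq hfix htr
  have hinv' : ∀ τ, h (δ • τ) = 1 * denom δ τ ^ 2 * h τ := by
    rw [← slash_eq_smul_iff, one_smul]
    exact hinv
  have h3 := pow_three_eq_one_of_rel hrel
  have hne : denom δ z ≠ 1 := by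
    intro h1
    rw [h1] at hrel
    norm_num at hrel
  by_contra hlt
  push Not at hlt
  obtain ⟨n, hn⟩ := ENat.ne_top_iff_exists.1 (hlt.ne_top)
  rw [← hn] at hlt
  have hlt' : n < 2 := by exact_mod_cast hlt
  have h1 := eq_one_of_smul_eq hh hfix hinv' hn.symm
  rw [one_mul] at h1
  interval_cases n
  · apply hne
    linear_combination h3 - denom δ z * h1
  · apply hne
    linear_combination h1 - denom δ z * h3

/-- Division of holomorphic functions. -/
lemma exists_eq_mul_of_ordAt_le {f h : ℍ → ℂ} (hf : MDiff f) (hh : MDiff h) (h0 : ∃ t, f t ≠ 0)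
    (hle : ∀ z, ordAt f z ≤ ordAt h z) : ∃ Ψ : ℍ → ℂ, MDiff Ψ ∧ ∀ τ, h τ = Ψ τ * f τ := by
  have hloc (z : ℍ) : ∃ k : ℂ → ℂ, AnalyticAt ℂ k z ∧
      (∀ᶠ w in 𝓝 (z : ℂ), h (ofComplex w) = k w * f (ofComplex w)) ∧
      ∀ᶠ w in 𝓝[≠] (z : ℂ), f (ofComplex w) ≠ 0 := by
    have hz := hle z
    obtain ⟨n, hn⟩ := ENat.ne_top_iff_exists.1 (ordAt_ne_top hf h0 z)
    rw [← hn] at hz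
    obtain ⟨u, hu, hu0, hfu⟩ := (analyticAt_comp_ofComplex hf z).analyticOrderAt_eq_natCast.1 hn.symm
    obtain ⟨v, hv, hhv⟩ := (natCast_le_analyticOrderAt (analyticAt_comp_ofComplex hh z)).1 hz
    have hu1 := hu.continuousAt.eventually_ne hu0
    refine ⟨fun w => v w / u w, hv.div hu hu0, ?_, ?_⟩
    · filter_upwards [hfu, hhv, hu1] with w e1 e2 e3
      rw [e1, e2, smul_eq_mul, smul_eq_mul]
      field_simp
    · filter_upwards [nhdsWithin_le_nhds hfu, nhdsWithin_le_nhds hu1, self_mem_nhdsWithin]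
        with w e1 e2 e3
      rw [e1]
      exact smul_ne_zero (pow_ne_zero n (sub_ne_zero.2 e3)) e2
  choose k hk hkf hkn using hloc
  refine ⟨fun τ => k τ τ, fun z => ?_, fun τ => ?_⟩
  · rw [UpperHalfPlane.mdifferentiableAt_iff]
    refine (hk z).differentiableAt.congr_of_eventuallyEq ?_
    have h1 := eventually_nhdsWithin_iff.1 (hkn z)
    filter_upwards [hkf z, h1, eventually_coe_ofComplex z] with w e1 e2 e3
    simp only [Function.comp_apply]
    by_cases hw : w = z
    · rw [e3, hw, ofComplex_apply]
    · have e4 := (hkf (ofComplex w)).self_of_nhds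
      rw [e3] at e4 ⊢
      exact mul_right_cancel₀ (e2 hw) (e4.symm.trans e1)
  · have h1 := (hkf τ).self_of_nhds
    rwa [ofComplex_apply] at h1

lemma isBigO_qParam_of_isZeroAtImInfty {f : ℍ → ℂ} (hf : MDiff f) {n : ℕ} (hn : 0 < n)
    (hper : Function.Periodic (f ∘ ofComplex) (n : ℝ)) (h0 : IsZeroAtImInfty f) :
    f =O[atImInfty] fun τ => Function.Periodic.qParam n τ := by
  rw [isBigO_qParam_iff]
  exact h0.exp_decay_atImInfty (by exact_mod_cast hn) hper hf
    (h0.isBigO_one ℝ)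

lemma isBoundedAtImInfty_of_isBigO_qParam {f g : ℍ → ℂ} {h : ℝ}
    (hf : f =O[atImInfty] fun τ => Function.Periodic.qParam h τ)
    (hg : IsBoundedAtImInfty fun τ => Function.Periodic.qParam h τ / g τ) :
    IsBoundedAtImInfty fun τ => f τ / g τ :=
  (hf.mul (Asymptotics.isBigO_refl (fun τ => (g τ)⁻¹) atImInfty)).trans hg

/-- Every such `h` vanishes at least to the order of `cuspRoot`: order `2` at its zeros, which are
elliptic points, and one power of the local parameters `q ^ (1/9)` and `q ^ (1/27)` at the two
cusps. The quotient is invariant, holomorphic and bounded, hence constant. -/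
lemma exists_eq_smul_cuspRoot {h : ℍ → ℂ} (hh : h ∈ holomorphicDifferentials levelTwentySeven) :
    ∃ c : ℂ, h = c • cuspRoot := by
  rw [mem_holomorphicDifferentials_iff (N := 27) (by norm_num) Gamma_le_levelTwentySeven] at hh
  obtain ⟨hm, hinv, hzero⟩ := hh
  obtain ⟨Ψ, hΨ, e⟩ := exists_eq_mul_of_ordAt_le mdiff_cuspRoot hm ⟨_, cuspRoot_ellPoint⟩ fun z => by
    by_cases hz : cuspRoot z = 0
    · obtain ⟨δ, hδ, htr, hfix⟩ := exists_smul_eq_of_cuspRoot_eq_zero hz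
      rw [ordAt_cuspRoot hz]
      exact two_le_ordAt hm hfix htr (hinv δ hδ)
    · rw [ordAt_eq_zero hz]
      exact zero_le
  have hΨinv : ∀ γ ∈ levelTwentySeven, ∀ τ, Ψ (γ • τ) = Ψ τ := by
    intro γ hγ
    have h1 (τ : ℍ) : (Ψ (γ • τ) - Ψ τ) * cuspRoot τ = 0 := by
      have e1 := (slash_eq_self_iff (k := 2)).1 (hinv γ hγ) τ
      have e2 := (slash_eq_self_iff (k := 2)).1 (cuspRoot_slash hγ) τ
      rw [e, e2, e] at e1
      have h4 : denom γ τ ^ 2 ≠ 0 := pow_ne_zero 2 (denom_ne_zero _ _)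
      refine mul_left_cancel₀ h4 ?_
      linear_combination e1
    have h2 := (UpperHalfPlane.mul_eq_zero_iff (mdiff_sub (mdiff_comp_smul hΨ γ) hΨ)
      mdiff_cuspRoot).1 (funext h1)
    rcases h2 with h2 | h2
    · exact fun τ => sub_eq_zero.1 (congrFun h2 τ)
    · exact absurd (congrFun h2 ellPoint) cuspRoot_ellPoint
  have hΨb : IsBoundedAtImInfty Ψ := by
    have h1 : h =O[atImInfty] fun τ => Function.Periodic.qParam 9 τ := by
      have hup : up 9 ∈ levelTwentySeven := by
        rw [mem_levelTwentySeven]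
        simp
      have hz := hzero 1
      rw [SlashAction.slash_one] at hz
      have hper := periodic_of_smul_up (f := h) (n := 9) fun τ => by
        have := congrFun (hinv _ hup) τ
        rwa [slash_up_apply] at this
      exact_mod_cast isBigO_qParam_of_isZeroAtImInfty hm (n := 9) (by norm_num)
        (by exact_mod_cast hper) hz
    refine (isBoundedAtImInfty_of_isBigO_qParam h1 cuspRoot_growth.2.1).congr' ?_ (by rfl)
    filter_upwards [cuspRoot_growth.2.2] with τ hτ
    rw [e, mul_div_cancel_right₀ _ hτ]
  have hΨsw : IsBoundedAtImInfty fun τ => Ψ (sw • τ) := by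
    have h1 := isBigO_qParam_of_isZeroAtImInfty (hm.slash 2 sw) (n := 27) (by norm_num)
      (periodic_slash Gamma_le_levelTwentySeven hinv sw) (hzero sw)
    refine (isBoundedAtImInfty_of_isBigO_qParam h1 cuspRoot_slash_sw_growth.2.1).congr' ?_ (by rfl)
    filter_upwards [cuspRoot_slash_sw_growth.2.2] with τ hτ
    change (h ∣[(2 : ℤ)] sw) τ / _ = _
    rw [slash_sw_apply h, e, mul_div_assoc, ← slash_sw_apply, mul_div_cancel_right₀ _ hτ]
  obtain ⟨c, hc⟩ := exists_const_of_invariant (N := 27) (by norm_num) Gamma_le_levelTwentySeven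
    hΨ hΨinv fun δ => by
      obtain ⟨γ, hγ, n, e | e⟩ := exists_coset_levelTwentySeven δ
      · refine (hΨb.comp_tendsto (tendsto_up_smul n)).congr_left fun τ => ?_
        rw [Function.comp_apply, e, mul_smul, hΨinv γ hγ]
      · refine (hΨsw.comp_tendsto (tendsto_up_smul n)).congr_left fun τ => ?_
        rw [Function.comp_apply, e, mul_smul, mul_smul, hΨinv γ hγ]
  refine ⟨c, funext fun τ => ?_⟩
  rw [e, hc]
  rfl

/-- The modular curve of `levelTwentySeven` has genus `1`. -/
theorem genus_levelTwentySeven : genus levelTwentySeven = 1 := by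
  rw [genus, rank_eq_one_iff]
  refine ⟨⟨cuspRoot, cuspRoot_mem⟩, ?_, fun h => ?_⟩
  · intro h0
    exact cuspRoot_ellPoint (congrFun (congrArg Subtype.val h0) ellPoint)
  · obtain ⟨c, hc⟩ := exists_eq_smul_cuspRoot h.2
    exact ⟨c, Subtype.ext hc.symm⟩

/-- The modular curve of `levelNine` has genus `0`. -/
theorem genus_levelNine : genus levelNine = 0 := by
  rw [genus, rank_zero_iff_forall_zero]
  rintro ⟨h, hh⟩
  have h9 := (mem_holomorphicDifferentials_iff (N := 9) (by norm_num) Gamma_nine_le_levelNine).1 hh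
  -- A differential for the larger group is one for `levelTwentySeven`, so it is a multiple of
  -- `cuspRoot`; but `al₁` multiplies `cuspRoot` by a nontrivial cube root of unity.
  obtain ⟨c, rfl⟩ := exists_eq_smul_cuspRoot (h := h) (by
    rw [mem_holomorphicDifferentials_iff (N := 27) (by norm_num) Gamma_le_levelTwentySeven]
    exact ⟨h9.1, fun γ hγ => h9.2.1 γ (levelTwentySeven_le hγ), h9.2.2⟩)
  have h1 := (slash_eq_self_iff (k := 2)).1 (h9.2.1 al₁ al₁_mem.1) ellPoint
  have h2 := cuspRoot_al₁_smul ellPoint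
  simp only [Pi.smul_apply, smul_eq_mul] at h1
  rw [h2] at h1
  have h3 : denom al₁ ellPoint ^ 2 * cuspRoot ellPoint ≠ 0 :=
    mul_ne_zero (pow_ne_zero 2 (denom_ne_zero _ _)) cuspRoot_ellPoint
  have h4 : omChar (ellThree al₁) - 1 ≠ 0 := by
    rw [sub_ne_zero, ellThree_al₁]
    exact fun h => one_ne_zero (eq_zero_of_omChar_eq_one h)
  have h5 : c * ((omChar (ellThree al₁) - 1) * (denom al₁ ellPoint ^ 2 * cuspRoot ellPoint)) = 0 := by
    linear_combination h1
  have hc := (mul_eq_zero.1 h5).resolve_right (mul_ne_zero h4 h3)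
  refine Subtype.ext (funext fun τ => ?_)
  change c * cuspRoot τ = 0
  rw [hc, zero_mul]

end Genus

end

end ModCurve

/-- The first conjunct is the dichotomy; the second one says that in each of the two cases there is
one and, up to conjugacy, only one such group. -/
theorem proposition4p12 :
    (∀ (Γ : Subgroup SL(2, ℤ)) (p e : ℕ), ModCurve.IsUnipotentOfLevel Γ p e →
      (ModCurve.HasExactLevel Γ 9 ∧ ModCurve.genus Γ = 0) ∨
      (ModCurve.HasExactLevel Γ 27 ∧ ModCurve.genus Γ = 1)) ∧
    (∀ e : ℕ, e = 2 ∨ e = 3 →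
      ∃ Γ : Subgroup SL(2, ℤ), ModCurve.IsUnipotentOfLevel Γ 3 e ∧
        ∀ Γ' : Subgroup SL(2, ℤ), ModCurve.IsUnipotentOfLevel Γ' 3 e →
          ModCurve.AreConjugate Γ Γ') := by
  -- The exact level tells the two conjugacy classes apart, which gives uniqueness in each level.
  have hlev {Γ : Subgroup SL(2, ℤ)} {m n : ℕ} (h : ModCurve.HasExactLevel Γ m)
      (h' : ModCurve.HasExactLevel Γ n) : m = n := h.unique h'
  refine ⟨fun Γ p e h => ?_, ?_⟩
  · obtain ⟨k, hk | hk⟩ := h.exists_conjBy_eq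
    · left
      have h9 := hk ▸ ModCurve.conjBy_inv_conjBy k Γ
      exact ⟨h9 ▸ ModCurve.hasExactLevel_levelNine.conjBy k⁻¹,
        by rw [← h9, ModCurve.genus_conjBy (N := 9) (by norm_num) ModCurve.Gamma_nine_le_levelNine,
          ModCurve.genus_levelNine]⟩
    · right
      have h27 := hk ▸ ModCurve.conjBy_inv_conjBy k Γ
      exact ⟨h27 ▸ ModCurve.hasExactLevel_levelTwentySeven.conjBy k⁻¹,
        by rw [← h27,
          ModCurve.genus_conjBy (N := 27) (by norm_num) ModCurve.Gamma_le_levelTwentySeven,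
          ModCurve.genus_levelTwentySeven]⟩
  · rintro e (rfl | rfl)
    · refine ⟨_, ModCurve.isUnipotentOfLevel_levelNine, fun Γ h => ?_⟩
      obtain ⟨k, hk | hk⟩ := h.exists_conjBy_eq
      · exact ⟨k⁻¹, by rw [← hk]; exact ModCurve.conjBy_inv_conjBy k Γ⟩
      · have := hlev (h.2.2.2.1.conjBy k) (hk ▸ ModCurve.hasExactLevel_levelTwentySeven)
        norm_num at this
    · refine ⟨_, ModCurve.isUnipotentOfLevel_levelTwentySeven, fun Γ h => ?_⟩
      obtain ⟨k, hk | hk⟩ := h.exists_conjBy_eq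
      · have := hlev (h.2.2.2.1.conjBy k) (hk ▸ ModCurve.hasExactLevel_levelNine)
        norm_num at this
      · exact ⟨k⁻¹, by rw [← hk]; exact ModCurve.conjBy_inv_conjBy k Γ⟩
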